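/- Let $p$ be a prime, $\Bbbk$ a field of characteristic $p$ and $\lambda\in\mathbb F_p$. **The algebra.** Let $\widetilde W$ be the (non-cyclotomic) Webster algebra of $\mathfrak{sl}_2$-type with two red and two black strands, in which the leftmost strand is red: the $\Bbbk$-algebra of planar diagrams of four strands whose boundary sequences begin with red, so that only the sequences $s_0=(\text{red},\text{black},\text{red},\text{black})$, $s_1=(\text{red},\text{red},\text{black},\text{black})$, $s_2=(\text{red},\text{black},\text{black},\text{red})$ occur. It is generated by the idempotents $e(s)$ (vertical strands), dots on black strands, and crossings of two neighbouring strands which are not both red; the leftmost red strand crosses nothing. The product $ab$ is $a$ stacked on top of $b$, and is zero if the sequences do not match. The relations are: distant generators commute; $\sum_s e(s)=1$; the nilHecke relations for black strands (a double crossing is $0$; a crossing with a dot below on the strand starting at the bottom left minus the crossing with the dot above on the same strand is the identity; a crossing with a dot above on the strand ending at the top left minus the crossing with the dot below on the same strand is the identity); a red-black double crossing is a dot on the black strand; dots slide through red-black crossings; triple crossings of two black strands and one red strand satisfy the braid relation if the red strand passes outermost, while, if the red strand runs from the middle to the middle, the diagram in which it passes to the left of the black crossing minus the diagram in which it passes to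 the right of it is the identity. The algebra is graded: dots have degree $2$, black-black crossings $-2$, red-black crossings $1$. The derivation $\partial_\lambda$ of degree $2$ vanishes on the $e(s)$, sends a dot to its square, a black-black crossing to the identity minus twice the crossing with a dot at its top left end, a crossing of a red strand (bottom left) with a black strand (bottom right) to $\lambda$ times the crossing with a dot at the top of its black strand, and a crossing of a black strand (bottom left) with a red strand (bottom right) to $1-\lambda$ times the crossing with a dot at the top of its black strand. Then $\partial_\lambda^p=0$, so $(\widetilde W,\partial_\lambda)$ is a $p$-DG algebra. Let $\mathcal D(\widetilde W,\partial_\lambda)$ be its derived category (graded left $p$-DG modules, with the morphisms that are isomorphisms in the stable category of $p$-complexes inverted), with homological shift $[1]$ and distinguished triangles coming from cones, and let $K_0(\widetilde W,\partial_\lambda)$ be the Grothendieck group of its full subcategory of compact objects; $q^{\pm1}$ acts on it by the grading shift $\{\pm1\}$. **The modules.** Let $W_i=\widetilde W e(s_i)$ for $i=0,1,2$. For $i=1,2$ let $\varepsilon_i\in e(s_i)\widetilde We(s_i)$ be minus the crossing of the two black strands on top of a dot on the right one of them. This is an idempotent with $\partial_\lambda(\varepsilon_i)\varepsilon_i=\partial_\lambda(\varepsilon_i)$.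 Let $W_i^{(2)}=(\widetilde W\varepsilon_i)\{-1\}$, so that $W_i\cong W_i^{(2)}\{1\}\oplus W_i^{(2)}\{-1\}$ as graded modules. Let $\phi_1$ be the diagram with bottom $s_1$ and top $s_0$ which consists, from bottom to top, of a dot on the rightmost (black) strand, the crossing of the two black strands, and the crossing of the second red strand with its black right neighbour. Let $\psi_2$ be the diagram with bottom $s_0$ and top $s_2$ in which, from bottom to top, the rightmost black strand crosses the second red strand and then the other black strand. **Claim.** The modules $W_0,W_1,W_2$ are compact in $\mathcal D(\widetilde W,\partial_\lambda)$ for every $\lambda\in\mathbb F_p$. If $p\neq2$, then $$(q+q^{-1})[W_0]=[W_1]+[W_2]\quad\text{in }K_0(\widetilde W,\partial_\lambda)$$ if and only if $\lambda=1$; the "if" part also holds for $p=2$. Furthermore, for $\lambda=1$ (and every $p$), right multiplication by $\psi_2$ and by $\phi_1$ are morphisms of graded $p$-DG modules $W_2^{(2)}\to W_0$ and $W_0\to W_1^{(2)}$, and there is a distinguished triangle in $\mathcal D(\widetilde W,\partial_1)$ $$W_2^{(2)}\xrightarrow{\ \psi_2\ }W_0\xrightarrow{\ \phi_1\ }W_1^{(2)}\longrightarrow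 W_2^{(2)}[1].$$ -/

import Mathlib

open CategoryTheory

universe u

set_option linter.unusedSimpArgs false

/-! ## p-DG algebras and p-DG modules -/

/-- A `p`-DG algebra over `k`: a `ℤ`-graded `k`-algebra with a `p`-nilpotent derivation of
degree two. -/
structure PDGAlgebra (k : Type u) [Field k] (p : ℕ) where
  carrier : Type u
  [ring : Ring carrier]
  [algebra : Algebra k carrier]
  gr : ℤ → Submodule k carrier
  internal : DirectSum.IsInternal gr
  one_mem : (1 : carrier) ∈ gr 0
  mul_mem : ∀ {i j : ℤ} {a b : carrier}, a ∈ gr i → b ∈ gr j → a * b ∈ gr (i + j)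
  d : Module.End k carrier
  d_mem : ∀ {i : ℤ} {a : carrier}, a ∈ gr i → d a ∈ gr (i + 2)
  leibniz : ∀ a b : carrier, d (a * b) = d a * b + a * d b
  d_pow : d ^ p = 0

attribute [instance] PDGAlgebra.ring PDGAlgebra.algebra

/-- A left `p`-DG module over a `p`-DG algebra. -/
structure PDGModule {k : Type u} [Field k] {p : ℕ} (A : PDGAlgebra k p) where
  carrier : Type u
  [addCommGroup : AddCommGroup carrier]
  [moduleBase : Module k carrier]
  [module : Module A.carrier carrier]
  [tower : IsScalarTower k A.carrier carrier]
  gr : ℤ → Submodule k carrier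
  internal : DirectSum.IsInternal gr
  smul_mem : ∀ {i j : ℤ} {a : A.carrier} {m : carrier}, a ∈ A.gr i → m ∈ gr j →
    a • m ∈ gr (i + j)
  d : Module.End k carrier
  d_mem : ∀ {i : ℤ} {m : carrier}, m ∈ gr i → d m ∈ gr (i + 2)
  leibniz : ∀ (a : A.carrier) (m : carrier), d (a • m) = A.d a • m + a • d m
  d_pow : d ^ p = 0

attribute [instance] PDGModule.addCommGroup PDGModule.moduleBase PDGModule.module
  PDGModule.tower

namespace PDGAux

/-- Independence of a family of submodules can be tested through a jointly injective family of
linear maps. -/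
theorem indep_of_maps {k : Type*} [Field k] {M : Type*} [AddCommGroup M] [Module k M]
    {J : Type*} {N : J → Type*} [∀ j, AddCommGroup (N j)] [∀ j, Module k (N j)]
    (ev : ∀ j, M →ₗ[k] N j) (hinj : ∀ x, (∀ j, ev j x = 0) → x = 0)
    (G : ℤ → Submodule k M) (G' : ∀ j, ℤ → Submodule k (N j))
    (h : ∀ j i x, x ∈ G i → ev j x ∈ G' j i) (hind : ∀ j, iSupIndep (G' j)) : iSupIndep G := by
  rw [iSupIndep_def]
  intro i
  rw [Submodule.disjoint_def]
  intro x hx hx'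
  apply hinj
  intro j
  have h1 := (iSupIndep_def.1 (hind j)) i
  rw [Submodule.disjoint_def] at h1
  refine h1 _ (h j i x hx) ?_
  have h2 : (⨆ (l : ℤ) (_ : l ≠ i), G l) ≤ (⨆ (l : ℤ) (_ : l ≠ i), G' j l).comap (ev j) := by
    refine iSup₂_le fun l hl y hy => ?_
    exact Submodule.mem_iSup_of_mem l (Submodule.mem_iSup_of_mem hl (h j l y hy))
  exact h2 hx'

/-- A family of submodules exhausts a module if the module is generated by the images of modules
which are exhausted by compatible families. -/
theorem top_of_maps {k : Type*} [Field k] {M : Type*} [AddCommGroup M] [Module k M]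
    {J : Type*} {N : J → Type*} [∀ j, AddCommGroup (N j)] [∀ j, Module k (N j)]
    (inc : ∀ j, N j →ₗ[k] M) (htop : ∀ x, x ∈ ⨆ j, LinearMap.range (inc j))
    (G : ℤ → Submodule k M) (G' : ∀ j, ℤ → Submodule k (N j))
    (h : ∀ j i x, x ∈ G' j i → inc j x ∈ ⨆ l, G l) (hG : ∀ j, (⨆ i, G' j i) = ⊤) :
    (⨆ i, G i) = ⊤ := by
  rw [eq_top_iff]
  intro x _
  have h2 : (⨆ j, LinearMap.range (inc j)) ≤ ⨆ i, G i := by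
    refine iSup_le fun j => ?_
    rw [LinearMap.range_eq_map, ← hG j, Submodule.map_iSup]
    refine iSup_le fun i => ?_
    rw [Submodule.map_le_iff_le_comap]
    intro y hy
    exact h j i y hy
  exact h2 (htop x)

theorem internal_of {k : Type*} [Field k] {M : Type*} [AddCommGroup M] [Module k M]
    {G : ℤ → Submodule k M} (h1 : iSupIndep G) (h2 : (⨆ i, G i) = ⊤) : DirectSum.IsInternal G :=
  DirectSum.isInternal_submodule_of_iSupIndep_of_iSup_eq_top h1 h2

theorem indep_shift {k : Type*} [Field k] {M : Type*} [AddCommGroup M] [Module k M]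
    {G : ℤ → Submodule k M} (h : DirectSum.IsInternal G) (l : ℤ) :
    iSupIndep fun i => G (i - l) :=
  h.submodule_iSupIndep.comp (sub_left_injective (b := l))

theorem top_shift {k : Type*} [Field k] {M : Type*} [AddCommGroup M] [Module k M]
    {G : ℤ → Submodule k M} (h : DirectSum.IsInternal G) (l : ℤ) :
    (⨆ i, G (i - l)) = ⊤ := by
  rw [← h.submodule_iSup_eq_top]
  exact (Equiv.subRight l).iSup_comp (g := G)

theorem natCast_end {k : Type*} [Field k] (p : ℕ) [CharP k p] {M : Type*} [AddCommGroup M]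
    [Module k M] : ((p : ℕ) : Module.End k M) = 0 := by
  rw [← map_natCast (algebraMap k (Module.End k M)), CharP.cast_eq_zero, map_zero]

theorem add_pow_eq_zero {k : Type*} [Field k] (p : ℕ) [hp : Fact p.Prime] [CharP k p] {M : Type*}
    [AddCommGroup M] [Module k M] {D T : Module.End k M} (h : Commute D T) (hD : D ^ p = 0)
    (hT : T ^ p = 0) : (D + T) ^ p = 0 := by
  obtain ⟨r, hr⟩ := h.exists_add_pow_prime_eq hp.out
  rw [hr, hD, hT, natCast_end (k := k) p]
  simp

theorem choose_pred_char {R : Type*} [Ring R] (p : ℕ) [hp : Fact p.Prime] (h0 : (p : R) = 0)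
    (m : ℕ) (hm : m < p) : (((p - 1).choose m : ℕ) : R) = (-1) ^ m := by
  induction m with
  | zero => simp
  | succ m ih =>
    have h1 : ((p.choose (m + 1) : ℕ) : R) = 0 := by
      obtain ⟨c, hc⟩ := hp.out.dvd_choose_self (Nat.succ_ne_zero m) hm
      rw [hc]; push_cast; rw [h0, zero_mul]
    have h2 : p.choose (m + 1) = (p - 1).choose m + (p - 1).choose (m + 1) := by
      obtain ⟨q, rfl⟩ : ∃ q, p = q + 1 := ⟨p - 1, by have := hp.out.pos; omega⟩
      simp [Nat.choose_succ_succ]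
    rw [h2] at h1
    push_cast at h1
    rw [ih (by omega)] at h1
    rw [eq_neg_of_add_eq_zero_right h1, pow_succ, mul_neg_one]

/-- In characteristic `p`, the sum defining `p`-null-homotopies is an iterated commutator. -/
theorem sum_eq_commutator {k : Type*} [Field k] (p : ℕ) [hp : Fact p.Prime] [CharP k p] {M : Type*}
    [AddCommGroup M] [Module k M] (D s : Module.End k M) :
    ∑ i ∈ Finset.range p, D ^ i * s * D ^ (p - 1 - i) =
      ((LinearMap.mulLeft k D - LinearMap.mulRight k D) ^ (p - 1)) s := by
  have hc : Commute (LinearMap.mulLeft k D) (-LinearMap.mulRight k D) :=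
    (LinearMap.commute_mulLeft_right (R := k) D D).neg_right
  have h0 : ((p : ℕ) : Module.End k (Module.End k M)) = 0 := natCast_end (k := k) p
  have hp1 : p - 1 + 1 = p := Nat.sub_add_cancel hp.out.one_le
  rw [sub_eq_add_neg, hc.add_pow, hp1, LinearMap.sum_apply]
  refine Finset.sum_congr rfl fun i hi => ?_
  have hi' := Finset.mem_range.1 hi
  rw [← Nat.choose_symm (show i ≤ p - 1 by omega),
    choose_pred_char p h0 _ (show p - 1 - i < p by omega), neg_pow (LinearMap.mulRight k D)]
  have h1 : LinearMap.mulLeft k D ^ i *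
      ((-1) ^ (p - 1 - i) * LinearMap.mulRight k D ^ (p - 1 - i)) * (-1) ^ (p - 1 - i) =
      LinearMap.mulLeft k D ^ i * LinearMap.mulRight k D ^ (p - 1 - i) := by
    rcases neg_one_pow_eq_or (Module.End k (Module.End k M)) (p - 1 - i) with h | h <;> simp [h]
  rw [h1, LinearMap.pow_mulLeft, LinearMap.pow_mulRight]
  simp [mul_assoc]

/-- Adding to `D` an operator `S` that commutes with `D` and `s` does not change the
`p`-null-homotopy given by `s`. -/
theorem sum_add_commute {k : Type*} [Field k] (p : ℕ) [Fact p.Prime] [CharP k p] {M : Type*}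
    [AddCommGroup M] [Module k M] (D S s : Module.End k M) (hSD : Commute S D)
    (hSs : Commute S s) :
    ∑ i ∈ Finset.range p, (D + S) ^ i * s * (D + S) ^ (p - 1 - i) =
      ∑ i ∈ Finset.range p, D ^ i * s * D ^ (p - 1 - i) := by
  rw [sum_eq_commutator p, sum_eq_commutator p]
  have key : ∀ n : ℕ, ((LinearMap.mulLeft k (D + S) - LinearMap.mulRight k (D + S)) ^ n) s =
      ((LinearMap.mulLeft k D - LinearMap.mulRight k D) ^ n) s ∧
      Commute S (((LinearMap.mulLeft k D - LinearMap.mulRight k D) ^ n) s) := by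
    intro n
    induction n with
    | zero => exact ⟨by simp, by simpa using hSs⟩
    | succ n ih =>
      rw [pow_succ', pow_succ', Module.End.mul_apply, Module.End.mul_apply, ih.1]
      set t := ((LinearMap.mulLeft k D - LinearMap.mulRight k D) ^ n) s
      have ht := ih.2
      constructor
      · simp only [LinearMap.sub_apply, LinearMap.mulLeft_apply, LinearMap.mulRight_apply,
          add_mul, mul_add, ht.eq]
        abel
      · simp only [LinearMap.sub_apply, LinearMap.mulLeft_apply, LinearMap.mulRight_apply]
        exact (hSD.mul_right ht).sub_right (ht.mul_right hSD)
  exact (key _).1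

/-- The operator on `Mⁿ` that moves every slot one place to the right. -/
def step (R : Type*) [Ring R] (M : Type*) [AddCommGroup M] [Module R M] (n : ℕ) :
    (Fin n → M) →ₗ[R] (Fin n → M) where
  toFun m j := if 0 < j.1 then m ⟨j.1 - 1, by omega⟩ else 0
  map_add' m m' := by
    funext j; by_cases h : 0 < j.1 <;> simp [h]
  map_smul' r m := by
    funext j; by_cases h : 0 < j.1 <;> simp [h]

theorem step_pow_apply {R : Type*} [Ring R] {M : Type*} [AddCommGroup M] [Module R M] (n : ℕ)
    (r : ℕ) (m : Fin n → M) (j : Fin n) (hj : j.1 < r) : ((step R M n) ^ r) m j = 0 := by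
  induction r generalizing j with
  | zero => omega
  | succ r ih =>
    rw [pow_succ', Module.End.mul_apply]
    by_cases h : 0 < j.1
    · simp only [step, LinearMap.coe_mk, AddHom.coe_mk, h, if_true]
      exact ih _ (show j.1 - 1 < r by omega)
    · simp [step, h]

theorem step_pow {R : Type*} [Ring R] {M : Type*} [AddCommGroup M] [Module R M] (n r : ℕ)
    (h : n ≤ r) : (step R M n) ^ r = 0 := by
  refine LinearMap.ext fun m => ?_
  funext j
  exact step_pow_apply n r m j (by omega)

theorem step_compLeft {R : Type*} [Ring R] {M N : Type*} [AddCommGroup M] [Module R M]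
    [AddCommGroup N] [Module R N] (n : ℕ) (f : M →ₗ[R] N) (m : Fin n → M) :
    step R N n (f.compLeft (Fin n) m) = f.compLeft (Fin n) (step R M n m) := by
  funext j
  by_cases h : 0 < j.1 <;> simp [step, h]

theorem compLeft_mul {R : Type*} [CommRing R] {M : Type*} [AddCommGroup M] [Module R M] (n : ℕ)
    (f g : Module.End R M) : (LinearMap.compLeft (f * g) (Fin n) : Module.End R (Fin n → M)) =
      LinearMap.compLeft f (Fin n) * LinearMap.compLeft g (Fin n) := rfl

theorem compLeft_pow {R : Type*} [CommRing R] {M : Type*} [AddCommGroup M] [Module R M] (n : ℕ)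
    (f : Module.End R M) (r : ℕ) : (LinearMap.compLeft (f ^ r) (Fin n) : Module.End R (Fin n → M)) =
      (LinearMap.compLeft f (Fin n) : Module.End R (Fin n → M)) ^ r := by
  induction r with
  | zero => rfl
  | succ r ih => rw [pow_succ, compLeft_mul, ih, pow_succ]

theorem step_commute {R : Type*} [CommRing R] {M : Type*} [AddCommGroup M] [Module R M] (n : ℕ)
    (f : Module.End R M) :
    Commute (step R M n) (LinearMap.compLeft f (Fin n) : Module.End R (Fin n → M)) := by
  refine LinearMap.ext fun m => ?_
  exact step_compLeft n f m

/-- The differential of `M ⊗ V` on coefficient families: the differential of `M` in every slot,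
plus the step to the right. -/
def shiftD {k : Type*} [Field k] {M : Type*} [AddCommGroup M] [Module k M] (d : Module.End k M)
    (n : ℕ) : Module.End k (Fin n → M) :=
  LinearMap.compLeft d (Fin n) + step k M n

theorem shiftD_apply {k : Type*} [Field k] {M : Type*} [AddCommGroup M] [Module k M]
    (d : Module.End k M) (n : ℕ) (m : Fin n → M) (j : Fin n) :
    shiftD d n m j = d (m j) + if 0 < j.1 then m ⟨j.1 - 1, by omega⟩ else 0 := rfl

theorem shiftD_pow {k : Type*} [Field k] (p : ℕ) [Fact p.Prime] [CharP k p] {M : Type*}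
    [AddCommGroup M] [Module k M] (d : Module.End k M) (n : ℕ) (hn : n ≤ p) (hd : d ^ p = 0) :
    shiftD d n ^ p = 0 :=
  add_pow_eq_zero p (step_commute _ _).symm (by rw [← compLeft_pow, hd]; rfl) (step_pow _ _ hn)

/-- The differential of a cone on pairs. -/
def coneD {k : Type*} [Field k] {M N : Type*} [AddCommGroup M] [Module k M] [AddCommGroup N]
    [Module k N] (d : Module.End k M) (e : Module.End k N) (u : M →ₗ[k] N) (n : ℕ) (l : Fin n) :
    Module.End k ((Fin n → M) × N) where
  toFun x := (shiftD d n x.1, e x.2 + u (x.1 l))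
  map_add' x y := by
    refine Prod.ext ?_ ?_
    · simp
    · simp only [Prod.snd_add, Prod.fst_add, map_add, Pi.add_apply]; abel
  map_smul' c x := by
    refine Prod.ext ?_ ?_
    · simp
    · simp

theorem coneD_pow {k : Type*} [Field k] (p : ℕ) [hp : Fact p.Prime] [CharP k p] {M N : Type*}
    [AddCommGroup M] [Module k M] [AddCommGroup N] [Module k N] (d : Module.End k M)
    (e : Module.End k N) (u : M →ₗ[k] N) (hu : ∀ m, u (d m) = e (u m)) (n : ℕ) (hn : n + 1 = p)
    (l : Fin n) (hd : d ^ p = 0) (he : e ^ p = 0) : coneD d e u n l ^ p = 0 := by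
  set D : Module.End k ((Fin n → M) × N) := (LinearMap.compLeft d (Fin n)).prodMap e with hDdef
  set T : Module.End k ((Fin n → M) × N) :=
    (step k M n).prodMap 0 + LinearMap.inr k (Fin n → M) N ∘ₗ u ∘ₗ LinearMap.proj l ∘ₗ LinearMap.fst k (Fin n → M) N
    with hTdef
  have hDp : ∀ (r : ℕ) (x : (Fin n → M) × N),
      (D ^ r) x = ((LinearMap.compLeft (d ^ r) (Fin n)) x.1, (e ^ r) x.2) := by
    intro r
    induction r with
    | zero => intro x; rfl
    | succ r ih =>
      intro x
      rw [pow_succ, Module.End.mul_apply, ih]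
      rfl
  have hTp : ∀ (r : ℕ) (x : (Fin n → M) × N), ((T ^ r) x).1 = ((step k M n) ^ r) x.1 := by
    intro r
    induction r with
    | zero => intro x; rfl
    | succ r ih =>
      intro x
      rw [pow_succ, pow_succ, Module.End.mul_apply, Module.End.mul_apply, ih]
      simp [T]
  have hsum : coneD d e u n l = D + T := by
    refine LinearMap.ext fun x => Prod.ext ?_ ?_
    · simp [D, T, coneD, shiftD]
    · simp [D, T, coneD]
  rw [hsum]
  refine add_pow_eq_zero p ?_ ?_ ?_
  · refine LinearMap.ext fun x => Prod.ext ?_ ?_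
    · have := (step_compLeft n d x.1).symm
      simpa [D, T] using this
    · simp [D, T, hu]
  · refine LinearMap.ext fun x => ?_
    rw [hDp, hd, he]
    rfl
  · refine LinearMap.ext fun x => ?_
    have h1 := hTp n x
    rw [step_pow n n le_rfl] at h1
    have h1' : ((T ^ n) x).1 = 0 := h1
    rw [← hn, pow_succ', Module.End.mul_apply]
    refine Prod.ext ?_ ?_
    · simp only [hTdef, LinearMap.add_apply, LinearMap.prodMap_apply, Prod.fst_add]
      rw [← hTdef, h1']; simp
    · simp only [hTdef, LinearMap.add_apply, LinearMap.prodMap_apply, Prod.snd_add]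
      rw [← hTdef]; simp [h1']

theorem internal_pi {k : Type*} [Field k] {M : Type*} [AddCommGroup M] [Module k M] (n : ℕ)
    (c : Fin n → ℤ) {G : ℤ → Submodule k M} (h : DirectSum.IsInternal G) :
    DirectSum.IsInternal fun i => Submodule.pi Set.univ fun j : Fin n => G (i - c j) := by
  refine internal_of
    (indep_of_maps (fun j : Fin n => LinearMap.proj j)
      (fun x hx => funext hx) _ (fun j i => G (i - c j))
      (fun j i x hx => hx j trivial) fun j => indep_shift h _)
    (top_of_maps (fun j : Fin n => LinearMap.single k (fun _ => M) j)
      (fun x => ?_) _ (fun j i => G (i - c j)) (fun j i x hx => ?_)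
      fun j => top_shift h _)
  · rw [LinearMap.iSup_range_single]; trivial
  · refine Submodule.mem_iSup_of_mem i ?_
    rw [Submodule.mem_pi]
    intro l _
    by_cases hl : l = j
    · subst hl; simpa using hx
    · simp [hl]

theorem internal_prod {k : Type*} [Field k] {M N : Type*} [AddCommGroup M] [Module k M]
    [AddCommGroup N] [Module k N] {G : ℤ → Submodule k M} {G' : ℤ → Submodule k N}
    (h : DirectSum.IsInternal G) (h' : DirectSum.IsInternal G') :
    DirectSum.IsInternal fun i => (G i).prod (G' i) := by
  refine internal_of (iSupIndep_def.2 fun i => ?_) (eq_top_iff.2 fun x _ => ?_)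
  · rw [Submodule.disjoint_def]
    intro x hx hx'
    have h1 := iSupIndep_def.1 h.submodule_iSupIndep i
    have h2 := iSupIndep_def.1 h'.submodule_iSupIndep i
    rw [Submodule.disjoint_def] at h1 h2
    refine Prod.ext (h1 _ hx.1 ?_) (h2 _ hx.2 ?_)
    · have h3 : (⨆ (l : ℤ) (_ : l ≠ i), (G l).prod (G' l)) ≤
          (⨆ (l : ℤ) (_ : l ≠ i), G l).comap (LinearMap.fst k M N) :=
        iSup₂_le fun l hl y hy =>
          Submodule.mem_iSup_of_mem l (Submodule.mem_iSup_of_mem hl hy.1)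
      exact h3 hx'
    · have h3 : (⨆ (l : ℤ) (_ : l ≠ i), (G l).prod (G' l)) ≤
          (⨆ (l : ℤ) (_ : l ≠ i), G' l).comap (LinearMap.snd k M N) :=
        iSup₂_le fun l hl y hy =>
          Submodule.mem_iSup_of_mem l (Submodule.mem_iSup_of_mem hl hy.2)
      exact h3 hx'
  · have h1 : (⊤ : Submodule k M) ≤ (⨆ l, (G l).prod (G' l)).comap (LinearMap.inl k M N) := by
      rw [← h.submodule_iSup_eq_top]
      exact iSup_le fun l y hy => Submodule.mem_iSup_of_mem l ⟨hy, zero_mem _⟩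
    have h2 : (⊤ : Submodule k N) ≤ (⨆ l, (G l).prod (G' l)).comap (LinearMap.inr k M N) := by
      rw [← h'.submodule_iSup_eq_top]
      exact iSup_le fun l y hy => Submodule.mem_iSup_of_mem l ⟨zero_mem _, hy⟩
    have h3 : LinearMap.inl k M N x.1 ∈ ⨆ l, (G l).prod (G' l) := h1 Submodule.mem_top
    have h4 : LinearMap.inr k M N x.2 ∈ ⨆ l, (G l).prod (G' l) := h2 Submodule.mem_top
    simpa using add_mem h3 h4

/-- The homogeneous elements of degree `l` of a direct sum. -/
def dsumGr {k : Type*} [Field k] {I : Type*} {M : I → Type*} [∀ i, AddCommGroup (M i)]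
    [∀ i, Module k (M i)] (G : ∀ i, ℤ → Submodule k (M i)) (l : ℤ) : Submodule k (Π₀ i, M i) where
  carrier := {x | ∀ i, x i ∈ G i l}
  add_mem' := fun hx hy i => add_mem (hx i) (hy i)
  zero_mem' := fun _ => zero_mem _
  smul_mem' := fun c _ hx i => Submodule.smul_mem _ c (hx i)

theorem internal_dsum {k : Type*} [Field k] {I : Type*} {M : I → Type*} [∀ i, AddCommGroup (M i)]
    [∀ i, Module k (M i)] {G : ∀ i, ℤ → Submodule k (M i)}
    (h : ∀ i, DirectSum.IsInternal (G i)) : DirectSum.IsInternal (dsumGr G) := by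
  classical
  refine internal_of
    (indep_of_maps (fun i : I => DFinsupp.lapply i)
      (fun x hx => DFinsupp.ext hx) _ G
      (fun j i x hx => hx j) fun j => (h j).submodule_iSupIndep)
    (top_of_maps (fun i : I => DFinsupp.lsingle i)
      (fun x => ?_) _ G (fun j i x hx => ?_)
      fun j => (h j).submodule_iSup_eq_top)
  · rw [DFinsupp.iSup_range_lsingle]; trivial
  · refine Submodule.mem_iSup_of_mem i ?_
    intro l
    by_cases hl : j = l
    · subst hl; simpa using hx
    · simp [DFinsupp.single_eq_of_ne (Ne.symm hl)]

theorem dsum_pow {k : Type*} [Field k] {I : Type*} {M : I → Type*} [∀ i, AddCommGroup (M i)]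
    [∀ i, Module k (M i)] (d : ∀ i, Module.End k (M i)) (p : ℕ) (hd : ∀ i, d i ^ p = 0) :
    (DFinsupp.mapRange.linearMap d : Module.End k (Π₀ i, M i)) ^ p = 0 := by
  have h : ∀ (r : ℕ) (x : Π₀ i, M i) (i : I),
      ((DFinsupp.mapRange.linearMap d : Module.End k (Π₀ i, M i)) ^ r) x i = (d i ^ r) (x i) := by
    intro r
    induction r with
    | zero => intro x i; rfl
    | succ r ih =>
      intro x i
      rw [pow_succ, pow_succ, Module.End.mul_apply, ih]
      simp
  refine LinearMap.ext fun x => DFinsupp.ext fun i => ?_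
  rw [h, hd i]
  rfl

open Classical in
/-- Extension of finitely supported families by zero. -/
noncomputable def extend (R : Type*) [Ring R] {I : Type*} (M : I → Type*)
    [∀ i, AddCommGroup (M i)] [∀ i, Module R (M i)] (J : Finset I) :
    (Π₀ j : {i // i ∈ J}, M j.1) →ₗ[R] (Π₀ i, M i) where
  toFun x := DFinsupp.mk J fun j => x ⟨j.1, j.2⟩
  map_add' x y := by
    ext i; by_cases h : i ∈ J <;> simp [h]
  map_smul' c x := by
    ext i; by_cases h : i ∈ J <;> simp [h]

open Classical in
theorem extend_apply (R : Type*) [Ring R] {I : Type*} (M : I → Type*)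
    [∀ i, AddCommGroup (M i)] [∀ i, Module R (M i)] (J : Finset I)
    (x : Π₀ j : {i // i ∈ J}, M j.1) (i : I) :
    extend R M J x i = if h : i ∈ J then x ⟨i, h⟩ else 0 := by
  simp only [extend, LinearMap.coe_mk, AddHom.coe_mk, DFinsupp.mk_apply]

end PDGAux

/-! ## The category of `p`-DG modules -/

namespace PDGModule

variable {k : Type u} [Field k] {p : ℕ} {A : PDGAlgebra k p}

/-- A morphism of `p`-DG modules: an `A`-linear map of degree zero commuting with the
differentials. -/
@[ext]
structure Hom (M N : PDGModule A) where
  lin : M.carrier →ₗ[A.carrier] N.carrier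
  map_gr : ∀ {i : ℤ} {m : M.carrier}, m ∈ M.gr i → lin m ∈ N.gr i
  map_d : ∀ m : M.carrier, lin (M.d m) = N.d (lin m)

instance : Category (PDGModule A) where
  Hom M N := Hom M N
  id M := ⟨LinearMap.id, fun h => h, fun _ => rfl⟩
  comp f g := ⟨g.lin ∘ₗ f.lin, fun h => g.map_gr (f.map_gr h), fun m => by
    simp [f.map_d, g.map_d]⟩

/-- The `A`-linear map underlying a morphism of `p`-DG modules. -/
def lin {M N : PDGModule A} (f : M ⟶ N) : M.carrier →ₗ[A.carrier] N.carrier := Hom.lin f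

/-- The `k`-linear map underlying a morphism of `p`-DG modules. -/
def linBase {M N : PDGModule A} (f : M ⟶ N) : M.carrier →ₗ[k] N.carrier :=
  (lin f).restrictScalars k

theorem hom_ext {M N : PDGModule A} {f g : M ⟶ N} (h : ∀ m, lin f m = lin g m) : f = g :=
  Hom.ext (LinearMap.ext h)

theorem map_gr {M N : PDGModule A} (f : M ⟶ N) {i : ℤ} {m : M.carrier} (h : m ∈ M.gr i) :
    lin f m ∈ N.gr i := Hom.map_gr f h

theorem map_d {M N : PDGModule A} (f : M ⟶ N) (m : M.carrier) :
    lin f (M.d m) = N.d (lin f m) := Hom.map_d f m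

@[simp] theorem lin_id (M : PDGModule A) (m : M.carrier) : lin (𝟙 M) m = m := rfl

@[simp] theorem lin_comp {M N P : PDGModule A} (f : M ⟶ N) (g : N ⟶ P) (m : M.carrier) :
    lin (f ≫ g) m = lin g (lin f m) := rfl

/-- An `A`-linear bijection that respects degrees and differentials is an isomorphism. -/
def mkIso (M N : PDGModule A) (e : M.carrier ≃ₗ[A.carrier] N.carrier)
    (hg : ∀ (i : ℤ) (m : M.carrier), e m ∈ N.gr i ↔ m ∈ M.gr i)
    (hd : ∀ m, e (M.d m) = N.d (e m)) : M ≅ N where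
  hom := ⟨e.toLinearMap, fun h => (hg _ _).2 h, hd⟩
  inv := ⟨e.symm.toLinearMap, fun {i m} h => by
      rw [← hg]; simpa using h, fun m => e.injective (by simp [hd])⟩
  hom_inv_id := hom_ext fun m => e.symm_apply_apply m
  inv_hom_id := hom_ext fun m => e.apply_symm_apply m

/-! ### Quasi-isomorphisms -/

/-- A `k`-linear endomorphism of (the `p`-complex underlying) `M` is null-homotopic if it is
`∑ dⁱ s dᵖ⁻¹⁻ⁱ` for a `k`-linear map `s` of degree `2 - 2p`, that is, if it vanishes in
the stable category of graded `k[d]/(dᵖ)`-modules. -/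
def NullHomotopic (M : PDGModule A) (f : Module.End k M.carrier) : Prop :=
  ∃ s : Module.End k M.carrier, (∀ (i : ℤ) (m : M.carrier), m ∈ M.gr i →
      s m ∈ M.gr (i - 2 * ((p : ℤ) - 1))) ∧
    f = ∑ i ∈ Finset.range p, M.d ^ i * s * M.d ^ (p - 1 - i)

/-- A morphism of `p`-DG modules is a quasi-isomorphism if it is an isomorphism of the underlying
`p`-complexes in the stable category of graded `k[d]/(dᵖ)`-modules, that is, if it has a
`k`-linear inverse up to homotopy. -/
def IsQuasiIso {M N : PDGModule A} (f : M ⟶ N) : Prop :=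
  ∃ g : N.carrier →ₗ[k] M.carrier, (∀ (i : ℤ) (n : N.carrier), n ∈ N.gr i → g n ∈ M.gr i) ∧
    (∀ n, g (N.d n) = M.d (g n)) ∧
    NullHomotopic M (g ∘ₗ linBase f - LinearMap.id) ∧
    NullHomotopic N (linBase f ∘ₗ g - LinearMap.id)

/-- The class of quasi-isomorphisms. -/
def quasiIso (A : PDGAlgebra k p) : MorphismProperty (PDGModule A) := fun _ _ f => IsQuasiIso f

/-! ### Grading shifts, homological shifts, cones and direct sums -/

/-- The grading shift `M{l}`, with `M{l}ⁱ = Mⁱ⁻ˡ`. -/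
abbrev gradingShift (l : ℤ) (M : PDGModule A) : PDGModule A where
  carrier := M.carrier
  gr i := M.gr (i - l)
  internal := PDGAux.internal_of (PDGAux.indep_shift M.internal l) (PDGAux.top_shift M.internal l)
  smul_mem {i j a m} ha hm := by
    have := M.smul_mem ha hm
    rwa [show i + (j - l) = i + j - l by ring] at this
  d := M.d
  d_mem {i m} hm := by
    have := M.d_mem hm
    rwa [show i - l + 2 = i + 2 - l by ring] at this
  leibniz := M.leibniz
  d_pow := M.d_pow

/-- The grading shift as a functor. -/
abbrev gradingShiftFunctor (A : PDGAlgebra k p) (l : ℤ) : PDGModule A ⥤ PDGModule A where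
  obj M := gradingShift l M
  map {M N} f :=
    { lin := (lin f : M.carrier →ₗ[A.carrier] N.carrier)
      map_gr := fun h => map_gr f h
      map_d := map_d f }

/-- The degree of the `j`-th basis vector of the `p`-complex `k = k = ⋯ = k` of
dimension `p - 1` that defines the homological shift. -/
def slotDegree (p j : ℕ) : ℤ := 2 * (j : ℤ) + 2 - 2 * (p : ℤ)

/-- The homological shift `M[1] = M ⊗ V`, where `V` is the `p`-complex `k = k = ⋯ = k` with
basis vectors `v₀, …, v₍ₚ₋₂₎` in degrees `2 - 2p, …, -2` and `d vⱼ = v₍ⱼ₊₁₎`; an element of it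
is written as the family of its coefficients in `M`. -/
abbrev homShift [Fact p.Prime] [CharP k p] (M : PDGModule A) : PDGModule A where
  carrier := Fin (p - 1) → M.carrier
  gr i := Submodule.pi Set.univ fun j : Fin (p - 1) => M.gr (i - slotDegree p j)
  internal := PDGAux.internal_pi (p - 1) (fun j => slotDegree p j) M.internal
  smul_mem {i j a m} ha hm l hl := by
    have := M.smul_mem ha (hm l hl)
    rwa [show i + (j - slotDegree p l) = i + j - slotDegree p l by ring] at this
  d := PDGAux.shiftD M.d (p - 1)
  d_mem {i m} hm l hl := by
    rw [PDGAux.shiftD_apply]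
    refine add_mem ?_ ?_
    · have := M.d_mem (hm l hl)
      rwa [show i - slotDegree p l + 2 = i + 2 - slotDegree p l by ring] at this
    · split_ifs with h
      · have h1 : m ⟨l.1 - 1, by omega⟩ ∈ M.gr (i - slotDegree p (l.1 - 1)) :=
          hm ⟨l.1 - 1, by omega⟩ trivial
        have h2 : i - slotDegree p (l.1 - 1) = i + 2 - slotDegree p l := by
          simp only [slotDegree]
          push_cast [Nat.cast_sub (show 1 ≤ l.1 from h)]
          ring
        rwa [h2] at h1
      · exact zero_mem _
  leibniz a m := by
    funext l
    simp only [PDGAux.shiftD_apply, Pi.add_apply, Pi.smul_apply, M.leibniz, smul_add]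
    split_ifs <;> simp [add_assoc]
  d_pow := PDGAux.shiftD_pow p M.d _ (by omega) M.d_pow

/-- The homological shift as a functor. -/
abbrev homShiftFunctor [Fact p.Prime] [CharP k p] (A : PDGAlgebra k p) :
    PDGModule A ⥤ PDGModule A where
  obj M := homShift M
  map {M N} f :=
    { lin := (lin f).compLeft (Fin (p - 1))
      map_gr := fun h l hl => map_gr f (h l hl)
      map_d := fun (m : Fin (p - 1) → M.carrier) => by
        funext l
        change lin f (PDGAux.shiftD M.d (p - 1) m l) =
          PDGAux.shiftD N.d (p - 1) (fun j => lin f (m j)) l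
        simp only [PDGAux.shiftD_apply, map_add, map_d]
        split_ifs <;> simp }

/-- The cone `M = M = ⋯ = M → N` of `u : M ⟶ N`, with `p - 1` copies of `M`: its elements
are pairs of an element `(m₀, …, m₍ₚ₋₂₎)` of `M[1]` and an element of `N`, and the differential of
`N` is corrected by `u m₍ₚ₋₂₎`. -/
abbrev cone [hp : Fact p.Prime] [CharP k p] {M N : PDGModule A} (u : M ⟶ N) : PDGModule A where
  carrier := (Fin (p - 1) → M.carrier) × N.carrier
  gr i := Submodule.prod (Submodule.pi Set.univ fun j : Fin (p - 1) => M.gr (i - slotDegree p j))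
    (N.gr i)
  internal := PDGAux.internal_prod
    (PDGAux.internal_pi (p - 1) (fun j => slotDegree p j) M.internal) N.internal
  smul_mem ha hm := ⟨(homShift M).smul_mem ha hm.1, N.smul_mem ha hm.2⟩
  d := PDGAux.coneD M.d N.d (linBase u) (p - 1) ⟨p - 2, by have := hp.out.two_le; omega⟩
  d_mem {i m} hm := by
    have hp2 := hp.out.two_le
    refine ⟨(homShift M).d_mem hm.1, add_mem (N.d_mem hm.2) ?_⟩
    have h1 : linBase u (m.1 ⟨p - 2, by omega⟩) ∈ N.gr (i - slotDegree p (p - 2)) :=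
      map_gr u (hm.1 ⟨p - 2, by omega⟩ trivial)
    have h2 : i - slotDegree p (p - 2) = i + 2 := by
      simp only [slotDegree]
      push_cast [Nat.cast_sub hp2]
      ring
    rwa [h2] at h1
  leibniz a m := by
    refine Prod.ext ((homShift M).leibniz a m.1) ?_
    change N.d (a • m.2) + lin u (a • m.1 _) = A.d a • m.2 + a • (N.d m.2 + lin u (m.1 _))
    rw [N.leibniz, map_smul, smul_add, add_assoc]
  d_pow := PDGAux.coneD_pow p M.d N.d (linBase u) (map_d u) _
    (Nat.sub_add_cancel hp.out.one_le) _ M.d_pow N.d_pow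

/-- The canonical morphism `N ⟶ cone u`. -/
def coneInr [Fact p.Prime] [CharP k p] {M N : PDGModule A} (u : M ⟶ N) : N ⟶ cone u where
  lin := LinearMap.inr A.carrier (Fin (p - 1) → M.carrier) N.carrier
  map_gr h := ⟨zero_mem _, h⟩
  map_d n := by
    refine Prod.ext (map_zero (PDGAux.shiftD M.d (p - 1))).symm ?_
    change N.d n = N.d n + lin u 0
    rw [map_zero, add_zero]

/-- The canonical morphism `cone u ⟶ M[1]`. -/
def coneFst [Fact p.Prime] [CharP k p] {M N : PDGModule A} (u : M ⟶ N) :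
    cone u ⟶ homShift M where
  lin := LinearMap.fst A.carrier (Fin (p - 1) → M.carrier) N.carrier
  map_gr h := h.1
  map_d _ := rfl

/-- The direct sum of a family of `p`-DG modules. -/
abbrev directSum {I : Type u} (N : I → PDGModule A) : PDGModule A where
  carrier := Π₀ i, (N i).carrier
  tower := ⟨fun x y z => by ext i; simp⟩
  gr := PDGAux.dsumGr fun i => (N i).gr
  internal := PDGAux.internal_dsum fun i => (N i).internal
  smul_mem ha hm i := (N i).smul_mem ha (hm i)
  d := DFinsupp.mapRange.linearMap fun i => (N i).d
  d_mem {l x} hm i := by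
    simpa using (N i).d_mem (hm i)
  leibniz a m := by
    ext i; simp [(N i).leibniz]
  d_pow := PDGAux.dsum_pow _ p fun i => (N i).d_pow

/-- The inclusion of the direct sum over a finite set of indices. -/
noncomputable def finiteInclusion {I : Type u} (N : I → PDGModule A) (J : Finset I) :
    directSum (fun j : {i // i ∈ J} => N j.1) ⟶ directSum N where
  lin := PDGAux.extend A.carrier (fun i => (N i).carrier) J
  map_gr {l x} hx i := by
    rw [PDGAux.extend_apply]
    split_ifs with h
    · exact hx ⟨i, h⟩
    · exact zero_mem _
  map_d x := by
    refine DFinsupp.ext fun i => ?_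
    have h1 : ∀ y : Π₀ i, (N i).carrier, (directSum N).d y i = (N i).d (y i) := fun y => rfl
    refine Eq.trans ?_ (h1 _).symm
    rw [PDGAux.extend_apply, PDGAux.extend_apply]
    split_ifs with h
    · rfl
    · simp

end PDGModule

/-! ## The derived category -/

namespace PDGModule

variable {k : Type u} [Field k] {p : ℕ}

theorem isQuasiIso_gradingShift {A : PDGAlgebra k p} (l : ℤ) {M N : PDGModule A} (f : M ⟶ N)
    (hf : IsQuasiIso f) : IsQuasiIso ((gradingShiftFunctor A l).map f) := by
  obtain ⟨g, hg, hgd, ⟨s, hs, hs'⟩, ⟨t, ht, ht'⟩⟩ := hf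
  refine ⟨g, fun i n hn => hg _ n hn, hgd, ⟨s, fun i m hm => ?_, hs'⟩, ⟨t, fun i m hm => ?_, ht'⟩⟩
  · have := hs _ m hm
    rwa [show i - l - 2 * ((p : ℤ) - 1) = i - 2 * ((p : ℤ) - 1) - l by ring] at this
  · have := ht _ m hm
    rwa [show i - l - 2 * ((p : ℤ) - 1) = i - 2 * ((p : ℤ) - 1) - l by ring] at this

theorem nullHomotopic_homShift [Fact p.Prime] [CharP k p] {A : PDGAlgebra k p} (M : PDGModule A)
    (f : Module.End k M.carrier) (hf : NullHomotopic M f) :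
    NullHomotopic (homShift M) (LinearMap.compLeft f (Fin (p - 1))) := by
  obtain ⟨s, hs, hs'⟩ := hf
  refine ⟨LinearMap.compLeft s (Fin (p - 1)), fun i m hm l hl => ?_, ?_⟩
  · have := hs _ _ (hm l hl)
    rwa [show i - slotDegree p l - 2 * ((p : ℤ) - 1) =
      i - 2 * ((p : ℤ) - 1) - slotDegree p l by ring] at this
  · refine Eq.trans ?_ (PDGAux.sum_add_commute p _ _ _ (PDGAux.step_commute (p - 1) M.d)
      (PDGAux.step_commute (p - 1) s)).symm
    have h1 : ∀ i, (LinearMap.compLeft M.d (Fin (p - 1)) :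
        Module.End k (Fin (p - 1) → M.carrier)) ^ i = LinearMap.compLeft (M.d ^ i) (Fin (p - 1)) :=
      fun i => (PDGAux.compLeft_pow _ _ _).symm
    simp only [h1, ← PDGAux.compLeft_mul]
    rw [hs']
    refine LinearMap.ext fun m => ?_
    funext l
    simp

theorem isQuasiIso_homShift [Fact p.Prime] [CharP k p] {A : PDGAlgebra k p} {M N : PDGModule A}
    (f : M ⟶ N) (hf : IsQuasiIso f) : IsQuasiIso ((homShiftFunctor A).map f) := by
  obtain ⟨g, hg, hgd, h1, h2⟩ := hf
  refine ⟨LinearMap.compLeft g (Fin (p - 1)), fun i n hn l hl => hg _ _ (hn l hl),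
    fun (n : Fin (p - 1) → N.carrier) => ?_,
    nullHomotopic_homShift M _ h1, nullHomotopic_homShift N _ h2⟩
  funext l
  change g (PDGAux.shiftD N.d (p - 1) n l) = PDGAux.shiftD M.d (p - 1) (fun j => g (n j)) l
  simp only [PDGAux.shiftD_apply, map_add, hgd]
  split_ifs <;> simp

end PDGModule

/-- The derived category `D(A)` of a `p`-DG algebra: the localization of the category of `p`-DG
modules at the quasi-isomorphisms. (Null-homotopic morphisms become zero in it, so that it is also
the localization of the homotopy category.) -/
abbrev DerivedPDG {k : Type u} [Field k] {p : ℕ} (A : PDGAlgebra k p) : Type (u + 1) :=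
  (PDGModule.quasiIso A).Localization

namespace DerivedPDG

variable {k : Type u} [Field k] {p : ℕ}

/-- The localization functor from `p`-DG modules to the derived category. -/
abbrev Q (A : PDGAlgebra k p) : PDGModule A ⥤ DerivedPDG A := (PDGModule.quasiIso A).Q

theorem gradingShift_inverts (A : PDGAlgebra k p) (l : ℤ) :
    (PDGModule.quasiIso A).IsInvertedBy (PDGModule.gradingShiftFunctor A l ⋙ Q A) :=
  fun _ _ f hf => (PDGModule.quasiIso A).Q_inverts _
    (PDGModule.isQuasiIso_gradingShift l f hf)

/-- The grading shift `X ↦ X{l}` on the derived category. -/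
noncomputable def gradingShift (A : PDGAlgebra k p) (l : ℤ) : DerivedPDG A ⥤ DerivedPDG A :=
  Localization.Construction.lift _ (gradingShift_inverts A l)

theorem homShift_inverts [Fact p.Prime] [CharP k p] (A : PDGAlgebra k p) :
    (PDGModule.quasiIso A).IsInvertedBy (PDGModule.homShiftFunctor A ⋙ Q A) :=
  fun _ _ f hf => (PDGModule.quasiIso A).Q_inverts _ (PDGModule.isQuasiIso_homShift f hf)

/-- The homological shift `X ↦ X[1]` on the derived category. -/
noncomputable def homShift [Fact p.Prime] [CharP k p] (A : PDGAlgebra k p) :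
    DerivedPDG A ⥤ DerivedPDG A :=
  Localization.Construction.lift _ (homShift_inverts A)

theorem gradingShift_obj (A : PDGAlgebra k p) (l : ℤ) (M : PDGModule A) :
    (gradingShift A l).obj ((Q A).obj M) = (Q A).obj (PDGModule.gradingShift l M) := rfl

theorem homShift_obj [Fact p.Prime] [CharP k p] (A : PDGAlgebra k p) (M : PDGModule A) :
    (homShift A).obj ((Q A).obj M) = (Q A).obj (PDGModule.homShift M) := rfl

theorem gradingShift_map (A : PDGAlgebra k p) (l : ℤ) {M N : PDGModule A} (f : M ⟶ N) :
    (gradingShift A l).map ((Q A).map f) =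
      (Q A).map ((PDGModule.gradingShiftFunctor A l).map f) := by
  exact (Functor.congr_hom (Localization.Construction.fac _ (gradingShift_inverts A l)) f).trans
    ((Category.id_comp _).trans (Category.comp_id _))

theorem homShift_map [Fact p.Prime] [CharP k p] (A : PDGAlgebra k p) {M N : PDGModule A}
    (f : M ⟶ N) :
    (homShift A).map ((Q A).map f) = (Q A).map ((PDGModule.homShiftFunctor A).map f) := by
  exact (Functor.congr_hom (Localization.Construction.fac _ (homShift_inverts A)) f).trans
    ((Category.id_comp _).trans (Category.comp_id _))

/-- The distinguished triangles `X ⟶ Y ⟶ Z ⟶ X[1]` of the derived category: those isomorphic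
to the triangle `M ⟶ N ⟶ cone u ⟶ M[1]` of a morphism `u : M ⟶ N` of `p`-DG modules. -/
def IsDistinguished [Fact p.Prime] [CharP k p] {A : PDGAlgebra k p} {X Y Z : DerivedPDG A}
    (f : X ⟶ Y) (g : Y ⟶ Z) (h : Z ⟶ (homShift A).obj X) : Prop :=
  ∃ (M N : PDGModule A) (u : M ⟶ N) (a : X ≅ (Q A).obj M) (b : Y ≅ (Q A).obj N)
    (c : Z ≅ (Q A).obj (PDGModule.cone u)),
    f ≫ b.hom = a.hom ≫ (Q A).map u ∧
    g ≫ c.hom = b.hom ≫ (Q A).map (PDGModule.coneInr u) ∧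
    h ≫ (homShift A).map a.hom = c.hom ≫ (Q A).map (PDGModule.coneFst u)

/-- `X` is compact in the derived category: `⨁ᵢ Hom(X, Nᵢ) → Hom(X, ⨁ᵢ Nᵢ)` is bijective for
all families `(Nᵢ)` of `p`-DG modules. This map is always injective (compose with the projections
to the `Nᵢ`), and its image consists of the morphisms that factor through the direct sum of
finitely many of the `Nᵢ`. -/
def IsCompact {A : PDGAlgebra k p} (X : DerivedPDG A) : Prop :=
  ∀ (I : Type u) (N : I → PDGModule A) (f : X ⟶ (Q A).obj (PDGModule.directSum N)),
    ∃ (J : Finset I) (g : X ⟶ (Q A).obj (PDGModule.directSum fun j : {i // i ∈ J} => N j.1)),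
      f = g ≫ (Q A).map (PDGModule.finiteInclusion N J)

/-! ### Grading shifts preserve compact objects and distinguished triangles -/

/-- `M{l}{m} ≅ M` for `l + m = 0`. -/
def shiftCancel {A : PDGAlgebra k p} (M : PDGModule A) (l m : ℤ) (h : l + m = 0) :
    PDGModule.gradingShift m (PDGModule.gradingShift l M) ≅ M :=
  PDGModule.mkIso _ _ (LinearEquiv.refl A.carrier M.carrier)
    (fun i x => by
      change x ∈ M.gr i ↔ x ∈ M.gr (i - m - l)
      rw [show i - m - l = i by linarith])
    fun _ => rfl

/-- `X{l}{m} ⟶ X` for `l + m = 0`, on the derived category. -/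
noncomputable def cancelNat (A : PDGAlgebra k p) (l m : ℤ) (h : l + m = 0) :
    gradingShift A l ⋙ gradingShift A m ⟶ 𝟭 (DerivedPDG A) :=
  Localization.Construction.natTransExtension
    { app := fun M => (Q A).map (shiftCancel M l m h).hom
      naturality := fun M N f => by
        have h1 : (gradingShift A m).map ((gradingShift A l).map ((Q A).map f)) =
            (Q A).map ((PDGModule.gradingShiftFunctor A m).map
              ((PDGModule.gradingShiftFunctor A l).map f)) :=
          (congrArg _ (gradingShift_map A l f)).trans (gradingShift_map A m _)
        have h2 : (PDGModule.gradingShiftFunctor A m).map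
              ((PDGModule.gradingShiftFunctor A l).map f) ≫ (shiftCancel N l m h).hom =
            (shiftCancel M l m h).hom ≫ f := rfl
        have h3 := congrArg (Q A).map h2
        rw [Functor.map_comp, Functor.map_comp] at h3
        exact (congrArg (fun t => t ≫ (Q A).map (shiftCancel N l m h).hom) h1).trans h3 }

theorem cancelNat_app (A : PDGAlgebra k p) (l m : ℤ) (h : l + m = 0) (M : PDGModule A) :
    (cancelNat A l m h).app ((Q A).obj M) = (Q A).map (shiftCancel M l m h).hom :=
  Localization.Construction.NatTransExtension.app_eq _ M

instance (A : PDGAlgebra k p) (l m : ℤ) (h : l + m = 0) (X : DerivedPDG A) :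
    IsIso ((cancelNat A l m h).app X) := by
  obtain ⟨M, rfl⟩ := (Localization.Construction.objEquiv (PDGModule.quasiIso A)).surjective X
  change IsIso ((cancelNat A l m h).app ((Q A).obj M))
  rw [cancelNat_app]
  exact Functor.map_isIso (Q A) (shiftCancel M l m h).hom

theorem IsCompact.gradingShift {A : PDGAlgebra k p} {X : DerivedPDG A} (hX : IsCompact X) (l : ℤ) :
    IsCompact ((DerivedPDG.gradingShift A l).obj X) := by
  intro I N f
  have h1 : l + -l = 0 := by ring
  have h2 : -l + l = 0 := by ring
  obtain ⟨J, g, hg⟩ := hX I (fun i => PDGModule.gradingShift (-l) (N i))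
    (inv ((cancelNat A l (-l) h1).app X) ≫ (DerivedPDG.gradingShift A (-l)).map f)
  let a : (DerivedPDG.gradingShift A l).obj X ⟶ (DerivedPDG.gradingShift A l).obj X :=
    (DerivedPDG.gradingShift A l).map (inv ((cancelNat A l (-l) h1).app X)) ≫
      (cancelNat A (-l) l h2).app ((DerivedPDG.gradingShift A l).obj X)
  refine ⟨J, inv a ≫ (DerivedPDG.gradingShift A l).map g ≫
    (cancelNat A (-l) l h2).app
      ((Q A).obj (PDGModule.directSum fun j : {i // i ∈ J} => N j.1)), ?_⟩
  rw [Category.assoc, IsIso.eq_inv_comp]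
  have h3 := congrArg (fun t => (DerivedPDG.gradingShift A l).map t ≫
    (cancelNat A (-l) l h2).app ((Q A).obj (PDGModule.directSum N))) hg
  have h4 := (cancelNat A (-l) l h2).naturality f
  have h5 := (cancelNat A (-l) l h2).naturality ((Q A).map (PDGModule.finiteInclusion N J))
  have h6 : (DerivedPDG.gradingShift A (-l)).map ((Q A).map (PDGModule.finiteInclusion N J)) =
    (Q A).map (PDGModule.finiteInclusion (fun i => PDGModule.gradingShift (-l) (N i)) J) :=
    gradingShift_map A (-l) _
  simp only [Functor.comp_map, Functor.id_map] at h4 h5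
  rw [h6] at h5
  have h7 : a ≫ f = (DerivedPDG.gradingShift A l).map g ≫
      (DerivedPDG.gradingShift A l).map ((Q A).map
        (PDGModule.finiteInclusion (fun i => PDGModule.gradingShift (-l) (N i)) J)) ≫
      (cancelNat A (-l) l h2).app ((Q A).obj (PDGModule.directSum N)) := by
    refine Eq.trans ?_ (h3.trans ?_)
    · refine (Category.assoc _ _ _).trans ?_
      refine Eq.trans (congrArg (fun t => (DerivedPDG.gradingShift A l).map
        (inv ((cancelNat A l (-l) h1).app X)) ≫ t) h4.symm) ?_
      refine (Category.assoc _ _ _).symm.trans ?_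
      exact congrArg (fun t => t ≫ (cancelNat A (-l) l h2).app
        ((Q A).obj (PDGModule.directSum N))) (Functor.map_comp _ _ _).symm
    · exact (congrArg (fun t => t ≫ (cancelNat A (-l) l h2).app
        ((Q A).obj (PDGModule.directSum N)))
        ((DerivedPDG.gradingShift A l).map_comp g _)).trans
        (Category.assoc ((DerivedPDG.gradingShift A l).map g) _ _)
  rw [h7]
  exact (congrArg (fun t => (DerivedPDG.gradingShift A l).map g ≫ t) h5).trans
    (Category.assoc _ _ _).symm

/-- `M[1]{l} ≅ M{l}[1]`. -/
def shiftComm [Fact p.Prime] [CharP k p] {A : PDGAlgebra k p} (M : PDGModule A) (l : ℤ) :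
    PDGModule.gradingShift l (PDGModule.homShift M) ≅
      PDGModule.homShift (PDGModule.gradingShift l M) :=
  PDGModule.mkIso _ _ (LinearEquiv.refl A.carrier (Fin (p - 1) → M.carrier))
    (fun i x => by
      simp only [Submodule.mem_pi, LinearEquiv.refl_apply, sub_right_comm])
    fun _ => rfl

/-- `X[1]{l} ⟶ X{l}[1]` on the derived category. -/
noncomputable def commNat [Fact p.Prime] [CharP k p] (A : PDGAlgebra k p) (l : ℤ) :
    homShift A ⋙ gradingShift A l ⟶ gradingShift A l ⋙ homShift A :=
  Localization.Construction.natTransExtension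
    { app := fun M => (Q A).map (shiftComm M l).hom
      naturality := fun M N f => by
        have h1 : (gradingShift A l).map ((homShift A).map ((Q A).map f)) =
            (Q A).map ((PDGModule.gradingShiftFunctor A l).map
              ((PDGModule.homShiftFunctor A).map f)) :=
          (congrArg _ (homShift_map A f)).trans (gradingShift_map A l _)
        have h1' : (homShift A).map ((gradingShift A l).map ((Q A).map f)) =
            (Q A).map ((PDGModule.homShiftFunctor A).map
              ((PDGModule.gradingShiftFunctor A l).map f)) :=
          (congrArg _ (gradingShift_map A l f)).trans (homShift_map A _)
        have h2 : (PDGModule.gradingShiftFunctor A l).map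
              ((PDGModule.homShiftFunctor A).map f) ≫ (shiftComm N l).hom =
            (shiftComm M l).hom ≫ (PDGModule.homShiftFunctor A).map
              ((PDGModule.gradingShiftFunctor A l).map f) := rfl
        have h3 := congrArg (Q A).map h2
        rw [Functor.map_comp, Functor.map_comp] at h3
        exact (congrArg (fun t => t ≫ (Q A).map (shiftComm N l).hom) h1).trans
          (h3.trans (congrArg (fun t => (Q A).map (shiftComm M l).hom ≫ t) h1'.symm)) }

theorem commNat_app [Fact p.Prime] [CharP k p] (A : PDGAlgebra k p) (l : ℤ) (M : PDGModule A) :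
    (commNat A l).app ((Q A).obj M) = (Q A).map (shiftComm M l).hom :=
  Localization.Construction.NatTransExtension.app_eq _ M

/-- `(cone u){l} ≅ cone (u{l})`. -/
def shiftCone [Fact p.Prime] [CharP k p] {A : PDGAlgebra k p} {M N : PDGModule A} (u : M ⟶ N)
    (l : ℤ) : PDGModule.gradingShift l (PDGModule.cone u) ≅
      PDGModule.cone ((PDGModule.gradingShiftFunctor A l).map u) :=
  PDGModule.mkIso _ _ (LinearEquiv.refl A.carrier ((Fin (p - 1) → M.carrier) × N.carrier))
    (fun i x => by
      obtain ⟨x, y⟩ := x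
      change ((∀ j ∈ Set.univ, x j ∈ M.gr (i - PDGModule.slotDegree p (j : Fin (p - 1)) - l)) ∧
        y ∈ N.gr (i - l)) ↔ ((∀ j ∈ Set.univ,
          x j ∈ M.gr (i - l - PDGModule.slotDegree p (j : Fin (p - 1)))) ∧ y ∈ N.gr (i - l))
      simp only [sub_right_comm])
    fun _ => rfl

theorem IsDistinguished.gradingShift [Fact p.Prime] [CharP k p] {A : PDGAlgebra k p}
    {X Y Z : DerivedPDG A} {f : X ⟶ Y} {g : Y ⟶ Z} {h : Z ⟶ (homShift A).obj X}
    (H : IsDistinguished f g h) (l : ℤ) :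
    IsDistinguished ((DerivedPDG.gradingShift A l).map f) ((DerivedPDG.gradingShift A l).map g)
      ((DerivedPDG.gradingShift A l).map h ≫ (commNat A l).app X) := by
  obtain ⟨M, N, u, a, b, c, h1, h2, h3⟩ := H
  have e2 : (PDGModule.gradingShiftFunctor A l).map (PDGModule.coneInr u) ≫ (shiftCone u l).hom =
      PDGModule.coneInr ((PDGModule.gradingShiftFunctor A l).map u) := rfl
  have e3 : (PDGModule.gradingShiftFunctor A l).map (PDGModule.coneFst u) ≫ (shiftComm M l).hom =
      (shiftCone u l).hom ≫ PDGModule.coneFst ((PDGModule.gradingShiftFunctor A l).map u) := rfl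
  refine ⟨PDGModule.gradingShift l M, PDGModule.gradingShift l N,
    (PDGModule.gradingShiftFunctor A l).map u, (DerivedPDG.gradingShift A l).mapIso a,
    (DerivedPDG.gradingShift A l).mapIso b,
    (DerivedPDG.gradingShift A l).mapIso c ≪≫ (Q A).mapIso (shiftCone u l), ?_, ?_, ?_⟩
  · have := congrArg (DerivedPDG.gradingShift A l).map h1
    rw [Functor.map_comp, Functor.map_comp, gradingShift_map] at this
    exact this
  · have h4 := congrArg (DerivedPDG.gradingShift A l).map h2
    rw [Functor.map_comp, Functor.map_comp, gradingShift_map] at h4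
    have h5 := congrArg (fun t => t ≫ (Q A).map (shiftCone u l).hom) h4
    refine (Category.assoc _ _ _).symm.trans (h5.trans ((Category.assoc _ _ _).trans ?_))
    exact congrArg (fun t => (DerivedPDG.gradingShift A l).map b.hom ≫ t)
      (((Q A).map_comp _ _).symm.trans (congrArg (Q A).map e2))
  · have h4 : (DerivedPDG.gradingShift A l).map h ≫
        (DerivedPDG.gradingShift A l).map ((homShift A).map a.hom) =
        (DerivedPDG.gradingShift A l).map c.hom ≫
          (Q A).map ((PDGModule.gradingShiftFunctor A l).map (PDGModule.coneFst u)) :=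
      ((Functor.map_comp _ _ _).symm.trans (congrArg (DerivedPDG.gradingShift A l).map h3)).trans
        ((Functor.map_comp _ _ _).trans (congrArg (fun t =>
          (DerivedPDG.gradingShift A l).map c.hom ≫ t) (gradingShift_map A l _)))
    have h5 : (DerivedPDG.gradingShift A l).map ((homShift A).map a.hom) ≫
        (Q A).map (shiftComm M l).hom = (commNat A l).app X ≫
          (homShift A).map ((DerivedPDG.gradingShift A l).map a.hom) :=
      (congrArg (fun t => (DerivedPDG.gradingShift A l).map ((homShift A).map a.hom) ≫ t)
        (commNat_app A l M)).symm.trans ((commNat A l).naturality a.hom)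
    have h6 : (Q A).map ((PDGModule.gradingShiftFunctor A l).map (PDGModule.coneFst u)) ≫
        (Q A).map (shiftComm M l).hom = (Q A).map (shiftCone u l).hom ≫
          (Q A).map (PDGModule.coneFst ((PDGModule.gradingShiftFunctor A l).map u)) :=
      ((Q A).map_comp _ _).symm.trans ((congrArg (Q A).map e3).trans ((Q A).map_comp _ _))
    refine (Category.assoc _ _ _).trans ((congrArg (fun t =>
      (DerivedPDG.gradingShift A l).map h ≫ t) h5.symm).trans ?_)
    refine (Category.assoc _ _ _).symm.trans ((congrArg (fun t =>
      t ≫ (Q A).map (shiftComm M l).hom) h4).trans ?_)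
    exact (Category.assoc _ _ _).trans ((congrArg (fun t =>
      (DerivedPDG.gradingShift A l).map c.hom ≫ t) h6).trans (Category.assoc _ _ _).symm)

end DerivedPDG

/-! ## The Grothendieck group -/

/-- The objects of the compact derived category. -/
abbrev CompactPDG {k : Type u} [Field k] {p : ℕ} (A : PDGAlgebra k p) : Type (u + 1) :=
  {X : DerivedPDG A // DerivedPDG.IsCompact X}

/-- The relations `[Y] = [X] + [Z]`, one for each distinguished triangle `X ⟶ Y ⟶ Z ⟶ X[1]` of
compact objects. -/
def K0Relations {k : Type u} [Field k] {p : ℕ} [Fact p.Prime] [CharP k p] (A : PDGAlgebra k p) :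
    AddSubgroup (FreeAbelianGroup (CompactPDG A)) :=
  AddSubgroup.closure {r | ∃ (X Y Z : CompactPDG A) (f : X.1 ⟶ Y.1) (g : Y.1 ⟶ Z.1)
    (h : Z.1 ⟶ (DerivedPDG.homShift A).obj X.1), DerivedPDG.IsDistinguished f g h ∧
    r = FreeAbelianGroup.of Y - (FreeAbelianGroup.of X + FreeAbelianGroup.of Z)}

/-- The Grothendieck group of the compact derived category. -/
abbrev K0 {k : Type u} [Field k] {p : ℕ} [Fact p.Prime] [CharP k p] (A : PDGAlgebra k p) :
    Type (u + 1) :=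
  FreeAbelianGroup (CompactPDG A) ⧸ K0Relations A

namespace K0

variable {k : Type u} [Field k] {p : ℕ} [Fact p.Prime] [CharP k p]

/-- The symbol of a compact object. -/
def symbol {A : PDGAlgebra k p} (X : DerivedPDG A) (hX : DerivedPDG.IsCompact X) : K0 A :=
  QuotientAddGroup.mk (FreeAbelianGroup.of ⟨X, hX⟩)

/-- Multiplication by `qˡ` on the Grothendieck group, induced by the grading shift `{l}`. -/
noncomputable def qPow (A : PDGAlgebra k p) (l : ℤ) : K0 A →+ K0 A :=
  QuotientAddGroup.map _ _
    (FreeAbelianGroup.map fun X : CompactPDG A =>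
      (⟨(DerivedPDG.gradingShift A l).obj X.1, X.2.gradingShift l⟩ : CompactPDG A))
    (by
      rw [K0Relations, AddSubgroup.closure_le]
      rintro _ ⟨X, Y, Z, f, g, h, H, rfl⟩
      refine AddSubgroup.subset_closure ⟨⟨_, X.2.gradingShift l⟩, ⟨_, Y.2.gradingShift l⟩,
        ⟨_, Z.2.gradingShift l⟩, _, _, _, H.gradingShift l, ?_⟩
      simp)

theorem qPow_symbol (A : PDGAlgebra k p) (l : ℤ) (X : DerivedPDG A)
    (hX : DerivedPDG.IsCompact X) : qPow A l (symbol X hX) =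
      symbol ((DerivedPDG.gradingShift A l).obj X) (hX.gradingShift l) := by
  simp [qPow, symbol]

end K0

/-! ## The Webster algebra with two red and two black strands -/

namespace Webster

/-- The two kinds of strands. -/
inductive Strand
  | red
  | black
  deriving DecidableEq

/-- The boundary sequences (from left to right) of the diagrams: there are four strands, two of
them red and two black, and the leftmost strand is red. There are three of them. -/
def Seq : Type :=
  {w : Fin 4 → Strand // w 0 = Strand.red ∧
    (Finset.univ.filter fun j => w j = Strand.red).card = 2}

instance : DecidableEq Seq := inferInstanceAs (DecidableEq {_w : Fin 4 → Strand // _})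

instance : Fintype Strand := ⟨{Strand.red, Strand.black}, fun x => by cases x <;> simp⟩

instance : Fintype Seq := inferInstanceAs (Fintype {_w : Fin 4 → Strand // _})

/-- The left one of the two positions `i + 1`, `i + 2` at which the crossing `i` takes place; the
leftmost strand, in position `0`, does not cross anything. -/
def lo (i : Fin 2) : Fin 4 := i.succ.castSucc

/-- The right one of the two positions `i + 1`, `i + 2` at which the crossing `i` takes place. -/
def hi (i : Fin 2) : Fin 4 := i.succ.succ

/-- Exchange of the strands in the positions `lo i` and `hi i`. -/
def Seq.swap (i : Fin 2) (w : Seq) : Seq :=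
  ⟨w.1 ∘ Equiv.swap (lo i) (hi i), by
    obtain ⟨w, h0, h⟩ := w
    revert w
    revert i
    decide⟩

theorem Seq.swap_swap (i : Fin 2) (w : Seq) : Seq.swap i (Seq.swap i w) = w := by
  revert i w; decide

theorem Seq.swap_eq {i : Fin 2} {w : Seq} (h : w.1 (lo i) = w.1 (hi i)) : Seq.swap i w = w := by
  revert i w; decide

/-- The local generators, placed in a diagram without further features. For the generators of the
second and third kind, `w` is the sequence at the bottom of the diagram. -/
inductive Gen
  /-- the diagram of vertical strands -/
  | idem (w : Seq)
  /-- a dot on the `j`-th strand -/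
  | dot (j : Fin 4) (w : Seq)
  /-- a crossing of the strands in the positions `lo i` and `hi i` -/
  | cross (i : Fin 2) (w : Seq)

/-- The degree of a generator: dots have degree two, crossings of black strands degree `-2`,
crossings of a red and a black strand degree one. -/
def Gen.deg : Gen → ℤ
  | .idem _ => 0
  | .dot _ _ => 2
  | .cross i w => if w.1 (lo i) = w.1 (hi i) then -2 else 1

variable (k : Type u) [Field k]

/-- The vertical strands in the free algebra. -/
abbrev fe (w : Seq) : FreeAlgebra k Gen := FreeAlgebra.ι k (Gen.idem w)

/-- A dot in the free algebra. -/
abbrev fx (j : Fin 4) (w : Seq) : FreeAlgebra k Gen := FreeAlgebra.ι k (Gen.dot j w)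

/-- A crossing in the free algebra. -/
abbrev fc (i : Fin 2) (w : Seq) : FreeAlgebra k Gen := FreeAlgebra.ι k (Gen.cross i w)

open Strand in
/-- The relations among the generators. A product `a * b` is the diagram `a` on top of the diagram
`b`; it is zero if the sequences do not match. Besides the leftmost strand there is only one red
strand, so that two red strands never meet. -/
inductive Rel : FreeAlgebra k Gen → FreeAlgebra k Gen → Prop
  | idem_mul_self (w : Seq) : Rel (fe k w * fe k w) (fe k w)
  | idem_mul_ne (v w : Seq) (h : v ≠ w) : Rel (fe k v * fe k w) 0
  | sum_idem : Rel (∑ w, fe k w) 1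
  | idem_mul_dot (j : Fin 4) (w : Seq) : Rel (fe k w * fx k j w) (fx k j w)
  | dot_mul_idem (j : Fin 4) (w : Seq) : Rel (fx k j w * fe k w) (fx k j w)
  | idem_mul_cross (i : Fin 2) (w : Seq) : Rel (fe k (w.swap i) * fc k i w) (fc k i w)
  | cross_mul_idem (i : Fin 2) (w : Seq) : Rel (fc k i w * fe k w) (fc k i w)
  /-- red strands carry no dots -/
  | dot_red (j : Fin 4) (w : Seq) (h : w.1 j = red) : Rel (fx k j w) 0
  /-- far away dots and crossings commute -/
  | dot_comm (j l : Fin 4) (w : Seq) : Rel (fx k j w * fx k l w) (fx k l w * fx k j w)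
  | dot_far (i : Fin 2) (l : Fin 4) (w : Seq) (h : l ≠ lo i) (h' : l ≠ hi i) :
      Rel (fc k i w * fx k l w) (fx k l (w.swap i) * fc k i w)
  /-- nilHecke relations -/
  | black_black (i : Fin 2) (w : Seq) (h : w.1 (lo i) = black) (h' : w.1 (hi i) = black) :
      Rel (fc k i (w.swap i) * fc k i w) 0
  | nilHecke_left (i : Fin 2) (w : Seq) (h : w.1 (lo i) = black) (h' : w.1 (hi i) = black) :
      Rel (fc k i w * fx k (lo i) w - fx k (hi i) (w.swap i) * fc k i w) (fe k w)
  | nilHecke_right (i : Fin 2) (w : Seq) (h : w.1 (lo i) = black) (h' : w.1 (hi i) = black) :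
      Rel (fx k (lo i) (w.swap i) * fc k i w - fc k i w * fx k (hi i) w) (fe k w)
  /-- a double crossing of a red and a black strand is a dot on the black strand -/
  | red_black (i : Fin 2) (w : Seq) (h : w.1 (lo i) = red) (h' : w.1 (hi i) = black) :
      Rel (fc k i (w.swap i) * fc k i w) (fx k (hi i) w)
  | black_red (i : Fin 2) (w : Seq) (h : w.1 (lo i) = black) (h' : w.1 (hi i) = red) :
      Rel (fc k i (w.swap i) * fc k i w) (fx k (lo i) w)
  /-- dots slide through crossings of red and black strands -/
  | slide_red_black (i : Fin 2) (w : Seq) (h : w.1 (lo i) = red) (h' : w.1 (hi i) = black) :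
      Rel (fc k i w * fx k (hi i) w) (fx k (lo i) (w.swap i) * fc k i w)
  | slide_black_red (i : Fin 2) (w : Seq) (h : w.1 (lo i) = black) (h' : w.1 (hi i) = red) :
      Rel (fc k i w * fx k (lo i) w) (fx k (hi i) (w.swap i) * fc k i w)
  /-- triple crossings; in the second relation the red strand is in the middle and passes, in the
  first product, to the left of the crossing of the black strands -/
  | triple (w : Seq) (h : w.1 2 = black) :
      Rel (fc k 0 ((w.swap 0).swap 1) * fc k 1 (w.swap 0) * fc k 0 w)
        (fc k 1 ((w.swap 1).swap 0) * fc k 0 (w.swap 1) * fc k 1 w)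
  | triple_middle (w : Seq) (h : w.1 2 = red) :
      Rel (fc k 0 ((w.swap 0).swap 1) * fc k 1 (w.swap 0) * fc k 0 w -
        fc k 1 ((w.swap 1).swap 0) * fc k 0 (w.swap 1) * fc k 1 w) (fe k w)

/-- The algebra `W̃` (without cyclotomic relation) for two red and two black strands. -/
def Alg : Type u := RingQuot (Rel k)

noncomputable instance : Ring (Alg k) := inferInstanceAs (Ring (RingQuot (Rel k)))

noncomputable instance : Algebra k (Alg k) := inferInstanceAs (Algebra k (RingQuot (Rel k)))

/-- The quotient map from the free algebra. -/
noncomputable def mk : FreeAlgebra k Gen →ₐ[k] Alg k := RingQuot.mkAlgHom k (Rel k)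

/-- The universal property of the algebra. -/
noncomputable def lift {B : Type*} [Ring B] [Algebra k B] (f : FreeAlgebra k Gen →ₐ[k] B)
    (h : ∀ a b, Rel k a b → f a = f b) : Alg k →ₐ[k] B :=
  RingQuot.liftAlgHom k ⟨f, fun {a b} => h a b⟩

theorem lift_mk {B : Type*} [Ring B] [Algebra k B] (f : FreeAlgebra k Gen →ₐ[k] B)
    (h : ∀ a b, Rel k a b → f a = f b) (a : FreeAlgebra k Gen) : lift k f h (mk k a) = f a :=
  RingQuot.liftAlgHom_mkAlgHom_apply k f (fun {a b} => h a b) a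

theorem mk_surjective : Function.Surjective (mk k) := RingQuot.mkAlgHom_surjective k (Rel k)

variable {k}

/-- A generator, as an element of the algebra. -/
noncomputable def gen (g : Gen) : Alg k := mk k (FreeAlgebra.ι k g)

/-- The vertical strands. -/
noncomputable abbrev e (w : Seq) : Alg k := gen (Gen.idem w)

/-- A dot on the strand in position `j`. -/
noncomputable abbrev x (j : Fin 4) (w : Seq) : Alg k := gen (Gen.dot j w)

/-- A crossing of the strands in the positions `lo i` and `hi i`. -/
noncomputable abbrev c (i : Fin 2) (w : Seq) : Alg k := gen (Gen.cross i w)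

section relations

theorem rel {a b : FreeAlgebra k Gen} (h : Rel k a b) :
    mk k a = mk k b := RingQuot.mkAlgHom_rel k h

theorem e_mul_self (w : Seq) : (e w * e w : Alg k) = e w := by
  simpa using! rel (Rel.idem_mul_self (k := k) w)

theorem e_mul_ne (v w : Seq) (h : v ≠ w) : (e v * e w : Alg k) = 0 := by
  simpa using! rel (Rel.idem_mul_ne (k := k) v w h)

theorem sum_e : (∑ w, e w : Alg k) = 1 := by
  simpa using! rel (Rel.sum_idem (k := k))

theorem e_x (j : Fin 4) (w : Seq) : (e w * x j w : Alg k) = x j w := by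
  simpa using! rel (Rel.idem_mul_dot (k := k) j w)

theorem x_e (j : Fin 4) (w : Seq) : (x j w * e w : Alg k) = x j w := by
  simpa using! rel (Rel.dot_mul_idem (k := k) j w)

theorem e_c (i : Fin 2) (w : Seq) : (e (w.swap i) * c i w : Alg k) = c i w := by
  simpa using! rel (Rel.idem_mul_cross (k := k) i w)

theorem c_e (i : Fin 2) (w : Seq) : (c i w * e w : Alg k) = c i w := by
  simpa using! rel (Rel.cross_mul_idem (k := k) i w)

theorem x_red (j : Fin 4) (w : Seq) (h : w.1 j = Strand.red) : (x j w : Alg k) = 0 := by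
  simpa using! rel (Rel.dot_red (k := k) j w h)

theorem x_comm (j l : Fin 4) (w : Seq) : (x j w * x l w : Alg k) = x l w * x j w := by
  simpa using! rel (Rel.dot_comm (k := k) j l w)

theorem c_x_far (i : Fin 2) (l : Fin 4) (w : Seq) (h : l ≠ lo i) (h' : l ≠ hi i) :
    (c i w * x l w : Alg k) = x l (w.swap i) * c i w := by
  simpa using! rel (Rel.dot_far (k := k) i l w h h')

variable {i : Fin 2} {w : Seq}

theorem c_c_black (h : w.1 (lo i) = Strand.black) (h' : w.1 (hi i) = Strand.black) :
    (c i w * c i w : Alg k) = 0 := by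
  have := rel (Rel.black_black (k := k) i w h h')
  rw [Seq.swap_eq (h.trans h'.symm)] at this
  simpa using! this

theorem nilHecke_left (h : w.1 (lo i) = Strand.black) (h' : w.1 (hi i) = Strand.black) :
    (c i w * x (lo i) w : Alg k) = x (hi i) w * c i w + e w := by
  have := rel (Rel.nilHecke_left (k := k) i w h h')
  rw [Seq.swap_eq (h.trans h'.symm)] at this
  rw [← sub_eq_iff_eq_add']
  simpa using! this

theorem nilHecke_right (h : w.1 (lo i) = Strand.black) (h' : w.1 (hi i) = Strand.black) :
    (c i w * x (hi i) w : Alg k) = x (lo i) w * c i w - e w := by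
  have := rel (Rel.nilHecke_right (k := k) i w h h')
  rw [Seq.swap_eq (h.trans h'.symm)] at this
  rw [eq_sub_iff_add_eq', ← eq_sub_iff_add_eq]
  simpa using! this.symm

theorem c_c_red_black (h : w.1 (lo i) = Strand.red) (h' : w.1 (hi i) = Strand.black) :
    (c i (w.swap i) * c i w : Alg k) = x (hi i) w := by
  simpa using! rel (Rel.red_black (k := k) i w h h')

theorem c_c_black_red (h : w.1 (lo i) = Strand.black) (h' : w.1 (hi i) = Strand.red) :
    (c i (w.swap i) * c i w : Alg k) = x (lo i) w := by
  simpa using! rel (Rel.black_red (k := k) i w h h')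

theorem slide_red_black (h : w.1 (lo i) = Strand.red) (h' : w.1 (hi i) = Strand.black) :
    (c i w * x (hi i) w : Alg k) = x (lo i) (w.swap i) * c i w := by
  simpa using! rel (Rel.slide_red_black (k := k) i w h h')

theorem slide_black_red (h : w.1 (lo i) = Strand.black) (h' : w.1 (hi i) = Strand.red) :
    (c i w * x (lo i) w : Alg k) = x (hi i) (w.swap i) * c i w := by
  simpa using! rel (Rel.slide_black_red (k := k) i w h h')

theorem triple (w : Seq) (h : w.1 2 = Strand.black) :
    (c 0 ((w.swap 0).swap 1) * c 1 (w.swap 0) * c 0 w : Alg k) =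
      c 1 ((w.swap 1).swap 0) * c 0 (w.swap 1) * c 1 w := by
  simpa using! rel (Rel.triple (k := k) w h)

theorem triple_middle (w : Seq) (h : w.1 2 = Strand.red) :
    (c 0 ((w.swap 0).swap 1) * c 1 (w.swap 0) * c 0 w -
      c 1 ((w.swap 1).swap 0) * c 0 (w.swap 1) * c 1 w : Alg k) = e w := by
  simpa using! rel (Rel.triple_middle (k := k) w h)

end relations

/-! ### The grading -/

/-- The homogeneous elements of degree `n`: the span of the products of generators of total
degree `n`. -/
noncomputable def gr (n : ℤ) : Submodule k (Alg k) :=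
  Submodule.span k {a | ∃ L : List Gen, (L.map Gen.deg).sum = n ∧ a = (L.map gen).prod}

theorem prod_mem_gr (L : List Gen) : ((L.map gen).prod : Alg k) ∈ gr (L.map Gen.deg).sum :=
  Submodule.subset_span ⟨L, rfl, rfl⟩

theorem gen_mem_gr (g : Gen) : (gen g : Alg k) ∈ gr g.deg := by
  simpa using prod_mem_gr (k := k) [g]

theorem one_mem_gr : (1 : Alg k) ∈ gr 0 := prod_mem_gr []

theorem mul_mem_gr {m n : ℤ} {a b : Alg k} (ha : a ∈ gr m) (hb : b ∈ gr n) :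
    a * b ∈ gr (m + n) := by
  have h := Submodule.mul_mem_mul ha hb
  rw [gr, gr, Submodule.span_mul_span] at h
  refine Submodule.span_mono ?_ h
  rintro _ ⟨_, ⟨L, rfl, rfl⟩, _, ⟨L', rfl, rfl⟩, rfl⟩
  exact ⟨L ++ L', by simp, by simp⟩

theorem span_prod :
    Submodule.span k (Set.range fun L : List Gen => ((L.map gen).prod : Alg k)) = ⊤ := by
  rw [eq_top_iff]
  rintro a -
  obtain ⟨a, rfl⟩ := mk_surjective k a
  induction a using FreeAlgebra.induction with
  | grade0 r =>
    rw [AlgHom.commutes, Algebra.algebraMap_eq_smul_one]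
    exact Submodule.smul_mem _ _ (Submodule.subset_span ⟨[], rfl⟩)
  | grade1 g => exact Submodule.subset_span ⟨[g], by simp [gen]⟩
  | mul a b ha hb =>
    rw [map_mul]
    have h := Submodule.mul_mem_mul ha hb
    rw [Submodule.span_mul_span] at h
    refine Submodule.span_mono ?_ h
    rintro _ ⟨_, ⟨L, rfl⟩, _, ⟨L', rfl⟩, rfl⟩
    exact ⟨L ++ L', by simp⟩
  | add a b ha hb =>
    rw [map_add]
    exact add_mem ha hb

theorem deg_cross_black {i : Fin 2} {w : Seq} (h : w.1 (lo i) = Strand.black)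
    (h' : w.1 (hi i) = Strand.black) : (Gen.cross i w).deg = -2 := by
  simp [Gen.deg, h, h']

theorem deg_cross_mixed {i : Fin 2} {w : Seq} (h : w.1 (lo i) ≠ w.1 (hi i)) :
    (Gen.cross i w).deg = 1 := by
  simp [Gen.deg, h]

theorem deg_cross_swap (i : Fin 2) (w : Seq) :
    (Gen.cross i (w.swap i)).deg = (Gen.cross i w).deg := by
  revert i w; decide

theorem deg_triple (w : Seq) : (Gen.cross 0 ((w.swap 0).swap 1)).deg +
    (Gen.cross 1 (w.swap 0)).deg + (Gen.cross 0 w).deg =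
      (Gen.cross 1 ((w.swap 1).swap 0)).deg + (Gen.cross 0 (w.swap 1)).deg +
        (Gen.cross 1 w).deg := by
  revert w; decide

theorem deg_triple_middle (w : Seq) (h : w.1 2 = Strand.red) :
    (Gen.cross 0 ((w.swap 0).swap 1)).deg + (Gen.cross 1 (w.swap 0)).deg +
      (Gen.cross 0 w).deg = 0 := by
  revert w; decide

/-- The algebra map `a ↦ ∑ aₙ Tⁿ` that records the degrees. -/
noncomputable def coaction : Alg k →ₐ[k] AddMonoidAlgebra (Alg k) ℤ :=
  lift k (FreeAlgebra.lift k fun g => AddMonoidAlgebra.single g.deg (gen g)) (by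
    intro a b h
    have hr := rel h
    cases h with
    | sum_idem =>
      simp only [map_sum, map_one, FreeAlgebra.lift_ι_apply] at hr ⊢
      change (∑ w, AddMonoidAlgebra.single (0 : ℤ) (e w : Alg k)) = 1
      exact (map_sum (AddMonoidAlgebra.singleAddHom (0 : ℤ)) (fun w => (e w : Alg k)) _).symm.trans
        (congrArg (AddMonoidAlgebra.single (0 : ℤ)) sum_e)
    | dot_red j w h => simp [x_red j w h]
    | dot_far i l w h h' =>
      simp only [map_mul, FreeAlgebra.lift_ι_apply, AddMonoidAlgebra.single_mul_single,
        c_x_far i l w h h']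
      congr 1
      simp only [Gen.deg]; ring
    | dot_comm j l w =>
      simp only [map_mul, FreeAlgebra.lift_ι_apply, AddMonoidAlgebra.single_mul_single,
        x_comm j l w]
      rfl
    | nilHecke_left i w h h' =>
      simp only [map_mul, map_sub, FreeAlgebra.lift_ι_apply, AddMonoidAlgebra.single_mul_single,
        Seq.swap_eq (h.trans h'.symm), nilHecke_left h h', deg_cross_black h h']
      simp only [Gen.deg]
      rw [AddMonoidAlgebra.single_add, add_comm (-2 : ℤ) 2]
      exact add_sub_cancel_left (G := AddMonoidAlgebra (Alg k) ℤ) _ _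
    | nilHecke_right i w h h' =>
      simp only [map_mul, map_sub, FreeAlgebra.lift_ι_apply, AddMonoidAlgebra.single_mul_single,
        Seq.swap_eq (h.trans h'.symm), nilHecke_right h h', deg_cross_black h h']
      simp [Gen.deg]
    | black_black i w h h' =>
      simp only [map_mul, FreeAlgebra.lift_ι_apply, AddMonoidAlgebra.single_mul_single,
        Seq.swap_eq (h.trans h'.symm), c_c_black h h']
      simp
    | red_black i w h h' =>
      simp only [map_mul, FreeAlgebra.lift_ι_apply, AddMonoidAlgebra.single_mul_single,
        c_c_red_black h h', deg_cross_swap, deg_cross_mixed (show w.1 (lo i) ≠ w.1 (hi i) by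
          rw [h, h']; decide)]
      rfl
    | black_red i w h h' =>
      simp only [map_mul, FreeAlgebra.lift_ι_apply, AddMonoidAlgebra.single_mul_single,
        c_c_black_red h h', deg_cross_swap, deg_cross_mixed (show w.1 (lo i) ≠ w.1 (hi i) by
          rw [h, h']; decide)]
      rfl
    | slide_red_black i w h h' =>
      simp only [map_mul, FreeAlgebra.lift_ι_apply, AddMonoidAlgebra.single_mul_single,
        slide_red_black h h']
      congr 1
      simp only [Gen.deg]; ring
    | slide_black_red i w h h' =>
      simp only [map_mul, FreeAlgebra.lift_ι_apply, AddMonoidAlgebra.single_mul_single,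
        slide_black_red h h']
      congr 1
      simp only [Gen.deg]; ring
    | triple w h =>
      simp only [map_mul, FreeAlgebra.lift_ι_apply, AddMonoidAlgebra.single_mul_single,
        triple w h, deg_triple]
    | triple_middle w h =>
      simp only [map_mul, map_sub, FreeAlgebra.lift_ι_apply, AddMonoidAlgebra.single_mul_single,
        ← deg_triple, deg_triple_middle w h]
      rw [← AddMonoidAlgebra.single_sub, triple_middle w h]
      rfl
    | idem_mul_self w =>
      simp only [map_mul, FreeAlgebra.lift_ι_apply, AddMonoidAlgebra.single_mul_single, e_mul_self]
      rfl
    | idem_mul_ne v w h =>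
      simp only [map_mul, FreeAlgebra.lift_ι_apply, AddMonoidAlgebra.single_mul_single,
        e_mul_ne v w h]
      simp
    | idem_mul_dot j w =>
      simp only [map_mul, FreeAlgebra.lift_ι_apply, AddMonoidAlgebra.single_mul_single, e_x]
      rfl
    | dot_mul_idem j w =>
      simp only [map_mul, FreeAlgebra.lift_ι_apply, AddMonoidAlgebra.single_mul_single, x_e]
      rfl
    | idem_mul_cross i w =>
      simp only [map_mul, FreeAlgebra.lift_ι_apply, AddMonoidAlgebra.single_mul_single, e_c]
      simp [Gen.deg]
    | cross_mul_idem i w =>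
      simp only [map_mul, FreeAlgebra.lift_ι_apply, AddMonoidAlgebra.single_mul_single, c_e]
      simp [Gen.deg])

theorem coaction_gen (g : Gen) :
    coaction (gen g : Alg k) = AddMonoidAlgebra.single g.deg (gen g) := by
  rw [coaction, gen, lift_mk, FreeAlgebra.lift_ι_apply, gen]

theorem coaction_prod (L : List Gen) : coaction ((L.map gen).prod : Alg k) =
    AddMonoidAlgebra.single (L.map Gen.deg).sum (L.map gen).prod := by
  induction L with
  | nil => exact map_one _
  | cons g L ih =>
    simp only [List.map_cons, List.prod_cons, List.sum_cons, map_mul, ih, coaction_gen,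
      AddMonoidAlgebra.single_mul_single]

theorem coaction_gr {n : ℤ} {a : Alg k} (ha : a ∈ gr n) :
    coaction a = AddMonoidAlgebra.single n a := by
  induction ha using Submodule.span_induction with
  | mem a h => obtain ⟨L, rfl, rfl⟩ := h; exact coaction_prod L
  | zero => simp
  | add a b _ _ ha hb => rw [map_add, ha, hb, AddMonoidAlgebra.single_add]
  | smul r a _ ha => rw [map_smul, ha, AddMonoidAlgebra.smul_single]

theorem gr_internal : DirectSum.IsInternal (gr (k := k)) := by
  refine DirectSum.isInternal_submodule_of_iSupIndep_of_iSup_eq_top ?_ ?_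
  · rw [iSupIndep_def]
    intro n
    rw [Submodule.disjoint_def]
    intro a ha ha'
    have h1 : ∀ b ∈ ⨆ (j : ℤ) (_ : j ≠ n), gr (k := k) j, 
        (coaction b).coeff n = 0 := by
      intro b hb
      induction hb using Submodule.iSup_induction' with
      | mem j b hb =>
        by_cases hj : j = n
        · simp [hj] at hb; simp [hb]
        · simp only [ne_eq, hj, not_false_eq_true, iSup_pos] at hb
          rw [coaction_gr hb]
          exact Finsupp.single_eq_of_ne (Ne.symm hj)
      | zero => simp
      | add b c _ _ hb hc => rw [map_add]; simp [hb, hc]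
    have h2 := h1 a ha'
    rw [coaction_gr ha, AddMonoidAlgebra.coeff_single, Finsupp.single_eq_same] at h2
    exact h2
  · rw [eq_top_iff, ← span_prod, Submodule.span_le]
    rintro _ ⟨L, rfl⟩
    exact Submodule.mem_iSup_of_mem _ (prod_mem_gr L)

end Webster

namespace Webster

variable {k : Type u} [Field k]

/-! ### The differential -/

open Strand in
/-- The value of the differential with parameter `μ` on the generators. -/
noncomputable def dGen (μ : k) : Gen → Alg k
  | .idem _ => 0
  | .dot j w => x j w * x j w
  | .cross i w =>
    match w.1 (lo i), w.1 (hi i) with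
    | black, black => e w - 2 • (x (lo i) w * c i w)
    | red, black => μ • (x (lo i) (w.swap i) * c i w)
    | black, red => (1 - μ) • (x (hi i) (w.swap i) * c i w)
    | red, red => 0

section dGen

variable {i : Fin 2} {w : Seq} (μ : k)

theorem dGen_idem (w : Seq) : dGen μ (.idem w) = 0 := rfl

theorem dGen_dot (j : Fin 4) (w : Seq) : dGen μ (.dot j w) = x j w * x j w := rfl

theorem dGen_black_black (h : w.1 (lo i) = Strand.black) (h' : w.1 (hi i) = Strand.black) :
    dGen μ (.cross i w) = e w - 2 • (x (lo i) w * c i w) := by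
  simp only [dGen, h, h']

theorem dGen_red_black (h : w.1 (lo i) = Strand.red) (h' : w.1 (hi i) = Strand.black) :
    dGen μ (.cross i w) = μ • (x (lo i) (w.swap i) * c i w) := by
  simp only [dGen, h, h']

theorem dGen_black_red (h : w.1 (lo i) = Strand.black) (h' : w.1 (hi i) = Strand.red) :
    dGen μ (.cross i w) = (1 - μ) • (x (hi i) (w.swap i) * c i w) := by
  simp only [dGen, h, h']

theorem swap_lo : (w.swap i).1 (lo i) = w.1 (hi i) := by
  revert i w; decide

theorem swap_hi : (w.swap i).1 (hi i) = w.1 (lo i) := by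
  revert i w; decide

/-- Two red strands do not meet. -/
theorem cross_cases (i : Fin 2) (w : Seq) :
    (w.1 (lo i) = .black ∧ w.1 (hi i) = .black) ∨ (w.1 (lo i) = .red ∧ w.1 (hi i) = .black) ∨
      (w.1 (lo i) = .black ∧ w.1 (hi i) = .red) := by
  revert i w; decide

end dGen

/-- The sequence red, black, red, black. -/
def s0 : Seq := ⟨![.red, .black, .red, .black], by decide⟩

/-- The sequence red, red, black, black. -/
def s1 : Seq := ⟨![.red, .red, .black, .black], by decide⟩

/-- The sequence red, black, black, red. -/
def s2 : Seq := ⟨![.red, .black, .black, .red], by decide⟩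

theorem seq_cases (w : Seq) : w = s0 ∨ w = s1 ∨ w = s2 := by
  revert w; decide

theorem swap_s0_0 : s0.swap 0 = s1 := by decide
theorem swap_s0_1 : s0.swap 1 = s2 := by decide
theorem swap_s1_0 : s1.swap 0 = s0 := by decide
theorem swap_s1_1 : s1.swap 1 = s1 := by decide
theorem swap_s2_0 : s2.swap 0 = s2 := by decide
theorem swap_s2_1 : s2.swap 1 = s0 := by decide

section concrete

variable (μ : k)

theorem lo_zero : lo 0 = 1 := rfl
theorem lo_one : lo 1 = 2 := rfl
theorem hi_zero : hi 0 = 2 := rfl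
theorem hi_one : hi 1 = 3 := rfl

theorem dGen_cross_s0_0 : dGen μ (.cross 0 s0) = (1 - μ) • (x 2 s1 * c 0 s0) :=
  swap_s0_0 ▸ dGen_black_red μ rfl rfl

theorem dGen_cross_s0_1 : dGen μ (.cross 1 s0) = μ • (x 2 s2 * c 1 s0) :=
  swap_s0_1 ▸ dGen_red_black μ rfl rfl

theorem dGen_cross_s1_0 : dGen μ (.cross 0 s1) = μ • (x 1 s0 * c 0 s1) :=
  swap_s1_0 ▸ dGen_red_black μ rfl rfl

theorem dGen_cross_s1_1 : dGen μ (.cross 1 s1) = e s1 - 2 • (x 2 s1 * c 1 s1) :=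
  dGen_black_black μ rfl rfl

theorem dGen_cross_s2_0 : dGen μ (.cross 0 s2) = e s2 - 2 • (x 1 s2 * c 0 s2) :=
  dGen_black_black μ rfl rfl

theorem dGen_cross_s2_1 : dGen μ (.cross 1 s2) = (1 - μ) • (x 3 s0 * c 1 s2) :=
  swap_s2_1 ▸ dGen_black_red μ rfl rfl

variable (k) in
/-- The instances of the relations for the three sequences, with dots moved upwards. -/
theorem concrete :
    (c 0 s0 * x 1 s0 : Alg k) = x 2 s1 * c 0 s0 ∧
    (c 0 s0 * x 3 s0 : Alg k) = x 3 s1 * c 0 s0 ∧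
    (c 1 s0 * x 3 s0 : Alg k) = x 2 s2 * c 1 s0 ∧
    (c 1 s0 * x 1 s0 : Alg k) = x 1 s2 * c 1 s0 ∧
    (c 0 s1 * x 2 s1 : Alg k) = x 1 s0 * c 0 s1 ∧
    (c 0 s1 * x 3 s1 : Alg k) = x 3 s0 * c 0 s1 ∧
    (c 1 s1 * x 2 s1 : Alg k) = x 3 s1 * c 1 s1 + e s1 ∧
    (c 1 s1 * x 3 s1 : Alg k) = x 2 s1 * c 1 s1 - e s1 ∧
    (c 0 s2 * x 1 s2 : Alg k) = x 2 s2 * c 0 s2 + e s2 ∧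
    (c 0 s2 * x 2 s2 : Alg k) = x 1 s2 * c 0 s2 - e s2 ∧
    (c 1 s2 * x 2 s2 : Alg k) = x 3 s0 * c 1 s2 ∧
    (c 1 s2 * x 1 s2 : Alg k) = x 1 s0 * c 1 s2 ∧
    (e s1 * c 0 s0 : Alg k) = c 0 s0 ∧
    (e s2 * c 1 s0 : Alg k) = c 1 s0 ∧
    (e s0 * c 0 s1 : Alg k) = c 0 s1 ∧
    (e s1 * c 1 s1 : Alg k) = c 1 s1 ∧
    (e s2 * c 0 s2 : Alg k) = c 0 s2 ∧
    (e s0 * c 1 s2 : Alg k) = c 1 s2 ∧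
    (c 0 s2 * (c 1 s0 * c 0 s1) : Alg k) = c 1 s0 * (c 0 s1 * c 1 s1) ∧
    (c 0 s0 * (c 1 s2 * c 0 s2) : Alg k) = c 1 s1 * (c 0 s0 * c 1 s2) ∧
    (c 0 s1 * (c 1 s1 * c 0 s0) : Alg k) = e s0 + c 1 s2 * (c 0 s2 * c 1 s0) := by
  have t1 := triple (k := k) s1 rfl
  have t2 := triple (k := k) s2 rfl
  have t0 := sub_eq_iff_eq_add.1 (triple_middle (k := k) s0 rfl)
  simp only [swap_s0_0, swap_s0_1, swap_s1_0, swap_s1_1, swap_s2_0, swap_s2_1, mul_assoc] at t0 t1 t2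
  exact ⟨swap_s0_0 ▸ slide_black_red (i := 0) rfl rfl,
    swap_s0_0 ▸ c_x_far 0 3 s0 (by decide) (by decide),
    swap_s0_1 ▸ slide_red_black (i := 1) rfl rfl,
    swap_s0_1 ▸ c_x_far 1 1 s0 (by decide) (by decide),
    swap_s1_0 ▸ slide_red_black (i := 0) rfl rfl,
    swap_s1_0 ▸ c_x_far 0 3 s1 (by decide) (by decide),
    nilHecke_left (i := 1) rfl rfl, nilHecke_right (i := 1) rfl rfl,
    nilHecke_left (i := 0) rfl rfl, nilHecke_right (i := 0) rfl rfl,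
    swap_s2_1 ▸ slide_black_red (i := 1) rfl rfl,
    swap_s2_1 ▸ c_x_far 1 1 s2 (by decide) (by decide),
    swap_s0_0 ▸ e_c 0 s0, swap_s0_1 ▸ e_c 1 s0, swap_s1_0 ▸ e_c 0 s1,
    by simpa only [swap_s1_1] using! e_c (k := k) 1 s1,
    by simpa only [swap_s2_0] using! e_c (k := k) 0 s2,
    swap_s2_1 ▸ e_c 1 s2, t1, t2, t0⟩

end concrete

theorem mul_assoc_of {R : Type*} [Semigroup R] {a b c : R} (h : a * b = c) (z : R) :
    a * (b * z) = c * z := by rw [← mul_assoc, h]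

open TrivSqZeroExt in
/-- The differential as an algebra map `a ↦ a + ∂(a) ε`. -/
noncomputable def dHom (μ : k) : Alg k →ₐ[k] TrivSqZeroExt (Alg k) (Alg k) :=
  lift k (FreeAlgebra.lift k fun g => inl (gen g) + inr (dGen μ g)) (by
    intro a b h
    have hr := rel h
    have hfst : ∀ z, (FreeAlgebra.lift k (fun g => (inl (gen g) + inr (dGen μ g) :
        TrivSqZeroExt (Alg k) (Alg k))) z).fst = mk k z := by
      intro z
      have : (fstHom k (Alg k) (Alg k)).comp (FreeAlgebra.lift k (fun g =>
          (inl (gen g) + inr (dGen μ g) : TrivSqZeroExt (Alg k) (Alg k)))) =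
          mk k := by
        ext g; simp [gen]
      exact congrArg (fun f => f z) this
    refine TrivSqZeroExt.ext ((hfst a).trans (hr.trans (hfst b).symm)) ?_
    clear hfst hr
    cases h with
    | sum_idem =>
      simp [dGen_idem, dGen_dot, TrivSqZeroExt.snd_sum]
    | dot_red j w h => simp [x_red j w h, dGen_idem, dGen_dot]
    | dot_far i l w h h' =>
      have hc := c_x_far (k := k) i l w h h'
      rcases cross_cases i w with ⟨h1, h2⟩ | ⟨h1, h2⟩ | ⟨h1, h2⟩
      · have hw := Seq.swap_eq (h1.trans h2.symm)
        simp only [hw] at hc ⊢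
        simp [dGen_black_black μ h1 h2, dGen_idem, dGen_dot, add_mul, mul_add, sub_mul, mul_sub, mul_assoc,
          mul_assoc_of hc, hc, two_mul, x_e, e_x, mul_assoc_of (x_comm (k := k) (lo i) l w)]
        abel
      · simp [dGen_red_black μ h1 h2, dGen_idem, dGen_dot, mul_assoc, mul_assoc_of hc, hc,
          mul_assoc_of (x_comm (k := k) (lo i) l _)]
        abel
      · simp [dGen_black_red μ h1 h2, dGen_idem, dGen_dot, mul_assoc, mul_assoc_of hc, hc,
          mul_assoc_of (x_comm (k := k) (hi i) l _)]
        abel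
    | dot_comm j l w =>
      simp [dGen_idem, dGen_dot, mul_assoc, mul_assoc_of (x_comm (k := k) j l w), x_comm (k := k) j l w]
      abel
    | nilHecke_left i w h h' =>
      have hc := nilHecke_left (k := k) h h'
      have hc' := nilHecke_right (k := k) h h'
      have hx := x_comm (k := k) (lo i) (hi i) w
      simp only [Seq.swap_eq (h.trans h'.symm)]
      simp [dGen_black_black μ h h', dGen_idem, dGen_dot, add_mul, mul_add, sub_mul, mul_sub, mul_assoc,
          mul_assoc_of hc, mul_assoc_of hc', hc, hc', two_mul, x_e, e_x, hx, mul_assoc_of hx]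
      abel
    | nilHecke_right i w h h' =>
      have hc := nilHecke_left (k := k) h h'
      have hc' := nilHecke_right (k := k) h h'
      have hx := x_comm (k := k) (lo i) (hi i) w
      simp only [Seq.swap_eq (h.trans h'.symm)]
      simp [dGen_black_black μ h h', dGen_idem, dGen_dot, add_mul, mul_add, sub_mul, mul_sub, mul_assoc,
          mul_assoc_of hc, mul_assoc_of hc', hc, hc', two_mul, x_e, e_x, hx, mul_assoc_of hx]
      abel
    | black_black i w h h' =>
      have hc := nilHecke_left (k := k) h h'
      have h0 := c_c_black (k := k) h h'
      have h1 := e_c (k := k) i w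
      simp only [Seq.swap_eq (h.trans h'.symm)] at h1 ⊢
      simp [dGen_black_black μ h h', dGen_idem, dGen_dot, add_mul, mul_add, sub_mul, mul_sub, mul_assoc,
          mul_assoc_of hc, hc, h0, c_e, h1, two_mul]
    | red_black i w h h' =>
      have h1 := slide_black_red (k := k) (i := i) (w := w.swap i) (swap_lo.trans h')
        (swap_hi.trans h)
      have h2 := c_c_red_black (k := k) h h'
      rw [Seq.swap_swap] at h1
      simp [dGen_red_black μ h h', dGen_black_red μ (i := i) (w := w.swap i) (swap_lo.trans h')
        (swap_hi.trans h), dGen_idem, dGen_dot, mul_assoc, mul_assoc_of h1, h2, Seq.swap_swap, sub_smul,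
        sub_mul]
    | black_red i w h h' =>
      have h1 := slide_red_black (k := k) (i := i) (w := w.swap i) (swap_lo.trans h')
        (swap_hi.trans h)
      have h2 := c_c_black_red (k := k) h h'
      rw [Seq.swap_swap] at h1
      simp [dGen_black_red μ h h', dGen_red_black μ (i := i) (w := w.swap i) (swap_lo.trans h')
        (swap_hi.trans h), dGen_idem, dGen_dot, mul_assoc, mul_assoc_of h1, h2, Seq.swap_swap]
      rw [← add_smul, sub_add_cancel, one_smul]
    | slide_red_black i w h h' =>
      have h1 := slide_red_black (k := k) h h'
      simp [dGen_red_black μ h h', dGen_idem, dGen_dot, mul_assoc, mul_assoc_of h1, h1]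
      abel
    | slide_black_red i w h h' =>
      have h1 := slide_black_red (k := k) h h'
      simp [dGen_black_red μ h h', dGen_idem, dGen_dot, mul_assoc, mul_assoc_of h1, h1]
      abel
    | triple w h =>
      obtain ⟨r1, r2, r3, r4, r5, r6, r7, r8, r9, r10, r11, r12, r13, r14, r15, r16, r17, r18,
        r19, r20, r21⟩ := concrete k
      rcases seq_cases w with rfl | rfl | rfl
      · exact absurd h (by decide)
      · simp only [swap_s0_0, swap_s0_1, swap_s1_0, swap_s1_1, swap_s2_0, swap_s2_1]
        simp [dGen_cross_s1_0, dGen_cross_s1_1, dGen_cross_s0_1, dGen_cross_s2_0, add_mul, mul_add,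
          sub_mul, mul_sub, mul_assoc, two_mul, mul_assoc_of r3, mul_assoc_of r4, mul_assoc_of r5,
          mul_assoc_of r6, mul_assoc_of r9, mul_assoc_of r10, mul_assoc_of r14, r14, r19, c_e]
        module
      · simp only [swap_s0_0, swap_s0_1, swap_s1_0, swap_s1_1, swap_s2_0, swap_s2_1]
        simp [dGen_cross_s2_0, dGen_cross_s2_1, dGen_cross_s0_0, dGen_cross_s1_1, add_mul, mul_add,
          sub_mul, mul_sub, mul_assoc, two_mul, mul_assoc_of r1, mul_assoc_of r2, mul_assoc_of r7,
          mul_assoc_of r8, mul_assoc_of r11, mul_assoc_of r12, mul_assoc_of r13, r20, c_e]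
        module
    | triple_middle w h =>
      obtain ⟨r1, r2, r3, r4, r5, r6, r7, r8, r9, r10, r11, r12, r13, r14, r15, r16, r17, r18,
        r19, r20, r21⟩ := concrete k
      rcases seq_cases w with rfl | rfl | rfl
      · have d1 : (c 0 s1 * c 0 s0 : Alg k) = x 1 s0 := swap_s0_0 ▸ c_c_black_red (i := 0) rfl rfl
        have d2 : (c 1 s2 * c 1 s0 : Alg k) = x 3 s0 := swap_s0_1 ▸ c_c_red_black (i := 1) rfl rfl
        simp only [swap_s0_0, swap_s0_1, swap_s1_0, swap_s1_1, swap_s2_0, swap_s2_1]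
        simp [dGen_cross_s2_0, dGen_cross_s2_1, dGen_cross_s0_0, dGen_cross_s1_1, add_mul, mul_add,
          dGen_cross_s1_0, dGen_cross_s0_1, dGen_idem,
          sub_mul, mul_sub, mul_assoc, two_mul, mul_assoc_of r5, mul_assoc_of r7, r13,
          mul_assoc_of r11, mul_assoc_of r12, r14, r21, mul_assoc_of r9, mul_assoc_of r10,
          mul_assoc_of r6, d1, d2, x_e]
        module
      · exact absurd h (by decide)
      · exact absurd h (by decide)
    | idem_mul_self w => simp [dGen_idem, dGen_dot]
    | idem_mul_ne v w h => simp [dGen_idem, dGen_dot]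
    | idem_mul_dot j w => simp [dGen_idem, dGen_dot, mul_assoc_of (e_x (k := k) j w)]
    | dot_mul_idem j w => simp [dGen_idem, dGen_dot, mul_assoc, x_e]
    | idem_mul_cross i w =>
      rcases cross_cases i w with ⟨h1, h2⟩ | ⟨h1, h2⟩ | ⟨h1, h2⟩
      · have hw := Seq.swap_eq (h1.trans h2.symm)
        simp only [hw]
        simp [dGen_black_black μ h1 h2, dGen_idem, dGen_dot, mul_sub, two_mul, mul_add, e_mul_self,
          mul_assoc_of (e_x (k := k) (lo i) w)]
      · simp [dGen_red_black μ h1 h2, dGen_idem, dGen_dot, mul_assoc_of (e_x (k := k) (lo i) _)]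
      · simp [dGen_black_red μ h1 h2, dGen_idem, dGen_dot, mul_assoc_of (e_x (k := k) (hi i) _)]
    | cross_mul_idem i w =>
      rcases cross_cases i w with ⟨h1, h2⟩ | ⟨h1, h2⟩ | ⟨h1, h2⟩
      · simp [dGen_black_black μ h1 h2, dGen_idem, dGen_dot, sub_mul, two_mul, add_mul, e_mul_self, mul_assoc, c_e]
      · simp [dGen_red_black μ h1 h2, dGen_idem, dGen_dot, mul_assoc, c_e]
      · simp [dGen_black_red μ h1 h2, dGen_idem, dGen_dot, mul_assoc, c_e])

end Webster

namespace PDGAux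

/-- In characteristic `p`, the `p`-th power of a derivation is a derivation. -/
theorem derivation_pow_mul {k : Type*} [Field k] (p : ℕ) [hp : Fact p.Prime] [CharP k p]
    {R : Type*} [Ring R] [Algebra k R] (D : Module.End k R)
    (hD : ∀ a b, D (a * b) = D a * b + a * D b) (a b : R) :
    (D ^ p) (a * b) = (D ^ p) a * b + a * (D ^ p) b := by
  have hc : Commute (LinearMap.mulLeft k D - LinearMap.mulRight k D)
      (LinearMap.mulRight k D) :=
    Commute.sub_left (R := Module.End k (Module.End k R))
      (LinearMap.commute_mulLeft_right (R := k) D D) (Commute.refl _)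
  have h1 : ∀ n : ℕ, ((LinearMap.mulLeft k D - LinearMap.mulRight k D) ^ n)
      (LinearMap.mulLeft k a) = LinearMap.mulLeft k ((D ^ n) a) := by
    intro n
    induction n with
    | zero => rfl
    | succ n ih =>
      rw [pow_succ', Module.End.mul_apply, ih, pow_succ', Module.End.mul_apply]
      refine LinearMap.ext fun z => ?_
      simp [hD]
  obtain ⟨r, hr⟩ := hc.exists_add_pow_prime_eq hp.out
  have h3 : LinearMap.mulLeft k D - LinearMap.mulRight k D + LinearMap.mulRight k D =
      LinearMap.mulLeft k D := LinearMap.ext fun z => sub_add_cancel _ _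
  rw [h3, natCast_end (k := k) p, LinearMap.pow_mulLeft,
    LinearMap.pow_mulRight] at hr
  have h2 := congrArg (fun f => f (LinearMap.mulLeft k a) b) hr
  simpa [h1] using h2

end PDGAux

namespace Webster

variable {k : Type u} [Field k]

theorem fst_dHom (μ : k) (a : Alg k) : (dHom μ a).fst = a := by
  obtain ⟨a, rfl⟩ := mk_surjective k a
  have h : ((TrivSqZeroExt.fstHom k (Alg k) (Alg k)).comp (dHom μ)).comp (mk k) = mk k := by
    refine FreeAlgebra.hom_ext (funext fun g => ?_)
    simp [dHom, gen, lift_mk]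
  exact congrArg (fun f => f a) h

/-- The differential `∂` with parameter `μ`. -/
noncomputable def d (μ : k) : Module.End k (Alg k) :=
  (TrivSqZeroExt.sndHom (Alg k) (Alg k)).restrictScalars k ∘ₗ (dHom μ).toLinearMap

theorem d_mul (μ : k) (a b : Alg k) : d μ (a * b) = d μ a * b + a * d μ b := by
  simp [d, fst_dHom, add_comm]

theorem d_gen (μ : k) (g : Gen) : d μ (gen g) = dGen μ g := by
  simp [d, dHom, gen, lift_mk]

theorem d_one (μ : k) : d μ 1 = 0 := by
  simp [d]

theorem dGen_mem (μ : k) (g : Gen) : dGen μ g ∈ gr (k := k) (g.deg + 2) := by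
  match g with
  | .idem w => exact zero_mem _
  | .dot j w => exact mul_mem_gr (gen_mem_gr (.dot j w)) (gen_mem_gr (.dot j w))
  | .cross i w =>
    have hx : ∀ j w', (x j w' * c i w : Alg k) ∈ gr ((Gen.cross i w).deg + 2) := fun j w' => by
      have := mul_mem_gr (gen_mem_gr (k := k) (.dot j w')) (gen_mem_gr (.cross i w))
      rwa [add_comm] at this
    rcases cross_cases i w with ⟨h1, h2⟩ | ⟨h1, h2⟩ | ⟨h1, h2⟩
    · rw [dGen_black_black μ h1 h2]
      refine sub_mem ?_ (nsmul_mem (hx _ _) 2)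
      rw [deg_cross_black h1 h2]
      exact gen_mem_gr (.idem w)
    · rw [dGen_red_black μ h1 h2]
      exact Submodule.smul_mem _ _ (hx _ _)
    · rw [dGen_black_red μ h1 h2]
      exact Submodule.smul_mem _ _ (hx _ _)

theorem d_mem (μ : k) {n : ℤ} {a : Alg k} (ha : a ∈ gr n) : d μ a ∈ gr (n + 2) := by
  induction ha using Submodule.span_induction with
  | mem a h =>
    obtain ⟨L, rfl, rfl⟩ := h
    induction L with
    | nil => rw [List.map_nil (f := gen), List.prod_nil, d_one]; exact zero_mem _
    | cons g L ih =>
      simp only [List.map_cons, List.prod_cons, List.sum_cons, d_mul, d_gen]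
      refine add_mem ?_ ?_
      · have := mul_mem_gr (dGen_mem μ g) (prod_mem_gr L)
        rwa [add_right_comm] at this
      · have := mul_mem_gr (gen_mem_gr g) ih
        rwa [← add_assoc] at this
  | zero => rw [map_zero]; exact zero_mem _
  | add a b _ _ ha hb => rw [map_add]; exact add_mem ha hb
  | smul r a _ ha => rw [map_smul]; exact Submodule.smul_mem _ _ ha

theorem d_pow_mul (p : ℕ) [hp : Fact p.Prime] [CharP k p] (μ : k) (a b : Alg k) :
    (d μ ^ p) (a * b) = (d μ ^ p) a * b + a * (d μ ^ p) b :=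
  PDGAux.derivation_pow_mul p (d μ) (d_mul μ) a b

theorem d_pow_of_d_eq_zero (p : ℕ) [hp : Fact p.Prime] (μ : k) {a : Alg k} (h : d μ a = 0) :
    (d μ ^ p) a = 0 := by
  have : p = p - 1 + 1 := by have := hp.out.pos; omega
  rw [this, pow_succ, Module.End.mul_apply, h, map_zero]

theorem d_x_pow (μ : k) (j : Fin 4) (w : Seq) (n : ℕ) :
    d μ (x j w ^ n) = n • x j w ^ (n + 1) := by
  induction n with
  | zero => simp [d_one]
  | succ n ih =>
    rw [pow_succ, d_mul, ih, d_gen, dGen_dot, smul_mul_assoc, ← pow_succ, ← mul_assoc, ← pow_succ,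
      ← pow_succ, succ_nsmul]

theorem d_pow_dot (p : ℕ) [hp : Fact p.Prime] [CharP k p] (μ : k) (j : Fin 4) (w : Seq) :
    (d μ ^ p) (x j w) = 0 := by
  have h : ∀ n : ℕ, (d μ ^ n) (x j w) = n.factorial • x j w ^ (n + 1) := by
    intro n
    induction n with
    | zero => simp
    | succ n ih =>
      rw [pow_succ', Module.End.mul_apply, ih, map_nsmul, d_x_pow, smul_smul, Nat.factorial_succ,
        mul_comm]
  rw [h, ← Nat.cast_smul_eq_nsmul k, (CharP.cast_eq_zero_iff k p _).2
    (Nat.dvd_factorial hp.out.pos le_rfl), zero_smul]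

theorem d_pow_mixed (p : ℕ) [hp : Fact p.Prime] [CharP k p] (μ ν : k) (l : ZMod p)
    (hl : ν = l.cast) (j : Fin 4) (w : Seq) (a : Alg k) (ha : d μ a = ν • (x j w * a)) :
    (d μ ^ p) a = 0 := by
  have h : ∀ n : ℕ, (d μ ^ n) a = (∏ m ∈ Finset.range n, (ν + m)) • (x j w ^ n * a) := by
    intro n
    induction n with
    | zero => simp
    | succ n ih =>
      rw [pow_succ', Module.End.mul_apply, ih, map_smul, d_mul, d_x_pow, ha, mul_smul_comm,
        ← mul_assoc, ← pow_succ, smul_mul_assoc, ← Nat.cast_smul_eq_nsmul k, ← add_smul,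
        smul_smul, Finset.prod_range_succ, add_comm (n : k)]
  have : NeZero p := ⟨hp.out.ne_zero⟩
  rw [h, Finset.prod_eq_zero (Finset.mem_range.2 (ZMod.val_lt (-l))), zero_smul]
  rw [hl, ZMod.natCast_val, ← ZMod.cast_add (dvd_refl p), add_neg_cancel, ZMod.cast_zero]

theorem d_pow_black (p : ℕ) [hp : Fact p.Prime] [CharP k p] (μ : k) {i : Fin 2} {w : Seq}
    (h : w.1 (lo i) = Strand.black) (h' : w.1 (hi i) = Strand.black) :
    (d μ ^ p) (c i w) = 0 := by
  have h1 : d μ (c i w) = e w - 2 • (x (lo i) w * c i w) := by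
    rw [d_gen, dGen_black_black μ h h']
  have h2 : d μ (d μ (c i w)) = 2 • (x (lo i) w * (x (lo i) w * c i w) - x (lo i) w) := by
    rw [h1, map_sub, map_nsmul, d_mul, h1, d_gen, d_gen, dGen_idem, dGen_dot]
    simp only [mul_sub, mul_smul_comm, x_e, mul_assoc]
    abel
  have h3 : d μ (d μ (d μ (c i w))) = 0 := by
    rw [h2, map_nsmul, map_sub, d_mul, d_mul, h1, d_gen, dGen_dot]
    simp only [mul_sub, mul_add, mul_smul_comm, x_e, mul_assoc]
    abel_nf
  by_cases hp2 : p = 2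
  · subst hp2
    rw [pow_two, Module.End.mul_apply, h2, ← Nat.cast_smul_eq_nsmul k, CharP.cast_eq_zero,
      zero_smul]
  · have : p = p - 3 + 3 := by have := hp.out.two_le; omega
    rw [this, pow_add, Module.End.mul_apply]
    exact (congrArg (d μ ^ (p - 3)) h3).trans (map_zero _)

theorem d_pow (p : ℕ) [hp : Fact p.Prime] [CharP k p] (l : ZMod p) :
    d (l.cast : k) ^ p = 0 := by
  have hg : ∀ g, (d (l.cast : k) ^ p) (gen g) = 0 := by
    intro g
    match g with
    | .idem w => exact d_pow_of_d_eq_zero p _ (d_gen _ _)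
    | .dot j w => exact d_pow_dot p _ j w
    | .cross i w =>
      rcases cross_cases i w with ⟨h1, h2⟩ | ⟨h1, h2⟩ | ⟨h1, h2⟩
      · exact d_pow_black p _ h1 h2
      · exact d_pow_mixed p _ _ l rfl _ _ _ (by rw [d_gen, dGen_red_black _ h1 h2])
      · exact d_pow_mixed p _ (1 - l.cast) (1 - l)
          (by rw [ZMod.cast_sub (dvd_refl p), ZMod.cast_one (dvd_refl p)]) _ _ _
          (by rw [d_gen, dGen_black_red _ h1 h2])
  refine LinearMap.ext fun a => ?_
  have ha : a ∈ Submodule.span k (Set.range fun L : List Gen => ((L.map gen).prod : Alg k)) := by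
    rw [span_prod]; trivial
  induction ha using Submodule.span_induction with
  | mem a h =>
    obtain ⟨L, rfl⟩ := h
    induction L with
    | nil => exact d_pow_of_d_eq_zero p _ (d_one _)
    | cons g L ih =>
      have ih' : (d (l.cast : k) ^ p) (L.map gen).prod = 0 := ih
      simp only [List.map_cons, List.prod_cons]
      rw [d_pow_mul, hg, ih']
      simp
  | zero => exact map_zero _
  | add a b _ _ ha hb => rw [map_add, ha, hb, map_add]
  | smul r a _ ha => rw [map_smul, ha, map_smul]

end Webster

/-! ## Projective modules cut out by idempotents -/

namespace PDGAlgebra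

variable {k : Type u} [Field k] {p : ℕ}

/-- The left ideal `A ε`, for an idempotent `ε`. -/
def idealOf (A : PDGAlgebra k p) (ε : A.carrier) : Submodule A.carrier A.carrier where
  carrier := {a | a * ε = a}
  add_mem' {a b} ha hb := by
    simp only [Set.mem_ofPred_eq] at *
    rw [add_mul, ha, hb]
  zero_mem' := zero_mul ε
  smul_mem' r a ha := by
    simp only [Set.mem_ofPred_eq, smul_eq_mul] at *
    rw [mul_assoc, ha]

/-- The restriction of the differential to `A ε`. -/
def idealOfD (A : PDGAlgebra k p) (ε : A.carrier) (hε : ε * ε = ε) (hd : A.d ε * ε = A.d ε) :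
    Module.End k (A.idealOf ε) where
  toFun a := ⟨A.d a.1, by
    obtain ⟨a, ha⟩ := a
    change a * ε = a at ha
    change A.d a * ε = A.d a
    nth_rewrite 1 [← ha]
    nth_rewrite 2 [← ha]
    rw [A.leibniz, add_mul, mul_assoc, hε, mul_assoc, hd]⟩
  map_add' a b := Subtype.ext (map_add A.d a.1 b.1)
  map_smul' r a := Subtype.ext (map_smul A.d r a.1)

/-- The `p`-DG module `A ε`, for an idempotent `ε` of degree zero such that `∂` preserves `A ε`. -/
def leftIdeal (A : PDGAlgebra k p) (ε : A.carrier) (hε : ε * ε = ε) (h0 : ε ∈ A.gr 0)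
    (hd : A.d ε * ε = A.d ε) : PDGModule A where
  carrier := A.idealOf ε
  gr n := (A.gr n).comap ((A.idealOf ε).subtype.restrictScalars k)
  internal := by
    refine PDGAux.internal_of
      (PDGAux.indep_of_maps (fun _ : Unit => (A.idealOf ε).subtype.restrictScalars k)
        (fun x hx => Subtype.ext (hx ())) _ (fun _ => A.gr) (fun _ i x hx => hx)
        fun _ => A.internal.submodule_iSupIndep)
      (PDGAux.top_of_maps (fun _ : Unit =>
        ({ toFun := fun a => ⟨a * ε, by
              change a * ε * ε = a * ε
              rw [mul_assoc, hε]⟩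
           map_add' := fun a b => Subtype.ext (add_mul a b ε)
           map_smul' := fun r a => Subtype.ext (smul_mul_assoc r a ε) } :
          A.carrier →ₗ[k] A.idealOf ε))
        (fun x => Submodule.mem_iSup_of_mem () ⟨x.1, Subtype.ext x.2⟩) _ (fun _ => A.gr)
        (fun _ i x hx => ?_) fun _ => A.internal.submodule_iSup_eq_top)
    refine Submodule.mem_iSup_of_mem i ?_
    change x * ε ∈ A.gr i
    simpa using A.mul_mem hx h0
  smul_mem ha hm := A.mul_mem ha hm
  d := A.idealOfD ε hε hd
  d_mem hm := A.d_mem hm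
  leibniz a m := Subtype.ext (A.leibniz a m.1)
  d_pow := by
    refine LinearMap.ext fun a => Subtype.ext ?_
    have h : ∀ n : ℕ, ((A.idealOfD ε hε hd ^ n) a).1 = (A.d ^ n) a.1 := by
      intro n
      induction n with
      | zero => rfl
      | succ n ih =>
        rw [pow_succ', pow_succ', Module.End.mul_apply, Module.End.mul_apply, ← ih]
        rfl
    refine (h p).trans ?_
    rw [A.d_pow]
    rfl

end PDGAlgebra

namespace Webster

variable (k : Type u) [Field k] (p : ℕ) [Fact p.Prime] [CharP k p]

/-- The `p`-DG algebra `(W̃, ∂_λ)`, for `λ` in the prime field. -/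
noncomputable def webster (l : ZMod p) : PDGAlgebra k p where
  carrier := Alg k
  gr := gr
  internal := gr_internal
  one_mem := one_mem_gr
  mul_mem := mul_mem_gr
  d := d (l.cast : k)
  d_mem := d_mem _
  leibniz := d_mul _
  d_pow := d_pow p l

/-- The `p`-DG module `W̃ e(w)`. -/
noncomputable def projective (l : ZMod p) (w : Seq) : PDGModule (webster k p l) :=
  (webster k p l).leftIdeal (e w : Alg k) (e_mul_self w) (gen_mem_gr (.idem w))
    (by
      have h : d (l.cast : k) (e w) = 0 := d_gen _ _
      have h' : d (l.cast : k) (e w) * e w = d (l.cast : k) (e w) := by rw [h, zero_mul]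
      exact h')

variable {k} in
/-- The idempotent attached to a crossing of black strands: minus the crossing on top of a dot on
its right strand. -/
noncomputable def divided (i : Fin 2) (w : Seq) : Alg k := -(c i w * x (hi i) w)

section

variable {i : Fin 2} {w : Seq} {k}

theorem divided_eq (h : w.1 (lo i) = Strand.black) (h' : w.1 (hi i) = Strand.black) :
    (divided i w : Alg k) = e w - x (lo i) w * c i w := by
  rw [divided, nilHecke_right h h', neg_sub]

theorem divided_mul_self (h : w.1 (lo i) = Strand.black) (h' : w.1 (hi i) = Strand.black) :
    (divided i w * divided i w : Alg k) = divided i w := by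
  have h1 := e_c (k := k) i w
  rw [Seq.swap_eq (h.trans h'.symm)] at h1
  nth_rewrite 1 [divided_eq h h']
  rw [divided, mul_neg, sub_mul, mul_assoc, mul_assoc_of (c_c_black h h'), mul_assoc_of h1,
    zero_mul, mul_zero, sub_zero]

theorem d_divided_eq (h : w.1 (lo i) = Strand.black) (h' : w.1 (hi i) = Strand.black) (μ : k) :
    d μ (divided i w) = -(x (lo i) w * divided i w) := by
  rw [divided_eq h h', map_sub, d_mul, d_gen, d_gen, d_gen, dGen_black_black μ h h', dGen_idem,
    dGen_dot, mul_sub, mul_sub, mul_smul_comm, x_e, mul_assoc]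
  abel

theorem d_divided (h : w.1 (lo i) = Strand.black) (h' : w.1 (hi i) = Strand.black) (μ : k) :
    d μ (divided i w) * divided i w = d μ (divided i w) := by
  rw [d_divided_eq h h', neg_mul, mul_assoc, divided_mul_self h h']

theorem divided_mem (h : w.1 (lo i) = Strand.black) (h' : w.1 (hi i) = Strand.black) :
    (divided i w : Alg k) ∈ gr 0 := by
  have := mul_mem_gr (gen_mem_gr (k := k) (.cross i w)) (gen_mem_gr (.dot (hi i) w))
  rw [deg_cross_black h h'] at this
  exact neg_mem this

end

/-- The `p`-DG module `W₀` of the sequence red, black, red, black. -/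
noncomputable abbrev W0 (l : ZMod p) : PDGModule (webster k p l) := projective k p l s0

/-- The `p`-DG module `W₁` of the sequence red, red, black, black. -/
noncomputable abbrev W1 (l : ZMod p) : PDGModule (webster k p l) := projective k p l s1

/-- The `p`-DG module `W₂` of the sequence red, black, black, red. -/
noncomputable abbrev W2 (l : ZMod p) : PDGModule (webster k p l) := projective k p l s2

/-- The divided power `W₁⁽²⁾`, shifted such that `W₁` is, up to filtration, the sum of
`W₁⁽²⁾{1}` and `W₁⁽²⁾{-1}`. -/
noncomputable abbrev W1div (l : ZMod p) : PDGModule (webster k p l) :=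
  PDGModule.gradingShift (-1) ((webster k p l).leftIdeal (divided 1 s1 : Alg k)
    (divided_mul_self rfl rfl) (divided_mem rfl rfl) (d_divided rfl rfl _))

/-- The divided power `W₂⁽²⁾`, shifted such that `W₂` is, up to filtration, the sum of
`W₂⁽²⁾{1}` and `W₂⁽²⁾{-1}`. -/
noncomputable abbrev W2div (l : ZMod p) : PDGModule (webster k p l) :=
  PDGModule.gradingShift (-1) ((webster k p l).leftIdeal (divided 0 s2 : Alg k)
    (divided_mul_self rfl rfl) (divided_mem rfl rfl) (d_divided rfl rfl _))

end Webster

namespace Webster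

variable (k : Type u) [Field k] (p : ℕ) [Fact p.Prime] [CharP k p]

/-- The element `φ₁`, right multiplication by which is the map from `W₀` to `W₁⁽²⁾`: from bottom to
top, a dot on the rightmost black strand, a crossing of this strand with the other black strand and
a crossing with the second red strand. -/
noncomputable def phi1 (l : ZMod p) : (webster k p l).carrier :=
  (c 0 s1 * c 1 s1 * x 3 s1 : Alg k)

/-- The element `ψ₂`, right multiplication by which is the map from `W₂⁽²⁾` to `W₀`: from bottom to
top, the rightmost black strand crosses the second red strand and the other black strand. -/
noncomputable def psi2 (l : ZMod p) : (webster k p l).carrier :=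
  (c 0 s2 * c 1 s0 : Alg k)

end Webster

/-! A split exact sequence gives the relation for λ = 1, and an Euler characteristic at a root of
unity excludes every other λ when p is odd.

The sequence. Let V₂ be the p-complex k = k in degrees −1 and 1. By the nilHecke relations (a₀, a₁)
↦ a₀ c + a₁ ε identifies Wᵢ⁽²⁾ ⊗ V₂ with Wᵢ, and it respects the differentials because ε ∂(c) = ε
(`dividedIso`). The composite of ψ₂ and φ₁ vanishes by the triple crossing relation. The relation
for a red strand in the middle says precisely that an explicit retraction and an explicit section
add up to the identity of W₀. So W₂⁽²⁾ → W₀ → W₁⁽²⁾ is exact and splits once the differentials are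
forgotten (`psiPhi`). For λ = 1 one has ∂(φ₁) = 0 and ε₂ ∂(ψ₂) = 0, so the maps respect the
differentials. Such a sequence gives a distinguished triangle: the kernel of the map from the cone
to the cokernel is M ⊗ Vₚ, with Vₚ the free module k[d]/(dᵖ), and is contractible
(`isQuasiIso_coneDesc`). Tensoring with V₂ gives W₂ → W₀ ⊗ V₂ → W₁, while W₀ ⊗ V₂ is also an
extension of W₀{−1} by W₀{1} (`symbol_relation`).

Compactness. A morphism from A e ⊗ V, with e a closed idempotent and V a string of length at most p,
is the choice of one element killed by a power of d. Such morphisms lift along quasi-isomorphisms up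
to maps that factor through a contractible module (`exists_lift_of_quasiIso`). Hence every morphism
from A e ⊗ V in the derived category is given by an element, and an element of a direct sum has
finite support.

The invariant. For a closed idempotent e, the homologies ker dᵖ⁻¹ / im d and ker d / im dᵖ⁻¹ of e M
are invariants of M in the derived category. They fit into periodic long exact sequences, so that
for qᵖ = 1 the graded dimension of the first minus q² times that of the second is additive on
triangles (`euler_add`). It remains to see that it is finite on compact M. If e A is
finite-dimensional up to homotopy, coinduction from e A turns sums of coefficients into direct sums
up to quasi-isomorphism. The coordinates of the first homology define a map from M to such a module;
by compactness this map meets finitely many summands only, so this homology is finite-dimensional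
(`DerivedPDG.isFinite_of_isCompact`). A filtration of ker d handles the second (`IsFinite.one`).

The computation. For e = e(s₁) the diagrams from w to s₁ have a basis indexed by the exponents m, n
of two dots and by a layer j in {0, 1}. It spans by straightening and is independent by a matrix
representation. The differential raises m with weight m + α, raises n with weight n + β and changes
the layer, for α, β depending on w and λ. A string with weights m + α splits into contractible
segments of length p after an initial segment of length (1 − α).val, so up to homotopy a box with
sides (1 − α).val, (1 − β).val and 2 remains. The relation then becomes an identity of geometric
sums in z = q². It factors: one factor gives z^λ = z, the other would force z² = 1 by comparing
absolute values. -/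

/-! ### Homotopy operators on p-complexes -/

namespace PDGAux

/-- The operator `∑ dⁱ s dᵖ⁻¹⁻ⁱ` attached to a homotopy `s`. -/
def homotopySum {k : Type*} [Field k] {M : Type*} [AddCommGroup M] [Module k M] (p : ℕ)
    (d s : Module.End k M) : Module.End k M :=
  ∑ i ∈ Finset.range p, d ^ i * s * d ^ (p - 1 - i)

section homotopySum

variable {k : Type*} [Field k] {M N : Type*} [AddCommGroup M] [Module k M] [AddCommGroup N]
  [Module k N]

theorem homotopySum_apply (p : ℕ) (d s : Module.End k M) (x : M) :
    homotopySum p d s x = ∑ i ∈ Finset.range p, (d ^ i) (s ((d ^ (p - 1 - i)) x)) := by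
  simp [homotopySum, LinearMap.sum_apply, Module.End.mul_apply]

theorem pow_intertwine {d : Module.End k M} {d' : Module.End k N} {f : M →ₗ[k] N}
    (h : ∀ x, f (d x) = d' (f x)) (n : ℕ) (x : M) : f ((d ^ n) x) = (d' ^ n) (f x) := by
  induction n generalizing x with
  | zero => rfl
  | succ n ih => rw [pow_succ, pow_succ, Module.End.mul_apply, Module.End.mul_apply, ih, h]

theorem homotopySum_intertwine {d s : Module.End k M} {d' s' : Module.End k N} {f : M →ₗ[k] N}
    (h : ∀ x, f (d x) = d' (f x)) (hs : ∀ x, f (s x) = s' (f x)) (p : ℕ) (x : M) :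
    f (homotopySum p d s x) = homotopySum p d' s' (f x) := by
  rw [homotopySum_apply, homotopySum_apply, map_sum]
  refine Finset.sum_congr rfl fun i _ => ?_
  rw [pow_intertwine h, hs, pow_intertwine h]

/-- The operator attached to a homotopy commutes with the differential. -/
theorem homotopySum_comm {p : ℕ} {d : Module.End k M} (hd : d ^ p = 0) (s : Module.End k M)
    (x : M) : homotopySum p d s (d x) = d (homotopySum p d s x) := by
  rcases p with _ | p
  · simp [homotopySum]
  have h1 : d * homotopySum (p + 1) d s = ∑ i ∈ Finset.range (p + 1), d ^ (i + 1) * s *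
      d ^ (p + 1 - (i + 1)) := by
    rw [homotopySum, Finset.mul_sum]
    refine Finset.sum_congr rfl fun i _ => ?_
    rw [pow_succ', mul_assoc, mul_assoc, mul_assoc]
    congr 4
    omega
  have h2 : homotopySum (p + 1) d s * d = ∑ i ∈ Finset.range (p + 1), d ^ i * s *
      d ^ (p + 1 - i) := by
    rw [homotopySum, Finset.sum_mul]
    refine Finset.sum_congr rfl fun i hi => ?_
    have := Finset.mem_range.1 hi
    rw [mul_assoc, ← pow_succ]
    congr 2
    omega
  have h3 : d * homotopySum (p + 1) d s = homotopySum (p + 1) d s * d := by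
    rw [h1, h2]
    -- Both sums are parts of the sum of dⁱ s dᵖ⁺¹⁻ⁱ over 0 ≤ i ≤ p + 1. Each omits one end term,
    -- and the end terms vanish because dᵖ⁺¹ = 0 (the exponent is now p + 1).
    have e1 := Finset.sum_range_succ' (fun i => d ^ i * s * d ^ (p + 1 - i)) (p + 1)
    have e2 := Finset.sum_range_succ (fun i => d ^ i * s * d ^ (p + 1 - i)) (p + 1)
    simp only [pow_zero, one_mul, Nat.sub_zero, hd, mul_zero, add_zero, zero_mul] at e1 e2
    rw [← e1, e2]
  exact (congrArg (fun f => f x) h3).symm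

theorem pow_mem {G : ℤ → Submodule k M} {d : Module.End k M}
    (h : ∀ (i : ℤ) (x : M), x ∈ G i → d x ∈ G (i + 2)) (n : ℕ) {i : ℤ} {x : M} (hx : x ∈ G i) :
    (d ^ n) x ∈ G (i + 2 * n) := by
  induction n with
  | zero => simpa using hx
  | succ n ih =>
    rw [pow_succ', Module.End.mul_apply]
    have := h _ _ ih
    rwa [show i + 2 * (n : ℤ) + 2 = i + 2 * ((n + 1 : ℕ) : ℤ) by push_cast; ring] at this

/-- Every summand applies d altogether p − 1 times, which undoes the degree 2 − 2p of `s`. -/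
theorem homotopySum_mem {G : ℤ → Submodule k M} {d s : Module.End k M} (p : ℕ)
    (h : ∀ (i : ℤ) (x : M), x ∈ G i → d x ∈ G (i + 2))
    (hs : ∀ (i : ℤ) (x : M), x ∈ G i → s x ∈ G (i - 2 * ((p : ℤ) - 1))) {i : ℤ} {x : M}
    (hx : x ∈ G i) : homotopySum p d s x ∈ G i := by
  rw [homotopySum_apply]
  refine Submodule.sum_mem _ fun j hj => ?_
  have hj := Finset.mem_range.1 hj
  have := pow_mem h j (hs _ _ (pow_mem h (p - 1 - j) hx))
  rwa [show i + 2 * ((p - 1 - j : ℕ) : ℤ) - 2 * ((p : ℤ) - 1) + 2 * (j : ℤ) = i by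
    rw [Nat.cast_sub (by omega), Nat.cast_sub (by omega)]; push_cast; ring] at this

/-- On the kernel of `dʳ`, the operator attached to a homotopy takes values in the image of
`dᵖ⁻ʳ`. -/
theorem homotopySum_of_pow_eq_zero {p r : ℕ} (hr : r ≤ p) {d s : Module.End k M} {x : M}
    (hx : (d ^ r) x = 0) : homotopySum p d s x =
      (d ^ (p - r)) (∑ j ∈ Finset.range r, (d ^ j) (s ((d ^ (r - 1 - j)) x))) := by
  -- The summands with i < p − r apply d at least r times to `x` and vanish.
  rw [homotopySum_apply, ← Finset.sum_range_add_sum_Ico _ (Nat.sub_le p r),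
    Finset.sum_eq_zero, zero_add, Finset.sum_Ico_eq_sum_range, map_sum,
    show p - (p - r) = r by omega]
  · refine Finset.sum_congr rfl fun j hj => ?_
    have := Finset.mem_range.1 hj
    rw [pow_add, Module.End.mul_apply, show p - 1 - (p - r + j) = r - 1 - j by omega]
  · intro j hj
    have := Finset.mem_range.1 hj
    rw [show p - 1 - j = (p - 1 - j - r) + r by omega, pow_add, Module.End.mul_apply, hx]
    simp

/-- Gives the degree of the preimage found in `homotopySum_of_pow_eq_zero`, so that null-homotopic
errors on cycles are boundaries of homogeneous elements. -/
theorem homotopySum_tail_mem {G : ℤ → Submodule k M} {d s : Module.End k M} (p r : ℕ)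
    (h : ∀ (i : ℤ) (x : M), x ∈ G i → d x ∈ G (i + 2))
    (hs : ∀ (i : ℤ) (x : M), x ∈ G i → s x ∈ G (i - 2 * ((p : ℤ) - 1))) {i : ℤ} {x : M}
    (hr : r ≤ p) (hx : x ∈ G i) :
    ∑ j ∈ Finset.range r, (d ^ j) (s ((d ^ (r - 1 - j)) x)) ∈ G (i - 2 * (p - r : ℕ)) := by
  refine Submodule.sum_mem _ fun j hj => ?_
  have hj := Finset.mem_range.1 hj
  have := pow_mem h j (hs _ _ (pow_mem h (r - 1 - j) hx))
  rwa [show i + 2 * ((r - 1 - j : ℕ) : ℤ) - 2 * ((p : ℤ) - 1) + 2 * (j : ℤ) =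
    i - 2 * (p - r : ℕ) by
    rw [Nat.cast_sub (by omega), Nat.cast_sub (by omega), Nat.cast_sub hr]; push_cast; ring] at this

theorem step_pow_eq (R : Type*) [Ring R] (M : Type*) [AddCommGroup M] [Module R M] (n r : ℕ)
    (m : Fin n → M) (j : Fin n) :
    ((step R M n) ^ r) m j = if h : r ≤ j.1 then m ⟨j.1 - r, by omega⟩ else 0 := by
  induction r generalizing j with
  | zero => simp
  | succ r ih =>
    rw [pow_succ', Module.End.mul_apply]
    simp only [step, LinearMap.coe_mk, AddHom.coe_mk]
    by_cases h : 0 < j.1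
    · rw [if_pos h]
      have := ih ⟨j.1 - 1, by omega⟩
      simp only [step] at this
      rw [this]
      by_cases h' : r + 1 ≤ j.1
      · rw [dif_pos h', dif_pos (by omega)]
        congr 2
        omega
      · rw [dif_neg h', dif_neg (by omega)]
    · rw [if_neg h, dif_neg (by omega)]

/-- The homotopy on `Mᵖ` that moves the last slot to the first one. -/
def lastToFirst (k : Type*) [Field k] (M : Type*) [AddCommGroup M] [Module k M] (p : ℕ)
    (l : Fin p) : Module.End k (Fin p → M) where
  toFun m j := if j.1 = 0 then m l else 0
  map_add' m m' := by funext j; by_cases h : j.1 = 0 <;> simp [h]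
  map_smul' c m := by funext j; by_cases h : j.1 = 0 <;> simp [h]

theorem lastToFirst_apply (p : ℕ) (l : Fin p) (m : Fin p → M) (j : Fin p) :
    lastToFirst k M p l m j = if j.1 = 0 then m l else 0 := rfl

/-- M ⊗ Vₚ is contractible whatever the p-complex M is. In characteristic p the differential of M
drops out of the sum, because it commutes with the step and with the homotopy; for the step alone,
summand i is the projection to slot i. -/
theorem homotopySum_lastToFirst (p : ℕ) [Fact p.Prime] [CharP k p] (d : Module.End k M)
    (l : Fin p) (hl : l.1 + 1 = p) : homotopySum p (shiftD d p) (lastToFirst k M p l) = 1 := by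
  have h1 : homotopySum p (shiftD d p) (lastToFirst k M p l) =
      homotopySum p (step k M p) (lastToFirst k M p l) := by
    rw [shiftD, add_comm]
    refine sum_add_commute p _ _ _ (step_commute p d).symm ?_
    refine LinearMap.ext fun m => funext fun j => ?_
    by_cases h : j.1 = 0 <;> simp [lastToFirst_apply, h]
  rw [h1]
  refine LinearMap.ext fun m => funext fun j => ?_
  -- The power p − 1 − i of the step carries slot i to the last slot, the homotopy carries that to
  -- slot 0, and the power i of the step brings it back to slot i.
  have h2 : ∀ i ∈ Finset.range p, ((step k M p) ^ i) (lastToFirst k M p l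
      (((step k M p) ^ (p - 1 - i)) m)) j = if i = j.1 then m j else 0 := by
    intro i hi
    have hi := Finset.mem_range.1 hi
    rw [step_pow_eq]
    by_cases h : i ≤ j.1
    · rw [dif_pos h, lastToFirst_apply]
      simp only
      by_cases h' : i = j.1
      · subst h'
        rw [if_pos (by omega), if_pos rfl, step_pow_eq, dif_pos (by omega)]
        congr 1
        ext; simp only; omega
      · rw [if_neg (by omega), if_neg h']
    · rw [dif_neg h, if_neg (by omega)]
  rw [homotopySum_apply, Finset.sum_apply, Finset.sum_congr rfl h2, Finset.sum_ite_eq',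
    if_pos (Finset.mem_range.2 j.2)]
  rfl

end homotopySum

end PDGAux

/-! ### Contractible kernels and tensor products with p-complexes -/

namespace PDGModule

open PDGAux

variable {k : Type u} [Field k] {p : ℕ} {A : PDGAlgebra k p}

/-- A surjective morphism of `p`-DG modules whose kernel is contractible is a
quasi-isomorphism. -/
theorem isQuasiIso_of_split {M N : PDGModule A} (f : M ⟶ N) (s : N.carrier →ₗ[k] M.carrier)
    (hs : ∀ (i : ℤ) (y : N.carrier), y ∈ N.gr i → s y ∈ M.gr i) (hfs : ∀ y, lin f (s y) = y)
    (t : Module.End k M.carrier)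
    (ht : ∀ (i : ℤ) (x : M.carrier), x ∈ M.gr i → t x ∈ M.gr (i - 2 * ((p : ℤ) - 1)))
    (hft : ∀ x, lin f (t x) = 0)
    (hT : ∀ x, lin f x = 0 → homotopySum p M.d t x = x) : IsQuasiIso f := by
  have hfT : ∀ x, lin f (homotopySum p M.d t x) = 0 := by
    intro x
    have := homotopySum_intertwine (f := linBase f) (s := t) (s' := 0) (map_d f) (fun x => hft x)
      p x
    refine this.trans ?_
    rw [homotopySum_apply]
    simp
  -- Write T for the operator of `t`. The defect d s − s d lies in the kernel of f, where T is the
  -- identity, so (1 − T) s commutes with d although s need not.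
  have h1 : ∀ y, homotopySum p M.d t (s (N.d y)) - s (N.d y) =
      homotopySum p M.d t (M.d (s y)) - M.d (s y) := by
    intro y
    have := hT (M.d (s y) - s (N.d y)) (by rw [map_sub, map_d, hfs, hfs, sub_self])
    rw [map_sub, sub_eq_sub_iff_sub_eq_sub] at this
    exact this.symm
  -- The inverse is (1 − T) s. Composed with f on one side it is the identity since f T = 0; on the
  -- other side it differs from the identity by −T.
  refine ⟨s - homotopySum p M.d t ∘ₗ s, fun i n hn => ?_, fun n => ?_, ⟨-t, fun i m hm => ?_, ?_⟩,
    ⟨0, fun i m _ => zero_mem _, ?_⟩⟩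
  · exact sub_mem (hs i n hn) (homotopySum_mem p (fun i x hx => M.d_mem hx) ht (hs i n hn))
  · simp only [LinearMap.sub_apply, LinearMap.comp_apply, map_sub]
    rw [← homotopySum_comm M.d_pow, ← neg_sub, h1, neg_sub]
  · exact neg_mem (ht i m hm)
  · refine LinearMap.ext fun x => ?_
    have h2 := hT (s (lin f x) - x) (by rw [map_sub, hfs, sub_self])
    have h3 : homotopySum p M.d (-t) x = -homotopySum p M.d t x := by
      simp [homotopySum_apply]
    refine Eq.trans ?_ h3.symm
    change s (lin f x) - homotopySum p M.d t (s (lin f x)) - x = _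
    rw [map_sub] at h2
    rw [eq_neg_iff_add_eq_zero, sub_right_comm, ← h2]
    abel
  · refine LinearMap.ext fun y => ?_
    change lin f (s y - homotopySum p M.d t (s y)) - y = _
    rw [map_sub, hfs, hfT]
    simp

/-- The tensor product `M ⊗ V` with the `p`-complex `V` of dimension `n ≤ p` with basis vectors
`v₀, …, v₍ₙ₋₁₎` in degrees `c, c + 2, …` and `d vⱼ = v₍ⱼ₊₁₎`. -/
abbrev tensorV [Fact p.Prime] [CharP k p] (n : ℕ) (hn : n ≤ p) (c : ℤ) (M : PDGModule A) :
    PDGModule A where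
  carrier := Fin n → M.carrier
  gr i := Submodule.pi Set.univ fun j : Fin n => M.gr (i - (c + 2 * (j.1 : ℤ)))
  internal := PDGAux.internal_pi n (fun j => c + 2 * (j.1 : ℤ)) M.internal
  smul_mem {i j a m} ha hm l hl := by
    have := M.smul_mem ha (hm l hl)
    rwa [← add_sub_assoc] at this
  d := PDGAux.shiftD M.d n
  d_mem {i m} hm l hl := by
    rw [PDGAux.shiftD_apply]
    refine add_mem ?_ ?_
    · have := M.d_mem (hm l hl)
      rwa [sub_add_eq_add_sub] at this
    · split_ifs with h
      · have h1 : m ⟨l.1 - 1, by omega⟩ ∈ M.gr (i - (c + 2 * ((l.1 - 1 : ℕ) : ℤ))) :=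
          hm ⟨l.1 - 1, by omega⟩ trivial
        rwa [show i - (c + 2 * ((l.1 - 1 : ℕ) : ℤ)) = i + 2 - (c + 2 * (l.1 : ℤ)) by
          push_cast [Nat.cast_sub (show 1 ≤ l.1 from h)]
          ring] at h1
      · exact zero_mem _
  leibniz a m := by
    funext l
    simp only [PDGAux.shiftD_apply, Pi.add_apply, Pi.smul_apply, M.leibniz, smul_add]
    split_ifs <;> simp [add_assoc]
  d_pow := PDGAux.shiftD_pow p M.d _ hn M.d_pow

/-- A `p`-DG module is contractible if its identity is null-homotopic over the ground field. -/
def Contractible (M : PDGModule A) : Prop := NullHomotopic M LinearMap.id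

theorem contractible_tensorV [hp : Fact p.Prime] [CharP k p] (c : ℤ) (M : PDGModule A) :
    Contractible (tensorV p le_rfl c M) := by
  obtain ⟨l, hl⟩ : ∃ l : Fin p, l.1 + 1 = p :=
    ⟨⟨p - 1, Nat.sub_lt hp.out.pos one_pos⟩, Nat.sub_add_cancel hp.out.one_le⟩
  have key := homotopySum_lastToFirst p M.d l hl
  refine ⟨lastToFirst k M.carrier p l, ?_, key.symm⟩
  intro i m hm j _
  -- The last slot lies 2 (p − 1) degrees above the first one, which is the degree required of a
  -- homotopy.
  have e : i - (c + 2 * (l.1 : ℤ)) = i - 2 * ((p : ℤ) - 1) - (c + 2 * (0 : ℤ)) := by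
    have : (l.1 : ℤ) + 1 = p := by exact_mod_cast hl
    rw [← this]; ring
  have h1 : m l ∈ M.gr (i - (c + 2 * (l.1 : ℤ))) := hm l trivial
  rw [e] at h1
  rw [lastToFirst_apply]
  change _ ∈ M.gr (i - 2 * ((p : ℤ) - 1) - (c + 2 * (j.1 : ℤ)))
  by_cases h : j.1 = 0
  · rw [if_pos h, h]
    exact h1
  · rw [if_neg h]
    exact zero_mem _

/-- The direct sum of two `p`-DG modules. -/
abbrev prod (M N : PDGModule A) : PDGModule A where
  carrier := M.carrier × N.carrier
  gr i := (M.gr i).prod (N.gr i)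
  internal := PDGAux.internal_prod M.internal N.internal
  smul_mem ha hm := ⟨M.smul_mem ha hm.1, N.smul_mem ha hm.2⟩
  d := M.d.prodMap N.d
  d_mem hm := ⟨M.d_mem hm.1, N.d_mem hm.2⟩
  leibniz a m := Prod.ext (M.leibniz a m.1) (N.leibniz a m.2)
  d_pow := by
    have h : ∀ (r : ℕ) (x : M.carrier × N.carrier),
        ((M.d.prodMap N.d) ^ r) x = ((M.d ^ r) x.1, (N.d ^ r) x.2) := by
      intro r
      induction r with
      | zero => intro x; rfl
      | succ r ih => intro x; rw [pow_succ, Module.End.mul_apply, ih]; rfl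
    refine LinearMap.ext fun x => ?_
    rw [h, M.d_pow, N.d_pow]
    rfl

end PDGModule

/-! ### Maps that differ by a map through a contractible module -/

namespace DerivedPDG

open PDGModule PDGAux

variable {k : Type u} [Field k] {p : ℕ} {A : PDGAlgebra k p}

/-- Morphisms of `p`-DG modules whose difference factors through a contractible module become
equal in the derived category. -/
theorem map_eq_of_contractible {X Y P : PDGModule A} (hP : Contractible P) (f g : X ⟶ Y)
    (h : X ⟶ P) (π : P ⟶ Y) (hfg : ∀ x, lin f x = lin g x + lin π (lin h x)) :
    (Q A).map f = (Q A).map g := by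
  -- Y ⊕ P serves as a path object. The maps (y, x) ↦ y and (y, x) ↦ y + π x have the common section
  -- y ↦ (y, 0), and the first is a quasi-isomorphism since its kernel P is contractible. In the
  -- derived category both are therefore the inverse of the section, and g and f are their
  -- composites with (g, h).
  let pr : prod Y P ⟶ Y :=
    { lin := LinearMap.fst A.carrier Y.carrier P.carrier
      map_gr := fun hx => hx.1
      map_d := fun _ => rfl }
  let pr' : prod Y P ⟶ Y :=
    { lin := LinearMap.fst A.carrier Y.carrier P.carrier +
        lin π ∘ₗ LinearMap.snd A.carrier Y.carrier P.carrier
      map_gr := fun hx => add_mem hx.1 (map_gr π hx.2)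
      map_d := fun x => by
        change Y.d x.1 + lin π (P.d x.2) = Y.d (x.1 + lin π x.2)
        rw [map_add, map_d] }
  let ι : Y ⟶ prod Y P :=
    { lin := LinearMap.inl A.carrier Y.carrier P.carrier
      map_gr := fun hx => ⟨hx, zero_mem _⟩
      map_d := fun x => Prod.ext rfl (map_zero P.d).symm }
  let j : X ⟶ prod Y P :=
    { lin := (lin g).prod (lin h)
      map_gr := fun hx => ⟨map_gr g hx, map_gr h hx⟩
      map_d := fun x => Prod.ext (map_d g x) (map_d h x) }
  have hpr : IsQuasiIso pr := by
    obtain ⟨t, ht, hT⟩ := hP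
    refine isQuasiIso_of_split pr (LinearMap.inl k Y.carrier P.carrier)
      (fun i y hy => ⟨hy, zero_mem _⟩) (fun y => rfl)
      (LinearMap.inr k Y.carrier P.carrier ∘ₗ t ∘ₗ LinearMap.snd k Y.carrier P.carrier)
      (fun i x hx => ⟨zero_mem _, ht i _ hx.2⟩) (fun x => rfl) fun x hx => ?_
    obtain ⟨y, x⟩ := x
    obtain rfl : y = 0 := hx
    have := homotopySum_intertwine (d := P.d) (s := t) (d' := (prod Y P).d)
      (s' := LinearMap.inr k Y.carrier P.carrier ∘ₗ t ∘ₗ LinearMap.snd k Y.carrier P.carrier)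
      (f := LinearMap.inr k Y.carrier P.carrier)
      (fun x => Prod.ext (map_zero Y.d).symm rfl) (fun x => rfl) p x
    refine this.symm.trans (congrArg _ ?_)
    exact (congrArg (fun f => f x) hT).symm
  have : IsIso ((Q A).map pr) := (quasiIso A).Q_inverts pr hpr
  have e1 : (Q A).map ι ≫ (Q A).map pr = 𝟙 _ := by
    rw [← Functor.map_comp, ← (Q A).map_id]; rfl
  have e2 : (Q A).map ι ≫ (Q A).map pr' = 𝟙 _ := by
    rw [← Functor.map_comp, ← (Q A).map_id]
    refine congrArg _ (hom_ext fun x => ?_)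
    change x + lin π 0 = x
    rw [map_zero, add_zero]
  have e3 : IsIso ((Q A).map ι) := by
    have : (Q A).map ι = inv ((Q A).map pr) := (IsIso.eq_inv_of_inv_hom_id e1)
    rw [this]; infer_instance
  have e4 : (Q A).map pr = (Q A).map pr' := by
    rw [← cancel_epi ((Q A).map ι), e1, e2]
  have e5 : f = j ≫ pr' := hom_ext fun x => hfg x
  have e6 : g = j ≫ pr := hom_ext fun x => rfl
  rw [e5, e6, Functor.map_comp, Functor.map_comp, e4]

end DerivedPDG

/-! ### Cells: the modules A e ⊗ V -/

namespace PDGModule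

open PDGAux

variable {k : Type u} [Field k] {p : ℕ} {A : PDGAlgebra k p}

/-- A `p`-DG module `P` identified with `A e`, for a closed idempotent `e` of degree zero. -/
structure IsFreeOn (P : PDGModule A) (e : A.carrier) where
  closed : A.d e = 0
  mem_zero : e ∈ A.gr 0
  idem : e * e = e
  gen : P.carrier
  coord : P.carrier →ₗ[A.carrier] A.carrier
  coord_gen : coord gen = e
  coord_smul : ∀ x, coord x • gen = x
  coord_mem : ∀ {i : ℤ} {x : P.carrier}, x ∈ P.gr i → coord x ∈ A.gr i
  coord_d : ∀ x, coord (P.d x) = A.d (coord x)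
  gen_mem : gen ∈ P.gr 0

/-- Because of this, k-linear maps that commute with d may be multiplied by e to make them
compatible with e M. -/
theorem smul_d_of_closed {e : A.carrier} (hde : A.d e = 0) {M : PDGModule A} (m : M.carrier) :
    e • M.d m = M.d (e • m) := by
  rw [M.leibniz, hde, zero_smul, zero_add]

theorem smul_pow_d_of_closed {e : A.carrier} (hde : A.d e = 0) {M : PDGModule A} (r : ℕ)
    (m : M.carrier) : e • (M.d ^ r) m = (M.d ^ r) (e • m) := by
  induction r generalizing m with
  | zero => rfl
  | succ r ih =>
    rw [pow_succ, Module.End.mul_apply, Module.End.mul_apply, ih, smul_d_of_closed hde]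

namespace IsFreeOn

variable {P : PDGModule A} {e : A.carrier} (F : IsFreeOn P e)

include F in
theorem smul_gen : e • F.gen = F.gen := by
  nth_rewrite 1 [← F.coord_gen]
  exact F.coord_smul _

theorem d_gen : P.d F.gen = 0 := by
  have h := F.coord_smul (P.d F.gen)
  rw [F.coord_d, F.coord_gen, F.closed, zero_smul] at h
  exact h.symm

variable [Fact p.Prime] [CharP k p] {n : ℕ} (hn : n + 1 ≤ p) (c : ℤ)

/-- The basis vectors of `P ⊗ V`. -/
def vec (n : ℕ) (j : Fin (n + 1)) : Fin (n + 1) → P.carrier := Pi.single j F.gen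

theorem vec_mem (j : Fin (n + 1)) : F.vec n j ∈ (tensorV (n + 1) hn c P).gr (c + 2 * (j.1 : ℤ)) := by
  intro l _
  change F.vec n j l ∈ P.gr (c + 2 * (j.1 : ℤ) - (c + 2 * (l.1 : ℤ)))
  by_cases h : l = j
  · subst h
    rw [sub_self, vec, Pi.single_eq_same]
    exact F.gen_mem
  · rw [vec, Pi.single_eq_of_ne h]
    exact zero_mem _

theorem d_vec (j : Fin (n + 1)) : (tensorV (n + 1) hn c P).d (F.vec n j) =
      if h : j.1 + 1 < n + 1 then F.vec n ⟨j.1 + 1, h⟩ else 0 := by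
  funext l
  refine (shiftD_apply _ _ _ _).trans ?_
  have h2 : P.d (F.vec n j l) = 0 := by
    by_cases h : l = j
    · subst h
      rw [vec, Pi.single_eq_same, F.d_gen]
    · rw [vec, Pi.single_eq_of_ne h, map_zero]
  rw [h2, zero_add]
  by_cases h : j.1 + 1 < n + 1
  · rw [dif_pos h]
    by_cases hl : l.1 = j.1 + 1
    · have e1 : (⟨l.1 - 1, by omega⟩ : Fin (n + 1)) = j := Fin.ext (by simp [hl])
      have e2 : l = ⟨j.1 + 1, h⟩ := Fin.ext hl
      rw [if_pos (by omega), e1, e2, vec, vec, Pi.single_eq_same, Pi.single_eq_same]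
    · have e2 : l ≠ ⟨j.1 + 1, h⟩ := fun h' => hl (congrArg Fin.val h')
      rw [show F.vec n ⟨j.1 + 1, h⟩ l = 0 from Pi.single_eq_of_ne e2 _]
      split_ifs with h'
      · refine Pi.single_eq_of_ne (fun h'' => hl ?_) _
        have := congrArg Fin.val h''
        simp only at this
        omega
      · rfl
  · rw [dif_neg h]
    split_ifs with h'
    · refine Pi.single_eq_of_ne (fun h'' => h ?_) _
      have := congrArg Fin.val h''
      simp only at this
      omega
    · rfl

theorem eq_sum_vec (a : Fin (n + 1) → P.carrier) : a = ∑ j, F.coord (a j) • F.vec n j := by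
  funext l
  rw [Finset.sum_apply, Finset.sum_eq_single l]
  · rw [Pi.smul_apply, vec, Pi.single_eq_same, F.coord_smul]
  · intro j _ h
    rw [Pi.smul_apply, vec, Pi.single_eq_of_ne h.symm, smul_zero]
  · simp

/-- The later basis vectors are iterated differentials of the first one, and all of them together
generate over A. -/
theorem eq_zero_of_vec {M : PDGModule A} (L : (Fin (n + 1) → P.carrier) →ₗ[A.carrier] M.carrier)
    (hL : ∀ x : Fin (n + 1) → P.carrier, L ((tensorV (n + 1) hn c P).d x) = M.d (L x))
    (h : L (F.vec n 0) = 0) (x : Fin (n + 1) → P.carrier) : L x = 0 := by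
  have h1 : ∀ (j : ℕ) (hj : j < n + 1), L (F.vec n ⟨j, hj⟩) = 0 := by
    intro j
    induction j with
    | zero => intro _; exact h
    | succ j ih =>
      intro hj
      have h2 := F.d_vec hn c (⟨j, by omega⟩ : Fin (n + 1))
      rw [dif_pos hj] at h2
      have h3 := hL (F.vec n ⟨j, by omega⟩)
      rw [h2, ih, map_zero] at h3
      exact h3
  rw [F.eq_sum_vec x, map_sum]
  refine Finset.sum_eq_zero fun j _ => ?_
  rw [map_smul, h1 j.1 j.2, smul_zero]

theorem pow_vec_zero (r : ℕ) : ((tensorV (n + 1) hn c P).d ^ r) (F.vec n 0) =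
      if h : r < n + 1 then F.vec n ⟨r, h⟩ else 0 := by
  induction r with
  | zero => rfl
  | succ r ih =>
    rw [pow_succ', Module.End.mul_apply, ih]
    by_cases h : r < n + 1
    · rw [dif_pos h, d_vec]
    · rw [dif_neg h, dif_neg (by omega), map_zero]

/-- The morphism out of `P ⊗ V` given by an element. -/
def cellHom {M : PDGModule A} (m : M.carrier) (hmc : m ∈ M.gr c) (hm : (M.d ^ (n + 1)) m = 0) :
    tensorV (n + 1) hn c P ⟶ M where
  lin :=
    { toFun := fun a : Fin (n + 1) → P.carrier => ∑ j, F.coord (a j) • (M.d ^ j.1) m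
      map_add' := fun a b => by
        simp only [Pi.add_apply, map_add, add_smul, Finset.sum_add_distrib]
      map_smul' := fun r a => by
        simp only [Pi.smul_apply, map_smul, smul_eq_mul, mul_smul, RingHom.id_apply,
          Finset.smul_sum] }
  map_gr {i} (a : Fin (n + 1) → P.carrier) ha := by
    change ∑ j, F.coord (a j) • (M.d ^ j.1) m ∈ M.gr i
    refine Submodule.sum_mem _ fun j _ => ?_
    have h1 : F.coord (a j) ∈ A.gr (i - (c + 2 * (j.1 : ℤ))) := F.coord_mem (ha j trivial)
    have := M.smul_mem h1 (pow_mem (fun i x hx => M.d_mem hx) j.1 hmc)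
    rwa [sub_add_cancel] at this
  map_d (a : Fin (n + 1) → P.carrier) := by
    change ∑ j, F.coord (shiftD P.d (n + 1) a j) • (M.d ^ j.1) m =
      M.d (∑ j, F.coord (a j) • (M.d ^ j.1) m)
    simp only [shiftD_apply, map_add, map_sum, M.leibniz, add_smul, Finset.sum_add_distrib,
      F.coord_d]
    congr 1
    rw [Fin.sum_univ_succ, Fin.sum_univ_castSucc]
    -- The last basis vector has no successor; here the condition on dⁿ⁺¹ m enters.
    have h2 : M.d ((M.d ^ (Fin.last n).1) m) = 0 := by
      rw [← Module.End.mul_apply, ← pow_succ']; exact hm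
    rw [h2]
    simp only [Fin.val_zero, lt_irrefl, if_false, map_zero, zero_smul, zero_add, smul_zero,
      add_zero]
    refine Finset.sum_congr rfl fun (j : Fin n) _ => ?_
    rw [if_pos (by simp), ← Module.End.mul_apply, ← pow_succ']
    rfl

theorem cellHom_vec {M : PDGModule A} (m : M.carrier) (hmc : m ∈ M.gr c)
    (hm : (M.d ^ (n + 1)) m = 0) (hem : e • m = m) :
    lin (F.cellHom hn c m hmc hm) (F.vec n 0) = m := by
  change ∑ j, F.coord (F.vec n 0 j) • (M.d ^ j.1) m = m
  rw [Finset.sum_eq_single 0]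
  · rw [vec, Pi.single_eq_same, F.coord_gen]
    exact hem
  · intro j _ h
    rw [vec, Pi.single_eq_of_ne h, map_zero, zero_smul]
  · simp

theorem smul_vec (j : Fin (n + 1)) : e • F.vec n j = F.vec n j := by
  rw [vec, ← Pi.single_smul, F.smul_gen]

variable {hn c}

theorem smul_lin_vec {M : PDGModule A} (g : tensorV (n + 1) hn c P ⟶ M) :
    e • lin g (F.vec n 0) = lin g (F.vec n 0) := by
  rw [← map_smul (lin g) e (F.vec n 0 : Fin (n + 1) → P.carrier), smul_vec]

theorem pow_lin_vec {M : PDGModule A} (g : tensorV (n + 1) hn c P ⟶ M) :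
    (M.d ^ (n + 1)) (lin g (F.vec n 0)) = 0 := by
  refine (pow_intertwine (f := linBase g) (map_d g) (n + 1) (F.vec n 0)).symm.trans ?_
  rw [F.pow_vec_zero hn c (n + 1), dif_neg (lt_irrefl _), map_zero]

theorem lin_vec_mem {M : PDGModule A} (g : tensorV (n + 1) hn c P ⟶ M) :
    lin g (F.vec n 0) ∈ M.gr c := by
  have := map_gr g (F.vec_mem hn c 0)
  simpa using this

theorem eq_add_of_vec {M : PDGModule A} (f g h : tensorV (n + 1) hn c P ⟶ M)
    (H : lin f (F.vec n 0) = lin g (F.vec n 0) + lin h (F.vec n 0)) (x : Fin (n + 1) → P.carrier) :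
    lin f x = lin g x + lin h x := by
  have key := F.eq_zero_of_vec hn c (M := M) (lin f - lin g - lin h) (fun x => ?_) ?_ x
  · rwa [LinearMap.sub_apply, LinearMap.sub_apply, sub_sub, sub_eq_zero] at key
  · rw [LinearMap.sub_apply, LinearMap.sub_apply, LinearMap.sub_apply, LinearMap.sub_apply,
      map_sub, map_sub]
    exact congrArg₂ (· - ·) (congrArg₂ (· - ·) (map_d f x) (map_d g x)) (map_d h x)
  · rw [LinearMap.sub_apply, LinearMap.sub_apply, H]
    abel

theorem eq_of_vec {M : PDGModule A} (f g : tensorV (n + 1) hn c P ⟶ M)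
    (H : lin f (F.vec n 0) = lin g (F.vec n 0)) : f = g := by
  refine hom_ext fun x => ?_
  have key := F.eq_zero_of_vec hn c (M := M) (lin f - lin g) (fun x => ?_) ?_ x
  · rwa [LinearMap.sub_apply, sub_eq_zero] at key
  · rw [LinearMap.sub_apply, LinearMap.sub_apply, map_sub]
    exact congrArg₂ (· - ·) (map_d f x) (map_d g x)
  · rw [LinearMap.sub_apply, H, sub_self]

include F in
/-- Morphisms from `P ⊗ V` lift along quasi-isomorphisms, up to equality in the derived
category. -/
theorem exists_lift_of_quasiIso {M N : PDGModule A} (f : M ⟶ N)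
    (hf : IsQuasiIso f) (g : tensorV (n + 1) hn c P ⟶ N) :
    ∃ g' : tensorV (n + 1) hn c P ⟶ M,
      (DerivedPDG.Q A).map g = (DerivedPDG.Q A).map (g' ≫ f) := by
  obtain ⟨γ, hγ, hγd, -, ⟨t, ht, hT⟩⟩ := hf
  obtain ⟨q, hq⟩ : ∃ q, q + 1 = p := ⟨p - 1, by omega⟩
  have hde := F.closed
  set y := lin g (F.vec n 0) with hy
  have hyd : (N.d ^ (n + 1)) y = 0 := F.pow_lin_vec g
  have hyc : y ∈ N.gr c := F.lin_vec_mem g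
  have hye : e • y = y := F.smul_lin_vec g
  have hm : (M.d ^ (n + 1)) (e • γ y) = 0 := by
    rw [← smul_pow_d_of_closed hde, ← pow_intertwine hγd, hyd, map_zero, smul_zero]
  have hmc : e • γ y ∈ M.gr c := by simpa using M.smul_mem F.mem_zero (hγ c y hyc)
  have hme : e • e • γ y = e • γ y := by rw [← mul_smul, F.idem]
  have h1 : lin f (γ y) - y = homotopySum p N.d t y := congrArg (fun F => F y) hT
  -- Since dⁿ⁺¹ kills y, the null-homotopic map f γ − 1 sends y into the image of dᵖ⁻ⁿ⁻¹.
  obtain ⟨w, hwc, h2⟩ : ∃ w ∈ N.gr (c - 2 * (p - (n + 1) : ℕ)),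
      lin f (γ y) - y = (N.d ^ (p - (n + 1))) w :=
    ⟨_, homotopySum_tail_mem p (n + 1) (fun i x hx => N.d_mem hx) ht hn hyc, by
      rw [h1, homotopySum_of_pow_eq_zero hn hyd]⟩
  -- The value of a morphism on the first basis vector must be fixed by e. Multiplying by e is
  -- harmless, as e is closed and fixes y.
  obtain ⟨z, hz⟩ : ∃ z, z = e • w := ⟨_, rfl⟩
  have hzc : z ∈ N.gr (c - 2 * (p - (n + 1) : ℕ)) := by
    simpa [hz] using N.smul_mem F.mem_zero hwc
  have hze : e • z = z := by rw [hz, ← mul_smul, F.idem]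
  have h3 : lin f (e • γ y) = y + (N.d ^ (p - (n + 1))) z := by
    rw [hz, ← smul_pow_d_of_closed hde, ← h2, map_smul, smul_sub, hye]; abel
  let g' : tensorV (n + 1) hn c P ⟶ M := F.cellHom hn c (e • γ y) hmc hm
  refine ⟨g', ?_⟩
  -- The error map factors through P ⊗ Vₚ: the first basis vector of that module goes to z, and its
  -- basis vector with index p − n − 1, which dⁿ⁺¹ kills, goes to the error dᵖ⁻ⁿ⁻¹ z.
  let E : PDGModule A := tensorV (q + 1) hq.le (c - 2 * (p - (n + 1) : ℕ)) P
  have hz0 : (N.d ^ (q + 1)) z = 0 := by rw [hq, N.d_pow]; rfl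
  let π : E ⟶ N := F.cellHom hq.le _ z hzc hz0
  let v : E.carrier := F.vec q ⟨p - (n + 1), by omega⟩
  have hv : (E.d ^ (p - (n + 1))) (F.vec q 0) = v :=
    (F.pow_vec_zero hq.le _ _).trans (dif_pos (by omega))
  have hvc : v ∈ E.gr c := by
    have := F.vec_mem hq.le (c - 2 * (p - (n + 1) : ℕ)) ⟨p - (n + 1), by omega⟩
    rwa [sub_add_cancel] at this
  have hvd : (E.d ^ (n + 1)) v = 0 := by
    rw [← hv, ← Module.End.mul_apply, ← pow_add, show n + 1 + (p - (n + 1)) = p by omega, E.d_pow]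
    rfl
  let h : tensorV (n + 1) hn c P ⟶ E := F.cellHom hn c v hvc hvd
  have hE : Contractible E := by
    -- The dimension is generalized so that the equation q + 1 = p can be substituted.
    have key : ∀ (m : ℕ) (hm : m ≤ p) (_ : m = p) (c' : ℤ),
        Contractible (tensorV m hm c' P) := by
      intro m hm h c'
      subst h
      exact contractible_tensorV c' _
    exact key _ _ hq _
  refine (DerivedPDG.map_eq_of_contractible hE (g' ≫ f) g h π fun x =>
    F.eq_add_of_vec (g' ≫ f) g (h ≫ π) ?_ x).symm
  have e2 : lin (h ≫ π) (F.vec n 0) = (N.d ^ (p - (n + 1))) z := by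
    rw [lin_comp, F.cellHom_vec hn c _ _ _ (F.smul_vec _), ← hv]
    refine (pow_intertwine (f := linBase π) (map_d π) _ _).trans ?_
    exact congrArg _ (F.cellHom_vec hq.le _ _ hzc hz0 hze)
  rw [e2, ← hy, ← h3, lin_comp, F.cellHom_vec hn c _ _ _ hme]

end IsFreeOn

end PDGModule

/-! ### Morphisms out of cells in the derived category, and compactness -/

namespace DerivedPDG

open PDGModule PDGAux

variable {k : Type u} [Field k] {p : ℕ} {A : PDGAlgebra k p}

/-- If morphisms out of `E` lift along quasi-isomorphisms, then every morphism out of `E` in the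
derived category comes from a morphism of `p`-DG modules. -/
theorem exists_map_eq {E : PDGModule A}
    (hE : ∀ {M N : PDGModule A} (f : M ⟶ N), IsQuasiIso f → ∀ g : E ⟶ N,
      ∃ g' : E ⟶ M, (Q A).map g = (Q A).map (g' ≫ f))
    {M : PDGModule A} (φ : (Q A).obj E ⟶ (Q A).obj M) : ∃ g : E ⟶ M, φ = (Q A).map g := by
  -- A morphism has the property P if its composites with represented morphisms out of E are
  -- represented. Compositions, images of morphisms of modules and formal inverses of
  -- quasi-isomorphisms have it, the last by the lifting hypothesis; these generate the
  -- localization.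
  let P : MorphismProperty (DerivedPDG A) := fun X Y φ =>
    ∀ (M N : PDGModule A) (h : (Q A).obj M = X) (h' : Y = (Q A).obj N) (g : E ⟶ M),
      ∃ g' : E ⟶ N, (Q A).map g ≫ eqToHom h ≫ φ ≫ eqToHom h' = (Q A).map g'
  have hinj : ∀ {M N : PDGModule A}, (Q A).obj M = (Q A).obj N → M = N := fun h =>
    (Localization.Construction.objEquiv (quasiIso A)).injective h
  have hP : P = ⊤ := by
    have : P.IsStableUnderComposition := ⟨by
      intro X Y Z f g hf hg M N h h' s
      obtain ⟨R, rfl⟩ : ∃ R, (Q A).obj R = Y :=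
        (Localization.Construction.objEquiv (quasiIso A)).surjective Y
      obtain ⟨g1, h1⟩ := hf M R h rfl s
      obtain ⟨g2, h2⟩ := hg R N rfl h' g1
      refine ⟨g2, ?_⟩
      rw [← h2, ← h1]
      simp⟩
    refine Localization.Construction.morphismProperty_eq_top P ?_ ?_
    · intro X Y f M N h h' g
      obtain rfl := hinj h
      obtain rfl := hinj h'
      exact ⟨g ≫ f, by simp⟩
    · intro X Y w hw M N h h' g
      obtain rfl := hinj h
      obtain rfl := hinj h'
      obtain ⟨g', hg'⟩ := hE w hw g
      refine ⟨g', ?_⟩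
      rw [hg', Functor.map_comp]
      have := (Localization.Construction.wIso w hw).hom_inv_id
      simp only [eqToHom_refl, Category.id_comp, Category.comp_id, Category.assoc]
      refine (congrArg (fun t => (Q A).map g' ≫ t) this).trans (Category.comp_id _)
  obtain ⟨g, hg⟩ : ∃ g' : E ⟶ M, (Q A).map (𝟙 E) ≫ eqToHom rfl ≫ φ ≫ eqToHom rfl = (Q A).map g' := by
    have : P φ := by rw [hP]; trivial
    exact this E M rfl rfl (𝟙 E)
  exact ⟨g, by simpa using hg⟩

/-- A morphism out of a cell is represented by a single element, and an element of a direct sum has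
finite support. -/
theorem isCompact_tensorV [Fact p.Prime] [CharP k p] {P : PDGModule A} {e : A.carrier}
    (F : IsFreeOn P e) {n : ℕ} (hn : n + 1 ≤ p) (c : ℤ) :
    IsCompact ((Q A).obj (tensorV (n + 1) hn c P)) := by
  classical
  intro I N f
  obtain ⟨g, rfl⟩ := exists_map_eq (fun f hf g => F.exists_lift_of_quasiIso f hf g) f
  have hpow : ∀ {I : Type u} (N : I → PDGModule A) (r : ℕ) (x : Π₀ i, (N i).carrier) (i : I),
      ((directSum N).d ^ r) x i = ((N i).d ^ r) (x i) := by
    intro I N r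
    induction r with
    | zero => intro x i; rfl
    | succ r ih =>
      intro x i
      rw [pow_succ, pow_succ, Module.End.mul_apply, ih]
      rfl
  obtain ⟨m, hm⟩ : ∃ m : Π₀ i, (N i).carrier, m = lin g (F.vec n 0) := ⟨_, rfl⟩
  have hm1 : m ∈ (directSum N).gr c := hm ▸ F.lin_vec_mem g
  have hm2 : ((directSum N).d ^ (n + 1)) m = 0 := hm ▸ F.pow_lin_vec g
  have hm3 : e • m = m := hm ▸ F.smul_lin_vec g
  let J := m.support
  let m' : Π₀ j : {i // i ∈ J}, (N j.1).carrier := DFinsupp.mk Finset.univ fun j => m j.1.1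
  have hm' : ∀ j, m' j = m j.1 := fun j => by simp [m', DFinsupp.mk_apply]
  let g' : tensorV (n + 1) hn c P ⟶ directSum fun j : {i // i ∈ J} => N j.1 :=
    F.cellHom hn c m' (fun j => by rw [hm']; exact hm1 j.1) (by
      refine DFinsupp.ext fun j => ?_
      refine (hpow (fun j : {i // i ∈ J} => N j.1) (n + 1) m' j).trans ?_
      rw [hm', ← hpow N, hm2]
      rfl)
  refine ⟨J, (Q A).map g', ?_⟩
  rw [← Functor.map_comp]
  have hm'e : e • m' = m' := DFinsupp.ext fun j => by
    rw [DFinsupp.smul_apply, hm']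
    exact congrArg (fun x : Π₀ i, (N i).carrier => x j.1) hm3
  refine congrArg _ (F.eq_of_vec _ _ ?_)
  have e1 : lin g' (F.vec n 0) = m' := F.cellHom_vec hn c _ _ _ hm'e
  rw [lin_comp, e1, ← hm]
  refine DFinsupp.ext fun i => Eq.trans ?_ 
    (extend_apply A.carrier (fun i => (N i).carrier) J m' i).symm
  by_cases h : i ∈ J
  · rw [dif_pos h, hm']
  · rw [dif_neg h]
    exact DFinsupp.notMem_support_iff.1 h

end DerivedPDG

/-! ### Split exact sequences and distinguished triangles -/

namespace PDGModule

open PDGAux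

variable {k : Type u} [Field k] {p : ℕ} {A : PDGAlgebra k p}

/-- A short exact sequence of `p`-DG modules, together with a splitting of the underlying graded
vector spaces. -/
structure SplitExact {M N P : PDGModule A} (f : M ⟶ N) (g : N ⟶ P) where
  retr : N.carrier →ₗ[k] M.carrier
  sect : P.carrier →ₗ[k] N.carrier
  retr_mem : ∀ {i : ℤ} {n : N.carrier}, n ∈ N.gr i → retr n ∈ M.gr i
  sect_mem : ∀ {i : ℤ} {y : P.carrier}, y ∈ P.gr i → sect y ∈ N.gr i
  retr_f : ∀ m, retr (lin f m) = m
  g_sect : ∀ y, lin g (sect y) = y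
  g_f : ∀ m, lin g (lin f m) = 0
  add : ∀ n, lin f (retr n) + sect (lin g n) = n

namespace SplitExact

variable {M N P : PDGModule A} {f : M ⟶ N} {g : N ⟶ P}

/-- Replacement of the outer terms by isomorphic modules. -/
def ofIso (S : SplitExact f g) {M' P' : PDGModule A} (a : M' ≅ M) (b : P ≅ P') :
    SplitExact (a.hom ≫ f) (g ≫ b.hom) where
  retr := linBase a.inv ∘ₗ S.retr
  sect := S.sect ∘ₗ linBase b.inv
  retr_mem h := map_gr a.inv (S.retr_mem h)
  sect_mem h := S.sect_mem (map_gr b.inv h)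
  retr_f m := by
    change lin a.inv (S.retr (lin f (lin a.hom m))) = m
    rw [S.retr_f, ← lin_comp, a.hom_inv_id, lin_id]
  g_sect y := by
    change lin b.hom (lin g (S.sect (lin b.inv y))) = y
    rw [S.g_sect, ← lin_comp, b.inv_hom_id, lin_id]
  g_f m := by
    change lin b.hom (lin g (lin f (lin a.hom m))) = 0
    rw [S.g_f, map_zero]
  add n := by
    change lin f (lin a.hom (lin a.inv (S.retr n))) + S.sect (lin b.inv (lin b.hom (lin g n))) = n
    have h1 : ∀ x, lin a.hom (lin a.inv x) = x := fun x => by rw [← lin_comp, a.inv_hom_id, lin_id]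
    have h2 : ∀ x, lin b.inv (lin b.hom x) = x := fun x => by rw [← lin_comp, b.hom_inv_id, lin_id]
    rw [h1, h2, S.add]

variable [hp : Fact p.Prime] [CharP k p]

/-- The canonical morphism from the cone of `f` to the cokernel. -/
def coneDesc (S : SplitExact f g) : cone f ⟶ P where
  lin := lin g ∘ₗ LinearMap.snd A.carrier (Fin (p - 1) → M.carrier) N.carrier
  map_gr h := map_gr g h.2
  map_d x := by
    change lin g (N.d x.2 + lin f (x.1 _)) = P.d (lin g x.2)
    rw [map_add, S.g_f, map_d, add_zero]

/-- The kernel of the map from the cone to the cokernel consists of p − 1 copies of M followed by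
the image of M in N. This is M ⊗ Vₚ, which is contractible. -/
theorem isQuasiIso_coneDesc (S : SplitExact f g) : IsQuasiIso S.coneDesc := by
  have h2p := hp.out.two_le
  obtain ⟨l, hl⟩ : ∃ l : Fin p, l.1 + 1 = p :=
    ⟨⟨p - 1, Nat.sub_lt hp.out.pos one_pos⟩, Nat.sub_add_cancel hp.out.one_le⟩
  let t : Module.End k ((Fin (p - 1) → M.carrier) × N.carrier) :=
    { toFun := fun x => (fun j => if j.1 = 0 then S.retr x.2 else 0, 0)
      map_add' := fun x y => Prod.ext (funext fun j => by
        by_cases h : j.1 = 0 <;> simp [h]) (by simp)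
      map_smul' := fun r x => Prod.ext (funext fun j => by
        by_cases h : j.1 = 0 <;> simp [h]) (by simp) }
  -- J identifies M ⊗ Vₚ with the kernel, the last slot being put into N by f. It turns
  -- `lastToFirst` into t, so that `homotopySum_lastToFirst` applies.
  let J : (Fin p → M.carrier) →ₗ[k] (Fin (p - 1) → M.carrier) × N.carrier :=
    { toFun := fun a => (fun j => a ⟨j.1, by omega⟩, linBase f (a l))
      map_add' := fun a b => Prod.ext rfl (by simp)
      map_smul' := fun r a => Prod.ext rfl (by simp) }
  have hJd : ∀ a, J (shiftD M.d p a) = (cone f).d (J a) := by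
    intro a
    refine Prod.ext (funext fun j => ?_) ?_
    · change shiftD M.d p a ⟨j.1, by omega⟩ = shiftD M.d (p - 1) (J a).1 j
      rw [shiftD_apply, shiftD_apply]
      rfl
    · change lin f (shiftD M.d p a l) = N.d (lin f (a l)) + lin f (a ⟨p - 2, _⟩)
      rw [shiftD_apply, if_pos (by omega), map_add, map_d]
      congr 3
      exact Fin.ext (by simp only; omega)
  have hJt : ∀ a, J (lastToFirst k M.carrier p l a) = t (J a) := by
    intro a
    refine Prod.ext (funext fun j => ?_) ?_
    · change (if j.1 = 0 then a l else 0) = if j.1 = 0 then S.retr (lin f (a l)) else 0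
      rw [S.retr_f]
    · change lin f (lastToFirst k M.carrier p l a l) = 0
      rw [lastToFirst_apply, if_neg (by omega), map_zero]
  refine isQuasiIso_of_split S.coneDesc (LinearMap.inr k _ _ ∘ₗ S.sect)
    (fun i y hy => ⟨zero_mem _, S.sect_mem hy⟩) (fun y => S.g_sect y) t
    (fun i x hx => ⟨fun j _ => ?_, zero_mem _⟩) (fun x => map_zero (lin g)) fun x hx => ?_
  · change (if j.1 = 0 then S.retr x.2 else 0) ∈
      M.gr (i - 2 * ((p : ℤ) - 1) - slotDegree p j.1)
    by_cases h : j.1 = 0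
    · rw [if_pos h, h]
      have := S.retr_mem hx.2
      rwa [show i = i - 2 * ((p : ℤ) - 1) - slotDegree p 0 by
        simp only [slotDegree]; push_cast; ring] at this
    · rw [if_neg h]; exact zero_mem _
  · obtain ⟨m, n⟩ := x
    have hn : lin f (S.retr n) = n := by
      have := S.add n
      rwa [show lin g n = 0 from hx, map_zero, add_zero] at this
    obtain ⟨a, ha⟩ : ∃ a, J a = (m, n) := by
      refine ⟨fun j => if h : j.1 < p - 1 then m ⟨j.1, h⟩ else S.retr n, Prod.ext ?_ ?_⟩
      · funext j
        exact dif_pos j.2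
      · change lin f (if h : l.1 < p - 1 then m ⟨l.1, h⟩ else S.retr n) = n
        rw [dif_neg (by omega), hn]
    rw [← ha]
    refine (homotopySum_intertwine hJd hJt p a).symm.trans ?_
    rw [homotopySum_lastToFirst p M.d l hl]
    rfl

/-- A split exact sequence gives a distinguished triangle. -/
theorem exists_isDistinguished (S : SplitExact f g) :
    ∃ δ : (DerivedPDG.Q A).obj P ⟶ (DerivedPDG.homShift A).obj ((DerivedPDG.Q A).obj M),
      DerivedPDG.IsDistinguished ((DerivedPDG.Q A).map f) ((DerivedPDG.Q A).map g) δ := by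
  have : IsIso ((DerivedPDG.Q A).map S.coneDesc) :=
    (quasiIso A).Q_inverts _ S.isQuasiIso_coneDesc
  let c := asIso ((DerivedPDG.Q A).map S.coneDesc)
  refine ⟨c.inv ≫ (DerivedPDG.Q A).map (coneFst f), M, N, f, Iso.refl _, Iso.refl _, c.symm,
    ?_, ?_, ?_⟩
  · simp
  · have h : (DerivedPDG.Q A).map g =
        (DerivedPDG.Q A).map (coneInr f) ≫ (DerivedPDG.Q A).map S.coneDesc := by
      rw [← Functor.map_comp]
      rfl
    rw [h]
    simp [c]
  · simp only [Iso.refl_hom, Iso.symm_hom]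
    exact (congrArg (fun t => (c.inv ≫ (DerivedPDG.Q A).map (coneFst f)) ≫ t)
      ((DerivedPDG.homShift A).map_id _)).trans (Category.comp_id _)

theorem symbol_eq (S : SplitExact f g)
    (hM : DerivedPDG.IsCompact ((DerivedPDG.Q A).obj M))
    (hN : DerivedPDG.IsCompact ((DerivedPDG.Q A).obj N))
    (hP : DerivedPDG.IsCompact ((DerivedPDG.Q A).obj P)) :
    K0.symbol _ hN = K0.symbol _ hM + K0.symbol _ hP := by
  obtain ⟨δ, hδ⟩ := S.exists_isDistinguished
  have h : FreeAbelianGroup.of (⟨_, hN⟩ : CompactPDG A) -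
      (FreeAbelianGroup.of (⟨_, hM⟩ : CompactPDG A) +
        FreeAbelianGroup.of (⟨_, hP⟩ : CompactPDG A)) ∈ K0Relations A :=
    AddSubgroup.subset_closure ⟨⟨_, hM⟩, ⟨_, hN⟩, ⟨_, hP⟩, _, _, δ, hδ, rfl⟩
  have h' := (QuotientAddGroup.eq_zero_iff _).2 h
  exact sub_eq_zero.1 h'

/-- The functoriality of `M ⊗ V` in `M`. -/
abbrev tensorMap (n : ℕ) (hn : n ≤ p) (c : ℤ) (f : M ⟶ N) :
    tensorV n hn c M ⟶ tensorV n hn c N where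
  lin := (lin f).compLeft (Fin n)
  map_gr := fun h l hl => map_gr f (h l hl)
  map_d := fun (m : Fin n → M.carrier) => by
    funext l
    change lin f (shiftD M.d n m l) = shiftD N.d n (fun j => lin f (m j)) l
    simp only [shiftD_apply, map_add, map_d]
    split_ifs <;> simp

/-- Tensoring a split exact sequence with a `p`-complex. -/
def tensor (S : SplitExact f g) (n : ℕ) (hn : n ≤ p) (c : ℤ) :
    SplitExact (M := tensorV n hn c M) (N := tensorV n hn c N) (P := tensorV n hn c P)
      (tensorMap n hn c f) (tensorMap n hn c g) where
  retr := S.retr.compLeft (Fin n)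
  sect := S.sect.compLeft (Fin n)
  retr_mem h j hj := S.retr_mem (h j hj)
  sect_mem h j hj := S.sect_mem (h j hj)
  retr_f (m : Fin n → M.carrier) := funext fun j => S.retr_f (m j)
  g_sect (m : Fin n → P.carrier) := funext fun j => S.g_sect (m j)
  g_f (m : Fin n → M.carrier) := funext fun j => S.g_f (m j)
  add (m : Fin n → N.carrier) := funext fun j => S.add (m j)

end SplitExact

/-- The filtration of `M ⊗ V`, for `V` of dimension two. -/
def splitExactTwo [hp : Fact p.Prime] [CharP k p] (h2 : 2 ≤ p) (c l l' : ℤ) (hl : l = c + 2)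
    (hl' : l' = c) (M : PDGModule A) :
    Σ' (f : gradingShift l M ⟶ tensorV 2 h2 c M) (g : tensorV 2 h2 c M ⟶ gradingShift l' M),
      SplitExact f g :=
  -- The second slot, in degree c + 2, is the subcomplex, and the first slot is the quotient.
  ⟨{ lin := LinearMap.single A.carrier (fun _ : Fin 2 => M.carrier) 1
     map_gr := fun {i m} hm j _ => by
       change Pi.single (M := fun _ : Fin 2 => M.carrier) 1 m j ∈ M.gr (i - (c + 2 * (j.1 : ℤ)))
       fin_cases j
       · exact zero_mem _
       · subst hl
         simpa using hm
     map_d := fun m => by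
       funext j
       change Pi.single (M := fun _ : Fin 2 => M.carrier) 1 (M.d m) j =
         shiftD M.d 2 (Pi.single (M := fun _ : Fin 2 => M.carrier) 1 m) j
       rw [shiftD_apply]
       fin_cases j <;> simp },
   { lin := LinearMap.proj (R := A.carrier) (φ := fun _ : Fin 2 => M.carrier) 0
     map_gr := fun {i} (m : Fin 2 → M.carrier) hm => by
       have h : m 0 ∈ M.gr (i - (c + 2 * ((0 : Fin 2).1 : ℤ))) := hm 0 trivial
       subst hl'
       change m 0 ∈ M.gr (i - l')
       simpa using h
     map_d := fun (m : Fin 2 → M.carrier) => by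
       change shiftD M.d 2 m 0 = M.d (m 0)
       rw [shiftD_apply]
       simp },
   { retr := LinearMap.proj (R := k) (φ := fun _ : Fin 2 => M.carrier) 1
     sect := LinearMap.single k (fun _ : Fin 2 => M.carrier) 0
     retr_mem := fun {i} (m : Fin 2 → M.carrier) hm => by
       have h : m 1 ∈ M.gr (i - (c + 2 * ((1 : Fin 2).1 : ℤ))) := hm 1 trivial
       subst hl
       change m 1 ∈ M.gr (i - (c + 2))
       simpa using h
     sect_mem := fun {i m} hm j _ => by
       change Pi.single (M := fun _ : Fin 2 => M.carrier) 0 m j ∈ M.gr (i - (c + 2 * (j.1 : ℤ)))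
       fin_cases j
       · subst hl'
         simpa using hm
       · exact zero_mem _
     retr_f := fun m => by
       change Pi.single (M := fun _ : Fin 2 => M.carrier) 1 m 1 = m
       simp
     g_sect := fun m => by
       change Pi.single (M := fun _ : Fin 2 => M.carrier) 0 m 0 = m
       simp
     g_f := fun m => by
       change Pi.single (M := fun _ : Fin 2 => M.carrier) 1 m 0 = 0
       simp
     add := fun (m : Fin 2 → M.carrier) => by
       funext j
       change Pi.single (M := fun _ : Fin 2 => M.carrier) 1 (m 1) j +
         Pi.single (M := fun _ : Fin 2 => M.carrier) 0 (m 0) j = m j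
       fin_cases j <;> simp }⟩

end PDGModule

/-! ### Diagram identities for divided powers and for ψ₂ and φ₁ -/

namespace PDGAlgebra

variable {k : Type u} [Field k] {p : ℕ}

/-- Right multiplication as a map between left ideals. -/
def mulRight (A : PDGAlgebra k p) {ε ε' : A.carrier} (y : A.carrier) (hy : y * ε' = y) :
    A.idealOf ε →ₗ[A.carrier] A.idealOf ε' where
  toFun a := ⟨a.1 * y, by
    change a.1 * y * ε' = a.1 * y
    rw [mul_assoc, hy]⟩
  map_add' a b := Subtype.ext (add_mul _ _ _)
  map_smul' r a := Subtype.ext (mul_assoc r a.1 y)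

end PDGAlgebra

namespace Webster

variable {k : Type u} [Field k]

section divided

variable {i : Fin 2} {w : Seq}

theorem e_c_black (h : w.1 (lo i) = Strand.black) (h' : w.1 (hi i) = Strand.black) :
    (e w * c i w : Alg k) = c i w := by
  have h1 := e_c (k := k) i w
  rwa [Seq.swap_eq (h.trans h'.symm)] at h1

theorem c_x_c (h : w.1 (lo i) = Strand.black) (h' : w.1 (hi i) = Strand.black) :
    (c i w * (x (hi i) w * c i w) : Alg k) = -c i w := by
  rw [← mul_assoc, nilHecke_right h h', sub_mul, mul_assoc, c_c_black h h', mul_zero,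
    e_c_black h h', zero_sub]

theorem c_x_c' (h : w.1 (lo i) = Strand.black) (h' : w.1 (hi i) = Strand.black) :
    (c i w * (x (lo i) w * c i w) : Alg k) = c i w := by
  rw [← mul_assoc, nilHecke_left h h', add_mul, mul_assoc, c_c_black h h', mul_zero,
    e_c_black h h', zero_add]

theorem divided_mul_c (h : w.1 (lo i) = Strand.black) (h' : w.1 (hi i) = Strand.black) :
    (divided i w * c i w : Alg k) = c i w := by
  rw [divided, neg_mul, mul_assoc, c_x_c h h', neg_neg]

theorem c_mul_divided (h : w.1 (lo i) = Strand.black) (h' : w.1 (hi i) = Strand.black) :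
    (c i w * divided i w : Alg k) = 0 := by
  rw [divided, mul_neg, ← mul_assoc, c_c_black h h', zero_mul, neg_zero]

/-- The product of both dots is symmetric, so it can be moved out from between the two crossings,
whose product is zero. -/
theorem x_x_c (h : w.1 (lo i) = Strand.black) (h' : w.1 (hi i) = Strand.black) :
    (c i w * (x (hi i) w * (x (lo i) w * c i w)) : Alg k) = 0 := by
  rw [mul_assoc_of (nilHecke_right h h'), sub_mul, mul_assoc, c_x_c' h h', ← mul_assoc (e w), e_x,
    sub_self]

theorem divided_x_c (h : w.1 (lo i) = Strand.black) (h' : w.1 (hi i) = Strand.black) :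
    (divided i w * (x (lo i) w * c i w) : Alg k) = 0 := by
  rw [divided, neg_mul, mul_assoc, x_x_c h h', neg_zero]

theorem divided_x_divided (h : w.1 (lo i) = Strand.black) (h' : w.1 (hi i) = Strand.black) :
    (divided i w * (x (lo i) w * divided i w) : Alg k) = 0 := by
  have h1 := divided_x_c (k := k) h h'
  rw [show (divided i w : Alg k) = -(c i w * x (hi i) w) from rfl] at h1 ⊢
  rw [mul_neg, mul_neg, ← mul_assoc (x (lo i) w), ← mul_assoc, h1, zero_mul, neg_zero]

theorem c_x_divided (h : w.1 (lo i) = Strand.black) (h' : w.1 (hi i) = Strand.black) :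
    (c i w * (x (lo i) w * divided i w) : Alg k) = divided i w := by
  rw [divided, mul_neg, mul_neg, ← mul_assoc (x (lo i) w), ← mul_assoc, c_x_c' h h']

/-- Together with `c_x_divided`, `c_mul_divided`, `divided_x_divided` and `divided_mul_self` this
says that the row (x ε, ε) and the column (c, ε) are inverse to each other, so that W̃ e(w) is two
copies of W̃ ε. -/
theorem x_divided_c (h : w.1 (lo i) = Strand.black) (h' : w.1 (hi i) = Strand.black) :
    (x (lo i) w * divided i w * c i w + divided i w : Alg k) = e w := by
  rw [mul_assoc, divided_mul_c h h', divided_eq h h']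
  abel

/-- For a in W̃ ε this gives a ∂(c) = a. It is the differential of V₂, from the copy of W̃ ε
attached to c to the copy attached to ε. -/
theorem divided_d_c (h : w.1 (lo i) = Strand.black) (h' : w.1 (hi i) = Strand.black) (μ : k) :
    (divided i w * d μ (c i w) : Alg k) = divided i w := by
  rw [d_gen, dGen_black_black μ h h', mul_sub, mul_smul_comm, divided_x_c h h', smul_zero, sub_zero,
    divided, neg_mul, mul_assoc, x_e]

theorem divided_e (i : Fin 2) (w : Seq) : (divided i w * e w : Alg k) = divided i w := by
  rw [divided, neg_mul, mul_assoc, x_e]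

end divided

-- The triple crossing relation moves the black crossing of ψ₂ down to the black crossing of φ₁, and
-- the double crossing is zero.
variable (k) in
theorem psi_mul_phi : (c 0 s2 * c 1 s0 * (c 0 s1 * c 1 s1 * x 3 s1) : Alg k) = 0 := by
  obtain ⟨-, -, -, -, -, -, -, -, -, -, -, -, -, -, -, -, -, -, r, -, -⟩ := concrete k
  have h : (c 1 s1 * c 1 s1 : Alg k) = 0 := c_c_black rfl rfl
  calc (c 0 s2 * c 1 s0 * (c 0 s1 * c 1 s1 * x 3 s1) : Alg k)
      = (c 0 s2 * (c 1 s0 * c 0 s1)) * (c 1 s1 * x 3 s1) := by simp only [mul_assoc]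
    _ = 0 := by
        rw [r]
        simp only [mul_assoc]
        rw [mul_assoc_of h, zero_mul, mul_zero, mul_zero]

variable (k) in
theorem c_s0_s2 : (c 1 s0 * c 1 s2 : Alg k) = x 2 s2 :=
  swap_s2_1 ▸ c_c_black_red (i := 1) (w := s2) rfl rfl

variable (k) in
theorem c_s0_s1 : (c 0 s0 * c 0 s1 : Alg k) = x 2 s1 :=
  swap_s1_0 ▸ c_c_red_black (i := 0) (w := s1) rfl rfl

-- The red-black double crossing is a dot, and it turns the black crossing of ψ₂ into −ε₂.
variable (k) in
theorem psi_mul_retr : (c 0 s2 * c 1 s0 * -(c 1 s2 * divided 0 s2) : Alg k) = divided 0 s2 := by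
  rw [mul_neg, mul_assoc, mul_assoc_of (c_s0_s2 k), ← mul_assoc, ← neg_mul]
  exact divided_mul_self rfl rfl

-- The red-black double crossing is a dot between two black crossings, and these reduce to a single
-- crossing.
variable (k) in
theorem sect_mul_phi : (-(c 1 s1 * c 0 s0) * (c 0 s1 * c 1 s1 * x 3 s1) : Alg k) =
    divided 1 s1 := by
  have h : (c 1 s1 * (x 2 s1 * c 1 s1) : Alg k) = c 1 s1 := c_x_c' (i := 1) (w := s1) rfl rfl
  rw [neg_mul, mul_assoc, mul_assoc, mul_assoc_of (c_s0_s1 k), ← mul_assoc, ← mul_assoc,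
    mul_assoc (c 1 s1), h]
  rfl

-- After superfluous black crossings are cancelled, the two summands are, up to sign, the two
-- diagrams in the triple crossing relation with the red strand in the middle, and that relation
-- says that they add up to the identity.
variable (k) in
theorem retr_add_sect : (-(c 1 s2 * divided 0 s2) * (c 0 s2 * c 1 s0) +
    c 0 s1 * c 1 s1 * x 3 s1 * -(c 1 s1 * c 0 s0) : Alg k) = e s0 := by
  obtain ⟨-, -, -, -, -, -, -, -, -, -, -, -, -, -, -, -, -, -, -, -, r⟩ := concrete k
  have h : (c 1 s1 * (x 3 s1 * c 1 s1) : Alg k) = -c 1 s1 := c_x_c (i := 1) (w := s1) rfl rfl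
  have h' : (divided 0 s2 * c 0 s2 : Alg k) = c 0 s2 := divided_mul_c rfl rfl
  have e1 : (-(c 1 s2 * divided 0 s2) * (c 0 s2 * c 1 s0) : Alg k) =
      -(c 1 s2 * (c 0 s2 * c 1 s0)) := by
    rw [neg_mul, mul_assoc, mul_assoc_of h']
  have e2 : (c 0 s1 * c 1 s1 * x 3 s1 * -(c 1 s1 * c 0 s0) : Alg k) =
      c 0 s1 * (c 1 s1 * c 0 s0) := by
    calc (c 0 s1 * c 1 s1 * x 3 s1 * -(c 1 s1 * c 0 s0) : Alg k)
        = -(c 0 s1 * ((c 1 s1 * (x 3 s1 * c 1 s1)) * c 0 s0)) := by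
          rw [mul_neg]; simp only [mul_assoc]
      _ = c 0 s1 * (c 1 s1 * c 0 s0) := by rw [h, neg_mul, mul_neg, neg_neg]
  rw [e1, e2, r]
  abel

-- For parameter 1 the derivative of the red-black crossing combines with that of the black one to
-- ∂(ψ₂) = −x ψ₂, the dot being on the left black strand at the top, and ε₂ x c = 0. Only ε₂ ∂(ψ₂)
-- matters, since a = a ε₂ on the source.
variable (k) in
theorem divided_d_psi : (divided 0 s2 * d (1 : k) (c 0 s2 * c 1 s0) : Alg k) = 0 := by
  obtain ⟨-, -, -, -, -, -, -, -, -, r10, -, -, -, r14, -⟩ := concrete k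
  have h1 : (divided 0 s2 * (x 1 s2 * c 0 s2) : Alg k) = 0 := divided_x_c (i := 0) (w := s2) rfl rfl
  have h : d (1 : k) (c 0 s2 * c 1 s0 : Alg k) = -(x 1 s2 * (c 0 s2 * c 1 s0)) := by
    rw [d_mul, d_gen, d_gen, dGen_cross_s2_0, dGen_cross_s0_1, one_smul, sub_mul, r14,
      mul_assoc_of r10, sub_mul, r14, two_smul, add_mul, mul_assoc]
    abel
  rw [h, mul_neg, ← mul_assoc (x 1 s2), ← mul_assoc, h1, zero_mul, neg_zero]

-- Let x be the dot on the left black strand at the top. The red-black crossing and the dot of φ₁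
-- contribute x φ₁ once each, the black crossing contributes −2 x φ₁, and the two remaining terms
-- cancel.
variable (k) in
theorem d_phi : (d (1 : k) (c 0 s1 * c 1 s1 * x 3 s1) : Alg k) = 0 := by
  obtain ⟨-, -, -, -, r5, -, -, r8, -⟩ := concrete k
  have hce : (c 0 s1 * e s1 : Alg k) = c 0 s1 := c_e 0 s1
  have hx : (x 2 s1 * x 3 s1 : Alg k) = x 3 s1 * x 2 s1 := x_comm 2 3 s1
  have hex : (e s1 * x 3 s1 : Alg k) = x 3 s1 := e_x 3 s1
  rw [d_mul, d_mul, d_gen, d_gen, d_gen, dGen_cross_s1_0, dGen_cross_s1_1, dGen_dot, one_smul]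
  simp only [mul_assoc, sub_mul, mul_sub, add_mul, mul_add, two_smul, mul_assoc_of r8, r8,
    mul_assoc_of r5, mul_assoc_of hce, hex]
  abel_nf

end Webster

/-! ### Compactness of W̃ e(w), and the exact sequence for λ = 1 -/

namespace DerivedPDG

variable {k : Type u} [Field k] {p : ℕ} {A : PDGAlgebra k p}

theorem IsCompact.of_iso {X Y : DerivedPDG A} (hX : IsCompact X) (a : X ≅ Y) : IsCompact Y := by
  intro I N f
  obtain ⟨J, g, hg⟩ := hX I N (a.hom ≫ f)
  refine ⟨J, a.inv ≫ g, ?_⟩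
  rw [Category.assoc, ← hg, a.inv_hom_id_assoc]

end DerivedPDG

namespace PDGModule

variable {k : Type u} [Field k] {p : ℕ} [hp : Fact p.Prime] [CharP k p] {A : PDGAlgebra k p}

/-- Tensoring with the one-dimensional `p`-complex of degree zero. -/
def tensorVOne (M : PDGModule A) : tensorV 1 hp.out.one_le 0 M ≅ M :=
  mkIso _ _ (LinearEquiv.funUnique (Fin 1) A.carrier M.carrier)
    (fun i (m : Fin 1 → M.carrier) => by
      constructor
      · intro h j _
        fin_cases j
        change m 0 ∈ M.gr i at h
        simpa using h
      · intro h
        have h0 : m 0 ∈ M.gr (i - (0 + 2 * ((0 : Fin 1).1 : ℤ))) := h 0 trivial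
        change m 0 ∈ M.gr i
        simpa using h0)
    fun (m : Fin 1 → M.carrier) => by
      change PDGAux.shiftD M.d 1 m 0 = M.d (m 0)
      rw [PDGAux.shiftD_apply]
      simp

theorem IsFreeOn.isCompact {P : PDGModule A} {e : A.carrier} (F : IsFreeOn P e) :
    DerivedPDG.IsCompact ((DerivedPDG.Q A).obj P) :=
  (DerivedPDG.isCompact_tensorV F (n := 0) hp.out.one_le 0).of_iso
    ((DerivedPDG.Q A).mapIso (tensorVOne P))

end PDGModule

namespace Webster

variable (k : Type u) [Field k] (p : ℕ) [hp : Fact p.Prime] [CharP k p]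

/-- The projective module of a sequence is free on its idempotent. -/
noncomputable def projectiveIsFreeOn (l : ZMod p) (w : Seq) :
    PDGModule.IsFreeOn (projective k p l w) (A := webster k p l) (e w : Alg k) where
  closed := d_gen (l.cast : k) (Gen.idem w)
  mem_zero := gen_mem_gr (.idem w)
  idem := e_mul_self w
  gen := ⟨(e w : Alg k), e_mul_self w⟩
  coord := ((webster k p l).idealOf (e w : Alg k)).subtype
  coord_gen := rfl
  coord_smul x := Subtype.ext x.2
  coord_mem h := h
  coord_d _ := rfl
  gen_mem := gen_mem_gr (.idem w)

variable {k p} in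
/-- The underlying element of the Webster algebra. -/
abbrev val {l : ZMod p} {ε : (webster k p l).carrier} (a : (webster k p l).idealOf ε) : Alg k := a.1

theorem isCompact_projective (l : ZMod p) (w : Seq) :
    DerivedPDG.IsCompact ((DerivedPDG.Q _).obj (projective k p l w)) :=
  (projectiveIsFreeOn k p l w).isCompact

variable {k p} in
/-- `W̃ e(w)` as an extension of shifts of the divided power. -/
noncomputable def dividedIso (l : ZMod p) {i : Fin 2} {w : Seq}
    (h : w.1 (lo i) = Strand.black) (h' : w.1 (hi i) = Strand.black) :
    PDGModule.tensorV 2 hp.out.two_le (-1) (PDGModule.gradingShift (-1)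
      ((webster k p l).leftIdeal (divided i w : Alg k) (divided_mul_self h h')
        (divided_mem h h') (d_divided h h' _))) ≅ projective k p l w :=
  let A := webster k p l
  -- The crossing has degree −2 and ε has degree 0; these are the degrees −1 and 1 of V₂, shifted by
  -- −1.
  let F : (Fin 2 → A.idealOf (divided i w : Alg k)) →ₗ[A.carrier] A.idealOf (e w : Alg k) :=
    A.mulRight (ε := (divided i w : Alg k)) (ε' := (e w : Alg k)) (c i w : Alg k) (c_e i w) ∘ₗ
      LinearMap.proj 0 +
    A.mulRight (ε := (divided i w : Alg k)) (ε' := (e w : Alg k)) (divided i w : Alg k)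
      (divided_e i w) ∘ₗ LinearMap.proj 1
  let G : A.idealOf (e w : Alg k) →ₗ[A.carrier] (Fin 2 → A.idealOf (divided i w : Alg k)) :=
    LinearMap.pi ![A.mulRight (ε := (e w : Alg k)) (ε' := (divided i w : Alg k))
        (x (lo i) w * divided i w : Alg k)
        ((mul_assoc (x (lo i) w : Alg k) _ _).trans
          (congrArg (fun a => (x (lo i) w * a : Alg k)) (divided_mul_self h h'))),
      A.mulRight (ε := (e w : Alg k)) (ε' := (divided i w : Alg k)) (divided i w : Alg k)
        (divided_mul_self h h')]
  PDGModule.mkIso _ _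
    (LinearEquiv.ofLinearMap (M := (Fin 2 → A.idealOf (divided i w : Alg k))) F G
      (LinearMap.ext fun m => Subtype.ext (by
        have hm : (val m * e w : Alg k) = val m := m.2
        suffices key : (val m * (x (lo i) w * divided i w) * c i w + val m * divided i w * divided i w
          : Alg k) = val m from key
        rw [mul_assoc, mul_assoc (val m), divided_mul_self h h', ← mul_add, x_divided_c h h', hm]))
      (LinearMap.ext fun a => by
        have h0 : (val (a 0) * divided i w : Alg k) = val (a 0) := (a 0).2
        have h1 : (val (a 1) * divided i w : Alg k) = val (a 1) := (a 1).2
        funext j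
        fin_cases j
        · refine Subtype.ext ?_
          suffices key : ((val (a 0) * c i w + val (a 1) * divided i w) * (x (lo i) w * divided i w)
            : Alg k) = val (a 0) from key
          rw [add_mul, mul_assoc, mul_assoc, c_x_divided h h', divided_x_divided h h', h0, mul_zero,
            add_zero]
        · refine Subtype.ext ?_
          suffices key : ((val (a 0) * c i w + val (a 1) * divided i w) * divided i w : Alg k) = val (a 1) from key
          rw [add_mul, mul_assoc, mul_assoc, c_mul_divided h h', divided_mul_self h h', h1,
            mul_zero, zero_add]))
    (fun n (a : Fin 2 → A.idealOf (divided i w : Alg k)) => by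
      have h0 : (val (a 0) * divided i w : Alg k) = val (a 0) := (a 0).2
      have h1 : (val (a 1) * divided i w : Alg k) = val (a 1) := (a 1).2
      have hε : (divided i w : Alg k) ∈ gr 0 := divided_mem h h'
      have hc : (c i w : Alg k) ∈ gr (-2) := by
        have := gen_mem_gr (k := k) (.cross i w)
        rwa [deg_cross_black h h'] at this
      have hx : (x (lo i) w : Alg k) ∈ gr 2 := gen_mem_gr (.dot (lo i) w)
      suffices key : (val (a 0) * c i w + val (a 1) * divided i w : Alg k) ∈ gr n ↔
        ∀ j ∈ Set.univ, val (a j) ∈ gr (n - (-1 + 2 * (j.1 : ℤ)) - -1) from key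
      constructor
      · intro ha j _
        fin_cases j
        · have := mul_mem_gr ha (mul_mem_gr hx hε)
          rw [add_mul, mul_assoc, mul_assoc, c_x_divided h h', divided_x_divided h h', h0, mul_zero,
            add_zero, add_zero] at this
          suffices key : (val (a 0) : Alg k) ∈ gr (n - (-1 + 2 * ((0 : ℕ) : ℤ)) - -1) from key
          rwa [show n - (-1 + 2 * ((0 : ℕ) : ℤ)) - -1 = n + 2 by push_cast; ring]
        · have := mul_mem_gr ha hε
          rw [add_mul, mul_assoc, mul_assoc, c_mul_divided h h', divided_mul_self h h', h1,
            mul_zero, zero_add] at this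
          suffices key : (val (a 1) : Alg k) ∈ gr (n - (-1 + 2 * ((1 : ℕ) : ℤ)) - -1) from key
          rwa [show n - (-1 + 2 * ((1 : ℕ) : ℤ)) - -1 = n + 0 by push_cast; ring]
      · intro ha
        have ha0 : (val (a 0) : Alg k) ∈ gr (n - (-1 + 2 * ((0 : ℕ) : ℤ)) - -1) := ha 0 trivial
        have ha1 : (val (a 1) : Alg k) ∈ gr (n - (-1 + 2 * ((1 : ℕ) : ℤ)) - -1) := ha 1 trivial
        have e0 := mul_mem_gr ha0 hc
        have e1 := mul_mem_gr ha1 hε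
        rw [show n - (-1 + 2 * ((0 : ℕ) : ℤ)) - -1 + -2 = n by push_cast; ring] at e0
        rw [show n - (-1 + 2 * ((1 : ℕ) : ℤ)) - -1 + 0 = n by push_cast; ring] at e1
        exact add_mem e0 e1)
    (fun (a : Fin 2 → A.idealOf (divided i w : Alg k)) => by
      have h0 : (val (a 0) * divided i w : Alg k) = val (a 0) := (a 0).2
      have h1 : (val (a 1) * divided i w : Alg k) = val (a 1) := (a 1).2
      have hd1 : (d (l.cast : k) (val (a 1)) * divided i w : Alg k) = d (l.cast : k) (val (a 1)) :=
        (A.idealOfD (divided i w : Alg k) (divided_mul_self h h') (d_divided h h' _) (a 1)).2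
      have hdc := divided_d_c h h' (l.cast : k)
      refine Subtype.ext ?_
      suffices key : ((d (l.cast : k) (val (a 0)) + val (0 : A.idealOf (divided i w : Alg k))) * c i w +
        (d (l.cast : k) (val (a 1)) + val (a 0)) * divided i w : Alg k) =
          d (l.cast : k) (val (a 0) * c i w + val (a 1) * divided i w) from key
      -- The term a₀ ∂(c) = a₀ = a₀ ε belongs to the second slot and is the step of V₂.
      have e0 : (val (a 0) * d (l.cast : k) (c i w) : Alg k) = val (a 0) := by
        nth_rewrite 1 [← h0]
        rw [mul_assoc, hdc, h0]
      rw [map_add, d_mul, e0, h1, add_mul, add_mul, h0, hd1]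
      have hz : (val (0 : A.idealOf (divided i w : Alg k)) * c i w : Alg k) = 0 := zero_mul _
      rw [hz]
      abel)

theorem cast_one : ((1 : ZMod p).cast : k) = 1 := ZMod.cast_one (dvd_refl p)

/-- Right multiplication by `ψ₂`, for `λ = 1`. -/
noncomputable def psiHom : W2div k p 1 ⟶ W0 k p 1 where
  lin := (webster k p 1).mulRight (ε := (divided 0 s2 : Alg k)) (ε' := (e s0 : Alg k)) (psi2 k p 1)
    ((mul_assoc (c 0 s2 : Alg k) _ _).trans (congrArg (fun a => (c 0 s2 * a : Alg k)) (c_e 1 s0)))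
  map_gr {i a} ha := by
    have h : (c 0 s2 * c 1 s0 : Alg k) ∈ gr (-2 + 1) :=
      mul_mem_gr (gen_mem_gr (.cross 0 s2)) (gen_mem_gr (.cross 1 s0))
    have ha' : (val a : Alg k) ∈ gr (i - -1) := ha
    have := mul_mem_gr ha' h
    rwa [show i - -1 + (-2 + 1) = i by ring] at this
  map_d a := Subtype.ext (by
    have h := divided_d_psi k
    rw [← cast_one k p] at h
    have ha : (val a * divided 0 s2 : Alg k) = val a := a.2
    have e0 : (val a * d ((1 : ZMod p).cast : k) (c 0 s2 * c 1 s0) : Alg k) = 0 := by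
      rw [← ha, mul_assoc, h, mul_zero]
    suffices key : (d ((1 : ZMod p).cast : k) (val a) * (c 0 s2 * c 1 s0) : Alg k) =
      d ((1 : ZMod p).cast : k) (val a * (c 0 s2 * c 1 s0)) from key
    rw [d_mul, e0, add_zero])

/-- Right multiplication by `φ₁`, for `λ = 1`. -/
noncomputable def phiHom : W0 k p 1 ⟶ W1div k p 1 where
  lin := (webster k p 1).mulRight (ε := (e s0 : Alg k)) (ε' := (divided 1 s1 : Alg k)) (phi1 k p 1)
    (by
      have h : (c 1 s1 * x 3 s1 : Alg k) = -divided 1 s1 := (neg_neg _).symm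
      have h' : (c 0 s1 * c 1 s1 * x 3 s1 * divided 1 s1 : Alg k) = c 0 s1 * c 1 s1 * x 3 s1 := by
        rw [mul_assoc (c 0 s1), h, mul_assoc, neg_mul, divided_mul_self rfl rfl]
      exact h')
  map_gr {i a} ha := by
    have h : (c 0 s1 * c 1 s1 * x 3 s1 : Alg k) ∈ gr (1 + -2 + 2) :=
      mul_mem_gr (mul_mem_gr (gen_mem_gr (.cross 0 s1)) (gen_mem_gr (.cross 1 s1)))
        (gen_mem_gr (.dot 3 s1))
    have ha' : (val a : Alg k) ∈ gr i := ha
    have := mul_mem_gr ha' h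
    rwa [show i + (1 + -2 + 2) = i - -1 by ring] at this
  map_d a := Subtype.ext (by
    have h := d_phi k
    rw [← cast_one k p] at h
    suffices key : (d ((1 : ZMod p).cast : k) (val a) * (c 0 s1 * c 1 s1 * x 3 s1) : Alg k) =
      d ((1 : ZMod p).cast : k) (val a * (c 0 s1 * c 1 s1 * x 3 s1)) from key
    rw [d_mul, h, mul_zero, add_zero])

/-- For `λ = 1`, the sequence given by `ψ₂` and `φ₁` is exact. -/
noncomputable def psiPhi : PDGModule.SplitExact (psiHom k p) (phiHom k p) where
  retr := ((webster k p 1).mulRight (ε := (e s0 : Alg k)) (ε' := (divided 0 s2 : Alg k))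
    (-(c 1 s2 * divided 0 s2) : Alg k) (by
      have h : (-(c 1 s2 * divided 0 s2) * divided 0 s2 : Alg k) = -(c 1 s2 * divided 0 s2) := by
        rw [neg_mul, mul_assoc, divided_mul_self rfl rfl]
      exact h)).restrictScalars k
  sect := ((webster k p 1).mulRight (ε := (divided 1 s1 : Alg k)) (ε' := (e s0 : Alg k))
    (-(c 1 s1 * c 0 s0) : Alg k) (by
      have h : (-(c 1 s1 * c 0 s0) * e s0 : Alg k) = -(c 1 s1 * c 0 s0) := by
        rw [neg_mul, mul_assoc, c_e]
      exact h)).restrictScalars k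
  retr_mem {i a} ha := by
    have h : (-(c 1 s2 * divided 0 s2) : Alg k) ∈ gr (1 + 0) :=
      neg_mem (mul_mem_gr (gen_mem_gr (.cross 1 s2)) (divided_mem rfl rfl))
    have ha' : (val a : Alg k) ∈ gr i := ha
    have := mul_mem_gr ha' h
    rwa [show i + (1 + 0) = i - -1 by ring] at this
  sect_mem {i a} ha := by
    have h : (-(c 1 s1 * c 0 s0) : Alg k) ∈ gr (-2 + 1) :=
      neg_mem (mul_mem_gr (gen_mem_gr (.cross 1 s1)) (gen_mem_gr (.cross 0 s0)))
    have ha' : (val a : Alg k) ∈ gr (i - -1) := ha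
    have := mul_mem_gr ha' h
    rwa [show i - -1 + (-2 + 1) = i by ring] at this
  retr_f a := Subtype.ext (by
    have ha : (val a * divided 0 s2 : Alg k) = val a := a.2
    suffices key : (val a * (c 0 s2 * c 1 s0) * -(c 1 s2 * divided 0 s2) : Alg k) = val a from key
    rw [mul_assoc, psi_mul_retr, ha])
  g_sect a := Subtype.ext (by
    have ha : (val a * divided 1 s1 : Alg k) = val a := a.2
    suffices key : (val a * -(c 1 s1 * c 0 s0) * (c 0 s1 * c 1 s1 * x 3 s1) : Alg k) = val a from key
    rw [mul_assoc, sect_mul_phi, ha])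
  g_f a := Subtype.ext (by
    suffices key : (val a * (c 0 s2 * c 1 s0) * (c 0 s1 * c 1 s1 * x 3 s1) : Alg k) = 0 from key
    rw [mul_assoc, psi_mul_phi, mul_zero])
  add a := Subtype.ext (by
    have ha : (val a * e s0 : Alg k) = val a := a.2
    suffices key : (val a * -(c 1 s2 * divided 0 s2) * (c 0 s2 * c 1 s0) +
      val a * (c 0 s1 * c 1 s1 * x 3 s1) * -(c 1 s1 * c 0 s0) : Alg k) = val a from key
    rw [mul_assoc, mul_assoc, ← mul_add, retr_add_sect, ha])

theorem symbol_relation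
    (h0 : DerivedPDG.IsCompact ((DerivedPDG.Q _).obj (W0 k p 1)))
    (h1 : DerivedPDG.IsCompact ((DerivedPDG.Q _).obj (W1 k p 1)))
    (h2 : DerivedPDG.IsCompact ((DerivedPDG.Q _).obj (W2 k p 1))) :
    K0.qPow _ 1 (K0.symbol _ h0) + K0.qPow _ (-1) (K0.symbol _ h0) =
      K0.symbol _ h1 + K0.symbol _ h2 := by
  have h2p := hp.out.two_le
  have hT := DerivedPDG.isCompact_tensorV (projectiveIsFreeOn k p 1 s0) (n := 1) h2p (-1)
  -- Tensoring the sequence of ψ₂ and φ₁ with V₂ replaces the divided powers by W₂ and W₁ and puts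
  -- W₀ ⊗ V₂ in the middle.
  have r1 := (((psiPhi k p).tensor 2 h2p (-1)).ofIso (dividedIso 1 rfl rfl).symm
    (dividedIso 1 rfl rfl)).symbol_eq h2 hT h1
  -- The filtration of V₂ computes the class of the same W₀ ⊗ V₂ as that of W₀{1} plus that of
  -- W₀{−1}.
  obtain ⟨f, g, S⟩ := PDGModule.splitExactTwo h2p (-1) 1 (-1) (by norm_num) rfl (W0 k p 1)
  have r2 := S.symbol_eq (h0.gradingShift 1) hT (h0.gradingShift (-1))
  rw [K0.qPow_symbol, K0.qPow_symbol, add_comm (K0.symbol _ h1), ← r1]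
  exact r2.symm

end Webster

/-! ### Homology and Euler characteristics of p-complexes -/

/-- A vector space with an operator `d` with `dᵖ = 0`, which has degree two for a family of
subspaces. -/
structure PComplex (k : Type u) [Field k] (p : ℕ) where
  carrier : Type u
  [addCommGroup : AddCommGroup carrier]
  [module : Module k carrier]
  gr : ℤ → Submodule k carrier
  d : Module.End k carrier
  d_mem : ∀ {i : ℤ} {x : carrier}, x ∈ gr i → d x ∈ gr (i + 2)
  d_pow : d ^ p = 0

attribute [instance] PComplex.addCommGroup PComplex.module

namespace PComplex

open Module

variable {k : Type u} [Field k] {p : ℕ}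

/-- A map of `p`-complexes. -/
structure Hom (X Y : PComplex k p) where
  lin : X.carrier →ₗ[k] Y.carrier
  map_gr : ∀ {i : ℤ} {x : X.carrier}, x ∈ X.gr i → lin x ∈ Y.gr i
  map_d : ∀ x, lin (X.d x) = Y.d (lin x)

section

variable (X Y Z : PComplex k p)

/-- The elements of degree `i` in the kernel of `dⁿ`. -/
def cycles (n : ℕ) (i : ℤ) : Submodule k X.carrier := X.gr i ⊓ LinearMap.ker (X.d ^ n)

/-- The elements of degree `i` in the image of `dᵐ`. -/
def boundaries (m : ℕ) (i : ℤ) : Submodule k X.carrier := (X.gr (i - 2 * m)).map (X.d ^ m)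

/-- The homology `ker dⁿ / im dᵖ⁻ⁿ` in degree `i`. -/
abbrev homology (n : ℕ) (i : ℤ) : Type u :=
  X.cycles n i ⧸ (X.boundaries (p - n) i).submoduleOf (X.cycles n i)

variable {X Y Z}

theorem mem_cycles {n : ℕ} {i : ℤ} {x : X.carrier} :
    x ∈ X.cycles n i ↔ x ∈ X.gr i ∧ (X.d ^ n) x = 0 := Iff.rfl

theorem mem_boundaries {m : ℕ} {i : ℤ} {x : X.carrier} :
    x ∈ X.boundaries m i ↔ ∃ y ∈ X.gr (i - 2 * m), (X.d ^ m) y = x := Iff.rfl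

theorem pow_mem (n : ℕ) {i : ℤ} {x : X.carrier} (hx : x ∈ X.gr i) :
    (X.d ^ n) x ∈ X.gr (i + 2 * n) := PDGAux.pow_mem (fun _ _ h => X.d_mem h) n hx

theorem pow_pow {n m : ℕ} (h : n + m = p) (x : X.carrier) : (X.d ^ n) ((X.d ^ m) x) = 0 := by
  rw [← Module.End.mul_apply, ← pow_add, h, X.d_pow]
  rfl

/-- The class of a cycle. -/
abbrev cls {n : ℕ} {i : ℤ} (x : X.cycles n i) : X.homology n i := Submodule.Quotient.mk x

theorem cls_eq_zero {n : ℕ} {i : ℤ} {x : X.cycles n i} :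
    cls x = 0 ↔ x.1 ∈ X.boundaries (p - n) i := Submodule.Quotient.mk_eq_zero _

theorem cls_eq {n : ℕ} {i : ℤ} {x y : X.cycles n i} :
    cls x = cls y ↔ x.1 - y.1 ∈ X.boundaries (p - n) i := Submodule.Quotient.eq _

/-- The map on homology induced by a linear map that respects cycles and boundaries. -/
def mapOf (L : X.carrier →ₗ[k] Y.carrier) {n n' : ℕ} {i i' : ℤ}
    (hc : ∀ x ∈ X.cycles n i, L x ∈ Y.cycles n' i')
    (hb : ∀ x ∈ X.boundaries (p - n) i, L x ∈ Y.boundaries (p - n') i') :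
    X.homology n i →ₗ[k] Y.homology n' i' :=
  Submodule.mapQ _ _ (L.restrict hc) fun x hx => hb x.1 hx

theorem mapOf_cls (L : X.carrier →ₗ[k] Y.carrier) {n n' : ℕ} {i i' : ℤ}
    (hc : ∀ x ∈ X.cycles n i, L x ∈ Y.cycles n' i')
    (hb : ∀ x ∈ X.boundaries (p - n) i, L x ∈ Y.boundaries (p - n') i') (x : X.cycles n i) :
    mapOf L hc hb (cls x) = cls ⟨L x.1, hc x.1 x.2⟩ := rfl

theorem Hom.map_pow (f : Hom X Y) (n : ℕ) (x : X.carrier) :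
    f.lin ((X.d ^ n) x) = (Y.d ^ n) (f.lin x) := PDGAux.pow_intertwine f.map_d n x

theorem Hom.map_cycles (f : Hom X Y) {n : ℕ} {i : ℤ} (x : X.carrier) (hx : x ∈ X.cycles n i) :
    f.lin x ∈ Y.cycles n i :=
  mem_cycles.2 ⟨f.map_gr hx.1, by rw [← f.map_pow, (mem_cycles.1 hx).2, map_zero]⟩

theorem Hom.map_boundaries (f : Hom X Y) {n : ℕ} {i : ℤ} (x : X.carrier)
    (hx : x ∈ X.boundaries n i) : f.lin x ∈ Y.boundaries n i := by
  obtain ⟨y, hy, rfl⟩ := hx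
  exact ⟨f.lin y, f.map_gr hy, (f.map_pow n y).symm⟩

/-- The map on homology induced by a map of `p`-complexes. -/
def Hom.map (f : Hom X Y) (n : ℕ) (i : ℤ) : X.homology n i →ₗ[k] Y.homology n i :=
  mapOf f.lin f.map_cycles f.map_boundaries

theorem Hom.map_cls (f : Hom X Y) {n : ℕ} {i : ℤ} (x : X.cycles n i) :
    f.map n i (cls x) = cls ⟨f.lin x.1, f.map_cycles x.1 x.2⟩ := rfl

/-- Null-homotopic endomorphisms vanish on homology. -/
theorem homotopySum_mem_boundaries {s : Module.End k X.carrier}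
    (hs : ∀ (i : ℤ) (x : X.carrier), x ∈ X.gr i → s x ∈ X.gr (i - 2 * ((p : ℤ) - 1))) {n : ℕ}
    (hn : n ≤ p) {i : ℤ} {x : X.carrier} (hx : x ∈ X.cycles n i) :
    PDGAux.homotopySum p X.d s x ∈ X.boundaries (p - n) i := by
  rw [PDGAux.homotopySum_of_pow_eq_zero hn (mem_cycles.1 hx).2]
  exact ⟨_, PDGAux.homotopySum_tail_mem p n (fun _ _ h => X.d_mem h) hs hn hx.1, rfl⟩

/-- Maps of `p`-complexes that are mutually inverse up to homotopy induce bijections on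
homology. -/
noncomputable def homologyEquiv (f : Hom X Y) (g : Hom Y X) {s : Module.End k X.carrier}
    (hs : ∀ (i : ℤ) (x : X.carrier), x ∈ X.gr i → s x ∈ X.gr (i - 2 * ((p : ℤ) - 1)))
    (hgf : ∀ (i : ℤ) (x : X.carrier), x ∈ X.gr i →
      g.lin (f.lin x) - x = PDGAux.homotopySum p X.d s x)
    {t : Module.End k Y.carrier}
    (ht : ∀ (i : ℤ) (y : Y.carrier), y ∈ Y.gr i → t y ∈ Y.gr (i - 2 * ((p : ℤ) - 1)))
    (hfg : ∀ (i : ℤ) (y : Y.carrier), y ∈ Y.gr i →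
      f.lin (g.lin y) - y = PDGAux.homotopySum p Y.d t y) {n : ℕ} (hn : n ≤ p) (i : ℤ) :
    X.homology n i ≃ₗ[k] Y.homology n i :=
  LinearEquiv.ofLinearMap (f.map n i) (g.map n i)
    (by
      refine LinearMap.ext fun y => ?_
      obtain ⟨y, rfl⟩ := Submodule.Quotient.mk_surjective _ y
      refine cls_eq.2 ?_
      change f.lin (g.lin y.1) - y.1 ∈ _
      rw [hfg i y.1 y.2.1]
      exact homotopySum_mem_boundaries ht hn y.2)
    (by
      refine LinearMap.ext fun x => ?_
      obtain ⟨x, rfl⟩ := Submodule.Quotient.mk_surjective _ x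
      refine cls_eq.2 ?_
      change g.lin (f.lin x.1) - x.1 ∈ _
      rw [hgf i x.1 x.2.1]
      exact homotopySum_mem_boundaries hs hn x.2)

end

/-! ### Split exact sequences -/

/-- A short exact sequence of `p`-complexes with a splitting of the graded vector spaces. -/
structure Split {X Y Z : PComplex k p} (f : Hom X Y) (g : Hom Y Z) where
  retr : Y.carrier →ₗ[k] X.carrier
  sect : Z.carrier →ₗ[k] Y.carrier
  retr_mem : ∀ {i : ℤ} {y : Y.carrier}, y ∈ Y.gr i → retr y ∈ X.gr i
  sect_mem : ∀ {i : ℤ} {z : Z.carrier}, z ∈ Z.gr i → sect z ∈ Y.gr i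
  retr_f : ∀ x, retr (f.lin x) = x
  g_sect : ∀ z, g.lin (sect z) = z
  g_f : ∀ x, g.lin (f.lin x) = 0
  add : ∀ y, f.lin (retr y) + sect (g.lin y) = y

namespace Split

variable {X Y Z : PComplex k p} {f : Hom X Y} {g : Hom Y Z} (S : Split f g) {n : ℕ} (hn : n ≤ p)
  (i : ℤ)

theorem f_retr {y : Y.carrier} (h : g.lin y = 0) : f.lin (S.retr y) = y := by
  have := S.add y
  rwa [h, map_zero, add_zero] at this

/-- The connecting map. -/
def connectingLin (n : ℕ) : Z.carrier →ₗ[k] X.carrier := S.retr ∘ₗ (Y.d ^ n) ∘ₗ S.sect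

/-- The snake construction: dⁿ of a lift of a cycle lies in the image of f, and the retraction pulls
it back to X. -/
theorem f_connectingLin {z : Z.carrier} (hz : (Z.d ^ n) z = 0) :
    f.lin (S.connectingLin n z) = (Y.d ^ n) (S.sect z) :=
  S.f_retr (y := (Y.d ^ n) (S.sect z)) (by rw [g.map_pow, S.g_sect, hz])

include S in
theorem f_injective : Function.Injective f.lin := fun x y h => by
  rw [← S.retr_f x, h, S.retr_f]

include hn in
theorem connecting_cycles (z : Z.carrier) (hz : z ∈ Z.cycles n i) :
    S.connectingLin n z ∈ X.cycles (p - n) (i + 2 * n) := by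
  refine mem_cycles.2 ⟨S.retr_mem (pow_mem n (S.sect_mem hz.1)), S.f_injective ?_⟩
  rw [f.map_pow, S.f_connectingLin (mem_cycles.1 hz).2, pow_pow (by omega), map_zero]

include hn in
theorem connecting_boundaries (z : Z.carrier) (hz : z ∈ Z.boundaries (p - n) i) :
    S.connectingLin n z ∈ X.boundaries (p - (p - n)) (i + 2 * n) := by
  obtain ⟨w, hw, rfl⟩ := hz
  have hd : (Z.d ^ n) ((Z.d ^ (p - n)) w) = 0 := pow_pow (by omega) w
  have hw2 := pow_mem (p - n) hw
  rw [sub_add_cancel] at hw2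
  have hw' := pow_mem (p - n) (S.sect_mem hw)
  rw [sub_add_cancel] at hw'
  rw [show p - (p - n) = n by omega]
  -- Both dᵖ⁻ⁿ of the lift of w and the lift of dᵖ⁻ⁿ w lie over the same element, so their
  -- difference comes from X. The former is killed by dⁿ and does not affect the result.
  refine mem_boundaries.2 ⟨S.retr (S.sect ((Z.d ^ (p - n)) w) - (Y.d ^ (p - n)) (S.sect w)), ?_, ?_⟩
  · rw [show i + 2 * (n : ℤ) - 2 * n = i by ring]
    exact S.retr_mem (sub_mem (S.sect_mem hw2) hw')
  · refine S.f_injective ?_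
    rw [f.map_pow, S.f_connectingLin hd, S.f_retr, map_sub, pow_pow (by omega), sub_zero]
    rw [map_sub, g.map_pow, S.g_sect, S.g_sect, sub_self]

/-- The connecting map on homology. -/
def connecting : Z.homology n i →ₗ[k] X.homology (p - n) (i + 2 * n) :=
  mapOf (S.connectingLin n) (S.connecting_cycles hn i) (S.connecting_boundaries hn i)

include S in
theorem exact_middle : LinearMap.range (f.map n i) = LinearMap.ker (g.map n i) := by
  ext x
  obtain ⟨x, rfl⟩ := Submodule.Quotient.mk_surjective _ x
  constructor
  · rintro ⟨y, hy⟩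
    obtain ⟨y, rfl⟩ := Submodule.Quotient.mk_surjective _ y
    rw [← hy, LinearMap.mem_ker, f.map_cls, g.map_cls, cls_eq_zero]
    simp only [S.g_f]
    exact zero_mem _
  · intro hx
    rw [LinearMap.mem_ker, g.map_cls, cls_eq_zero] at hx
    obtain ⟨z, hz, hzx⟩ := hx
    have hz' := pow_mem (p - n) (S.sect_mem hz)
    rw [sub_add_cancel] at hz'
    by_cases hn : n ≤ p
    -- Subtracting dᵖ⁻ⁿ of a lift of z moves x into the image of f without changing its class.
    · have h1 : f.lin (S.retr (x.1 - (Y.d ^ (p - n)) (S.sect z))) =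
          x.1 - (Y.d ^ (p - n)) (S.sect z) := S.f_retr (by
        rw [map_sub, g.map_pow, S.g_sect, hzx, sub_self])
      refine ⟨cls ⟨S.retr (x.1 - (Y.d ^ (p - n)) (S.sect z)), mem_cycles.2
        ⟨S.retr_mem (sub_mem x.2.1 hz'), S.f_injective ?_⟩⟩, ?_⟩
      · rw [f.map_pow, h1, map_sub, (mem_cycles.1 x.2).2, pow_pow (by omega), sub_zero, map_zero]
      · rw [f.map_cls, cls_eq]
        change f.lin (S.retr (x.1 - (Y.d ^ (p - n)) (S.sect z))) - x.1 ∈ _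
        rw [h1, sub_sub_cancel_left]
        exact neg_mem ⟨_, S.sect_mem hz, rfl⟩
    -- For n > p truncated subtraction gives p − n = 0, every element is a boundary, and the
    -- homology is zero.
    · refine ⟨0, ?_⟩
      rw [map_zero, eq_comm, cls_eq_zero, show p - n = 0 by omega]
      exact ⟨x.1, by simpa using x.2.1, by simp⟩

theorem exact_right : LinearMap.range (g.map n i) = LinearMap.ker (S.connecting hn i) := by
  ext x
  obtain ⟨x, rfl⟩ := Submodule.Quotient.mk_surjective _ x
  constructor
  · rintro ⟨y, hy⟩
    obtain ⟨y, rfl⟩ := Submodule.Quotient.mk_surjective _ y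
    rw [← hy, LinearMap.mem_ker, g.map_cls, connecting, mapOf_cls, cls_eq_zero]
    -- The cycle y is the sum of its component in X and the lift of its image in Z, so dⁿ takes
    -- opposite values on the two.
    refine mem_boundaries.2 ⟨-S.retr y.1, ?_, ?_⟩
    · rw [show i + 2 * (n : ℤ) - 2 * (p - (p - n) : ℕ) = i by
        rw [show p - (p - n) = n by omega]; ring]
      exact neg_mem (S.retr_mem y.2.1)
    · have hg : (Z.d ^ n) (g.lin y.1) = 0 := by
        rw [← g.map_pow, (mem_cycles.1 y.2).2, map_zero]
      refine S.f_injective ?_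
      rw [show p - (p - n) = n by omega, f.map_pow, S.f_connectingLin hg, map_neg, map_neg,
        eq_sub_of_add_eq' (S.add y.1), map_sub, (mem_cycles.1 y.2).2, zero_sub]
  · intro hx
    rw [LinearMap.mem_ker, connecting, mapOf_cls, cls_eq_zero] at hx
    obtain ⟨z, hz, hzx⟩ := hx
    rw [show i + 2 * (n : ℤ) - 2 * (p - (p - n) : ℕ) = i by
        rw [show p - (p - n) = n by omega]; ring] at hz
    rw [show p - (p - n) = n by omega] at hzx
    -- The lift of x fails to be a cycle by dⁿ (f z); subtracting f z repairs it and keeps the image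
    -- in Z.
    refine ⟨cls ⟨S.sect x.1 - f.lin z, mem_cycles.2 ⟨sub_mem (S.sect_mem x.2.1) (f.map_gr hz),
      ?_⟩⟩, ?_⟩
    · rw [map_sub, ← f.map_pow, hzx, S.f_connectingLin (mem_cycles.1 x.2).2, sub_self]
    · rw [g.map_cls, cls_eq]
      simp only [map_sub, S.g_sect, S.g_f, sub_zero, sub_self]
      exact zero_mem _

theorem exact_left : LinearMap.range (S.connecting hn i) =
    LinearMap.ker (f.map (p - n) (i + 2 * n)) := by
  ext x
  obtain ⟨x, rfl⟩ := Submodule.Quotient.mk_surjective _ x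
  constructor
  · rintro ⟨y, hy⟩
    obtain ⟨y, rfl⟩ := Submodule.Quotient.mk_surjective _ y
    rw [← hy, LinearMap.mem_ker, connecting, mapOf_cls, f.map_cls, cls_eq_zero]
    refine mem_boundaries.2 ⟨S.sect y.1, ?_, ?_⟩
    · rw [show i + 2 * (n : ℤ) - 2 * (p - (p - n) : ℕ) = i by
        rw [show p - (p - n) = n by omega]; ring]
      exact S.sect_mem y.2.1
    · rw [show p - (p - n) = n by omega]
      exact (S.f_connectingLin (mem_cycles.1 y.2).2).symm
  · intro hx
    rw [LinearMap.mem_ker, f.map_cls, cls_eq_zero] at hx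
    obtain ⟨z, hz, hzx⟩ := hx
    rw [show i + 2 * (n : ℤ) - 2 * (p - (p - n) : ℕ) = i by
        rw [show p - (p - n) = n by omega]; ring] at hz
    rw [show p - (p - n) = n by omega] at hzx
    have hg : (Z.d ^ n) (g.lin z) = 0 := by
      rw [← g.map_pow, hzx, S.g_f]
    -- Here dⁿ z = f x, so z is a lift of g z whose connecting image is x, up to the choice of the
    -- lift.
    refine ⟨cls ⟨g.lin z, mem_cycles.2 ⟨g.map_gr hz, hg⟩⟩, ?_⟩
    rw [connecting, mapOf_cls, cls_eq, show p - (p - n) = n by omega]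
    refine mem_boundaries.2 ⟨-S.retr z, ?_, S.f_injective ?_⟩
    · rw [show i + 2 * (n : ℤ) - 2 * n = i by ring]
      exact neg_mem (S.retr_mem hz)
    · have hzx' : (Y.d ^ n) z = f.lin x.1 := hzx
      rw [f.map_pow, map_sub, S.f_connectingLin hg, ← hzx', map_neg, map_neg,
        eq_sub_of_add_eq' (S.add z), map_sub]
      abel

end Split

/-! ### Euler characteristics -/

/-- The homology `ker dⁿ / im dᵖ⁻ⁿ` has finite total dimension. -/
def IsFinite (X : PComplex k p) (n : ℕ) : Prop :=
  (∀ i, FiniteDimensional k (X.homology n i)) ∧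
    (Function.support fun i => finrank k (X.homology n i)).Finite

/-- The graded dimension of `ker dⁿ / im dᵖ⁻ⁿ`, evaluated at `q`. -/
noncomputable def dimAt (X : PComplex k p) (n : ℕ) (q : ℂ) : ℂ :=
  ∑ᶠ i : ℤ, (finrank k (X.homology n i) : ℂ) * q ^ i

/-- The Euler characteristic: the difference of the graded dimensions of `ker dᵖ⁻¹ / im d` and
of a shift of `ker d / im dᵖ⁻¹`, evaluated at a root of unity `q`. -/
noncomputable def euler (X : PComplex k p) (q : ℂ) : ℂ :=
  X.dimAt (p - 1) q - q ^ 2 * X.dimAt 1 q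

theorem finsum_add_of_eq {a b c : ℤ → ℕ} (h : ∀ i, a i = b i + c i)
    (ha : (Function.support a).Finite) (q : ℂ) :
    ∑ᶠ i : ℤ, (a i : ℂ) * q ^ i = (∑ᶠ i : ℤ, (b i : ℂ) * q ^ i) + ∑ᶠ i : ℤ, (c i : ℂ) * q ^ i := by
  have hb : (Function.support fun i : ℤ => (b i : ℂ) * q ^ i).Finite :=
    ha.subset fun i hi hi' => hi (by
      have : b i = 0 := by have := h i; omega
      simp [this])
  have hc : (Function.support fun i : ℤ => (c i : ℂ) * q ^ i).Finite :=
    ha.subset fun i hi hi' => hi (by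
      have : c i = 0 := by have := h i; omega
      simp [this])
  rw [← finsum_add_distrib hb hc]
  exact finsum_congr fun i => by rw [h i]; push_cast; ring

theorem finsum_shift (a : ℤ → ℕ) (l : ℤ) {q : ℂ} (hq : q ≠ 0) :
    ∑ᶠ i : ℤ, (a (i - l) : ℂ) * q ^ i = q ^ l * ∑ᶠ i : ℤ, (a i : ℂ) * q ^ i := by
  rw [mul_finsum, ← finsum_comp_equiv (Equiv.addRight l)]
  refine finsum_congr fun i => ?_
  simp only [Equiv.coe_addRight, add_sub_cancel_right]
  rw [zpow_add₀ hq]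
  ring

namespace Split

variable {X Y Z : PComplex k p} {f : Hom X Y} {g : Hom Y Z} (S : Split f g)

-- The exact sequences for n = 1 and n = p − 1 close up periodically, and every graded dimension is
-- a sum of two rank series. The ranks of the maps f and g match up directly. The connecting maps
-- shift degrees by 2 and by 2 (p − 1); their ranks cancel against the factor q², since q²ᵖ = 1.
include S in
theorem euler_add (hp : 1 ≤ p) (hX : X.IsFinite (p - 1)) (hX' : X.IsFinite 1)
    (hY : Y.IsFinite (p - 1)) (hY' : Y.IsFinite 1) (hZ : Z.IsFinite (p - 1)) (hZ' : Z.IsFinite 1)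
    {q : ℂ} (hq : q ^ p = 1) : Y.euler q = X.euler q + Z.euler q := by
  have hq0 : q ≠ 0 := by rintro rfl; rw [zero_pow (by omega)] at hq; exact zero_ne_one hq
  have hrank : ∀ {U V W : Type u} [AddCommGroup U] [AddCommGroup V] [AddCommGroup W] [Module k U]
      [Module k V] [Module k W] (a : U →ₗ[k] V) (b : V →ₗ[k] W) [FiniteDimensional k V],
      LinearMap.range a = LinearMap.ker b →
      finrank k V = finrank k (LinearMap.range a) + finrank k (LinearMap.range b) := by
    intro U V W _ _ _ _ _ _ a b _ h
    rw [h, add_comm, LinearMap.finrank_range_add_finrank_ker]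
  have hYs : ∀ n, Y.IsFinite n → Y.dimAt n q =
      (∑ᶠ i : ℤ, (finrank k (LinearMap.range (f.map n i)) : ℂ) * q ^ i) +
        ∑ᶠ i : ℤ, (finrank k (LinearMap.range (g.map n i)) : ℂ) * q ^ i := fun n h =>
    finsum_add_of_eq (fun i => have := h.1 i; hrank _ _ (S.exact_middle i)) h.2 q
  have hZs : ∀ n, (hn : n ≤ p) → Z.IsFinite n → Z.dimAt n q =
      (∑ᶠ i : ℤ, (finrank k (LinearMap.range (g.map n i)) : ℂ) * q ^ i) +
        ∑ᶠ i : ℤ, (finrank k (LinearMap.range (S.connecting hn i)) : ℂ) * q ^ i := fun n hn h =>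
    finsum_add_of_eq (fun i => have := h.1 i; hrank _ _ (S.exact_right hn i)) h.2 q
  have hXs : ∀ n m, (hn : n ≤ p) → p - n = m → X.IsFinite m → X.dimAt m q =
      (q ^ (2 * n : ℤ) *
        ∑ᶠ i : ℤ, (finrank k (LinearMap.range (S.connecting hn i)) : ℂ) * q ^ i) +
        ∑ᶠ i : ℤ, (finrank k (LinearMap.range (f.map m i)) : ℂ) * q ^ i := by
    rintro n _ hn rfl h
    rw [← finsum_shift _ _ hq0]
    refine finsum_add_of_eq (fun i => ?_) h.2 q
    obtain ⟨j, rfl⟩ : ∃ j, i = j + 2 * (n : ℤ) := ⟨i - 2 * n, by ring⟩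
    have := h.1 (j + 2 * n)
    rw [hrank _ _ (S.exact_left hn j), add_sub_cancel_right]
  rw [euler, euler, euler, hYs _ hY, hYs _ hY', hZs (p - 1) (by omega) hZ, hZs 1 hp hZ',
    hXs 1 (p - 1) hp rfl hX, hXs (p - 1) 1 (by omega) (by omega) hX']
  have h1 : q ^ (2 * ((p - 1 : ℕ) : ℤ)) * q ^ 2 = 1 := by
    rw [← zpow_natCast q 2, ← zpow_add₀ hq0,
      show 2 * ((p - 1 : ℕ) : ℤ) + (2 : ℕ) = (p : ℤ) * 2 by push_cast [Nat.cast_sub hp]; ring,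
      zpow_mul, zpow_natCast, hq, one_zpow]
  have h2 : q ^ (2 * ((1 : ℕ) : ℤ)) = q ^ 2 := by
    rw [← zpow_natCast q 2]; norm_num
  rw [h2]
  linear_combination (∑ᶠ i : ℤ, (finrank k (LinearMap.range (S.connecting (n := p - 1)
    (by omega) i)) : ℂ) * q ^ i) * h1

-- If the middle term has no homology, the connecting map embeds the homology of the quotient in
-- that of the subcomplex. This is applied to cones of identity maps.
include S in
theorem isFinite_right {n : ℕ} (hn : n ≤ p) (hX : X.IsFinite (p - n))
    (hY : ∀ i, Subsingleton (Y.homology n i)) : Z.IsFinite n := by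
  have hinj : ∀ i, Function.Injective (S.connecting hn i) := fun i => by
    rw [← LinearMap.ker_eq_bot, ← S.exact_right hn i, eq_bot_iff]
    rintro _ ⟨y, rfl⟩
    rw [Subsingleton.elim y 0, map_zero]
    exact zero_mem _
  refine ⟨fun i => ?_, ?_⟩
  · have := hX.1 (i + 2 * n)
    exact FiniteDimensional.of_injective _ (hinj i)
  · refine (hX.2.image fun i => i - 2 * (n : ℤ)).subset fun i hi => ⟨i + 2 * n, fun h => hi ?_, ?_⟩
    · have := hX.1 (i + 2 * n)
      have := LinearMap.finrank_le_finrank_of_injective (hinj i)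
      change finrank k (X.homology (p - n) (i + 2 * n)) = 0 at h
      change finrank k (Z.homology n i) = 0
      omega
    · simp
end Split

end PComplex

/-! ### The homology of e M, and its behaviour under cones -/

/-- A closed idempotent of degree zero. -/
structure PDGAlgebra.IsClosedIdem {k : Type u} [Field k] {p : ℕ} (A : PDGAlgebra k p)
    (e : A.carrier) : Prop where
  closed : A.d e = 0
  mem_zero : e ∈ A.gr 0
  idem : e * e = e

namespace PDGModule

open PDGAux Module

variable {k : Type u} [Field k] {p : ℕ} {A : PDGAlgebra k p} {e : A.carrier}

/-- The elements fixed by an idempotent. -/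
def fixed (M : PDGModule A) (e : A.carrier) : Submodule k M.carrier where
  carrier := {m | e • m = m}
  add_mem' {m n} hm hn := by
    simp only [Set.mem_ofPred_eq] at *
    rw [smul_add, hm, hn]
  zero_mem' := smul_zero e
  smul_mem' r m hm := by
    simp only [Set.mem_ofPred_eq] at *
    rw [smul_comm, hm]

theorem mem_fixed {M : PDGModule A} {m : M.carrier} : m ∈ M.fixed e ↔ e • m = m := Iff.rfl

variable (he : A.IsClosedIdem e)

/-- The `p`-complex `e M`, for a closed idempotent `e`. -/
abbrev part (M : PDGModule A) : PComplex k p where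
  carrier := M.carrier
  gr i := M.gr i ⊓ M.fixed e
  d := M.d
  d_mem {i m} hm := ⟨M.d_mem hm.1, mem_fixed.2 (by
    rw [smul_d_of_closed he.closed, mem_fixed.1 hm.2])⟩
  d_pow := M.d_pow

/-- Functoriality of `e M`. -/
abbrev partMap {M N : PDGModule A} (f : M ⟶ N) : PComplex.Hom (part he M) (part he N) where
  lin := linBase f
  map_gr {i m} hm := ⟨map_gr f hm.1, mem_fixed.2 (by
    change e • lin f m = lin f m
    rw [← map_smul, mem_fixed.1 hm.2])⟩
  map_d := map_d f

include he in
theorem smul_mem_gr {M : PDGModule A} {i : ℤ} {m : M.carrier} (hm : m ∈ M.gr i) :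
    e • m ∈ M.gr i ⊓ M.fixed e := by
  refine ⟨?_, mem_fixed.2 (by rw [smul_smul, he.idem])⟩
  simpa using M.smul_mem he.mem_zero hm

/-- The homology of `e M` as a functor. -/
def homologyFunctor (n : ℕ) (i : ℤ) : PDGModule A ⥤ ModuleCat.{u} k where
  obj M := ModuleCat.of k ((part he M).homology n i)
  map f := ModuleCat.ofHom ((partMap he f).map n i)
  map_id M := by
    refine ModuleCat.hom_ext (LinearMap.ext fun x => ?_)
    obtain ⟨x, rfl⟩ := Submodule.Quotient.mk_surjective _ x
    rfl
  map_comp f g := by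
    refine ModuleCat.hom_ext (LinearMap.ext fun x => ?_)
    obtain ⟨x, rfl⟩ := Submodule.Quotient.mk_surjective _ x
    rfl

-- A k-linear homotopy need not preserve e M. Composing it with multiplication by e repairs this,
-- because e commutes with d.
include he in
theorem homotopySum_part {M : PDGModule A} (s f : Module.End k M.carrier)
    (h : f = ∑ i ∈ Finset.range p, M.d ^ i * s * M.d ^ (p - 1 - i)) (x : M.carrier) :
    homotopySum p M.d (Algebra.lsmul k k M.carrier e ∘ₗ s) x = e • f x := by
  have h' : f x = homotopySum p M.d s x := by rw [h]; rfl
  rw [h', homotopySum_apply, homotopySum_apply, Finset.smul_sum]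
  refine Finset.sum_congr rfl fun i _ => ?_
  rw [smul_pow_d_of_closed he.closed]
  rfl

/-- Multiplied by e, the k-linear inverse of a quasi-isomorphism and the homotopies restrict to e M,
and null-homotopic maps vanish on homology. -/
theorem homologyFunctor_inverts {n : ℕ} (hn : n ≤ p) (i : ℤ) :
    (quasiIso A).IsInvertedBy (homologyFunctor he n i) := by
  rintro M N f ⟨g, hg, hgd, ⟨s, hs, hs'⟩, ⟨t, ht, ht'⟩⟩
  let g' : PComplex.Hom (part he N) (part he M) :=
    { lin := Algebra.lsmul k k M.carrier e ∘ₗ g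
      map_gr := fun {i y} hy => smul_mem_gr he (hg i y hy.1)
      map_d := fun y => by
        change e • g (N.d y) = M.d (e • g y)
        rw [hgd, smul_d_of_closed he.closed] }
  let E := PComplex.homologyEquiv (partMap he f) g'
    (s := Algebra.lsmul k k M.carrier e ∘ₗ s) (fun i x hx => smul_mem_gr he (hs i x hx.1))
    (fun i x hx => by
      rw [homotopySum_part he s _ hs']
      change e • g (lin f x) - x = e • (g (lin f x) - x)
      rw [smul_sub, mem_fixed.1 hx.2])
    (t := Algebra.lsmul k k N.carrier e ∘ₗ t) (fun i x hx => smul_mem_gr he (ht i x hx.1))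
    (fun i y hy => by
      rw [homotopySum_part he t _ ht']
      change lin f (e • g y) - y = e • (lin f (g y) - y)
      rw [smul_sub, mem_fixed.1 hy.2, map_smul]) hn i
  have h : (homologyFunctor he n i).map f = E.toModuleIso.hom := rfl
  rw [h]
  exact E.toModuleIso.isIso_hom

/-- The splitting of `e M` induced by a splitting that is linear over the algebra. -/
def SplitExact.part {M N P : PDGModule A} {f : M ⟶ N} {g : N ⟶ P} (S : SplitExact f g)
    (hr : ∀ n, S.retr (e • n) = e • S.retr n) (hs : ∀ y, S.sect (e • y) = e • S.sect y) :
    PComplex.Split (partMap he f) (partMap he g) where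
  retr := S.retr
  sect := S.sect
  retr_mem h := ⟨S.retr_mem h.1, mem_fixed.2 (by rw [← hr, mem_fixed.1 h.2])⟩
  sect_mem h := ⟨S.sect_mem h.1, mem_fixed.2 (by rw [← hs, mem_fixed.1 h.2])⟩
  retr_f := S.retr_f
  g_sect := S.g_sect
  g_f := S.g_f
  add := S.add

/-- The canonical exact sequence of a cone. -/
def coneSplit [Fact p.Prime] [CharP k p] {M N : PDGModule A} (u : M ⟶ N) :
    SplitExact (coneInr u) (coneFst u) where
  retr := LinearMap.snd k (Fin (p - 1) → M.carrier) N.carrier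
  sect := LinearMap.inl k (Fin (p - 1) → M.carrier) N.carrier
  retr_mem h := h.2
  sect_mem h := ⟨h, zero_mem _⟩
  retr_f _ := rfl
  g_sect _ := rfl
  g_f _ := rfl
  add _ := Prod.ext (zero_add _) (add_zero _)

/-- The zero module. -/
abbrev zeroModule (A : PDGAlgebra k p) : PDGModule A where
  carrier := PUnit
  gr _ := ⊤
  internal := by
    refine internal_of (iSupIndep_def.2 fun i => ?_) (Subsingleton.elim _ _)
    rw [Submodule.disjoint_def]
    exact fun x _ _ => Subsingleton.elim (α := PUnit) _ _
  smul_mem _ _ := trivial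
  d := 0
  d_mem _ := trivial
  leibniz _ _ := rfl
  d_pow := rfl

/-- The exact sequence `M = M → 0`. -/
def idSplit (M : PDGModule A) : SplitExact (P := zeroModule A) (𝟙 M)
    { lin := 0, map_gr := fun _ => trivial, map_d := fun _ => rfl } where
  retr := LinearMap.id
  sect := 0
  retr_mem h := h
  sect_mem _ := zero_mem _
  retr_f _ := rfl
  g_sect _ := rfl
  g_f _ := rfl
  add _ := add_zero _

variable [hp : Fact p.Prime] [CharP k p]

/-- The cone of the identity maps quasi-isomorphically to the cokernel of the identity, which is
zero. -/
theorem subsingleton_homology_cone_id (M : PDGModule A) {n : ℕ} (hn : n ≤ p) (i : ℤ) :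
    Subsingleton ((part he (cone (𝟙 M))).homology n i) := by
  have := homologyFunctor_inverts he hn i _ (idSplit M).isQuasiIso_coneDesc
  let E := (asIso ((homologyFunctor he n i).map (idSplit M).coneDesc)).toLinearEquiv
  have h : Subsingleton ((part he (zeroModule A)).homology n i) := by
    have : Subsingleton ((part he (zeroModule A)).cycles n i) :=
      ⟨fun x y => Subtype.ext (Subsingleton.elim (α := PUnit) _ _)⟩
    exact Quotient.instSubsingletonQuotient _
  exact E.toEquiv.subsingleton (β := (part he (zeroModule A)).homology n i)

/-- In the sequence of M, the cone of its identity and M[1], the middle term is acyclic, so the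
homology of M[1] for n embeds in that of M for p − n. -/
theorem isFinite_homShift (M : PDGModule A) {n : ℕ} (hn : n ≤ p)
    (h : (part he M).IsFinite (p - n)) : (part he (homShift M)).IsFinite n :=
  ((coneSplit (𝟙 M)).part he (fun _ => rfl) fun _ => Prod.ext rfl (smul_zero e).symm).isFinite_right
    hn h fun i => subsingleton_homology_cone_id he M hn i

theorem dimAt_cone_id (M : PDGModule A) {n : ℕ} (hn : n ≤ p) (q : ℂ) :
    (part he (cone (𝟙 M))).dimAt n q = 0 := by
  refine (finsum_congr fun i => ?_).trans finsum_zero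
  have := subsingleton_homology_cone_id he M hn i
  rw [Module.finrank_zero_of_subsingleton, Nat.cast_zero, zero_mul]

theorem isFinite_cone_id (M : PDGModule A) {n : ℕ} (hn : n ≤ p) :
    (part he (cone (𝟙 M))).IsFinite n := by
  have h := fun i => subsingleton_homology_cone_id he M hn i
  refine ⟨fun i => ?_, ?_⟩
  · have := h i
    infer_instance
  · convert Set.finite_empty
    rw [Function.support_eq_empty_iff]
    funext i
    have := h i
    exact Module.finrank_zero_of_subsingleton

/-- The Euler characteristic of a cone. -/
theorem euler_cone {M N : PDGModule A} (u : M ⟶ N)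
    (hM : (part he M).IsFinite (p - 1)) (hM' : (part he M).IsFinite 1)
    (hN : (part he N).IsFinite (p - 1)) (hN' : (part he N).IsFinite 1)
    (hC : (part he (cone u)).IsFinite (p - 1)) (hC' : (part he (cone u)).IsFinite 1)
    {q : ℂ} (hq : q ^ p = 1) :
    (part he N).euler q = (part he M).euler q + (part he (cone u)).euler q := by
  have h1p := hp.out.one_le
  have e1 : p - (p - 1) = 1 := by omega
  have hS := isFinite_homShift he M (n := p - 1) (by omega) (by rwa [e1])
  have hS' := isFinite_homShift he M (n := 1) h1p hM
  have r1 := ((coneSplit u).part he (fun _ => rfl)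
    fun _ => Prod.ext rfl (smul_zero e).symm).euler_add h1p hN hN' hC hC' hS hS' hq
  -- For the identity of M the same sequence shows that the Euler characteristic of M[1] is the
  -- negative of that of M.
  have r2 := ((coneSplit (𝟙 M)).part he (fun _ => rfl)
    fun _ => Prod.ext rfl (smul_zero e).symm).euler_add h1p hM hM' (isFinite_cone_id he M (by omega))
      (isFinite_cone_id he M h1p) hS hS' hq
  rw [PComplex.euler, dimAt_cone_id he M (by omega), dimAt_cone_id he M h1p] at r2
  rw [r1]
  linear_combination r2

end PDGModule

/-! ### Homology on the derived category, Euler characteristic on K₀ -/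

namespace DerivedPDG

open PDGModule Module

variable {k : Type u} [Field k] {p : ℕ} {A : PDGAlgebra k p} {e : A.carrier}
  (he : A.IsClosedIdem e)

/-- The homology of `e M` on the derived category. -/
noncomputable def homologyLift {n : ℕ} (hn : n ≤ p) (i : ℤ) : DerivedPDG A ⥤ ModuleCat.{u} k :=
  Localization.Construction.lift _ (homologyFunctor_inverts he hn i)

theorem homologyLift_map {n : ℕ} (hn : n ≤ p) (i : ℤ) {M N : PDGModule A} (f : M ⟶ N) :
    (homologyLift he hn i).map ((Q A).map f) = (homologyFunctor he n i).map f :=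
  (Functor.congr_hom (Localization.Construction.fac _ (homologyFunctor_inverts he hn i)) f).trans
    ((Category.id_comp _).trans (Category.comp_id _))

/-- Isomorphisms in the derived category induce isomorphisms on homology. -/
noncomputable def homologyIso {n : ℕ} (hn : n ≤ p) (i : ℤ) {M N : PDGModule A}
    (a : (Q A).obj M ≅ (Q A).obj N) :
    (part he M).homology n i ≃ₗ[k] (part he N).homology n i :=
  ((homologyLift he hn i).mapIso a).toLinearEquiv

theorem dimAt_eq {n : ℕ} (hn : n ≤ p) {M N : PDGModule A}
    (a : (Q A).obj M ≅ (Q A).obj N) (q : ℂ) : (part he M).dimAt n q = (part he N).dimAt n q :=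
  finsum_congr fun i => by rw [(homologyIso he hn i a).finrank_eq]

theorem euler_eq (hp : 1 ≤ p) {M N : PDGModule A} (a : (Q A).obj M ≅ (Q A).obj N) (q : ℂ) :
    (part he M).euler q = (part he N).euler q := by
  rw [PComplex.euler, PComplex.euler, dimAt_eq he (by omega) a, dimAt_eq he hp a]

/-- A `p`-DG module that represents an object of the derived category. -/
noncomputable def representative (X : DerivedPDG A) : PDGModule A :=
  (Localization.Construction.objEquiv (quasiIso A)).symm X

theorem representative_eq (X : DerivedPDG A) : (Q A).obj (representative X) = X :=
  (Localization.Construction.objEquiv (quasiIso A)).apply_symm_apply X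

end DerivedPDG

namespace K0

open DerivedPDG PDGModule

variable {k : Type u} [Field k] {p : ℕ} [hp : Fact p.Prime] [CharP k p] {A : PDGAlgebra k p}
  {e : A.carrier}

/-- The Euler characteristic of `e M` on the Grothendieck group. -/
noncomputable def euler (he : A.IsClosedIdem e)
    (hF : ∀ M : PDGModule A, IsCompact ((Q A).obj M) →
      (part he M).IsFinite (p - 1) ∧ (part he M).IsFinite 1) (q : ℂ) (hq : q ^ p = 1) :
    K0 A →+ ℂ :=
  QuotientAddGroup.lift _
    (FreeAbelianGroup.lift fun X : CompactPDG A => (part he (representative X.1)).euler q) (by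
      rw [K0Relations, AddSubgroup.closure_le]
      -- The Euler characteristic depends on objects up to isomorphism only, so the triangle may be
      -- replaced by that of a cone.
      rintro _ ⟨X, Y, Z, f, g, h, ⟨M, N, u, a, b, c, -, -, -⟩, rfl⟩
      have hM := hF M (X.2.of_iso a)
      have hN := hF N (Y.2.of_iso b)
      have hC := hF _ (Z.2.of_iso c)
      have h1p := hp.out.one_le
      have r := euler_cone he u hM.1 hM.2 hN.1 hN.2 hC.1 hC.2 hq
      have a' := euler_eq he h1p (eqToIso (representative_eq X.1) ≪≫ a) q
      have b' := euler_eq he h1p (eqToIso (representative_eq Y.1) ≪≫ b) q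
      have c' := euler_eq he h1p (eqToIso (representative_eq Z.1) ≪≫ c) q
      rw [← a', ← b', ← c'] at r
      simp only [SetLike.mem_coe, AddMonoidHom.mem_ker, map_sub, map_add,
        FreeAbelianGroup.lift_apply_of, r, sub_self])

theorem euler_symbol (he : A.IsClosedIdem e)
    (hF : ∀ M : PDGModule A, IsCompact ((Q A).obj M) →
      (part he M).IsFinite (p - 1) ∧ (part he M).IsFinite 1) (q : ℂ) (hq : q ^ p = 1)
    (M : PDGModule A) (hM : IsCompact ((Q A).obj M)) :
    euler he hF q hq (symbol _ hM) = (part he M).euler q := by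
  refine Eq.trans ?_ (euler_eq he hp.out.one_le (eqToIso (representative_eq ((Q A).obj M))) q)
  simp [euler, symbol]

end K0

/-! ### Graded duals of e A: coinduced modules -/

namespace PDGAux

section graded

variable {k : Type*} [Field k] {M N : Type*} [AddCommGroup M] [Module k M] [AddCommGroup N]
  [Module k N]

/-- The linear map given by its restrictions to the homogeneous components. -/
noncomputable def gradedLift {G : ℤ → Submodule k M} (h : DirectSum.IsInternal G)
    (f : ∀ i, G i →ₗ[k] N) : M →ₗ[k] N :=
  DirectSum.toModule k ℤ N f ∘ₗ
    (LinearEquiv.ofBijective (DirectSum.coeLinearMap G) h).symm.toLinearMap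

theorem gradedLift_of_mem {G : ℤ → Submodule k M} (h : DirectSum.IsInternal G)
    (f : ∀ i, G i →ₗ[k] N) {i : ℤ} {x : M} (hx : x ∈ G i) : gradedLift h f x = f i ⟨x, hx⟩ := by
  have h1 : (LinearEquiv.ofBijective (DirectSum.coeLinearMap G) h).symm x =
      DirectSum.lof k ℤ (fun i => G i) i ⟨x, hx⟩ := by
    rw [LinearEquiv.symm_apply_eq]
    exact (DirectSum.coeLinearMap_lof (A := G) i ⟨x, hx⟩).symm
  simp only [gradedLift, LinearMap.comp_apply, LinearEquiv.coe_coe, h1, DirectSum.toModule_lof]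

theorem ext_of_top {G : ℤ → Submodule k M} (h : (⨆ i, G i) = ⊤) {f g : M →ₗ[k] N}
    (hfg : ∀ i, ∀ x ∈ G i, f x = g x) (x : M) : f x = g x := by
  have hx : x ∈ ⨆ i, G i := by rw [h]; trivial
  induction hx using Submodule.iSup_induction' with
  | mem i x hx => exact hfg i x hx
  | zero => rw [map_zero, map_zero]
  | add x y _ _ hx hy => rw [map_add, map_add, hx, hy]

end graded

end PDGAux

namespace PDGModule

open PDGAux

variable {k : Type u} [Field k] {p : ℕ} {A : PDGAlgebra k p} {e : A.carrier}

/-- The linear maps from the algebra to a vector space, on which the algebra acts through right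
multiplication. -/
def Functional (A : PDGAlgebra k p) (S : Type u) [AddCommGroup S] [Module k S] : Type u :=
  A.carrier →ₗ[k] S

namespace Functional

variable {S : Type u} [AddCommGroup S] [Module k S]

instance : AddCommGroup (Functional A S) := inferInstanceAs (AddCommGroup (A.carrier →ₗ[k] S))
instance : Module k (Functional A S) := inferInstanceAs (Module k (A.carrier →ₗ[k] S))

/-- The values of a functional. -/
def app : Functional A S →ₗ[k] A.carrier →ₗ[k] S := LinearMap.id

theorem app_ext {φ ψ : Functional A S} (h : ∀ a, app φ a = app ψ a) : φ = ψ := LinearMap.ext h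

/-- A functional from a linear map. -/
def of (f : A.carrier →ₗ[k] S) : Functional A S := f

theorem app_of (f : A.carrier →ₗ[k] S) (a : A.carrier) : app (of f) a = f a := rfl

instance : SMul A.carrier (Functional A S) := ⟨fun b φ => of (app φ ∘ₗ LinearMap.mulRight k b)⟩

theorem smul_app (b : A.carrier) (φ : Functional A S) (a : A.carrier) :
    app (b • φ) a = app φ (a * b) := rfl

instance : Module A.carrier (Functional A S) where
  one_smul φ := app_ext fun a => by rw [smul_app, mul_one]
  mul_smul b c φ := app_ext fun a => by rw [smul_app, smul_app, smul_app, mul_assoc]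
  smul_zero b := app_ext fun a => by rw [smul_app]; simp
  smul_add b φ ψ := app_ext fun a => by
    rw [smul_app, map_add, map_add, LinearMap.add_apply, LinearMap.add_apply, smul_app, smul_app]
  add_smul b c φ := app_ext fun a => by
    rw [smul_app, map_add, LinearMap.add_apply, smul_app, smul_app, mul_add, map_add]
  zero_smul φ := app_ext fun a => by rw [smul_app, mul_zero]; simp

instance : IsScalarTower k A.carrier (Functional A S) := ⟨fun r b φ => app_ext fun a => by
  rw [smul_app, map_smul, LinearMap.smul_apply, smul_app, mul_smul_comm, map_smul]⟩

/-- The differential on functionals. -/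
def dual : Module.End k (Functional A S) where
  -- With this sign the Leibniz rule holds for the action of A through right multiplication.
  toFun φ := of (-(app φ ∘ₗ A.d))
  map_add' φ ψ := app_ext fun a => by
    simp only [map_add, app_of, LinearMap.neg_apply, LinearMap.comp_apply, LinearMap.add_apply]
    abel
  map_smul' r φ := app_ext fun a => by
    simp only [map_smul, app_of, LinearMap.neg_apply, LinearMap.comp_apply, LinearMap.smul_apply,
      RingHom.id_apply, smul_neg]

theorem dual_app (φ : Functional A S) (a : A.carrier) : app (dual φ) a = -app φ (A.d a) := rfl

theorem dual_pow_app (n : ℕ) (φ : Functional A S) (a : A.carrier) :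
    app ((dual ^ n) φ) a = (-1) ^ n • app φ ((A.d ^ n) a) := by
  induction n generalizing a with
  | zero => simp
  | succ n ih =>
    rw [pow_succ' dual, Module.End.mul_apply, dual_app, ih, pow_succ A.d, Module.End.mul_apply,
      pow_succ, mul_neg_one, neg_smul]

theorem dual_smul (b : A.carrier) (φ : Functional A S) :
    dual (b • φ) = A.d b • φ + b • dual φ := app_ext fun a => by
  rw [dual_app, smul_app, map_add, LinearMap.add_apply, smul_app, smul_app, dual_app, A.leibniz,
    map_add]
  abel

variable (e) (Sgr : ℤ → Submodule k S)

/-- The functionals of degree `i` on `e A`. -/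
def piece (i : ℤ) : Submodule k (Functional A S) where
  carrier := {φ | (∀ a, app φ (e * a) = app φ a) ∧ ∀ j, ∀ a ∈ A.gr j, app φ a ∈ Sgr (i + j)}
  add_mem' {φ ψ} hφ hψ := ⟨fun a => by
      rw [map_add, LinearMap.add_apply, LinearMap.add_apply, hφ.1, hψ.1],
    fun j a ha => add_mem (hφ.2 j a ha) (hψ.2 j a ha)⟩
  zero_mem' := ⟨fun a => rfl, fun j a _ => zero_mem _⟩
  smul_mem' r φ hφ := ⟨fun a => by
      rw [map_smul, LinearMap.smul_apply, LinearMap.smul_apply, hφ.1],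
    fun j a ha => Submodule.smul_mem _ r (hφ.2 j a ha)⟩

theorem smul_mem_piece {i j : ℤ} {b : A.carrier} (hb : b ∈ A.gr i) {φ : Functional A S}
    (hφ : φ ∈ piece e Sgr j) : b • φ ∈ piece e Sgr (i + j) :=
  ⟨fun a => by rw [smul_app, smul_app, mul_assoc, hφ.1], fun l a ha => by
    rw [smul_app, add_assoc, add_left_comm, add_comm i l]
    exact hφ.2 _ _ (A.mul_mem ha hb)⟩

/-- The sums of homogeneous functionals on `e A`. -/
def total : Submodule A.carrier (Functional A S) where
  carrier := (⨆ i, piece e Sgr i : Submodule k (Functional A S))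
  add_mem' := add_mem
  zero_mem' := zero_mem _
  smul_mem' b φ hφ := by
    have hb : b ∈ ⨆ i, A.gr i := by rw [A.internal.submodule_iSup_eq_top]; trivial
    have h1 : ∀ i, ∀ b ∈ A.gr i, ∀ φ ∈ ⨆ i, piece e Sgr i,
        b • φ ∈ (⨆ i, piece e Sgr i : Submodule k (Functional A S)) := by
      intro i b hb φ hφ
      induction hφ using Submodule.iSup_induction' with
      | mem j φ hφ => exact Submodule.mem_iSup_of_mem _ (smul_mem_piece e Sgr hb hφ)
      | zero => rw [smul_zero]; exact zero_mem _
      | add φ ψ _ _ hφ hψ => rw [smul_add]; exact add_mem hφ hψ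
    change b • φ ∈ ⨆ i, piece e Sgr i
    induction hb using Submodule.iSup_induction' with
    | mem i b hb => exact h1 i b hb φ hφ
    | zero => rw [zero_smul]; exact zero_mem _
    | add b c _ _ hb hc => rw [add_smul]; exact add_mem hb hc

theorem mem_total {φ : Functional A S} :
    φ ∈ total e Sgr ↔ φ ∈ (⨆ i, piece e Sgr i : Submodule k (Functional A S)) := Iff.rfl

theorem total_map {S' : Type u} [AddCommGroup S'] [Module k S'] {Sgr' : ℤ → Submodule k S'} {e' : A.carrier}
    (L : Functional A S →ₗ[k] Functional A S') (l : ℤ)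
    (h : ∀ i, ∀ φ ∈ piece e Sgr i, L φ ∈ piece e' Sgr' (i + l)) {φ : Functional A S}
    (hφ : φ ∈ total e Sgr) : L φ ∈ total e' Sgr' := by
  have h1 : (⨆ i, piece e Sgr i : Submodule k (Functional A S)) ≤
      (⨆ i, piece e' Sgr' i : Submodule k (Functional A S')).comap L :=
    iSup_le fun i φ hφ => Submodule.mem_iSup_of_mem _ (h i φ hφ)
  exact h1 hφ

/-- A map of functionals of degree `l`, restricted to sums of homogeneous functionals. -/
def totalMap {S' : Type u} [AddCommGroup S'] [Module k S'] {Sgr' : ℤ → Submodule k S'} {e' : A.carrier}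
    (L : Functional A S →ₗ[k] Functional A S') (l : ℤ)
    (h : ∀ i, ∀ φ ∈ piece e Sgr i, L φ ∈ piece e' Sgr' (i + l)) :
    total (A := A) e Sgr →ₗ[k] total (A := A) e' Sgr' where
  toFun φ := ⟨L φ.1, total_map e Sgr L l h φ.2⟩
  map_add' φ ψ := Subtype.ext (map_add L φ.1 ψ.1)
  map_smul' r φ := Subtype.ext (map_smul L r φ.1)

variable {e}

theorem dual_mem_piece (he : A.IsClosedIdem e) {i : ℤ} {φ : Functional A S}
    (hφ : φ ∈ piece e Sgr i) : dual φ ∈ piece e Sgr (i + 2) :=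
  ⟨fun a => by
    rw [dual_app, dual_app, A.leibniz, he.closed, zero_mul, zero_add, hφ.1], fun j a ha => by
    rw [dual_app, add_right_comm, add_assoc]
    exact neg_mem (hφ.2 _ _ (A.d_mem ha))⟩

end Functional

open Functional

variable (he : A.IsClosedIdem e) {S : Type u} [AddCommGroup S] [Module k S]
  {Sgr : ℤ → Submodule k S} (hS : DirectSum.IsInternal Sgr)

/-- The coinduced module: the graded dual of `e A`, with coefficients in a graded vector space. -/
abbrev coinduced : PDGModule A where
  carrier := total (A := A) e Sgr
  gr i := (piece (A := A) e Sgr i).comap ((total e Sgr).subtype.restrictScalars k)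
  internal := by
    refine internal_of
      (indep_of_maps (J := Σ j, A.gr j) (N := fun _ => S)
        (fun a => LinearMap.applyₗ a.2.1 ∘ₗ app ∘ₗ (total e Sgr).subtype.restrictScalars k)
        (fun φ hφ => Subtype.ext (app_ext fun a => ?_)) _ (fun a i => Sgr (i + a.1))
        (fun a i φ hφ => hφ.2 a.1 a.2.1 a.2.2) fun a => ?_) ?_
    · exact ext_of_top (g := app (A := A) (S := S) 0) A.internal.submodule_iSup_eq_top
        (fun i a ha => hφ ⟨i, a, ha⟩) a
    · exact hS.submodule_iSupIndep.comp (add_left_injective a.1)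
    · rw [eq_top_iff]
      rintro ⟨φ, hφ⟩ -
      have h1 : ∀ φ ∈ (⨆ i, piece (A := A) e Sgr i), ∃ h : φ ∈ total (A := A) e Sgr,
          (⟨φ, h⟩ : total (A := A) e Sgr) ∈
            ⨆ i, (piece (A := A) e Sgr i).comap ((total e Sgr).subtype.restrictScalars k) := by
        intro φ hφ
        induction hφ using Submodule.iSup_induction' with
        | mem i φ hφ =>
          exact ⟨Submodule.mem_iSup_of_mem i hφ, Submodule.mem_iSup_of_mem i hφ⟩
        | zero => exact ⟨zero_mem _, zero_mem _⟩
        | add φ ψ _ _ hφ hψ =>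
          obtain ⟨h1, h2⟩ := hφ
          obtain ⟨h3, h4⟩ := hψ
          exact ⟨add_mem h1 h3, add_mem h2 h4⟩
      exact (h1 φ hφ).2
  smul_mem ha hφ := smul_mem_piece e Sgr ha hφ
  d := totalMap e Sgr dual 2 fun i φ hφ => dual_mem_piece Sgr he hφ
  d_mem hφ := dual_mem_piece Sgr he hφ
  leibniz b φ := Subtype.ext (dual_smul b φ.1)
  d_pow := by
    refine LinearMap.ext fun φ => Subtype.ext ?_
    have h := pow_intertwine (f := (total (A := A) e Sgr).subtype.restrictScalars k)
      (d := totalMap e Sgr dual 2 fun i φ hφ => dual_mem_piece Sgr he hφ) (d' := dual)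
      (fun φ => rfl) p φ
    refine h.trans (app_ext fun a => ?_)
    rw [dual_pow_app, A.d_pow]
    simp

variable {S' : Type u} [AddCommGroup S'] [Module k S'] {Sgr' : ℤ → Submodule k S'}
  (hS' : DirectSum.IsInternal Sgr')

/-- Functoriality of coinduced modules in the coefficients. -/
def coinducedMap (h : S →ₗ[k] S') (hh : ∀ i, ∀ x ∈ Sgr i, h x ∈ Sgr' i) :
    coinduced he hS ⟶ coinduced he hS' where
  lin :=
    { toFun := totalMap e Sgr (Sgr' := Sgr') (e' := e) (LinearMap.compRight k h) 0
        fun i φ hφ => ⟨fun a => congrArg h (hφ.1 a), fun j a ha => by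
          rw [add_zero]
          exact hh _ _ (hφ.2 j a ha)⟩
      map_add' := map_add _
      map_smul' := fun b φ => rfl }
  map_gr {i φ} hφ := ⟨fun a => congrArg h (hφ.1 a), fun j a ha => hh _ _ (hφ.2 j a ha)⟩
  map_d φ := Subtype.ext (app_ext fun a => by
    change h (-(app φ.1 (A.d a))) = -(h (app φ.1 (A.d a)))
    rw [map_neg])

theorem coinducedMap_app (h : S →ₗ[k] S') (hh : ∀ i, ∀ x ∈ Sgr i, h x ∈ Sgr' i)
    (φ : (coinduced he hS).carrier) (a : A.carrier) :
    app (lin (coinducedMap he hS hS' h hh) φ).1 a = h (app φ.1 a) := rfl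

/-- The map to a coinduced module that corresponds to a linear map on `e M`. -/
noncomputable def toCoinduced {M : PDGModule A} (θ : M.carrier →ₗ[k] S) (hθ : ∀ i, ∀ m ∈ M.gr i, θ m ∈ Sgr i)
    (hθe : ∀ m, θ (e • m) = θ m) (hθd : ∀ m, θ (M.d m) = 0) : M ⟶ coinduced he hS :=
  let L : M.carrier →ₗ[k] Functional A S :=
    { toFun := fun m => of (θ ∘ₗ (LinearMap.toSpanSingleton A.carrier M.carrier m).restrictScalars k)
      map_add' := fun m n => app_ext fun a => by
        change θ (a • (m + n)) = θ (a • m) + θ (a • n)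
        rw [smul_add, map_add]
      map_smul' := fun r m => app_ext fun a => by
        change θ (a • r • m) = r • θ (a • m)
        rw [smul_comm, map_smul] }
  have hL : ∀ i, ∀ m ∈ M.gr i, L m ∈ piece e Sgr i := fun i m hm => ⟨fun a => by
      change θ ((e * a) • m) = θ (a • m)
      rw [mul_smul, hθe], fun j a ha => by
      rw [add_comm]
      exact hθ _ _ (M.smul_mem ha hm)⟩
  { lin :=
      { toFun := fun m => ⟨L m, by
          have h1 : (⨆ i, M.gr i) ≤
              (⨆ i, piece e Sgr i : Submodule k (Functional A S)).comap L :=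
            iSup_le fun i m hm => Submodule.mem_iSup_of_mem i (hL i m hm)
          rw [M.internal.submodule_iSup_eq_top] at h1
          exact h1 Submodule.mem_top⟩
        map_add' := fun m n => Subtype.ext (map_add L m n)
        map_smul' := fun b m => Subtype.ext (app_ext fun a => by
          change θ (a • b • m) = θ ((a * b) • m)
          rw [mul_smul]) }
    map_gr := fun {i m} hm => hL i m hm
    map_d := fun m => Subtype.ext (app_ext fun a => by
      -- Both sides agree because θ vanishes on d (a m), which the Leibniz rule expands.
      change θ (a • M.d m) = -θ (A.d a • m)
      rw [eq_neg_iff_add_eq_zero, add_comm, ← map_add, ← M.leibniz, hθd]) }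

theorem toCoinduced_app {M : PDGModule A} (θ : M.carrier →ₗ[k] S)
    (hθ : ∀ i, ∀ m ∈ M.gr i, θ m ∈ Sgr i)
    (hθe : ∀ m, θ (e • m) = θ m) (hθd : ∀ m, θ (M.d m) = 0) (m : M.carrier) (a : A.carrier) :
    app (lin (toCoinduced he hS θ hθ hθe hθd) m).1 a = θ (a • m) := rfl

end PDGModule

namespace PDGAux

variable {k : Type*} [Field k]

/-- The grading of a line that is concentrated in one degree. -/
def lineGr (k : Type*) [Field k] (l i : ℤ) : Submodule k k := if i = l then ⊤ else ⊥

theorem lineGr_self (l : ℤ) : lineGr k l l = ⊤ := if_pos rfl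

theorem eq_zero_of_mem_lineGr {l i : ℤ} (h : i ≠ l) {x : k} (hx : x ∈ lineGr k l i) : x = 0 := by
  rw [lineGr, if_neg h] at hx
  exact hx

theorem lineGr_internal (l : ℤ) : DirectSum.IsInternal (lineGr k l) := by
  refine internal_of (iSupIndep_def.2 fun i => ?_) (eq_top_iff.2 fun x _ =>
    Submodule.mem_iSup_of_mem l (by rw [lineGr_self]; trivial))
  rw [Submodule.disjoint_def]
  intro x hx hx'
  by_cases h : i = l
  · subst h
    have h1 : (⨆ (j : ℤ) (_ : j ≠ i), lineGr k i j) ≤ ⊥ :=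
      iSup₂_le fun j hj y hy => eq_zero_of_mem_lineGr hj hy
    exact h1 hx'
  · exact eq_zero_of_mem_lineGr h hx

/-- The grading of a vector space with a homogeneous basis. -/
def basisGr (k : Type*) [Field k] {I : Type*} (deg : I → ℤ) (i : ℤ) : Submodule k (I →₀ k) :=
  Finsupp.supported k k {j | deg j = i}

theorem mem_basisGr {I : Type*} {deg : I → ℤ} {i : ℤ} {x : I →₀ k} :
    x ∈ basisGr k deg i ↔ ∀ j, x j ∈ lineGr k (deg j) i := by
  rw [basisGr, Finsupp.mem_supported']
  refine forall_congr' fun j => ?_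
  by_cases h : i = deg j
  · subst h
    simp [lineGr_self]
  · simp [lineGr, h, Ne.symm h]

theorem basisGr_internal {I : Type*} (deg : I → ℤ) : DirectSum.IsInternal (basisGr k deg) := by
  refine internal_of
    (indep_of_maps (fun j : I => Finsupp.lapply j) (fun x hx => Finsupp.ext hx) _
      (fun j => lineGr k (deg j)) (fun j i x hx => mem_basisGr.1 hx j)
      fun j => (lineGr_internal (deg j)).submodule_iSupIndep)
    (top_of_maps (fun j : I => Finsupp.lsingle j) (fun x => ?_) _ (fun j => lineGr k (deg j))
      (fun j i x hx => Submodule.mem_iSup_of_mem i (mem_basisGr.2 fun l => ?_))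
      fun j => (lineGr_internal (deg j)).submodule_iSup_eq_top)
  · rw [Finsupp.iSup_lsingle_range]; trivial
  · by_cases h : j = l
    · subst h
      simpa using hx
    · simp [Finsupp.single_apply, h]

end PDGAux

/-! ### Homotopies of coinduced modules -/

namespace PDGModule

open PDGAux Functional

variable {k : Type u} [Field k] {p : ℕ} {A : PDGAlgebra k p} {e : A.carrier}
  (he : A.IsClosedIdem e) 

section homotopy

variable {S : Type u} [AddCommGroup S] [Module k S] {Sgr : ℤ → Submodule k S}
  {s : Module.End k A.carrier}
  (hs : ∀ (i : ℤ) (a : A.carrier), a ∈ A.gr i → s a ∈ A.gr (i - 2 * ((p : ℤ) - 1)))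

/-- Precomposition with a homotopy of `e A`. -/
def precomp (S : Type u) [AddCommGroup S] [Module k S] (e : A.carrier) (s : Module.End k A.carrier) :
    Functional A S →ₗ[k] Functional A S where
  -- The factor (−1)ᵖ makes the sign in `homotopySum_coinduced` equal to −1 for every p.
  toFun φ := of ((-1 : k) ^ p • (app φ ∘ₗ s ∘ₗ LinearMap.mulLeft k e))
  map_add' φ ψ := app_ext fun a => by
    simp only [app_of, LinearMap.smul_apply, LinearMap.comp_apply, map_add, LinearMap.add_apply,
      smul_add]
  map_smul' r φ := app_ext fun a => by
    simp only [app_of, LinearMap.smul_apply, LinearMap.comp_apply, map_smul, RingHom.id_apply]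
    rw [smul_comm]

theorem precomp_app (φ : Functional A S) (a : A.carrier) :
    app (precomp S e s φ) a = (-1 : k) ^ p • app φ (s (e * a)) := rfl

include he in
theorem mul_mem_gr_of_closedIdem {i : ℤ} {a : A.carrier} (ha : a ∈ A.gr i) : e * a ∈ A.gr i := by
  simpa using A.mul_mem he.mem_zero ha

include he in
theorem mul_pow_d (n : ℕ) (a : A.carrier) : e * (A.d ^ n) a = (A.d ^ n) (e * a) := by
  induction n generalizing a with
  | zero => rfl
  | succ n ih =>
    rw [pow_succ, Module.End.mul_apply, Module.End.mul_apply, ih, A.leibniz, he.closed, zero_mul,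
      zero_add]

include he hs in
theorem precomp_mem (i : ℤ) (φ : Functional A S) (hφ : φ ∈ piece e Sgr i) :
    precomp S e s φ ∈ piece e Sgr (i + -(2 * ((p : ℤ) - 1))) :=
  ⟨fun a => by rw [precomp_app, precomp_app, ← mul_assoc, he.idem], fun j a ha => by
    rw [precomp_app]
    refine Submodule.smul_mem _ _ ?_
    have := hφ.2 _ _ (hs _ _ (mul_mem_gr_of_closedIdem he ha))
    rwa [show i + (j - 2 * ((p : ℤ) - 1)) = i + -(2 * ((p : ℤ) - 1)) + j by ring] at this⟩

variable (hS : DirectSum.IsInternal Sgr)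

/-- The homotopy of a coinduced module given by a homotopy of `e A`. -/
def coinducedHomotopy : Module.End k (coinduced he hS).carrier :=
  totalMap e Sgr (precomp S e s) _ (precomp_mem he hs)

theorem coinducedHomotopy_mem {i : ℤ} {φ : (coinduced he hS).carrier}
    (hφ : φ ∈ (coinduced he hS).gr i) :
    coinducedHomotopy he hs hS φ ∈ (coinduced he hS).gr (i - 2 * ((p : ℤ) - 1)) :=
  precomp_mem he hs i φ.1 hφ

theorem coinduced_pow_app (n : ℕ) (φ : (coinduced he hS).carrier) (a : A.carrier) :
    app (((coinduced he hS).d ^ n) φ).1 a = (-1 : k) ^ n • app φ.1 ((A.d ^ n) a) := by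
  induction n generalizing a with
  | zero => simp
  | succ n ih =>
    rw [pow_succ' (coinduced he hS).d, Module.End.mul_apply]
    refine (dual_app _ a).trans ?_
    rw [ih, pow_succ A.d, Module.End.mul_apply, pow_succ, mul_neg_one, neg_smul]

/-- Dualizing reverses the order of composition and so exchanges i and p − 1 − i. The p − 1 dual
differentials contribute (−1)ᵖ⁻¹, and the factor of `precomp` turns this into −1. -/
theorem homotopySum_coinduced (φ : (coinduced he hS).carrier) (a : A.carrier) :
    app (homotopySum p (coinduced he hS).d (coinducedHomotopy he hs hS) φ).1 a =
      -app φ.1 (homotopySum p A.d s (e * a)) := by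
  rcases Nat.eq_zero_or_pos p with h0 | h0
  · subst h0
    simp [homotopySum]
  rw [homotopySum_apply, homotopySum_apply, map_sum, ← Finset.sum_neg_distrib,
    ← Finset.sum_range_reflect]
  have h1 : ∀ (f : ℕ → (coinduced he hS).carrier), app (∑ i ∈ Finset.range p, f i).1 a =
      ∑ i ∈ Finset.range p, app (f i).1 a := fun f =>
    map_sum ((LinearMap.applyₗ a) ∘ₗ app ∘ₗ (total (A := A) e Sgr).subtype.restrictScalars k) f _
  refine (h1 _).trans (Finset.sum_congr rfl fun i hi => ?_)
  have hi := Finset.mem_range.1 hi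
  rw [coinduced_pow_app]
  have h2 : ∀ ψ : (coinduced he hS).carrier, ∀ b, app (coinducedHomotopy he hs hS ψ).1 b =
    (-1 : k) ^ p • app ψ.1 (s (e * b)) := fun _ _ => rfl
  rw [h2, coinduced_pow_app, mul_pow_d he, smul_smul, smul_smul, ← pow_add, ← pow_add,
    show p - 1 - (p - 1 - i) = i by omega, show p - 1 - i + p + i = 2 * (p - 1) + 1 by omega,
    pow_succ, pow_mul]
  simp

end homotopy

/-! ### Direct sums of coinduced modules -/

section sum

variable {I : Type u} (deg : I → ℤ)

/-- The summands of `sumCoinduced`. -/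
abbrev lineCoinduced (j : I) : PDGModule A := coinduced he (lineGr_internal (k := k) (deg j))

/-- The module coinduced from a graded vector space with a homogeneous basis. -/
noncomputable abbrev basisCoinduced : PDGModule A := coinduced he (basisGr_internal (k := k) deg)

theorem lsingle_mem (j : I) (i : ℤ) (x : k) (hx : x ∈ lineGr k (deg j) i) :
    Finsupp.lsingle (R := k) j x ∈ basisGr k deg i := mem_basisGr.2 fun l => by
  classical
  by_cases h : j = l
  · subst h
    simpa using hx
  · simp [Finsupp.single_apply, h]

open Classical in
/-- The linear map underlying `sumCoinduced`. -/
noncomputable def sumCoinducedLin :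
    (Π₀ j, (lineCoinduced he deg j).carrier) →ₗ[A.carrier] (basisCoinduced he deg).carrier :=
  DFinsupp.lsum ℕ fun j => lin (coinducedMap he (lineGr_internal (k := k) (deg j))
    (basisGr_internal (k := k) deg) (Finsupp.lsingle j) (lsingle_mem deg j))

theorem sumCoinducedLin_app (x : Π₀ j, (lineCoinduced he deg j).carrier) (a : A.carrier) (j : I) :
    app (sumCoinducedLin he deg x).1 a j = app (x j).1 a := by
  classical
  let L1 : (Π₀ j, (lineCoinduced he deg j).carrier) →ₗ[k] k :=
    Finsupp.lapply j ∘ₗ LinearMap.applyₗ a ∘ₗ app ∘ₗ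
      (total (A := A) e (basisGr k deg)).subtype.restrictScalars k ∘ₗ
        (sumCoinducedLin he deg).restrictScalars k
  let L2 : (Π₀ j, (lineCoinduced he deg j).carrier) →ₗ[k] k :=
    LinearMap.applyₗ a ∘ₗ app ∘ₗ (total (A := A) e (lineGr k (deg j))).subtype.restrictScalars k ∘ₗ
        DFinsupp.lapply j
  have h : L1 = L2 := by
    refine DFinsupp.lhom_ext fun l φ => ?_
    have h1 : sumCoinducedLin he deg (DFinsupp.single l φ) =
        lin (coinducedMap he (lineGr_internal (k := k) (deg l))
          (basisGr_internal (k := k) deg) (Finsupp.lsingle l) (lsingle_mem deg l)) φ :=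
      DFinsupp.lsum_single ..
    change app (sumCoinducedLin he deg (DFinsupp.single l φ)).1 a j =
      app ((DFinsupp.single l φ : Π₀ j, (lineCoinduced he deg j).carrier) j).1 a
    rw [h1, coinducedMap_app]
    by_cases h : l = j
    · subst h
      simp
    · rw [DFinsupp.single_eq_of_ne (Ne.symm h)]
      simp [Finsupp.single_apply, h]
  exact congrArg (fun f => f x) h

/-- The inclusion of the direct sum of coinduced modules in the module coinduced from the direct
sum. -/
noncomputable def sumCoinduced : directSum (lineCoinduced he deg) ⟶ basisCoinduced he deg where
  lin := sumCoinducedLin he deg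
  map_gr {i x} hx := ⟨fun a => Finsupp.ext fun j =>
      (sumCoinducedLin_app he deg x _ j).trans
        (((hx j).1 a).trans (sumCoinducedLin_app he deg x a j).symm),
    fun l a ha => mem_basisGr.2 fun j => by
      exact (congrArg (fun y => y ∈ lineGr k (deg j) (i + l))
        (sumCoinducedLin_app he deg x a j)).mpr ((hx j).2 l a ha)⟩
  map_d x := Subtype.ext (app_ext fun a => Finsupp.ext fun j => by
    refine (sumCoinducedLin_app he deg _ a j).trans ?_
    change -app (x j).1 (A.d a) = (-(app (sumCoinducedLin he deg x).1 (A.d a))) j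
    rw [Finsupp.neg_apply, sumCoinducedLin_app])

variable {s : Module.End k A.carrier}
  (hs : ∀ (i : ℤ) (a : A.carrier), a ∈ A.gr i → s a ∈ A.gr (i - 2 * ((p : ℤ) - 1)))
  (F : Submodule k A.carrier) [FiniteDimensional k F]
  (hF : ∀ a, e * a = a → a - homotopySum p A.d s a ∈ F)

/-- The endomorphism of `e A` of finite rank that is homotopic to the identity. -/
def finiteRank (e : A.carrier) (s : Module.End k A.carrier) : Module.End k A.carrier :=
  (LinearMap.id - homotopySum p A.d s) ∘ₗ LinearMap.mulLeft k e

theorem finiteRank_apply (a : A.carrier) :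
    finiteRank e s a = e * a - homotopySum p A.d s (e * a) := rfl

include he in
theorem finiteRank_mul (a : A.carrier) : finiteRank e s (e * a) = finiteRank e s a := by
  rw [finiteRank_apply, finiteRank_apply, ← mul_assoc, he.idem]

include he in
theorem finiteRank_d (a : A.carrier) : finiteRank e s (A.d a) = A.d (finiteRank e s a) := by
  have h : e * A.d a = A.d (e * a) := by rw [A.leibniz, he.closed, zero_mul, zero_add]
  rw [finiteRank_apply, finiteRank_apply, h, homotopySum_comm A.d_pow, map_sub]

include he hs in
theorem finiteRank_mem {i : ℤ} {a : A.carrier} (ha : a ∈ A.gr i) : finiteRank e s a ∈ A.gr i :=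
  sub_mem (mul_mem_gr_of_closedIdem he ha)
    (homotopySum_mem p (fun _ _ h => A.d_mem h) hs (mul_mem_gr_of_closedIdem he ha))

theorem app_finiteRank_sub {S : Type u} [AddCommGroup S] [Module k S] (f : A.carrier →ₗ[k] S)
    (hf : ∀ a, f (e * a) = f a) (a : A.carrier) :
    f (finiteRank e s a) - f a = -f (homotopySum p A.d s (e * a)) := by
  rw [finiteRank_apply, map_sub, hf]
  abel

theorem app_mul_of_total {S : Type u} [AddCommGroup S] [Module k S] {Sgr : ℤ → Submodule k S}
    {φ : Functional A S} (hφ : φ ∈ total e Sgr) (a : A.carrier) : app φ (e * a) = app φ a := by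
  rw [mem_total] at hφ
  induction hφ using Submodule.iSup_induction' with
  | mem i φ hφ => exact hφ.1 a
  | zero => rfl
  | add φ ψ _ _ hφ hψ => rw [map_add, LinearMap.add_apply, LinearMap.add_apply, hφ, hψ]

/-- The components of the inverse of `sumCoinduced`. -/
noncomputable def component (j : I) :
    (basisCoinduced (A := A) he deg).carrier →ₗ[k] (lineCoinduced he deg j).carrier :=
  totalMap e (basisGr k deg) (e' := e)
    ({ toFun := fun φ => of (Finsupp.lapply j ∘ₗ app φ ∘ₗ finiteRank e s)
       map_add' := fun _ _ => rfl
       map_smul' := fun _ _ => rfl } : Functional A (I →₀ k) →ₗ[k] Functional A k) 0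
    fun i φ hφ => ⟨fun a => by
        change app φ (finiteRank e s (e * a)) j = app φ (finiteRank e s a) j
        rw [finiteRank_mul he], fun l a ha => by
        rw [add_zero]
        exact mem_basisGr.1 (hφ.2 l _ (finiteRank_mem he hs ha)) j⟩

theorem component_mem {j : I} {i : ℤ} {φ : (basisCoinduced (A := A) he deg).carrier}
    (hφ : φ ∈ (basisCoinduced he deg).gr i) :
    component he deg hs j φ ∈ (lineCoinduced he deg j).gr i :=
  ⟨fun a => by
    change app φ.1 (finiteRank e s (e * a)) j = app φ.1 (finiteRank e s a) j
    rw [finiteRank_mul he], fun l a ha => mem_basisGr.1 (hφ.2 l _ (finiteRank_mem he hs ha)) j⟩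

theorem component_app (j : I) (φ : (basisCoinduced (A := A) he deg).carrier) (a : A.carrier) :
    app (component he deg hs j φ).1 a = app φ.1 (finiteRank e s a) j := rfl

-- A functional with values in finitely supported families need not have all its values supported in
-- a common finite set, but its restriction to the finite-dimensional F does, and `finiteRank` takes
-- its values in F. This makes the components an element of the direct sum.
include hF in
theorem finite_support_component (φ : (basisCoinduced (A := A) he deg).carrier) :
    {j | component he deg hs j φ ≠ 0}.Finite := by
  classical
  obtain ⟨b, hb⟩ := Submodule.fg_iff_finiteDimensional F |>.2 inferInstance
  refine (Set.Finite.biUnion b.finite_toSet fun f _ => (app φ.1 f).hasFiniteSupport).subset ?_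
  intro j hj
  by_contra hj'
  refine hj (Subtype.ext (app_ext fun a => ?_))
  rw [component_app]
  have h1 : F ≤ LinearMap.ker (Finsupp.lapply j ∘ₗ app φ.1 : A.carrier →ₗ[k] k) := by
    rw [← hb, Submodule.span_le]
    intro f hf
    by_contra hf'
    exact hj' (Set.mem_biUnion hf (by simpa using hf'))
  exact h1 (hF (e * a) (by rw [← mul_assoc, he.idem]))

open Classical in
theorem mk_component (φ : (basisCoinduced (A := A) he deg).carrier) (j : I) :
    (DFinsupp.mk (finite_support_component he deg hs F hF φ).toFinset
      fun j => component he deg hs j φ : Π₀ j, (lineCoinduced he deg j).carrier) j =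
        component he deg hs j φ := by
  rw [DFinsupp.mk_apply]
  split_ifs with h
  · rfl
  · by_contra h'
    exact h (by simpa using Ne.symm h')

open Classical in
/-- The inverse of `sumCoinduced` up to homotopy. -/
noncomputable def sumCoinducedInv :
    (basisCoinduced (A := A) he deg).carrier →ₗ[k] Π₀ j, (lineCoinduced he deg j).carrier where
  toFun φ := DFinsupp.mk (finite_support_component he deg hs F hF φ).toFinset
    fun j => component he deg hs j φ
  map_add' φ ψ := by
    refine DFinsupp.ext fun j => (mk_component he deg hs F hF _ j).trans ?_
    exact (map_add _ φ ψ).trans (congrArg₂ (· + ·) (mk_component he deg hs F hF φ j).symm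
      (mk_component he deg hs F hF ψ j).symm)
  map_smul' r φ := by
    refine DFinsupp.ext fun j => (mk_component he deg hs F hF _ j).trans ?_
    exact (map_smul _ r φ).trans (congrArg (r • ·) (mk_component he deg hs F hF φ j).symm)

theorem sumCoinducedInv_apply (φ : (basisCoinduced (A := A) he deg).carrier) (j : I) :
    sumCoinducedInv he deg hs F hF φ j = component he deg hs j φ :=
  mk_component he deg hs F hF φ j

include hs in
/-- Coinduction from a finite-dimensional algebra up to homotopy commutes with direct sums. -/
theorem isQuasiIso_sumCoinduced (hF : ∀ a, e * a = a → a - homotopySum p A.d s a ∈ F) :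
    IsQuasiIso (sumCoinduced he deg) := by
  -- Both composites are precomposition with `finiteRank`, which is homotopic to the identity on e
  -- A; the homotopies are the dual ones.
  refine ⟨sumCoinducedInv he deg hs F hF, fun i φ hφ j => ?_, fun φ => DFinsupp.ext fun j => ?_,
    ⟨DFinsupp.mapRange.linearMap fun j => coinducedHomotopy he hs (lineGr_internal (deg j)),
      fun i x hx j => ?_, LinearMap.ext fun x => DFinsupp.ext fun j => ?_⟩,
    ⟨coinducedHomotopy he hs (basisGr_internal deg), fun i φ hφ => coinducedHomotopy_mem he hs _ hφ,
      LinearMap.ext fun φ => Subtype.ext (app_ext fun a => ?_)⟩⟩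
  · rw [sumCoinducedInv_apply]
    exact component_mem he deg hs hφ
  · refine (sumCoinducedInv_apply he deg hs F hF _ j).trans ?_
    refine Eq.trans (Subtype.ext (app_ext fun a => ?_))
      (congrArg (lineCoinduced he deg j).d (sumCoinducedInv_apply he deg hs F hF φ j).symm)
    change (-app φ.1 (A.d (finiteRank e s a))) j = -(app φ.1 (finiteRank e s (A.d a))) j
    rw [finiteRank_d he, Finsupp.neg_apply]
  · exact coinducedHomotopy_mem he hs _ (hx j)
  · have h1 := homotopySum_intertwine (d := (directSum (lineCoinduced he deg)).d)
      (d' := (lineCoinduced he deg j).d) (f := DFinsupp.lapply j)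
      (s := DFinsupp.mapRange.linearMap fun j => coinducedHomotopy he hs (lineGr_internal (deg j)))
      (s' := coinducedHomotopy he hs (lineGr_internal (deg j)))
      (fun x => rfl) (fun x => rfl) p x
    refine Eq.trans ?_ h1.symm
    refine Subtype.ext (app_ext fun a => ?_)
    rw [homotopySum_coinduced]
    refine Eq.trans ?_ (app_finiteRank_sub (e := e) (s := s) (app (x j).1)
      (app_mul_of_total (x j).2) a)
    refine congrArg (· - app (x j).1 a) ?_
    refine (congrArg (fun φ : (lineCoinduced he deg j).carrier => app φ.1 a)
      (sumCoinducedInv_apply he deg hs F hF _ j)).trans ?_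
    exact (component_app he deg hs j _ a).trans (sumCoinducedLin_app he deg x _ j)
  · refine Eq.trans ?_ (homotopySum_coinduced he hs (basisGr_internal deg) φ a).symm
    refine Eq.trans ?_ (app_finiteRank_sub (e := e) (s := s) (app φ.1)
      (app_mul_of_total φ.2) a)
    refine congrArg (· - app φ.1 a) (Finsupp.ext fun j => ?_)
    refine (sumCoinducedLin_app he deg _ a j).trans ?_
    refine (congrArg (fun φ : (lineCoinduced he deg j).carrier => app φ.1 a)
      (sumCoinducedInv_apply he deg hs F hF _ j)).trans ?_
    exact component_app he deg hs j _ a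

end sum

end PDGModule

/-! ### Finiteness of the homology of compact modules -/

namespace DerivedPDG

open PDGModule PDGAux Functional

variable {k : Type u} [Field k] {p : ℕ} {A : PDGAlgebra k p} {e : A.carrier}
  (he : A.IsClosedIdem e)

/-- A factorization in the derived category lifts cycles up to boundaries. -/
theorem exists_cycle_of_factor {n : ℕ} (hn : n ≤ p) {M N P : PDGModule A} (f : M ⟶ P) (u : N ⟶ P)
    (g : (Q A).obj M ⟶ (Q A).obj N) (h : (Q A).map f = g ≫ (Q A).map u) {i : ℤ}
    (m : M.carrier) (hm : m ∈ (part he M).cycles n i) :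
    ∃ y ∈ (part he N).cycles n i, lin f m - lin u y ∈ (part he P).boundaries (p - n) i := by
  have h1 := congrArg (homologyLift he hn i).map h
  rw [Functor.map_comp, homologyLift_map, homologyLift_map] at h1
  have h2 := congrArg (fun t => t.hom (PComplex.cls ⟨m, hm⟩)) h1
  obtain ⟨y, hy⟩ := Submodule.Quotient.mk_surjective _
    (((homologyLift he hn i).map g).hom (PComplex.cls ⟨m, hm⟩) : (part he N).homology n i)
  refine ⟨y.1, y.2, PComplex.cls_eq (x := ⟨_, (partMap he f).map_cycles m hm⟩)
    (y := ⟨_, (partMap he u).map_cycles y.1 y.2⟩) |>.1 ?_⟩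
  exact Eq.trans h2 (congrArg ((partMap he u).map n i) hy.symm)

variable {s : Module.End k A.carrier}
  (hs : ∀ (i : ℤ) (a : A.carrier), a ∈ A.gr i → s a ∈ A.gr (i - 2 * ((p : ℤ) - 1)))
  (F : Submodule k A.carrier) [FiniteDimensional k F]
  (hF : ∀ a, e * a = a → a - homotopySum p A.d s a ∈ F)

/-- The homogeneous elements of a basis of the homology of `e M`. -/
abbrev HomologyIndex (M : PDGModule A) (n : ℕ) : Type u :=
  Σ i : ℤ, Module.Basis.ofVectorSpaceIndex k ((part he M).homology n i)

/-- The coordinates of homology classes are extended from cycles to all elements by linear algebra,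
degree by degree, after multiplication by e. Boundaries have zero class, so the extension kills the
image of d, which is the condition of `toCoinduced`. -/
theorem exists_coordinates (M : PDGModule A) (hp : 1 ≤ p) :
    ∃ θ : M.carrier →ₗ[k] (HomologyIndex he M (p - 1) →₀ k),
      (∀ i, ∀ m ∈ M.gr i, θ m ∈ basisGr k Sigma.fst i) ∧ (∀ m, θ (e • m) = θ m) ∧
      (∀ m, θ (M.d m) = 0) ∧ ∀ (j : HomologyIndex he M (p - 1)),
        ∃ m ∈ (part he M).cycles (p - 1) j.1, θ m j ≠ 0 := by
  classical
  have ext (i : ℤ) := LinearMap.exists_extend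
    ((Module.Basis.ofVectorSpace k ((part he M).homology (p - 1) i)).repr.toLinearMap ∘ₗ
      Submodule.mkQ _)
  choose g hg using ext
  have hg' : ∀ (i : ℤ) (m : M.carrier) (hm : m ∈ (part he M).cycles (p - 1) i), g i m =
      (Module.Basis.ofVectorSpace k ((part he M).homology (p - 1) i)).repr
        (PComplex.cls ⟨m, hm⟩) := fun i m hm => congrArg (fun f => f ⟨m, hm⟩) (hg i)
  let θ := gradedLift M.internal fun i =>
    (Finsupp.lmapDomain k k (Sigma.mk (β := fun i => Module.Basis.ofVectorSpaceIndex k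
      ((part he M).homology (p - 1) i)) i) ∘ₗ g i ∘ₗ Algebra.lsmul k k M.carrier e) ∘ₗ
        (M.gr i).subtype
  have hθ : ∀ i, ∀ m ∈ M.gr i, θ m = Finsupp.mapDomain (Sigma.mk i) (g i (e • m)) :=
    fun i m hm => gradedLift_of_mem _ _ hm
  have htop := M.internal.submodule_iSup_eq_top
  refine ⟨θ, fun i m hm => mem_basisGr.2 fun j => ?_, fun m => ?_, fun m => ?_, fun j => ?_⟩
  · by_cases h : j.1 = i
    · rw [h, lineGr_self]; trivial
    · rw [hθ i m hm, Finsupp.mapDomain_of_notMem_range]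
      · exact zero_mem _
      · rintro ⟨x, rfl⟩
        exact h rfl
  · refine ext_of_top htop (f := θ ∘ₗ Algebra.lsmul k k M.carrier e) (g := θ) (fun i m hm => ?_) m
    have h1 : e • m ∈ M.gr i := (smul_mem_gr he hm).1
    refine (hθ i _ h1).trans (Eq.trans ?_ (hθ i m hm).symm)
    rw [smul_smul, he.idem]
  · refine ext_of_top htop (f := θ ∘ₗ M.d) (g := 0) (fun i m hm => ?_) m
    refine (hθ _ _ (M.d_mem hm)).trans ?_
    have h2 : e • m ∈ (part he M).gr i := smul_mem_gr he hm
    have h3 : e • M.d m ∈ (part he M).boundaries (p - (p - 1)) (i + 2) := by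
      refine ⟨e • m, ?_, ?_⟩
      · rw [show p - (p - 1) = 1 by omega]
        simpa using h2
      · rw [show p - (p - 1) = 1 by omega, pow_one]
        exact (smul_d_of_closed he.closed m).symm
    have h4 : e • M.d m ∈ (part he M).cycles (p - 1) (i + 2) :=
      ⟨smul_mem_gr he (M.d_mem hm), by
        obtain ⟨y, -, hy⟩ := h3
        change ((part he M).d ^ (p - 1)) (e • M.d m) = 0
        rw [← hy]
        exact PComplex.pow_pow (by omega) y⟩
    rw [hg' _ _ h4, PComplex.cls_eq_zero.2 h3, map_zero]
    simp
  · obtain ⟨i, x⟩ := j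
    obtain ⟨m, hm⟩ := Submodule.Quotient.mk_surjective _
      (Module.Basis.ofVectorSpace k ((part he M).homology (p - 1) i) x)
    refine ⟨m.1, m.2, ?_⟩
    have h1 := mem_fixed.1 m.2.1.2
    rw [hθ i _ m.2.1.1, h1, hg' i _ m.2, Finsupp.mapDomain_apply sigma_mk_injective]
    have h2 : PComplex.cls (⟨m.1, m.2⟩ : (part he M).cycles (p - 1) i) =
      Module.Basis.ofVectorSpace k ((part he M).homology (p - 1) i) x := hm
    rw [h2, Module.Basis.repr_self, Finsupp.single_eq_same]
    exact one_ne_zero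

include hs hF in
/-- The homology of `e M` is finite-dimensional for compact `M`, if `e A` is finite-dimensional up
to homotopy. -/
theorem isFinite_of_isCompact (hp : 1 ≤ p) {M : PDGModule A} (hM : IsCompact ((Q A).obj M)) :
    (part he M).IsFinite (p - 1) := by
  classical
  obtain ⟨θ, hθ, hθe, hθd, hθj⟩ := exists_coordinates he M hp
  -- Compactness is applied to the coordinate map into the module coinduced from all of the
  -- homology, which is a direct sum in the derived category.
  let X := toCoinduced he (basisGr_internal (k := k) Sigma.fst) θ hθ hθe hθd
  have hiso : IsIso ((Q A).map (sumCoinduced he (I := HomologyIndex he M (p - 1)) Sigma.fst)) :=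
    (quasiIso A).Q_inverts _ (isQuasiIso_sumCoinduced he _ hs F hF)
  obtain ⟨J, g, hg⟩ := hM _ _ ((Q A).map X ≫ inv ((Q A).map (sumCoinduced he Sigma.fst)))
  rw [IsIso.comp_inv_eq, Category.assoc, ← Functor.map_comp] at hg
  -- Evaluation at e reads off the coordinates of a cycle. For j outside J, the j-th coordinate of
  -- every cycle would be that of a boundary d ψ, and (d ψ)(e) = −ψ(∂ e) = 0; but some cycle has a
  -- nonzero j-th coordinate.
  have hJ : ∀ j, j ∈ J := by
    intro j
    by_contra hj
    obtain ⟨m, hm, hmj⟩ := hθj j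
    obtain ⟨y, -, ψ, -, hψ⟩ := exists_cycle_of_factor he (Nat.sub_le p 1) X _ g hg m hm
    have h1 := congrArg (fun φ : (basisCoinduced he Sigma.fst).carrier => app φ.1 e j) hψ
    have h5 : ∀ r, r = 1 → app (((basisCoinduced he (Sigma.fst : HomologyIndex he M (p - 1) → ℤ)).d ^
        r) ψ).1 e j = (-app ψ.1 (A.d e)) j := by
      rintro r rfl
      rfl
    have h2 : (-app ψ.1 (A.d e)) j = app (lin X m).1 e j - app (lin (sumCoinduced he Sigma.fst)
      (extend A.carrier (fun j => (lineCoinduced he Sigma.fst j).carrier) J y)).1 e j := (h5 _ (by omega)).symm.trans h1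
    have h3 : app (lin (sumCoinduced he Sigma.fst)
      (extend A.carrier (fun j => (lineCoinduced he Sigma.fst j).carrier) J y)).1 e j = 0 := by
      refine (sumCoinducedLin_app he _ _ e j).trans ?_
      rw [extend_apply, dif_neg hj]
      rfl
    have h4 : app (lin X m).1 e = θ (e • m) := toCoinduced_app ..
    rw [h3, h4, hθe, he.closed, map_zero, neg_zero, sub_zero] at h2
    exact hmj h2.symm
  have hfin : Finite (HomologyIndex he M (p - 1)) :=
    Set.finite_univ_iff.1 (J.finite_toSet.subset fun j _ => hJ j)
  refine ⟨fun i => ?_, ?_⟩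
  · have : Finite (Module.Basis.ofVectorSpaceIndex k ((part he M).homology (p - 1) i)) :=
      Finite.of_injective (Sigma.mk i : _ → HomologyIndex he M (p - 1)) sigma_mk_injective
    exact Module.Basis.finiteDimensional_of_finite (Module.Basis.ofVectorSpace k _)
  · refine (Set.finite_range (Sigma.fst : HomologyIndex he M (p - 1) → ℤ)).subset fun i hi => ?_
    by_contra hi'
    have : IsEmpty (Module.Basis.ofVectorSpaceIndex k ((part he M).homology (p - 1) i)) :=
      ⟨fun x => hi' ⟨⟨i, x⟩, rfl⟩⟩
    refine hi ?_
    exact (Module.finrank_eq_nat_card_basis (Module.Basis.ofVectorSpace k _)).trans Nat.card_of_isEmpty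

end DerivedPDG

/-! ### From ker dᵖ⁻¹ / im d to ker d / im dᵖ⁻¹ -/

namespace PComplex

open Module

variable {k : Type u} [Field k] {p : ℕ} (X : PComplex k p)

/-- The cocycles of degree `i` that are in the image of `dʲ`. -/
def iterated (j : ℕ) (i : ℤ) : Submodule k X.carrier :=
  (X.cycles (j + 1) (i - 2 * j)).map (X.d ^ j)

variable {X}

theorem mem_iterated {j : ℕ} {i : ℤ} {x : X.carrier} : x ∈ X.iterated j i ↔
    ∃ y ∈ X.gr (i - 2 * j), (X.d ^ (j + 1)) y = 0 ∧ (X.d ^ j) y = x :=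
  ⟨fun ⟨y, hy, h⟩ => ⟨y, hy.1, hy.2, h⟩, fun ⟨y, hy, hy', h⟩ => ⟨y, ⟨hy, hy'⟩, h⟩⟩

/-- The spaces `iterated` j filter ker d, from all of it for j = 0 down into im dʲ. By this lemma
the quotient of step j by step j + 1 only depends on cycles of dʲ⁺¹ modulo im d. -/
theorem iterated_succ_of_mem_boundaries {j : ℕ} {i : ℤ} {y : X.carrier}
    (hy : y ∈ X.boundaries 1 (i - 2 * j)) (h : (X.d ^ (j + 1)) y = 0) :
    (X.d ^ j) y ∈ X.iterated (j + 1) i := by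
  obtain ⟨z, hz, rfl⟩ := hy
  refine mem_iterated.2 ⟨z, ?_, ?_, ?_⟩
  · have h1 : z ∈ X.gr (i - 2 * (j : ℤ) - 2 * (1 : ℕ)) := hz
    rwa [show i - 2 * (j : ℤ) - 2 * (1 : ℕ) = i - 2 * ((j + 1 : ℕ) : ℤ) by push_cast; ring] at h1
  · rw [← h, ← Module.End.mul_apply, ← pow_add]
  · rw [← Module.End.mul_apply, ← pow_add]

theorem iterated_succ_le (j : ℕ) (i : ℤ) : X.iterated (j + 1) i ≤ X.iterated j i := by
  intro x hx
  obtain ⟨y, hy, hy', rfl⟩ := mem_iterated.1 hx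
  refine mem_iterated.2 ⟨X.d y, ?_, ?_, ?_⟩
  · have := X.d_mem hy
    rwa [show i - 2 * ((j + 1 : ℕ) : ℤ) + 2 = i - 2 * (j : ℤ) by push_cast; ring] at this
  · rw [← hy', pow_succ X.d (j + 1)]; rfl
  · rw [pow_succ]; rfl

theorem iterated_le_boundaries (j : ℕ) (i : ℤ) : X.iterated j i ≤ X.boundaries j i := by
  rintro x ⟨y, hy, rfl⟩
  exact ⟨y, hy.1, rfl⟩

theorem cycles_one_le (i : ℤ) : X.cycles 1 i ≤ X.iterated 0 i := by
  intro x hx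
  exact mem_iterated.2 ⟨x, by simpa using hx.1, hx.2, rfl⟩

theorem cycles_mono {m n : ℕ} (h : m ≤ n) (i : ℤ) : X.cycles m i ≤ X.cycles n i := by
  intro x hx
  refine ⟨hx.1, ?_⟩
  change (X.d ^ n) x = 0
  rw [show n = n - m + m by omega, pow_add, Module.End.mul_apply, (mem_cycles.1 hx).2, map_zero]

/-- The relative dimension of the steps of the filtration of the cocycles is finite. -/
theorem fg_iterated (hX : ∀ i, FiniteDimensional k (X.homology (p - 1) i)) (i : ℤ) {j : ℕ}
    (hj : j + 1 < p) : ((X.iterated j i).map (X.iterated (j + 1) i).mkQ).FG := by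
  have hX := hX (i - 2 * j)
  have e1 : p - (p - 1) = 1 := by omega
  have h0 : ((X.cycles (p - 1) (i - 2 * j)).map (X.boundaries (p - (p - 1)) (i - 2 * j)).mkQ).FG := by
    have hk : (X.boundaries (p - (p - 1)) (i - 2 * j)).submoduleOf (X.cycles (p - 1) (i - 2 * j)) ≤
        LinearMap.ker ((X.boundaries (p - (p - 1)) (i - 2 * j)).mkQ ∘ₗ
          (X.cycles (p - 1) (i - 2 * j)).subtype) := fun x hx =>
      (Submodule.Quotient.mk_eq_zero _).2 hx
    have h1 : (X.cycles (p - 1) (i - 2 * j)).map (X.boundaries (p - (p - 1)) (i - 2 * j)).mkQ =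
        LinearMap.range (Submodule.liftQ _ _ hk) := by
      rw [Submodule.range_liftQ, LinearMap.range_comp, Submodule.range_subtype]
    rw [h1, Submodule.fg_iff_finiteDimensional]
    infer_instance
  rw [e1] at h0
  -- Cycles of dʲ⁺¹ are cycles of dᵖ⁻¹, so modulo im d they lie in a finite-dimensional space.
  have h2 : ((X.cycles (j + 1) (i - 2 * j)).map (X.boundaries 1 (i - 2 * j)).mkQ).FG := by
    rw [Submodule.fg_iff_finiteDimensional] at h0 ⊢
    exact Submodule.finiteDimensional_of_le (Submodule.map_mono (cycles_mono (show j + 1 ≤ p - 1 by omega) _))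
  obtain ⟨b, hb⟩ := h2
  classical
  have h3 : ∀ c : X.carrier ⧸ X.boundaries 1 (i - 2 * j), ∃ y : X.carrier,
      c ∈ b → y ∈ X.cycles (j + 1) (i - 2 * j) ∧ (X.boundaries 1 (i - 2 * j)).mkQ y = c := by
    intro c
    by_cases hc : c ∈ b
    · have : c ∈ Submodule.span k (b : Set (X.carrier ⧸ X.boundaries 1 (i - 2 * j))) :=
        Submodule.subset_span hc
      rw [hb] at this
      obtain ⟨y, hy, h⟩ := this
      exact ⟨y, fun _ => ⟨hy, h⟩⟩
    · exact ⟨0, fun h => absurd h hc⟩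
  choose f hf using h3
  refine ⟨b.image fun c => (X.iterated (j + 1) i).mkQ ((X.d ^ j) (f c)), le_antisymm ?_ ?_⟩
  · rw [Submodule.span_le]
    intro x hx
    obtain ⟨c, hc, rfl⟩ := Finset.mem_image.1 hx
    exact ⟨_, ⟨_, (hf c hc).1, rfl⟩, rfl⟩
  · rintro _ ⟨_, ⟨y, hy, rfl⟩, rfl⟩
    let N := (Submodule.span k ((b.image fun c => (X.iterated (j + 1) i).mkQ ((X.d ^ j) (f c)) :
      Finset _) : Set (X.carrier ⧸ X.iterated (j + 1) i)))
    have h4 : (X.boundaries 1 (i - 2 * j)).mkQ y ∈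
        Submodule.span k (b : Set (X.carrier ⧸ X.boundaries 1 (i - 2 * j))) := by
      rw [hb]; exact ⟨y, hy, rfl⟩
    have h5 : (b : Set (X.carrier ⧸ X.boundaries 1 (i - 2 * j))) ⊆
        (X.boundaries 1 (i - 2 * j)).mkQ '' (b.image f) := by
      intro c hc
      exact ⟨f c, Finset.mem_coe.2 (Finset.mem_image_of_mem f hc), (hf c hc).2⟩
    -- Modulo im d, the cycle y is a combination v of the finitely many chosen representatives; then
    -- dʲ y and dʲ v agree modulo the next step.
    obtain ⟨v, hv, hvy⟩ : (X.boundaries 1 (i - 2 * j)).mkQ y ∈ (Submodule.span k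
        ((b.image f : Finset _) : Set X.carrier)).map (X.boundaries 1 (i - 2 * j)).mkQ := by
      rw [Submodule.map_span]
      exact Submodule.span_mono h5 h4
    have h6 : v ∈ X.cycles (j + 1) (i - 2 * j) := by
      refine Submodule.span_le.2 ?_ hv
      intro x hx
      obtain ⟨c, hc, rfl⟩ := Finset.mem_image.1 hx
      exact (hf c hc).1
    have h7 : y - v ∈ X.boundaries 1 (i - 2 * j) := by
      rw [← Submodule.Quotient.eq]
      exact hvy.symm
    have h8 := iterated_succ_of_mem_boundaries h7 (sub_mem hy h6).2
    have h9 : (X.iterated (j + 1) i).mkQ ((X.d ^ j) y) =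
        (X.iterated (j + 1) i).mkQ ((X.d ^ j) v) := by
      rw [map_sub] at h8
      exact (Submodule.Quotient.eq _).2 h8
    rw [h9]
    have h10 : Submodule.span k ((b.image f : Finset _) : Set X.carrier) ≤
        N.comap ((X.iterated (j + 1) i).mkQ ∘ₗ (X.d ^ j)) := by
      rw [Submodule.span_le]
      intro x hx
      obtain ⟨c, hc, rfl⟩ := Finset.mem_image.1 hx
      exact Submodule.subset_span (Finset.mem_coe.2 (Finset.mem_image.2 ⟨c, hc, rfl⟩))
    exact h10 hv

theorem iterated_le_of_subsingleton {i : ℤ} {j : ℕ} (hj : j + 1 < p)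
    (h : Subsingleton (X.homology (p - 1) (i - 2 * j))) :
    X.iterated j i ≤ X.iterated (j + 1) i := by
  rintro x ⟨y, hy, rfl⟩
  have h1 : PComplex.cls ⟨y, cycles_mono (show j + 1 ≤ p - 1 by omega) _ hy⟩ = 0 :=
    Subsingleton.elim _ _
  rw [cls_eq_zero, show p - (p - 1) = 1 by omega] at h1
  exact iterated_succ_of_mem_boundaries h1 hy.2

/-- The successive quotients of the filtration are finite-dimensional. For j = p − 1 the last step
lies in im dᵖ⁻¹, which bounds the homology ker d / im dᵖ⁻¹. -/
theorem fg_cycles (hX : ∀ i, FiniteDimensional k (X.homology (p - 1) i)) (i : ℤ) {j : ℕ}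
    (hj : j < p) : ((X.iterated 0 i).map (X.iterated j i).mkQ).FG := by
  induction j with
  | zero =>
    convert Submodule.fg_bot
    exact Submodule.mkQ_map_self _
  | succ j ih =>
    refine Submodule.fg_of_fg_map_of_fg_inf_ker (Submodule.factor (iterated_succ_le j i)) ?_ ?_
    · rw [← Submodule.map_comp, Submodule.factor_comp_mk]
      exact ih (by omega)
    · have h1 := fg_iterated hX i hj
      rw [Submodule.fg_iff_finiteDimensional] at h1 ⊢
      refine Submodule.finiteDimensional_of_le (S₂ := (X.iterated j i).map
        (X.iterated (j + 1) i).mkQ) ?_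
      rintro _ ⟨⟨y, -, rfl⟩, hy⟩
      refine ⟨y, ?_, rfl⟩
      exact (Submodule.Quotient.mk_eq_zero _).1 (LinearMap.mem_ker.1 hy)

theorem cycles_le_iterated {i : ℤ} (h : ∀ j < p, Subsingleton (X.homology (p - 1) (i - 2 * j)))
    {j : ℕ} (hj : j < p) : X.iterated 0 i ≤ X.iterated j i := by
  induction j with
  | zero => exact le_rfl
  | succ j ih => exact (ih (by omega)).trans (iterated_le_of_subsingleton hj (h j (by omega)))

/-- If `ker dᵖ⁻¹ / im d` is finite-dimensional, then so is `ker d / im dᵖ⁻¹`. -/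
theorem IsFinite.one (hp : 1 ≤ p) (hX : X.IsFinite (p - 1)) : X.IsFinite 1 := by
  have hfin := hX.1
  refine ⟨fun i => ?_, ?_⟩
  · have h1 := fg_cycles hX.1 i (j := p - 1) (by omega)
    have h2 : ((X.cycles 1 i).map (X.boundaries (p - 1) i).mkQ).FG := by
      have h3 := h1.map (Submodule.factor (iterated_le_boundaries (p - 1) i))
      rw [← Submodule.map_comp, Submodule.factor_comp_mk] at h3
      rw [Submodule.fg_iff_finiteDimensional] at h3 ⊢
      exact Submodule.finiteDimensional_of_le (Submodule.map_mono (cycles_one_le i))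
    rw [Submodule.fg_iff_finiteDimensional] at h2
    let f : X.homology 1 i →ₗ[k] (X.cycles 1 i).map (X.boundaries (p - 1) i).mkQ :=
      Submodule.liftQ _ (((X.boundaries (p - 1) i).mkQ ∘ₗ (X.cycles 1 i).subtype).codRestrict _
        fun x => ⟨x.1, x.2, rfl⟩) fun x hx => Subtype.ext (by
          exact (Submodule.Quotient.mk_eq_zero _).2 hx)
    refine FiniteDimensional.of_injective f ?_
    rw [← LinearMap.ker_eq_bot, LinearMap.ker_eq_bot']
    intro x hx
    obtain ⟨x, rfl⟩ := Submodule.Quotient.mk_surjective _ x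
    exact cls_eq_zero.2 ((Submodule.Quotient.mk_eq_zero _).1 (congrArg Subtype.val hx))
  -- If ker d / im dᵖ⁻¹ is nonzero in degree i, then ker dᵖ⁻¹ / im d is nonzero in one of the
  -- degrees i − 2 j with j < p.
  · refine Set.Finite.subset (Set.Finite.biUnion (Finset.finite_toSet (Finset.range p)) fun j _ =>
      hX.2.image fun i => i + 2 * (j : ℤ)) fun i hi => ?_
    by_contra h
    refine hi ?_
    have h1 : ∀ j < p, Subsingleton (X.homology (p - 1) (i - 2 * j)) := by
      intro j hj
      by_contra h'
      refine h (Set.mem_biUnion (by simpa using hj) ⟨i - 2 * j, ?_, by ring⟩)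
      intro h0
      exact h' (Module.finrank_zero_iff.1 h0)
    have : Subsingleton (X.homology 1 i) := by
      refine subsingleton_of_forall_eq 0 fun x => ?_
      obtain ⟨x, rfl⟩ := Submodule.Quotient.mk_surjective _ x
      exact cls_eq_zero.2 (iterated_le_boundaries _ _
        (cycles_le_iterated h1 (by omega) (cycles_one_le i x.2)))
    exact Module.finrank_zero_of_subsingleton

end PComplex

/-! ### Strings and planes of weighted shifts -/

namespace PDGAux

variable {k : Type*} [Field k]

theorem cast_factorial_pred (p : ℕ) [Fact p.Prime] [CharP k p] :
    (((p - 1).factorial : ℕ) : k) = -1 := by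
  have h := congrArg (ZMod.castHom (dvd_refl p) k) (ZMod.wilsons_lemma p)
  simpa only [map_natCast, map_neg, map_one] using h

/-- The last index of the string that `m` belongs to, seen from `m`. -/
theorem val_le_iff (p : ℕ) [hp : Fact p.Prime] (α : ZMod p) (m : ℕ) :
    ((m : ZMod p) + α - 1).val ≤ m ↔ (1 - α).val ≤ m := by
  have : NeZero p := ⟨hp.out.ne_zero⟩
  have h0 : (((1 - α).val : ℕ) : ZMod p) = 1 - α := ZMod.natCast_zmod_val _
  have hlt : (1 - α).val < p := ZMod.val_lt _
  by_cases h : (1 - α).val ≤ m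
  · have h1 : (m : ZMod p) + α - 1 = ((m - (1 - α).val : ℕ) : ZMod p) := by
      rw [Nat.cast_sub h, h0]; ring
    rw [h1, ZMod.val_natCast]
    have := Nat.mod_le (m - (1 - α).val) p
    exact ⟨fun _ => h, fun _ => by omega⟩
  · have h1 : (m : ZMod p) + α - 1 = ((m + p - (1 - α).val : ℕ) : ZMod p) := by
      rw [Nat.cast_sub (by omega), h0]; push_cast; rw [ZMod.natCast_self]; ring
    rw [h1, ZMod.val_natCast, Nat.mod_eq_of_lt (by omega)]
    omega

/-- A string of vectors `v₀ → v₁ → ⋯` with the weights `m + α` is, up to homotopy, cut off after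
the first zero weight. -/
theorem homotopySum_string {M : Type*} [AddCommGroup M] [Module k M] (p : ℕ) [hp : Fact p.Prime]
    [CharP k p] (α : ZMod p) {D s : Module.End k M} {v : ℕ → M}
    (hD : ∀ m, D (v m) = ((m : k) + α.cast) • v (m + 1))
    (hs : ∀ m, s (v m) = if (m : ZMod p) + α = 0 ∧ p - 1 ≤ m then -v (m - (p - 1)) else 0)
    (m : ℕ) : homotopySum p D s (v m) = if (1 - α).val ≤ m then v m else 0 := by
  have hNZ : NeZero p := ⟨hp.out.ne_zero⟩
  have hpow : ∀ r m : ℕ, (D ^ r) (v m) =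
      (∏ l ∈ Finset.range r, ((m : k) + l + α.cast)) • v (m + r) := by
    intro r
    induction r with
    | zero => intro m; simp
    | succ r ih =>
      intro m
      rw [pow_succ', Module.End.mul_apply, ih, map_smul, hD, smul_smul, Finset.prod_range_succ]
      push_cast
      rfl
  -- The string breaks after each zero weight. A full segment has weights 1, …, p − 1, 0, and s
  -- leads from its end back to its beginning; the only summand that contributes has as index i the
  -- position of m in its segment. The initial segment is incomplete, of length (1 − α).val, and
  -- contributes nothing.
  have hterm : ∀ i ∈ Finset.range p, (D ^ i) (s ((D ^ (p - 1 - i)) (v m))) =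
      if i = ((m : ZMod p) + α - 1).val ∧ i ≤ m then v m else 0 := by
    intro i hi
    have hi := Finset.mem_range.1 hi
    have hc : ((m + (p - 1 - i) : ℕ) : ZMod p) + α = 0 ↔ i = ((m : ZMod p) + α - 1).val := by
      have h1 : ((m + (p - 1 - i) : ℕ) : ZMod p) = m - 1 - i := by
        rw [Nat.cast_add, Nat.cast_sub (by omega), Nat.cast_sub hp.out.one_le, ZMod.natCast_self]
        push_cast; ring
      rw [h1]
      constructor
      · intro h
        have h2 : (m : ZMod p) + α - 1 = (i : ZMod p) := by linear_combination h
        rw [h2, ZMod.val_natCast, Nat.mod_eq_of_lt hi]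
      · intro h
        have h2 : (i : ZMod p) = m + α - 1 := by rw [h, ZMod.natCast_zmod_val]
        rw [h2]; ring
    rw [hpow, map_smul, map_smul, hs]
    by_cases h : i = ((m : ZMod p) + α - 1).val ∧ i ≤ m
    · rw [if_pos ⟨hc.2 h.1, by omega⟩, if_pos h, map_neg, show m + (p - 1 - i) - (p - 1) = m - i by omega,
        hpow, show m - i + i = m by omega, smul_neg, smul_smul, ← neg_smul]
      have h1 : (m : k) - i + α.cast = 1 := by
        have h2 : (m : ZMod p) - i + α = 1 := by
          rw [h.1, ZMod.natCast_zmod_val]; ring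
        have h3 := congrArg (ZMod.castHom (dvd_refl p) k) h2
        simpa using h3
      -- The weights met from m to the end of the segment and from its beginning to m are together
      -- 1, …, p − 1. By Wilson's theorem their product is −1, which cancels the sign of s.
      have h2 : (∏ l ∈ Finset.range (p - 1 - i), ((m : k) + l + α.cast)) *
          (∏ l ∈ Finset.range i, (((m - i : ℕ) : k) + l + α.cast)) = -1 := by
        rw [mul_comm, ← cast_factorial_pred (k := k) p, ← Finset.prod_range_add_one_eq_factorial,
          show p - 1 = i + (p - 1 - i) by omega, Finset.prod_range_add, Nat.cast_mul, Nat.cast_prod,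
          Nat.cast_prod, show i + (p - 1 - i) - i = p - 1 - i by omega]
        refine congrArg₂ _ (Finset.prod_congr rfl fun l _ => ?_)
          (Finset.prod_congr rfl fun l _ => ?_)
        · rw [Nat.cast_sub h.2]; push_cast; linear_combination h1
        · push_cast; linear_combination h1
      rw [h2, neg_neg, one_smul]
    · rw [if_neg h, if_neg, map_zero, smul_zero]
      rintro ⟨h1, h2⟩
      exact h ⟨hc.1 h1, by omega⟩
  rw [homotopySum_apply, Finset.sum_congr rfl hterm, Finset.sum_eq_single ((m : ZMod p) + α - 1).val]
  · exact if_congr ((and_iff_right rfl).trans (val_le_iff p α m)) rfl rfl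
  · intro i _ hi
    rw [if_neg fun h => hi h.1]
  · intro h
    exact absurd (Finset.mem_range.2 (ZMod.val_lt _)) h

theorem homotopySum_add {M : Type*} [AddCommGroup M] [Module k M] (p : ℕ)
    (D s t : Module.End k M) :
    homotopySum p D (s + t) = homotopySum p D s + homotopySum p D t := by
  simp only [homotopySum, mul_add, add_mul, Finset.sum_add_distrib]

theorem homotopySum_mul {M : Type*} [AddCommGroup M] [Module k M] {p : ℕ}
    {D C : Module.End k M} (h : Commute C D) (s : Module.End k M) :
    homotopySum p D (C * s) = C * homotopySum p D s := by
  simp only [homotopySum, Finset.mul_sum]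
  refine Finset.sum_congr rfl fun i _ => ?_
  rw [← mul_assoc, ← mul_assoc, ← mul_assoc, (h.pow_right i).eq]

/-! ### Weighted shift operators -/

section weighted

variable {I : Type*}

/-- The operator that takes the basis vector `i` to a multiple of the basis vector `f i`. -/
noncomputable def weighted (f : I → I) (c : I → k) : Module.End k (I →₀ k) :=
  Finsupp.lsum k fun i => c i • Finsupp.lsingle (f i)

theorem weighted_single (f : I → I) (c : I → k) (i : I) :
    weighted f c (Finsupp.single i 1) = c i • Finsupp.single (f i) 1 := by
  simp [weighted]

theorem weighted_commute {f g : I → I} {c c' : I → k} (h : ∀ i, f (g i) = g (f i))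
    (h' : ∀ i, c' i * c (g i) = c i * c' (f i)) : Commute (weighted f c) (weighted g c') := by
  refine Finsupp.lhom_ext' fun i => LinearMap.ext_ring ?_
  change weighted f c (weighted g c' (Finsupp.single i 1)) =
    weighted g c' (weighted f c (Finsupp.single i 1))
  rw [weighted_single, weighted_single, map_smul, map_smul, weighted_single, weighted_single,
    smul_smul, smul_smul, h, h']

theorem weighted_mem {f : I → I} {c : I → k} {deg : I → ℤ} {l : ℤ}
    (h : ∀ i, c i ≠ 0 → deg (f i) = deg i + l) {i : ℤ} {x : I →₀ k} (hx : x ∈ basisGr k deg i) :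
    weighted f c x ∈ basisGr k deg (i + l) := by
  rw [weighted, Finsupp.lsum_apply]
  refine Submodule.sum_mem _ fun j hj => ?_
  have h1 : deg j = i := by
    by_contra h2
    exact Finsupp.mem_support_iff.1 hj (Finsupp.mem_supported' k x |>.1 hx j h2)
  by_cases h0 : c j = 0
  · simp [h0]
  · refine Submodule.smul_mem _ _ (Finsupp.single_mem_supported k _ ?_)
    change deg (f j) = i + l
    rw [h j h0, h1]

end weighted

/-! ### The differential of a plane with a double layer -/

section plane

variable (k) (p : ℕ) [hp : Fact p.Prime] [CharP k p] (α β : ZMod p)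

/-- The part of `planeD` in the first direction. -/
noncomputable def planeD₁ : Module.End k (ℕ × ℕ × Fin 2 →₀ k) :=
  weighted (fun i => (i.1 + 1, i.2)) fun i => i.1 + α.cast

/-- The part of `planeD` in the second direction. -/
noncomputable def planeD₂ : Module.End k (ℕ × ℕ × Fin 2 →₀ k) :=
  weighted (fun i => (i.1, i.2.1 + 1, i.2.2)) fun i => i.2.1 + β.cast

/-- The part of `planeD` that changes the layer. -/
noncomputable def planeN : Module.End k (ℕ × ℕ × Fin 2 →₀ k) :=
  weighted (fun i => (i.1, i.2.1, 1)) fun i => if i.2.2 = 0 then -1 else 0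

/-- The differential `(m, n, j) ↦ (m + α) (m + 1, n, j) + (n + β) (m, n + 1, j)`, corrected by
`(m, n, 0) ↦ -(m, n, 1)`. -/
noncomputable def planeD : Module.End k (ℕ × ℕ × Fin 2 →₀ k) :=
  planeD₁ k p α + (planeD₂ k p β + planeN k)

/-- The homotopy in the first direction. -/
noncomputable def planeS₁ : Module.End k (ℕ × ℕ × Fin 2 →₀ k) :=
  weighted (fun i => (i.1 - (p - 1), i.2))
    fun i => if (i.1 : ZMod p) + α = 0 ∧ p - 1 ≤ i.1 then -1 else 0

/-- The homotopy in the second direction. -/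
noncomputable def planeS₂ : Module.End k (ℕ × ℕ × Fin 2 →₀ k) :=
  weighted (fun i => (i.1, i.2.1 - (p - 1), i.2.2))
    fun i => if (i.2.1 : ZMod p) + β = 0 ∧ p - 1 ≤ i.2.1 then -1 else 0

/-- The differential in the other direction and the change of layer commute with everything in the
first direction, so `sum_add_commute` reduces the plane to single strings. -/
theorem homotopySum_planeS₁ (m : ℕ) (i : ℕ × Fin 2) :
    homotopySum p (planeD k p α β) (planeS₁ k p α) (Finsupp.single (m, i) 1) =
      if (1 - α).val ≤ m then Finsupp.single (m, i) 1 else 0 := by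
  have h := sum_add_commute p (planeD₁ k p α) (planeD₂ k p β + planeN k) (planeS₁ k p α)
    (Commute.add_left (weighted_commute (fun _ => rfl) fun _ => mul_comm _ _)
      (weighted_commute (fun _ => rfl) fun _ => mul_comm _ _))
    (Commute.add_left (weighted_commute (fun _ => rfl) fun _ => mul_comm _ _)
      (weighted_commute (fun _ => rfl) fun _ => mul_comm _ _))
  have h' : homotopySum p (planeD k p α β) (planeS₁ k p α) =
    homotopySum p (planeD₁ k p α) (planeS₁ k p α) := h
  rw [h']
  refine homotopySum_string p α (v := fun m => Finsupp.single (m, i) 1)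
    (fun m => weighted_single _ _ _) (fun m => ?_) m
  refine (weighted_single _ _ _).trans ?_
  dsimp only
  split_ifs <;> simp

theorem homotopySum_planeS₂ (m n : ℕ) (j : Fin 2) :
    homotopySum p (planeD k p α β) (planeS₂ k p β) (Finsupp.single (m, n, j) 1) =
      if (1 - β).val ≤ n then Finsupp.single (m, n, j) 1 else 0 := by
  have h := sum_add_commute p (planeD₂ k p β) (planeD₁ k p α + planeN k) (planeS₂ k p β)
    (Commute.add_left (weighted_commute (fun _ => rfl) fun _ => mul_comm _ _)
      (weighted_commute (fun _ => rfl) fun _ => mul_comm _ _))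
    (Commute.add_left (weighted_commute (fun _ => rfl) fun _ => mul_comm _ _)
      (weighted_commute (fun _ => rfl) fun _ => mul_comm _ _))
  have h' : homotopySum p (planeD k p α β) (planeS₂ k p β) =
    homotopySum p (planeD₂ k p β) (planeS₂ k p β) := by
    rw [planeD, add_left_comm]
    exact h
  rw [h']
  refine homotopySum_string p β (v := fun n => Finsupp.single (m, n, j) 1)
    (fun m => weighted_single _ _ _) (fun m => ?_) n
  refine (weighted_single _ _ _).trans ?_
  dsimp only
  split_ifs <;> simp

/-- The homotopy of the plane. -/
noncomputable def planeS : Module.End k (ℕ × ℕ × Fin 2 →₀ k) :=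
  planeS₁ k p α + (1 - homotopySum p (planeD k p α β) (planeS₁ k p α)) * planeS₂ k p β

/-- The degrees of the basis vectors of the plane. -/
def planeDeg (c : ℤ) (i : ℕ × ℕ × Fin 2) : ℤ := c + 2 * i.1 + 2 * i.2.1 + 2 * (i.2.2 : ℕ)

variable {k}

theorem planeD_mem (c : ℤ) {i : ℤ} {x : ℕ × ℕ × Fin 2 →₀ k} (hx : x ∈ basisGr k (planeDeg c) i) :
    planeD k p α β x ∈ basisGr k (planeDeg c) (i + 2) := by
  refine add_mem (weighted_mem (fun j _ => ?_) hx) (add_mem (weighted_mem (fun j _ => ?_) hx)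
    (weighted_mem (fun j hj => ?_) hx))
  · simp only [planeDeg]; push_cast; ring
  · simp only [planeDeg]; push_cast; ring
  · have : j.2.2 = 0 := by
      by_contra h
      exact hj (if_neg h)
    simp only [planeDeg, this]
    simp

theorem planeS_mem (c : ℤ) {i : ℤ} {x : ℕ × ℕ × Fin 2 →₀ k}
    (hx : x ∈ basisGr k (planeDeg c) i) :
    planeS k p α β x ∈ basisGr k (planeDeg c) (i - 2 * ((p : ℤ) - 1)) := by
  have h1p := hp.out.one_le
  have h1 : ∀ (i : ℤ) (x : ℕ × ℕ × Fin 2 →₀ k), x ∈ basisGr k (planeDeg c) i →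
      planeS₁ k p α x ∈ basisGr k (planeDeg c) (i - 2 * ((p : ℤ) - 1)) := fun i x hx => by
    rw [sub_eq_add_neg]
    refine weighted_mem (fun j hj => ?_) hx
    have : p - 1 ≤ j.1 := by
      by_contra h
      exact hj (if_neg fun h' => h h'.2)
    simp only [planeDeg]
    push_cast [Nat.cast_sub this, Nat.cast_sub h1p]
    ring
  have h2 : planeS₂ k p β x ∈ basisGr k (planeDeg c) (i - 2 * ((p : ℤ) - 1)) := by
    rw [sub_eq_add_neg]
    refine weighted_mem (fun j hj => ?_) hx
    have : p - 1 ≤ j.2.1 := by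
      by_contra h
      exact hj (if_neg fun h' => h h'.2)
    simp only [planeDeg]
    push_cast [Nat.cast_sub this, Nat.cast_sub h1p]
    ring
  exact add_mem (h1 i x hx) (sub_mem h2
    (homotopySum_mem p (fun i x hx => planeD_mem p α β c hx) h1 h2))

/-- The finite part of the plane. -/
noncomputable def planeBox : Finset (ℕ × ℕ × Fin 2) :=
  Finset.range (1 - α).val ×ˢ Finset.range (1 - β).val ×ˢ Finset.univ

/-- Let T₁, T₂ be the operators of the two homotopies. As 1 − T₁ commutes with the differential, the
operator of `planeS` is T₁ + (1 − T₁) T₂. It fixes a basis vector if T₁ or T₂ does, and kills those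
that both kill, which form the box. -/
theorem homotopySum_planeS (hd : planeD k p α β ^ p = 0) (i : ℕ × ℕ × Fin 2) :
    homotopySum p (planeD k p α β) (planeS k p α β) (Finsupp.single i 1) =
      if i ∈ planeBox p α β then 0 else Finsupp.single i 1 := by
  obtain ⟨m, n, j⟩ := i
  set T := homotopySum p (planeD k p α β) (planeS₁ k p α) with hT
  have hcomm : Commute (1 - T) (planeD k p α β) := by
    have : Commute T (planeD k p α β) := LinearMap.ext fun x => homotopySum_comm hd _ x
    refine LinearMap.ext fun x => ?_
    change planeD k p α β x - T (planeD k p α β x) = planeD k p α β (x - T x)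
    rw [map_sub]
    exact congrArg _ (LinearMap.congr_fun this x)
  rw [planeS, homotopySum_add, homotopySum_mul hcomm, LinearMap.add_apply, Module.End.mul_apply,
    homotopySum_planeS₂]
  by_cases h1 : (1 - α).val ≤ m <;> by_cases h2 : (1 - β).val ≤ n <;>
    simp [hT, homotopySum_planeS₁, planeBox, h1, h2, not_lt.2, not_le.1]

end plane

end PDGAux

namespace Webster

variable {k : Type u} [Field k]

/-! ### A representation by two-by-two matrices -/

section matrices

variable {R : Type*} [CommRing R] (y z : R)

/-- The action of a dot on the first black strand. -/
def firstDot : Matrix (Fin 2) (Fin 2) R := !![0, -(y * z); 1, y + z]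

/-- The action of a dot on the second black strand. -/
def secondDot : Matrix (Fin 2) (Fin 2) R := !![y + z, y * z; -1, 0]

/-- The action of a crossing of black strands. -/
def blackCrossing (R : Type*) [CommRing R] : Matrix (Fin 2) (Fin 2) R := !![0, 1; 0, 0]

/-- The matrices are multiplication by X₁ and X₂ and the divided difference operator on polynomials
in X₁, X₂ with X₁ + X₂ = y + z and X₁ X₂ = y z, in the basis 1, X₁. This explains all nilHecke
identities below. -/
theorem firstDot_mul_secondDot : firstDot y z * secondDot y z = secondDot y z * firstDot y z := by
  refine Matrix.ext fun i j => ?_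
  fin_cases i <;> fin_cases j <;>
    simp [firstDot, secondDot, Matrix.mul_apply, Fin.sum_univ_two] <;> ring

theorem blackCrossing_mul_self : blackCrossing R * blackCrossing R = 0 := by
  refine Matrix.ext fun i j => ?_
  fin_cases i <;> fin_cases j <;> simp [blackCrossing, Matrix.mul_apply, Fin.sum_univ_two]

theorem blackCrossing_mul_firstDot :
    blackCrossing R * firstDot y z - secondDot y z * blackCrossing R = 1 := by
  refine Matrix.ext fun i j => ?_
  fin_cases i <;> fin_cases j <;>
    simp [blackCrossing, firstDot, secondDot, Matrix.mul_apply, Fin.sum_univ_two]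

theorem firstDot_mul_blackCrossing :
    firstDot y z * blackCrossing R - blackCrossing R * secondDot y z = 1 := by
  refine Matrix.ext fun i j => ?_
  fin_cases i <;> fin_cases j <;>
    simp [blackCrossing, firstDot, secondDot, Matrix.mul_apply, Fin.sum_univ_two]

/-- The product of both dots is the scalar y z. -/
theorem blackCrossing_mul_dots : blackCrossing R * secondDot y z * firstDot y z =
    secondDot y z * firstDot y z * blackCrossing R := by
  refine Matrix.ext fun i j => ?_
  fin_cases i <;> fin_cases j <;>
    simp [blackCrossing, firstDot, secondDot, Matrix.mul_apply, Fin.sum_univ_two]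

/-- The block of a dot. -/
def dotBlock (j : Fin 4) (w : Seq) : Matrix (Fin 2) (Fin 2) R :=
  if w.1 j = Strand.red then 0 else
    if j = 1 ∨ w = s1 ∧ j = 2 then firstDot y z else secondDot y z

/-- The block of a crossing. -/
def crossBlock (i : Fin 2) (w : Seq) : Matrix (Fin 2) (Fin 2) R :=
  if w.1 (lo i) = w.1 (hi i) then blackCrossing R else
    if w = s1 then firstDot y z else if w = s0 ∧ i = 1 then secondDot y z else 1

/-- The matrix of a generator. -/
def blockMatrix : Gen → Matrix Seq Seq (Matrix (Fin 2) (Fin 2) R)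
  | .idem w => Matrix.single w w 1
  | .dot j w => Matrix.single w w (dotBlock y z j w)
  | .cross i w => Matrix.single (w.swap i) w (crossBlock y z i w)

@[simp] theorem dotBlock_0_s0 : dotBlock y z 0 s0 = 0 := if_pos (by decide)
@[simp] theorem dotBlock_0_s1 : dotBlock y z 0 s1 = 0 := if_pos (by decide)
@[simp] theorem dotBlock_0_s2 : dotBlock y z 0 s2 = 0 := if_pos (by decide)
@[simp] theorem dotBlock_1_s0 : dotBlock y z 1 s0 = firstDot y z :=
  (if_neg (by decide)).trans (if_pos (by decide))
@[simp] theorem dotBlock_2_s0 : dotBlock y z 2 s0 = 0 :=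
  if_pos (by decide)
@[simp] theorem dotBlock_3_s0 : dotBlock y z 3 s0 = secondDot y z :=
  (if_neg (by decide)).trans (if_neg (by decide))
@[simp] theorem dotBlock_1_s1 : dotBlock y z 1 s1 = 0 :=
  if_pos (by decide)
@[simp] theorem dotBlock_2_s1 : dotBlock y z 2 s1 = firstDot y z :=
  (if_neg (by decide)).trans (if_pos (by decide))
@[simp] theorem dotBlock_3_s1 : dotBlock y z 3 s1 = secondDot y z :=
  (if_neg (by decide)).trans (if_neg (by decide))
@[simp] theorem dotBlock_1_s2 : dotBlock y z 1 s2 = firstDot y z :=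
  (if_neg (by decide)).trans (if_pos (by decide))
@[simp] theorem dotBlock_2_s2 : dotBlock y z 2 s2 = secondDot y z :=
  (if_neg (by decide)).trans (if_neg (by decide))
@[simp] theorem dotBlock_3_s2 : dotBlock y z 3 s2 = 0 :=
  if_pos (by decide)
@[simp] theorem crossBlock_0_s0 : crossBlock y z 0 s0 = 1 :=
  (if_neg (by decide)).trans ((if_neg (by decide)).trans (if_neg (by decide)))
@[simp] theorem crossBlock_1_s0 : crossBlock y z 1 s0 = secondDot y z :=
  (if_neg (by decide)).trans ((if_neg (by decide)).trans (if_pos (by decide)))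
@[simp] theorem crossBlock_0_s1 : crossBlock y z 0 s1 = firstDot y z :=
  (if_neg (by decide)).trans (if_pos (by decide))
@[simp] theorem crossBlock_1_s1 : crossBlock y z 1 s1 = blackCrossing R :=
  if_pos (by decide)
@[simp] theorem crossBlock_0_s2 : crossBlock y z 0 s2 = blackCrossing R :=
  if_pos (by decide)
@[simp] theorem crossBlock_1_s2 : crossBlock y z 1 s2 = 1 :=
  (if_neg (by decide)).trans ((if_neg (by decide)).trans (if_neg (by decide)))

theorem sum_single_one {I R : Type*} [Fintype I] [DecidableEq I] [Semiring R] :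
    (∑ i : I, Matrix.single i i (1 : R)) = 1 := by
  ext i j
  rw [Matrix.sum_apply, Matrix.one_apply]
  simp only [Matrix.single_apply]
  by_cases h : i = j
  · subst h; simp
  · rw [if_neg h]
    refine Finset.sum_eq_zero fun l _ => if_neg ?_
    rintro ⟨rfl, rfl⟩
    exact h rfl

theorem matrix_single_sub {I R : Type*} [DecidableEq I] [Ring R] (i j : I) (a b : R) :
    Matrix.single i j (a - b) = Matrix.single i j a - Matrix.single i j b := by
  ext i' j'
  simp only [Matrix.sub_apply, Matrix.single_apply]
  split_ifs <;> simp

theorem dotBlock_comm (j l : Fin 4) (w : Seq) :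
    dotBlock y z j w * dotBlock y z l w = dotBlock y z l w * dotBlock y z j w := by
  simp only [dotBlock]
  split_ifs <;> simp [firstDot_mul_secondDot]

theorem crossBlock_black {i : Fin 2} {w : Seq} (h : w.1 (lo i) = w.1 (hi i)) :
    crossBlock y z i w = blackCrossing R := if_pos h

theorem crossBlock_mul_dotBlock_far (i : Fin 2) (l : Fin 4) (w : Seq) (h : l ≠ lo i)
    (h' : l ≠ hi i) : crossBlock y z i w * dotBlock y z l w =
      dotBlock y z l (w.swap i) * crossBlock y z i w := by
  revert h h'
  fin_cases i <;> fin_cases l <;> rcases seq_cases w with rfl | rfl | rfl <;> intro h h' <;>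
    first
    | exact absurd rfl h
    | exact absurd rfl h'
    | simp [firstDot_mul_secondDot, swap_s0_0, swap_s0_1, swap_s1_0, swap_s1_1, swap_s2_0, swap_s2_1]

theorem crossBlock_mul_dotBlock_left (i : Fin 2) (w : Seq) (h : w.1 (lo i) = Strand.black)
    (h' : w.1 (hi i) = Strand.black) : crossBlock y z i w * dotBlock y z (lo i) w -
      dotBlock y z (hi i) w * crossBlock y z i w = 1 := by
  revert h h'
  fin_cases i <;> rcases seq_cases w with rfl | rfl | rfl <;> intro h h' <;>
    first
    | exact absurd h (by decide)
    | exact absurd h' (by decide)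
    | simpa [lo, hi, swap_s0_0, swap_s0_1, swap_s1_0, swap_s1_1, swap_s2_0, swap_s2_1] using blackCrossing_mul_firstDot y z

theorem dotBlock_mul_crossBlock_left (i : Fin 2) (w : Seq) (h : w.1 (lo i) = Strand.black)
    (h' : w.1 (hi i) = Strand.black) : dotBlock y z (lo i) w * crossBlock y z i w -
      crossBlock y z i w * dotBlock y z (hi i) w = 1 := by
  revert h h'
  fin_cases i <;> rcases seq_cases w with rfl | rfl | rfl <;> intro h h' <;>
    first
    | exact absurd h (by decide)
    | exact absurd h' (by decide)
    | simpa [lo, hi, swap_s0_0, swap_s0_1, swap_s1_0, swap_s1_1, swap_s2_0, swap_s2_1] using firstDot_mul_blackCrossing y z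

/-- A black strand acts by its dot when it crosses a red strand to the left and by the identity when
it crosses to the right, so a double crossing always produces one dot. -/
theorem crossBlock_mul_crossBlock (i : Fin 2) (w : Seq) (h : w.1 (lo i) ≠ w.1 (hi i)) :
    crossBlock y z i (w.swap i) * crossBlock y z i w =
      dotBlock y z (if w.1 (lo i) = Strand.black then lo i else hi i) w := by
  revert h
  fin_cases i <;> rcases seq_cases w with rfl | rfl | rfl <;> intro h <;>
    first
    | exact absurd (by decide) h
    | simp +decide [lo, hi, swap_s0_0, swap_s0_1, swap_s1_0, swap_s1_1, swap_s2_0, swap_s2_1]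

theorem crossBlock_mul_dotBlock_slide (i : Fin 2) (w : Seq) (h : w.1 (lo i) ≠ w.1 (hi i)) :
    crossBlock y z i w * dotBlock y z (if w.1 (lo i) = Strand.black then lo i else hi i) w =
      dotBlock y z (if w.1 (lo i) = Strand.black then hi i else lo i) (w.swap i) *
        crossBlock y z i w := by
  revert h
  fin_cases i <;> rcases seq_cases w with rfl | rfl | rfl <;> intro h <;>
    first
    | exact absurd (by decide) h
    | simp +decide [lo, hi, swap_s0_0, swap_s0_1, swap_s1_0, swap_s1_1, swap_s2_0, swap_s2_1]

theorem crossBlock_triple (w : Seq) (h : w.1 2 = Strand.black) :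
    crossBlock y z 0 ((w.swap 0).swap 1) * crossBlock y z 1 (w.swap 0) * crossBlock y z 0 w =
      crossBlock y z 1 ((w.swap 1).swap 0) * crossBlock y z 0 (w.swap 1) *
        crossBlock y z 1 w := by
  revert h
  rcases seq_cases w with rfl | rfl | rfl <;> intro h <;>
    first
    | exact absurd h (by decide)
    | simp [blackCrossing_mul_dots, swap_s0_0, swap_s0_1, swap_s1_0, swap_s1_1, swap_s2_0, swap_s2_1]

/-- In one triple crossing the dot of the first strand ends up above the black crossing, in the
other the dot of the second strand ends up below it; the difference is a nilHecke relation. -/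
theorem crossBlock_triple_middle (w : Seq) (h : w.1 2 = Strand.red) :
    crossBlock y z 0 ((w.swap 0).swap 1) * crossBlock y z 1 (w.swap 0) * crossBlock y z 0 w -
      crossBlock y z 1 ((w.swap 1).swap 0) * crossBlock y z 0 (w.swap 1) * crossBlock y z 1 w =
        1 := by
  revert h
  rcases seq_cases w with rfl | rfl | rfl <;> intro h <;>
    first
    | exact absurd h (by decide)
    | simpa [swap_s0_0, swap_s0_1, swap_s1_0, swap_s1_1, swap_s2_0, swap_s2_1] using firstDot_mul_blackCrossing y z

variable [Algebra k R]

theorem blockMatrix_rel {a b : FreeAlgebra k Gen} (h : Rel k a b) :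
    FreeAlgebra.lift k (blockMatrix y z) a = FreeAlgebra.lift k (blockMatrix y z) b := by
  have hrb : ∀ {i : Fin 2} {w : Seq}, w.1 (lo i) = Strand.red → w.1 (hi i) = Strand.black →
      w.1 (lo i) ≠ w.1 (hi i) ∧ ¬ w.1 (lo i) = Strand.black := fun h h' => by
    rw [h, h']; decide
  have hbr : ∀ {i : Fin 2} {w : Seq}, w.1 (lo i) = Strand.black → w.1 (hi i) = Strand.red →
      w.1 (lo i) ≠ w.1 (hi i) := fun h h' => by rw [h, h']; decide
  cases h with
  | sum_idem =>
    simp only [map_sum, map_one, FreeAlgebra.lift_ι_apply, blockMatrix]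
    exact sum_single_one
  | idem_mul_self w =>
    simp only [map_mul, FreeAlgebra.lift_ι_apply, blockMatrix, Matrix.single_mul_single_same,
      one_mul]
  | idem_mul_ne v w h =>
    simp only [map_mul, map_zero, FreeAlgebra.lift_ι_apply, blockMatrix]
    rw [Matrix.single_mul_single_of_ne _ _ _ _ h]
  | idem_mul_dot j w =>
    simp only [map_mul, FreeAlgebra.lift_ι_apply, blockMatrix, Matrix.single_mul_single_same,
      one_mul]
  | dot_mul_idem j w =>
    simp only [map_mul, FreeAlgebra.lift_ι_apply, blockMatrix, Matrix.single_mul_single_same,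
      mul_one]
  | idem_mul_cross i w =>
    simp only [map_mul, FreeAlgebra.lift_ι_apply, blockMatrix, Matrix.single_mul_single_same,
      one_mul]
  | cross_mul_idem i w =>
    simp only [map_mul, FreeAlgebra.lift_ι_apply, blockMatrix, Matrix.single_mul_single_same,
      mul_one]
  | dot_red j w h =>
    simp only [map_zero, FreeAlgebra.lift_ι_apply, blockMatrix]
    rw [dotBlock, if_pos h, Matrix.single_zero]
  | dot_comm j l w =>
    simp only [map_mul, FreeAlgebra.lift_ι_apply, blockMatrix, Matrix.single_mul_single_same]
    rw [dotBlock_comm]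
  | dot_far i l w h h' =>
    simp only [map_mul, FreeAlgebra.lift_ι_apply, blockMatrix, Matrix.single_mul_single_same]
    rw [crossBlock_mul_dotBlock_far y z i l w h h']
  | black_black i w h h' =>
    simp only [map_mul, map_zero, FreeAlgebra.lift_ι_apply, blockMatrix,
      Matrix.single_mul_single_same]
    rw [Seq.swap_eq (h.trans h'.symm), crossBlock_black y z (h.trans h'.symm),
      blackCrossing_mul_self, Matrix.single_zero]
  | nilHecke_left i w h h' =>
    simp only [map_mul, map_sub, FreeAlgebra.lift_ι_apply, blockMatrix]
    rw [Seq.swap_eq (h.trans h'.symm), Matrix.single_mul_single_same,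
      Matrix.single_mul_single_same, ← matrix_single_sub, crossBlock_mul_dotBlock_left y z i w h h']
  | nilHecke_right i w h h' =>
    simp only [map_mul, map_sub, FreeAlgebra.lift_ι_apply, blockMatrix]
    rw [Seq.swap_eq (h.trans h'.symm), Matrix.single_mul_single_same,
      Matrix.single_mul_single_same, ← matrix_single_sub, dotBlock_mul_crossBlock_left y z i w h h']
  | red_black i w h h' =>
    simp only [map_mul, FreeAlgebra.lift_ι_apply, blockMatrix, Matrix.single_mul_single_same]
    rw [crossBlock_mul_crossBlock y z i w (hrb h h').1, if_neg (hrb h h').2, Seq.swap_swap]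
  | black_red i w h h' =>
    simp only [map_mul, FreeAlgebra.lift_ι_apply, blockMatrix, Matrix.single_mul_single_same]
    rw [crossBlock_mul_crossBlock y z i w (hbr h h'), if_pos h, Seq.swap_swap]
  | slide_red_black i w h h' =>
    have := crossBlock_mul_dotBlock_slide y z i w (hrb h h').1
    rw [if_neg (hrb h h').2, if_neg (hrb h h').2] at this
    simp only [map_mul, FreeAlgebra.lift_ι_apply, blockMatrix, Matrix.single_mul_single_same, this]
  | slide_black_red i w h h' =>
    have := crossBlock_mul_dotBlock_slide y z i w (hbr h h')
    rw [if_pos h, if_pos h] at this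
    simp only [map_mul, FreeAlgebra.lift_ι_apply, blockMatrix, Matrix.single_mul_single_same, this]
  | triple w h =>
    have h1 : ((w.swap 0).swap 1).swap 0 = ((w.swap 1).swap 0).swap 1 := by revert w; decide
    simp only [map_mul, FreeAlgebra.lift_ι_apply, blockMatrix, Matrix.single_mul_single_same]
    rw [crossBlock_triple y z w h, h1]
  | triple_middle w h =>
    have h1 : ((w.swap 0).swap 1).swap 0 = w := by revert w; decide
    have h2 : ((w.swap 1).swap 0).swap 1 = w := by revert w; decide
    simp only [map_mul, map_sub, FreeAlgebra.lift_ι_apply, blockMatrix,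
      Matrix.single_mul_single_same]
    rw [h1, h2, ← matrix_single_sub, crossBlock_triple_middle y z w h]

/-- The representation of the algebra by two-by-two matrices. -/
noncomputable def represent : Alg k →ₐ[k] Matrix Seq Seq (Matrix (Fin 2) (Fin 2) R) :=
  lift k (FreeAlgebra.lift k (blockMatrix y z)) fun _ _ => blockMatrix_rel y z

theorem represent_gen (g : Gen) : represent y z (gen g : Alg k) = blockMatrix y z g := by
  rw [represent, gen, lift_mk, FreeAlgebra.lift_ι_apply]

end matrices

end Webster

namespace Webster

variable {k : Type u} [Field k]

/-! ### A basis of the diagrams that end at the sequence red, red, black, black -/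

/-- The position of the first black strand. -/
def firstBlack (w : Seq) : Fin 4 := if w = s1 then 2 else 1

/-- The position of the second black strand. -/
def secondBlack (w : Seq) : Fin 4 := if w = s2 then 2 else 3

/-- The dot on the first black strand. -/
noncomputable def xa (w : Seq) : Alg k := x (firstBlack w) w

/-- The dot on the second black strand. -/
noncomputable def xb (w : Seq) : Alg k := x (secondBlack w) w

/-- The diagram without dots and black crossings from a given sequence. -/
noncomputable def connect (w : Seq) : Alg k :=
  if w = s1 then e s1 else if w = s0 then c 0 s0 else c 0 s0 * c 1 s2

/-- The crossing of black strands without and with a dot. -/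
noncomputable def layer (j : Fin 2) : Alg k := if j = 0 then c 1 s1 else x 2 s1 * c 1 s1

/-- The basis diagrams. -/
noncomputable def basisDiagram (w : Seq) (i : ℕ × ℕ × Fin 2) : Alg k :=
  layer i.2.2 * connect w * xa w ^ i.1 * xb w ^ i.2.1

theorem connect_s0 : (connect s0 : Alg k) = c 0 s0 := (if_neg (by decide)).trans (if_pos rfl)
theorem connect_s1 : (connect s1 : Alg k) = e s1 := if_pos rfl
theorem connect_s2 : (connect s2 : Alg k) = c 0 s0 * c 1 s2 :=
  (if_neg (by decide)).trans (if_neg (by decide))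

theorem xa_xb (w : Seq) : Commute (xa w : Alg k) (xb w) := x_comm _ _ w

theorem x_comm_e (j : Fin 4) (w : Seq) : Commute (x j w : Alg k) (e w) :=
  (x_e j w).trans (e_x j w).symm

theorem connect_e (w : Seq) : (connect w * e w : Alg k) = connect w := by
  rcases seq_cases w with rfl | rfl | rfl
  · rw [connect_s0, c_e]
  · rw [connect_s1, e_mul_self]
  · rw [connect_s2, mul_assoc, c_e]

theorem basisDiagram_e (w : Seq) (i : ℕ × ℕ × Fin 2) :
    (basisDiagram w i * e w : Alg k) = basisDiagram w i := by
  have h1 := ((x_comm_e (k := k) (firstBlack w) w).pow_left i.1).eq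
  have h2 := ((x_comm_e (k := k) (secondBlack w) w).pow_left i.2.1).eq
  rw [basisDiagram, xa, xb, mul_assoc _ _ (e w), h2, ← mul_assoc, mul_assoc _ _ (e w), h1,
    ← mul_assoc, mul_assoc _ _ (e w), connect_e]

theorem e_c_s1 : (e s1 * c 1 s1 : Alg k) = c 1 s1 := by
  simpa only [swap_s1_1] using e_c (k := k) 1 s1

theorem e_layer (j : Fin 2) : (e s1 * layer j : Alg k) = layer j := by
  have h : (e s1 * c 1 s1 : Alg k) = c 1 s1 := e_c_s1
  rw [layer]
  split_ifs
  · exact h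
  · rw [← mul_assoc, e_x]

theorem e_basisDiagram (w : Seq) (i : ℕ × ℕ × Fin 2) :
    (e s1 * basisDiagram w i : Alg k) = basisDiagram w i := by
  simp only [basisDiagram, ← mul_assoc, e_layer]

theorem basisDiagram_xa (w : Seq) (m n : ℕ) (j : Fin 2) :
    (basisDiagram w (m, n, j) * xa w : Alg k) = basisDiagram w (m + 1, n, j) := by
  simp only [basisDiagram]
  rw [mul_assoc _ _ (xa w), ((xa_xb w).symm.pow_left n).eq, ← mul_assoc, mul_assoc _ _ (xa w),
    ← pow_succ]

theorem basisDiagram_xb (w : Seq) (m n : ℕ) (j : Fin 2) :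
    (basisDiagram w (m, n, j) * xb w : Alg k) = basisDiagram w (m, n + 1, j) := by
  simp only [basisDiagram]
  rw [mul_assoc _ _ (xb w), ← pow_succ]

/-- The crossings of a red and a black strand respect the dots. -/
theorem mixed_semiconj (i : Fin 2) (w : Seq) (h : w.1 (lo i) ≠ w.1 (hi i)) :
    SemiconjBy (c i w : Alg k) (xa w) (xa (w.swap i)) ∧
      SemiconjBy (c i w : Alg k) (xb w) (xb (w.swap i)) := by
  revert h
  fin_cases i <;> rcases seq_cases w with rfl | rfl | rfl <;> intro h
  · exact ⟨slide_black_red (i := 0) (w := s0) rfl rfl,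
      c_x_far 0 3 s0 (by decide) (by decide)⟩
  · exact ⟨slide_red_black (i := 0) (w := s1) rfl rfl,
      c_x_far 0 3 s1 (by decide) (by decide)⟩
  · exact absurd rfl h
  · exact ⟨c_x_far 1 1 s0 (by decide) (by decide),
      slide_red_black (i := 1) (w := s0) rfl rfl⟩
  · exact absurd rfl h
  · exact ⟨c_x_far 1 1 s2 (by decide) (by decide),
      slide_black_red (i := 1) (w := s2) rfl rfl⟩

/-- Dots slide through red-black crossings, so only the product of `connect` with the crossing is
left to compute. -/
theorem basisDiagram_mul_mixed (i : Fin 2) (w : Seq) (h : w.1 (lo i) ≠ w.1 (hi i)) (m n : ℕ)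
    (j : Fin 2) : (basisDiagram (w.swap i) (m, n, j) * c i w : Alg k) =
      layer j * (connect (w.swap i) * c i w) * xa w ^ m * xb w ^ n := by
  obtain ⟨h1, h2⟩ := mixed_semiconj (k := k) i w h
  simp only [basisDiagram]
  rw [mul_assoc _ _ (c i w), ← (h2.pow_right n).eq, ← mul_assoc, mul_assoc _ _ (c i w),
    ← (h1.pow_right m).eq, ← mul_assoc, mul_assoc _ _ (c i w)]

theorem layer_mul_c (j : Fin 2) : (layer j * c 1 s1 : Alg k) = 0 := by
  have h : (c 1 s1 * c 1 s1 : Alg k) = 0 := c_c_black rfl rfl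
  rw [layer]
  split_ifs
  · exact h
  · rw [mul_assoc, h, mul_zero]

/-- The span of the basis diagrams. -/
noncomputable def basisSpan (k : Type u) [Field k] : Submodule k (Alg k) :=
  Submodule.span k (Set.range fun t : Seq × ℕ × ℕ × Fin 2 => basisDiagram t.1 t.2)

theorem basisDiagram_mem (w : Seq) (i : ℕ × ℕ × Fin 2) : basisDiagram w i ∈ basisSpan k :=
  Submodule.subset_span ⟨(w, i), rfl⟩

/-- Stability under a black crossing, by induction on the number of dots. -/
theorem basisDiagram_mul_black (i : Fin 2) (w : Seq) (hl : lo i = firstBlack w)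
    (hh : hi i = secondBlack w) (h : w.1 (lo i) = Strand.black) (h' : w.1 (hi i) = Strand.black)
    (h0 : ∀ j, (layer j * connect w * c i w : Alg k) = 0) (t : ℕ × ℕ × Fin 2) :
    basisDiagram w t * c i w ∈ basisSpan k := by
  obtain ⟨m, n, j⟩ := t
  have hS : ∀ y ∈ Submodule.span k (Set.range (basisDiagram (k := k) w)),
      y * xa w ∈ Submodule.span k (Set.range (basisDiagram (k := k) w)) ∧
      y * xb w ∈ Submodule.span k (Set.range (basisDiagram (k := k) w)) := by
    intro y hy
    induction hy using Submodule.span_induction with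
    | mem y hy =>
      obtain ⟨⟨m, n, j⟩, rfl⟩ := hy
      rw [basisDiagram_xa, basisDiagram_xb]
      exact ⟨Submodule.subset_span ⟨_, rfl⟩, Submodule.subset_span ⟨_, rfl⟩⟩
    | zero => simp
    | add y z _ _ hy hz =>
      rw [add_mul, add_mul]
      exact ⟨add_mem hy.1 hz.1, add_mem hy.2 hz.2⟩
    | smul r y _ hy =>
      rw [smul_mul_assoc, smul_mul_assoc]
      exact ⟨Submodule.smul_mem _ _ hy.1, Submodule.smul_mem _ _ hy.2⟩
  have ha : (xa w * c i w : Alg k) = c i w * xb w + e w := by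
    rw [xa, xb, ← hl, ← hh, nilHecke_right h h', sub_add_cancel]
  have hb : (xb w * c i w : Alg k) = c i w * xa w - e w := by
    rw [xa, xb, ← hl, ← hh, nilHecke_left h h', add_sub_cancel_right]
  -- The crossing is moved up past the dots one by one. By the nilHecke relations each dot changes
  -- strands and leaves a basis diagram without the crossing; when no dots are left, the product
  -- vanishes by assumption.
  have key : ∀ n m, basisDiagram w (m, n, j) * c i w ∈
      Submodule.span k (Set.range (basisDiagram (k := k) w)) := by
    intro n
    induction n with
    | zero =>
      intro m
      induction m with
      | zero =>
        simp only [basisDiagram, pow_zero, mul_one, h0]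
        exact zero_mem _
      | succ m ih =>
        rw [← basisDiagram_xa, mul_assoc, ha, mul_add, ← mul_assoc, basisDiagram_e]
        exact add_mem (hS _ ih).2 (Submodule.subset_span ⟨_, rfl⟩)
    | succ n ih =>
      intro m
      rw [← basisDiagram_xb, mul_assoc, hb, mul_sub, ← mul_assoc, basisDiagram_e]
      exact sub_mem (hS _ (ih m)).1 (Submodule.subset_span ⟨_, rfl⟩)
  refine Submodule.span_mono ?_ (key n m)
  rintro _ ⟨t, rfl⟩
  exact ⟨(w, t), rfl⟩

/-- The sequence at the top of a generator. -/
def Gen.top : Gen → Seq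
  | .idem w => w
  | .dot _ w => w
  | .cross i w => w.swap i

theorem e_top_gen (g : Gen) : (e g.top * gen g : Alg k) = gen g := by
  match g with
  | .idem w => exact e_mul_self w
  | .dot j w => exact e_x j w
  | .cross i w => exact e_c i w

/-- A red-black crossing either extends `connect` or completes a double crossing, which is a dot. A
black crossing can be moved up to the layer, which annihilates it. -/
theorem basisDiagram_mul_gen_mem (w : Seq) (t : ℕ × ℕ × Fin 2) (g : Gen) :
    basisDiagram w t * gen g ∈ basisSpan k := by
  by_cases hg : g.top = w
  swap
  · have h0 : (basisDiagram w t * gen g : Alg k) = 0 := by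
      rw [← basisDiagram_e, ← e_top_gen g, mul_assoc, ← mul_assoc (e w), e_mul_ne _ _ (Ne.symm hg),
        zero_mul, mul_zero]
    rw [h0]
    exact zero_mem _
  obtain ⟨m, n, j⟩ := t
  subst hg
  match g with
  | .idem w =>
    have h := basisDiagram_e (k := k) w (m, n, j)
    exact h.symm ▸ basisDiagram_mem w _
  | .dot l w =>
    change basisDiagram w (m, n, j) * x l w ∈ basisSpan k
    have : ∀ (w : Seq) (l : Fin 4), w.1 l = Strand.red ∨ l = firstBlack w ∨ l = secondBlack w := by
      decide
    rcases this w l with h | rfl | rfl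
    · rw [x_red l w h, mul_zero]
      exact zero_mem _
    · have h := basisDiagram_xa (k := k) w m n j
      exact h.symm ▸ basisDiagram_mem w _
    · have h := basisDiagram_xb (k := k) w m n j
      exact h.symm ▸ basisDiagram_mem w _
  | .cross i w =>
    change basisDiagram (w.swap i) (m, n, j) * c i w ∈ basisSpan k
    have hc : ∀ (i : Fin 2) (w : Seq), (i = 0 ∧ w = s0) ∨ (i = 0 ∧ w = s1) ∨ (i = 0 ∧ w = s2) ∨
      (i = 1 ∧ w = s0) ∨ (i = 1 ∧ w = s1) ∨ (i = 1 ∧ w = s2) := by decide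
    rcases hc i w with ⟨rfl, rfl⟩ | ⟨rfl, rfl⟩ | ⟨rfl, rfl⟩ | ⟨rfl, rfl⟩ | ⟨rfl, rfl⟩ | ⟨rfl, rfl⟩
    · rw [basisDiagram_mul_mixed 0 s0 (by decide), swap_s0_0, connect_s1]
      have h : (e s1 * c 0 s0 : Alg k) = c 0 s0 := by
        simpa only [swap_s0_0] using e_c (k := k) 0 s0
      rw [h, ← connect_s0]
      exact basisDiagram_mem s0 (m, n, j)
    · rw [basisDiagram_mul_mixed 0 s1 (by decide), swap_s1_0, connect_s0, c_s0_s1]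
      have h : (x 2 s1 : Alg k) = connect s1 * xa s1 := by
        rw [connect_s1]; exact (e_x 2 s1).symm
      rw [h, ← mul_assoc, mul_assoc _ (xa s1), ← pow_succ']
      exact basisDiagram_mem s1 (m + 1, n, j)
    · rw [swap_s2_0]
      refine basisDiagram_mul_black 0 s2 rfl rfl rfl rfl (fun j => ?_) _
      -- The triple crossing relation carries the black crossing through `connect` to the layer.
      have h : (c 0 s0 * c 1 s2 * c 0 s2 : Alg k) = c 1 s1 * c 0 s0 * c 1 s2 := by
        simpa only [swap_s0_0, swap_s0_1, swap_s1_0, swap_s1_1, swap_s2_0, swap_s2_1] using triple (k := k) s2 rfl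
      rw [connect_s2, mul_assoc, h, ← mul_assoc, ← mul_assoc, layer_mul_c, zero_mul, zero_mul]
    · rw [basisDiagram_mul_mixed 1 s0 (by decide), swap_s0_1, connect_s2, mul_assoc (c 0 s0)]
      have h : (c 1 s2 * c 1 s0 : Alg k) = xb s0 := by
        have h := c_c_red_black (k := k) (i := 1) (w := s0) rfl rfl
        rw [swap_s0_1] at h
        exact h
      rw [h, ← connect_s0, ← mul_assoc, mul_assoc _ (xb s0), ((xa_xb s0).symm.pow_right m).eq,
        ← mul_assoc, mul_assoc _ (xb s0), ← pow_succ']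
      exact basisDiagram_mem s0 (m, n + 1, j)
    · rw [swap_s1_1]
      refine basisDiagram_mul_black 1 s1 rfl rfl rfl rfl (fun j => ?_) _
      have h : (e s1 * c 1 s1 : Alg k) = c 1 s1 := e_c_s1
      rw [connect_s1, mul_assoc, h, layer_mul_c]
    · rw [basisDiagram_mul_mixed 1 s2 (by decide), swap_s2_1, connect_s0, ← connect_s2]
      exact basisDiagram_mem s2 (m, n, j)

theorem mul_mem_basisSpan {y : Alg k} (hy : y ∈ basisSpan k) (a : Alg k) :
    y * a ∈ basisSpan k := by
  have h1 : ∀ g, ∀ y ∈ basisSpan k, y * gen g ∈ basisSpan k := by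
    intro g y hy
    induction hy using Submodule.span_induction with
    | mem y hy =>
      obtain ⟨t, rfl⟩ := hy
      exact basisDiagram_mul_gen_mem _ _ _
    | zero => rw [zero_mul]; exact zero_mem _
    | add y z _ _ hy hz => rw [add_mul]; exact add_mem hy hz
    | smul r y _ hy => rw [smul_mul_assoc]; exact Submodule.smul_mem _ _ hy
  have ha : a ∈ Submodule.span k (Set.range fun L : List Gen => ((L.map gen).prod : Alg k)) := by
    rw [span_prod]; trivial
  induction ha using Submodule.span_induction with
  | mem a ha =>
    obtain ⟨L, rfl⟩ := ha
    dsimp only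
    induction L generalizing y with
    | nil => simpa using hy
    | cons g L ih =>
      rw [List.map_cons, List.prod_cons, ← mul_assoc]
      exact ih (h1 g y hy)
  | zero => rw [mul_zero]; exact zero_mem _
  | add a b _ _ ha hb => rw [mul_add]; exact add_mem ha hb
  | smul r a _ ha => rw [mul_smul_comm]; exact Submodule.smul_mem _ _ ha

/-- The nilHecke relation writes the identity as x c − c x′. As the span is stable under right
multiplication, it therefore contains e(s₁) W̃. -/
theorem e_mem_basisSpan : (e s1 : Alg k) ∈ basisSpan k := by
  have h : (c 1 s1 * x 3 s1 : Alg k) = x 2 s1 * c 1 s1 - e s1 :=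
    nilHecke_right (i := 1) (w := s1) rfl rfl
  have h' : (c 1 s1 * e s1 : Alg k) = c 1 s1 := c_e 1 s1
  have h1 : (e s1 : Alg k) = basisDiagram s1 (0, 0, 1) - basisDiagram s1 (0, 1, 0) := by
    simp only [basisDiagram, connect_s1, pow_zero, mul_one, pow_one]
    change (e s1 : Alg k) = x 2 s1 * c 1 s1 * e s1 - c 1 s1 * e s1 * x 3 s1
    rw [mul_assoc, h', h, sub_sub_cancel]
  rw [h1]
  exact sub_mem (basisDiagram_mem _ _) (basisDiagram_mem _ _)

end Webster

namespace Webster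

open PDGAux

variable {k : Type u} [Field k]

/-! ### Linear independence -/

section independence

variable {R : Type*} [CommRing R] (y z : R) [Algebra k R]

theorem represent_xa (w : Seq) :
    represent y z (xa w : Alg k) = Matrix.single w w (firstDot y z) := by
  refine (represent_gen y z _).trans (congrArg (Matrix.single w w) ?_)
  rcases seq_cases w with rfl | rfl | rfl
  · exact dotBlock_1_s0 y z
  · exact dotBlock_2_s1 y z
  · exact dotBlock_1_s2 y z

theorem represent_xb (w : Seq) :
    represent y z (xb w : Alg k) = Matrix.single w w (secondDot y z) := by
  refine (represent_gen y z _).trans (congrArg (Matrix.single w w) ?_)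
  rcases seq_cases w with rfl | rfl | rfl
  · exact dotBlock_3_s0 y z
  · exact dotBlock_3_s1 y z
  · exact dotBlock_2_s2 y z

theorem represent_connect (w : Seq) :
    represent y z (connect w : Alg k) = Matrix.single s1 w 1 := by
  have h0 : represent y z (c 0 s0 : Alg k) = Matrix.single s1 s0 1 := by
    rw [represent_gen, blockMatrix, swap_s0_0, crossBlock_0_s0]
  have h2 : represent y z (c 1 s2 : Alg k) = Matrix.single s0 s2 1 := by
    rw [represent_gen, blockMatrix, swap_s2_1, crossBlock_1_s2]
  rcases seq_cases w with rfl | rfl | rfl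
  · rw [connect_s0, h0]
  · rw [connect_s1, represent_gen, blockMatrix]
  · rw [connect_s2, map_mul, h0, h2, Matrix.single_mul_single_same, one_mul]

/-- The block of `layer`. -/
def layerBlock (j : Fin 2) : Matrix (Fin 2) (Fin 2) R :=
  if j = 0 then blackCrossing R else firstDot y z * blackCrossing R

theorem represent_layer (j : Fin 2) :
    represent y z (layer j : Alg k) = Matrix.single s1 s1 (layerBlock y z j) := by
  have h : represent y z (c 1 s1 : Alg k) = Matrix.single s1 s1 (blackCrossing R) := by
    rw [represent_gen, blockMatrix, swap_s1_1, crossBlock_1_s1]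
  have h' : represent y z (x 2 s1 : Alg k) = Matrix.single s1 s1 (firstDot y z) := represent_xa y z s1
  rw [layer, layerBlock]
  split_ifs
  · exact h
  · rw [map_mul, h, h', Matrix.single_mul_single_same]

theorem single_mul_single_pow {I S : Type*} [Fintype I] [DecidableEq I] [Semiring S] (v w : I)
    (M Y : S) (n : ℕ) :
    Matrix.single v w M * Matrix.single w w Y ^ n = Matrix.single v w (M * Y ^ n) := by
  induction n with
  | zero => simp
  | succ n ih => rw [pow_succ, ← mul_assoc, ih, Matrix.single_mul_single_same, mul_assoc, ← pow_succ]

theorem represent_basisDiagram (w : Seq) (i : ℕ × ℕ × Fin 2) :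
    represent y z (basisDiagram w i : Alg k) = Matrix.single s1 w
      (layerBlock y z i.2.2 * firstDot y z ^ i.1 * secondDot y z ^ i.2.1) := by
  rw [basisDiagram, map_mul, map_mul, map_mul, map_pow, map_pow, represent_xa, represent_xb,
    represent_layer, represent_connect, Matrix.single_mul_single_same, mul_one,
    single_mul_single_pow, single_mul_single_pow]

/-- The vector stands for X₁ − z, a common eigenvector of both dots with eigenvalues y and z, so
that powers of dots become monomials. -/
theorem firstDot_mulVec : (firstDot y z).mulVec ![-z, 1] = y • ![-z, 1] := by
  funext i
  fin_cases i <;> simp [firstDot, Matrix.mulVec, dotProduct, Fin.sum_univ_two]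

theorem secondDot_mulVec : (secondDot y z).mulVec ![-z, 1] = z • ![-z, 1] := by
  funext i
  fin_cases i <;> simp [secondDot, Matrix.mulVec, dotProduct, Fin.sum_univ_two]
  ring

theorem pow_mulVec {Y : Matrix (Fin 2) (Fin 2) R} {v : Fin 2 → R} {r : R} (h : Y.mulVec v = r • v)
    (n : ℕ) : (Y ^ n).mulVec v = r ^ n • v := by
  induction n with
  | zero => simp
  | succ n ih =>
    rw [pow_succ, ← Matrix.mulVec_mulVec, h, Matrix.mulVec_smul, ih, smul_smul, pow_succ']

/-- The crossing sends X₁ − z to 1, and a dot on top of it gives X₁; the two layers thus land in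
different coordinates. -/
theorem layerBlock_mulVec (j : Fin 2) : (layerBlock y z j).mulVec ![-z, 1] = Pi.single j 1 := by
  funext i
  fin_cases j <;> fin_cases i <;>
    simp [layerBlock, firstDot, blackCrossing, Matrix.mulVec, dotProduct, Fin.sum_univ_two,
      Matrix.mul_apply]

/-- The coordinates of the diagrams that start at `w`. -/
noncomputable def coordinate (w : Seq) : Alg k →ₗ[k] (Fin 2 → R) :=
  { toFun := fun M => (M s1 w).mulVec ![-z, 1]
    map_add' := fun M N => Matrix.add_mulVec _ _ _
    map_smul' := fun r M => by
      change (r • M s1 w).mulVec ![-z, 1] = r • (M s1 w).mulVec ![-z, 1]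
      exact Matrix.smul_mulVec _ _ _ :
      Matrix Seq Seq (Matrix (Fin 2) (Fin 2) R) →ₗ[k] (Fin 2 → R) } ∘ₗ
    (represent (k := k) y z).toLinearMap

theorem coordinate_basisDiagram (w : Seq) (m n : ℕ) (j : Fin 2) :
    coordinate y z w (basisDiagram w (m, n, j) : Alg k) = Pi.single j (y ^ m * z ^ n) := by
  change ((represent y z (basisDiagram w (m, n, j) : Alg k)) s1 w).mulVec ![-z, 1] = _
  rw [represent_basisDiagram, Matrix.single_apply_same, ← Matrix.mulVec_mulVec,
    ← Matrix.mulVec_mulVec, pow_mulVec (secondDot_mulVec y z), Matrix.mulVec_smul,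
    pow_mulVec (firstDot_mulVec y z), Matrix.mulVec_smul, Matrix.mulVec_smul, layerBlock_mulVec,
    smul_smul, ← Pi.single_smul, smul_eq_mul, mul_one, mul_comm]

end independence

/-- The linear combinations of basis diagrams that start at `w`. -/
noncomputable def planeMap (w : Seq) : (ℕ × ℕ × Fin 2 →₀ k) →ₗ[k] Alg k :=
  Finsupp.linearCombination k (basisDiagram w)

theorem planeMap_single (w : Seq) (i : ℕ × ℕ × Fin 2) :
    planeMap w (Finsupp.single i 1) = (basisDiagram w i : Alg k) := by
  simp [planeMap]

/-- Over k[y][z] the coordinates of the basis diagrams are pairwise different monomials in one of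
two slots, so every coefficient can be read off. -/
theorem planeMap_injective (w : Seq) : Function.Injective (planeMap (k := k) w) := by
  rw [← LinearMap.ker_eq_bot, LinearMap.ker_eq_bot']
  intro f hf
  refine Finsupp.ext fun i => ?_
  obtain ⟨m, n, j⟩ := i
  let φ : (Fin 2 → Polynomial (Polynomial k)) →ₗ[k] k :=
    Polynomial.lcoeff k m ∘ₗ (Polynomial.lcoeff (Polynomial k) n).restrictScalars k ∘ₗ
      LinearMap.proj j
  have h : Finsupp.lapply (m, n, j) = φ ∘ₗ coordinate (k := k) (Polynomial.C Polynomial.X)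
      Polynomial.X w ∘ₗ planeMap w := by
    refine Finsupp.lhom_ext' fun i => LinearMap.ext_ring ?_
    obtain ⟨m', n', j'⟩ := i
    change (Finsupp.single (m', n', j') (1 : k)) (m, n, j) =
      φ (coordinate _ _ w (planeMap w (Finsupp.single (m', n', j') 1)))
    rw [planeMap_single, coordinate_basisDiagram]
    change _ = (((Pi.single j' (Polynomial.C Polynomial.X ^ m' * Polynomial.X ^ n') :
      Fin 2 → Polynomial (Polynomial k)) j).coeff n).coeff m
    rw [Finsupp.single_apply, Pi.single_apply, ← Polynomial.C_pow]
    by_cases hj : j = j'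
    · subst hj
      rw [if_pos rfl, Polynomial.coeff_C_mul_X_pow]
      by_cases hn : n = n'
      · subst hn
        rw [if_pos rfl, Polynomial.coeff_X_pow]
        simp [Prod.ext_iff, eq_comm]
      · simp [Prod.ext_iff, hn, Ne.symm hn]
    · simp [Prod.ext_iff, hj, Ne.symm hj]
  have h1 := LinearMap.congr_fun h f
  refine h1.trans ?_
  change φ (coordinate _ _ w (planeMap w f)) = 0
  rw [hf, map_zero, map_zero]

theorem planeMap_e (w : Seq) (f : ℕ × ℕ × Fin 2 →₀ k) : planeMap w f * e w = planeMap w f := by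
  induction f using Finsupp.induction_linear with
  | zero => rw [map_zero, zero_mul]
  | add f g hf hg => rw [map_add, add_mul, hf, hg]
  | single i r =>
    rw [planeMap, Finsupp.linearCombination_single, smul_mul_assoc, basisDiagram_e]

theorem e_planeMap (w : Seq) (f : ℕ × ℕ × Fin 2 →₀ k) : e s1 * planeMap w f = planeMap w f := by
  induction f using Finsupp.induction_linear with
  | zero => rw [map_zero, mul_zero]
  | add f g hf hg => rw [map_add, mul_add, hf, hg]
  | single i r =>
    rw [planeMap, Finsupp.linearCombination_single, mul_smul_comm, e_basisDiagram]

theorem exists_planeMap (w : Seq) (a : Alg k) :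
    ∃ f, planeMap w f = e s1 * a * e w := by
  have h : ∀ y ∈ basisSpan k, ∃ f, planeMap w f = y * e w := by
    intro y hy
    induction hy using Submodule.span_induction with
    | mem y hy =>
      obtain ⟨⟨v, i⟩, rfl⟩ := hy
      by_cases hv : v = w
      · subst hv
        exact ⟨Finsupp.single i 1, by rw [planeMap_single, basisDiagram_e]⟩
      · refine ⟨0, ?_⟩
        dsimp only
        rw [map_zero, ← basisDiagram_e, mul_assoc, e_mul_ne _ _ hv, mul_zero]
    | zero => exact ⟨0, by rw [map_zero, zero_mul]⟩
    | add y z _ _ hy hz =>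
      obtain ⟨f, hf⟩ := hy
      obtain ⟨g, hg⟩ := hz
      exact ⟨f + g, by rw [map_add, add_mul, hf, hg]⟩
    | smul r y _ hy =>
      obtain ⟨f, hf⟩ := hy
      exact ⟨r • f, by rw [map_smul, smul_mul_assoc, hf]⟩
  exact h _ (mul_mem_basisSpan e_mem_basisSpan a)

/-- The coordinates of `e(s₁) a e(w)`. -/
noncomputable def planeInv (w : Seq) : Alg k →ₗ[k] (ℕ × ℕ × Fin 2 →₀ k) where
  toFun a := (exists_planeMap w a).choose
  map_add' a b := planeMap_injective w (by
    rw [map_add, (exists_planeMap w (a + b)).choose_spec, (exists_planeMap w a).choose_spec,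
      (exists_planeMap w b).choose_spec, mul_add, add_mul])
  map_smul' r a := planeMap_injective w (by
    rw [RingHom.id_apply, map_smul, (exists_planeMap w (r • a)).choose_spec,
      (exists_planeMap w a).choose_spec, mul_smul_comm, smul_mul_assoc])

theorem planeMap_planeInv (w : Seq) (a : Alg k) : planeMap w (planeInv w a) = e s1 * a * e w :=
  (exists_planeMap w a).choose_spec

theorem planeInv_planeMap (w : Seq) (f : ℕ × ℕ × Fin 2 →₀ k) : planeInv w (planeMap w f) = f :=
  planeMap_injective w (by rw [planeMap_planeInv, e_planeMap, planeMap_e])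

/-! ### The grading -/

/-- The degree of `connect`. -/
def connectDeg (w : Seq) : ℤ := if w = s1 then 0 else if w = s0 then 1 else 2

theorem gr_cast {m n : ℤ} (h : m = n) {a : Alg k} (ha : a ∈ gr m) : a ∈ gr n := h ▸ ha

theorem connect_mem (w : Seq) : (connect w : Alg k) ∈ gr (connectDeg w) := by
  rcases seq_cases w with rfl | rfl | rfl
  · rw [connect_s0]; exact gr_cast (by decide) (gen_mem_gr (.cross 0 s0))
  · rw [connect_s1]; exact gr_cast (by decide) (gen_mem_gr (.idem s1))
  · rw [connect_s2]
    exact gr_cast (by decide) (mul_mem_gr (gen_mem_gr (.cross 0 s0)) (gen_mem_gr (.cross 1 s2)))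

theorem layer_mem (j : Fin 2) : (layer j : Alg k) ∈ gr (-2 + 2 * (j : ℕ)) := by
  fin_cases j
  · exact gr_cast (by decide) (gen_mem_gr (.cross 1 s1))
  · exact gr_cast (by decide) (mul_mem_gr (gen_mem_gr (.dot 2 s1)) (gen_mem_gr (.cross 1 s1)))

theorem x_pow_mem (j : Fin 4) (w : Seq) (n : ℕ) : (x j w ^ n : Alg k) ∈ gr (2 * (n : ℤ)) := by
  induction n with
  | zero => simpa using one_mem_gr (k := k)
  | succ n ih =>
    have := mul_mem_gr ih (gen_mem_gr (k := k) (.dot j w))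
    rw [pow_succ]
    refine gr_cast ?_ this
    simp only [Gen.deg]
    push_cast; ring

theorem basisDiagram_mem_gr (w : Seq) (i : ℕ × ℕ × Fin 2) :
    (basisDiagram w i : Alg k) ∈ gr (planeDeg (connectDeg w - 2) i) := by
  have h := mul_mem_gr (mul_mem_gr (mul_mem_gr (layer_mem (k := k) i.2.2) (connect_mem w))
    (x_pow_mem (firstBlack w) w i.1)) (x_pow_mem (secondBlack w) w i.2.1)
  refine gr_cast ?_ h
  simp only [planeDeg]
  ring

theorem planeMap_mem (w : Seq) {i : ℤ} {f : ℕ × ℕ × Fin 2 →₀ k}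
    (hf : f ∈ basisGr k (planeDeg (connectDeg w - 2)) i) : planeMap w f ∈ gr (k := k) i := by
  rw [planeMap, Finsupp.linearCombination_apply]
  refine Submodule.sum_mem _ fun j hj => Submodule.smul_mem _ _ ?_
  have h1 : planeDeg (connectDeg w - 2) j = i := by
    by_contra h2
    exact Finsupp.mem_support_iff.1 hj (Finsupp.mem_supported' k f |>.1 hf j h2)
  rw [← h1]
  exact basisDiagram_mem_gr w j

end Webster

/-! ### Degrees of the coordinates -/

namespace PDGAux

/-- An injective map of graded vector spaces reflects degrees. -/
theorem mem_of_injective {k : Type*} [Field k] {M N : Type*} [AddCommGroup M] [Module k M]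
    [AddCommGroup N] [Module k N] {G : ℤ → Submodule k M} {G' : ℤ → Submodule k N}
    (hG : DirectSum.IsInternal G) (hG' : DirectSum.IsInternal G') {f : M →ₗ[k] N}
    (hf : Function.Injective f) (h : ∀ i, ∀ x ∈ G i, f x ∈ G' i) {i : ℤ} {x : M}
    (hx : f x ∈ G' i) : x ∈ G i := by
  classical
  obtain ⟨s, rfl⟩ := hG.2 x
  let P : ∀ j, G j →ₗ[k] G' j := fun j => f.restrict (h j)
  have h1 : DirectSum.coeLinearMap G' (DirectSum.lmap P s) = f (DirectSum.coeLinearMap G s) := by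
    have : DirectSum.coeLinearMap G' ∘ₗ DirectSum.lmap P = f ∘ₗ DirectSum.coeLinearMap G := by
      refine DirectSum.linearMap_ext k fun j => LinearMap.ext fun y => ?_
      simp [P]
    exact LinearMap.congr_fun this s
  have h2 : DirectSum.lmap P s = DirectSum.lof k ℤ (fun j => G' j) i
      ⟨f (DirectSum.coeLinearMap G s), hx⟩ := by
    refine hG'.1 ?_
    exact h1.trans (DirectSum.coeLinearMap_lof (A := G') i ⟨_, hx⟩).symm
  have h3 : ∀ j, j ≠ i → s j = 0 := by
    intro j hj
    have h4 : DirectSum.lmap P s j = 0 := by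
      rw [h2, DirectSum.lof_eq_of, DirectSum.of_eq_of_ne _ _ _ hj]
    have h5 : P j (s j) = 0 := by
      rw [← h4]; rfl
    exact Subtype.ext (hf ((congrArg Subtype.val h5).trans (map_zero f).symm))
  have h6 : s = DirectSum.of (fun j => G j) i (s i) := by
    refine DFinsupp.ext fun j => ?_
    by_cases hj : j = i
    · subst hj
      rw [DirectSum.of_eq_same]
    · rw [DirectSum.of_eq_of_ne _ _ _ hj, h3 j hj]
  change DirectSum.coeAddMonoidHom G s ∈ G i
  rw [h6, DirectSum.coeAddMonoidHom_of]
  exact (s i).2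

end PDGAux

namespace Webster

open PDGAux

variable {k : Type u} [Field k]

/-- The map `planeMap` is homogeneous and injective, hence reflects degrees. -/
theorem planeInv_mem (w : Seq) {i : ℤ} {a : Alg k} (ha : a ∈ gr i) :
    planeInv w a ∈ basisGr k (planeDeg (connectDeg w - 2)) i := by
  have h1 : planeMap w (planeInv w a) ∈ gr (k := k) i → planeInv w a ∈
      basisGr k (planeDeg (connectDeg w - 2)) i :=
    mem_of_injective (G := basisGr k (planeDeg (connectDeg w - 2))) (G' := gr (k := k))
      (f := planeMap w) (basisGr_internal _) gr_internal (planeMap_injective w)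
      fun i x hx => planeMap_mem w hx
  refine h1 ?_
  rw [planeMap_planeInv]
  refine gr_cast ?_ (mul_mem_gr (mul_mem_gr (gen_mem_gr (k := k) (.idem s1)) ha)
    (gen_mem_gr (.idem w)))
  simp only [Gen.deg]
  ring

end Webster

namespace Webster

open PDGAux

variable {k : Type u} [Field k]

/-! ### The differential on the basis diagrams -/

theorem layer_connect_xa (w : Seq) (m n : ℕ) (j : Fin 2) :
    (layer j * (connect w * xa w) * xa w ^ m * xb w ^ n : Alg k) = basisDiagram w (m + 1, n, j) := by
  simp only [basisDiagram]
  rw [← mul_assoc, mul_assoc _ (xa w), ← pow_succ']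

theorem layer_connect_xb (w : Seq) (m n : ℕ) (j : Fin 2) :
    (layer j * (connect w * xb w) * xa w ^ m * xb w ^ n : Alg k) = basisDiagram w (m, n + 1, j) := by
  simp only [basisDiagram]
  rw [← mul_assoc, mul_assoc _ (xb w), ((xa_xb w).symm.pow_right m).eq, ← mul_assoc,
    mul_assoc _ (xb w), ← pow_succ']

theorem x_connect (w : Seq) : (x 3 s1 * connect w : Alg k) = connect w * xb w := by
  have h0 : (x 3 s1 * c 0 s0 : Alg k) = c 0 s0 * x 3 s0 := by
    have := c_x_far (k := k) 0 3 s0 (by decide) (by decide)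
    rw [swap_s0_0] at this
    exact this.symm
  have h2 : (x 3 s0 * c 1 s2 : Alg k) = c 1 s2 * x 2 s2 := by
    have := slide_black_red (k := k) (i := 1) (w := s2) rfl rfl
    rw [swap_s2_1] at this
    exact this.symm
  rcases seq_cases w with rfl | rfl | rfl
  · rw [connect_s0]; exact h0
  · rw [connect_s1]; exact x_comm_e 3 s1
  · rw [connect_s2, ← mul_assoc, h0, mul_assoc, h2, ← mul_assoc]; rfl

/-- Since e = x c − c x′, the derivative e − 2 x c of the crossing equals −x c − c x′. The dot x′
below the layer is responsible for the −1 in `beta`, and −x c is the change of layer. -/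
theorem d_layer (μ : k) (j : Fin 2) : (d μ (layer j) : Alg k) =
    (if j = 0 then -1 else 0 : k) • layer 1 - layer j * x 3 s1 := by
  have h : (c 1 s1 * x 3 s1 : Alg k) = x 2 s1 * c 1 s1 - e s1 :=
    nilHecke_right (i := 1) (w := s1) rfl rfl
  have hd : d μ (c 1 s1) = e s1 - 2 • (x 2 s1 * c 1 s1) := by
    rw [d_gen, dGen_black_black (i := 1) (w := s1) μ rfl rfl]
    rfl
  fin_cases j
  · change d μ (c 1 s1) = (-1 : k) • (x 2 s1 * c 1 s1) - c 1 s1 * x 3 s1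
    rw [hd, h, neg_one_smul]
    abel
  · change d μ (x 2 s1 * c 1 s1) = (0 : k) • (x 2 s1 * c 1 s1) - x 2 s1 * c 1 s1 * x 3 s1
    rw [d_mul, d_gen, dGen_dot, hd, mul_assoc (x 2 s1) (c 1 s1), h, zero_smul]
    simp only [mul_sub, mul_smul_comm, ← mul_assoc]
    abel

section

variable (p : ℕ) [hp : Fact p.Prime] [CharP k p] (l : ZMod p)

/-- The weight of the differential in the direction of the first dot. -/
def alpha (w : Seq) : ZMod p := if w = s1 then 0 else 1 - l

/-- The weight of the differential in the direction of the second dot. -/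
def beta (w : Seq) : ZMod p := (if w = s2 then 1 - l else 0) - 1

theorem one_sub_cast : ((1 - l : ZMod p).cast : k) = 1 - l.cast := by
  rw [ZMod.cast_sub (dvd_refl p), ZMod.cast_one (dvd_refl p)]

theorem d_connect (w : Seq) : (d (l.cast : k) (connect w) : Alg k) =
    ((alpha p l w).cast : k) • (connect w * xa w) +
      ((beta p l w).cast + 1 : k) • (connect w * xb w) := by
  have h0 : (x 2 s1 * c 0 s0 : Alg k) = c 0 s0 * x 1 s0 := by
    have := slide_black_red (k := k) (i := 0) (w := s0) rfl rfl
    rw [swap_s0_0] at this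
    exact this.symm
  have h1 : (x 1 s0 * c 1 s2 : Alg k) = c 1 s2 * x 1 s2 := by
    have := c_x_far (k := k) 1 1 s2 (by decide) (by decide)
    rw [swap_s2_1] at this
    exact this.symm
  have h2 : (x 3 s0 * c 1 s2 : Alg k) = c 1 s2 * x 2 s2 := by
    have := slide_black_red (k := k) (i := 1) (w := s2) rfl rfl
    rw [swap_s2_1] at this
    exact this.symm
  have hb : ((beta p l w).cast + 1 : k) = if w = s2 then 1 - (l.cast : k) else 0 := by
    rw [beta, ZMod.cast_sub (dvd_refl p), ZMod.cast_one (dvd_refl p), sub_add_cancel]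
    split_ifs
    · exact one_sub_cast p l
    · exact ZMod.cast_zero
  have ha : ((alpha p l w).cast : k) = if w = s1 then 0 else 1 - (l.cast : k) := by
    rw [alpha]
    split_ifs
    · exact ZMod.cast_zero
    · exact one_sub_cast p l
  rw [ha, hb]
  rcases seq_cases w with rfl | rfl | rfl
  · rw [if_neg (by decide), if_neg (by decide), zero_smul, add_zero, connect_s0, d_gen,
      dGen_cross_s0_0, h0]
    rfl
  · rw [if_pos rfl, if_neg (by decide), zero_smul, zero_smul, add_zero, connect_s1, d_gen, dGen_idem]
  · rw [if_neg (by decide), if_pos rfl, connect_s2, d_mul, d_gen, d_gen, dGen_cross_s0_0,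
      dGen_cross_s2_1, h0, h2, smul_mul_assoc, mul_smul_comm, mul_assoc, h1, ← mul_assoc,
      ← mul_assoc]
    rfl

/-- By the Leibniz rule the powers of dots contribute their exponents m and n, `connect` contributes
α and β + 1, and the layer contributes −1 to the second weight together with the change of layer. -/
theorem d_basisDiagram (w : Seq) (m n : ℕ) (j : Fin 2) :
    (d (l.cast : k) (basisDiagram w (m, n, j)) : Alg k) =
      ((m : k) + (alpha p l w).cast) • basisDiagram w (m + 1, n, j) +
        (((n : k) + (beta p l w).cast) • basisDiagram w (m, n + 1, j) +
          (if j = 0 then -1 else 0 : k) • basisDiagram w (m, n, 1)) := by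
  have h1 : ∀ m : ℕ, d (l.cast : k) (xa w ^ m) = (m : k) • (xa w ^ (m + 1) : Alg k) := fun m => by
    rw [xa, d_x_pow, Nat.cast_smul_eq_nsmul]
  have h2 : ∀ m : ℕ, d (l.cast : k) (xb w ^ m) = (m : k) • (xb w ^ (m + 1) : Alg k) := fun m => by
    rw [xb, d_x_pow, Nat.cast_smul_eq_nsmul]
  have e0 : (basisDiagram w (m, n, j) : Alg k) =
    layer j * connect w * xa w ^ m * xb w ^ n := rfl
  have e1 : (basisDiagram w (m, n, 1) : Alg k) =
    layer 1 * connect w * xa w ^ m * xb w ^ n := rfl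
  have e2 : (basisDiagram w (m + 1, n, j) : Alg k) =
    layer j * connect w * xa w ^ (m + 1) * xb w ^ n := rfl
  have e3 : (basisDiagram w (m, n + 1, j) : Alg k) =
    layer j * connect w * xa w ^ m * xb w ^ (n + 1) := rfl
  rw [e0, d_mul, d_mul, d_mul, h1, h2, d_layer, d_connect p l]
  simp only [sub_mul, add_mul, mul_add, smul_mul_assoc, mul_smul_comm]
  rw [layer_connect_xa, layer_connect_xb, mul_assoc (layer j) (x 3 s1), x_connect,
    layer_connect_xb, ← e1, ← e2, ← e3]
  module

theorem planeMap_planeD (w : Seq) (f : ℕ × ℕ × Fin 2 →₀ k) :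
    planeMap w (planeD k p (alpha p l w) (beta p l w) f) = d (l.cast : k) (planeMap w f) := by
  have h : planeMap w ∘ₗ planeD k p (alpha p l w) (beta p l w) =
      d (l.cast : k) ∘ₗ planeMap w := by
    refine Finsupp.lhom_ext' fun i => LinearMap.ext_ring ?_
    obtain ⟨m, n, j⟩ := i
    change planeMap w (planeD k p (alpha p l w) (beta p l w) (Finsupp.single (m, n, j) 1)) =
      d (l.cast : k) (planeMap w (Finsupp.single (m, n, j) 1))
    rw [planeMap_single, d_basisDiagram, planeD, LinearMap.add_apply, LinearMap.add_apply, planeD₁,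
      planeD₂, planeN, weighted_single, weighted_single, weighted_single]
    simp only [map_add, map_smul, planeMap_single]
  exact LinearMap.congr_fun h f

/-- Inherited from the nilpotency of ∂ through the injective map `planeMap`. -/
theorem planeD_pow (w : Seq) : planeD k p (alpha p l w) (beta p l w) ^ p = 0 := by
  refine LinearMap.ext fun f => planeMap_injective w ?_
  rw [pow_intertwine (d' := d (l.cast : k)) (planeMap_planeD p l w), d_pow]
  simp

end

end Webster

/-! ### Euler characteristics of finite-dimensional p-complexes -/

namespace PComplex

open Module

variable {k : Type u} [Field k] {p : ℕ} (X : PComplex k p)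

theorem boundaries_le_cycles {n : ℕ} (hn : n ≤ p) (i : ℤ) :
    X.boundaries (p - n) i ≤ X.cycles n i := by
  rintro _ ⟨y, hy, rfl⟩
  refine ⟨?_, pow_pow (by omega) y⟩
  have := X.pow_mem (p - n) hy
  rwa [sub_add_cancel] at this

theorem finrank_cycles (n : ℕ) (i : ℤ) [FiniteDimensional k (X.gr i)] :
    finrank k (X.cycles n i) + finrank k ((X.gr i).map (X.d ^ n)) = finrank k (X.gr i) := by
  have h := LinearMap.finrank_range_add_finrank_ker ((X.d ^ n).domRestrict (X.gr i))
  have h1 : (LinearMap.ker ((X.d ^ n).domRestrict (X.gr i))).map (X.gr i).subtype =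
      X.cycles n i := by
    ext x
    constructor
    · rintro ⟨y, hy, rfl⟩
      exact ⟨y.2, hy⟩
    · rintro ⟨hx, hx'⟩
      exact ⟨⟨x, hx⟩, hx', rfl⟩
  rw [← h1, Submodule.finrank_map_subtype_eq, ← h, add_comm, LinearMap.range_domRestrict]

theorem finrank_homology {n : ℕ} (hn : n ≤ p) (i : ℤ) [FiniteDimensional k (X.gr i)] :
    finrank k (X.gr i) = finrank k (X.homology n i) +
      (finrank k (X.boundaries (p - n) i) + finrank k ((X.gr i).map (X.d ^ n))) := by
  have : FiniteDimensional k (X.cycles n i) := Submodule.finiteDimensional_of_le inf_le_left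
  have h := Submodule.finrank_quotient_add_finrank
    ((X.boundaries (p - n) i).submoduleOf (X.cycles n i))
  rw [(Submodule.submoduleOfEquivOfLe (X.boundaries_le_cycles hn i)).finrank_eq] at h
  rw [← finrank_cycles X n i, ← h, add_assoc]

/-- The Euler characteristic of a finite-dimensional complex. -/
theorem euler_of_finite (hp : 1 ≤ p) (hX : ∀ i, FiniteDimensional k (X.gr i))
    (hs : (Function.support fun i => finrank k (X.gr i)).Finite) {q : ℂ} (hq : q ^ p = 1) :
    X.euler q = (1 - q ^ 2) * ∑ᶠ i : ℤ, (finrank k (X.gr i) : ℂ) * q ^ i := by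
  have hq0 : q ≠ 0 := by rintro rfl; rw [zero_pow (by omega)] at hq; exact zero_ne_one hq
  let r : ℕ → ℂ := fun n => ∑ᶠ i : ℤ, (finrank k ((X.gr i).map (X.d ^ n)) : ℂ) * q ^ i
  -- The total dimension is that of the homology plus the ranks of dᵐ and dⁿ, the former shifted by
  -- 2 m. The rank terms for n = p − 1 equal q² times those for n = 1 because q²ᵖ = 1, so they
  -- disappear from the Euler characteristic.
  have key : ∀ n m, n + m = p → (∑ᶠ i : ℤ, (finrank k (X.gr i) : ℂ) * q ^ i) =
      X.dimAt n q + (q ^ (2 * m : ℤ) * r m + r n) := by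
    intro n m hnm
    obtain rfl : m = p - n := by omega
    have h1 := finsum_add_of_eq (fun i => X.finrank_homology (n := n) (by omega) i) hs q
    have hs' : (Function.support fun i => finrank k (X.boundaries (p - n) i) +
        finrank k ((X.gr i).map (X.d ^ n))).Finite := by
      refine hs.subset fun i hi => ?_
      have h2 := X.finrank_homology (n := n) (by omega) i
      simp only [Function.mem_support] at hi ⊢
      omega
    have h3 := finsum_add_of_eq (fun i => rfl) hs' q
    rw [h1, h3, dimAt]
    congr 2
    rw [← finsum_shift _ _ hq0]
    rfl
  have k1 := key (p - 1) 1 (by omega)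
  have k2 := key 1 (p - 1) (by omega)
  have hq2 : q ^ 2 * q ^ (2 * (p - 1 : ℕ) : ℤ) = 1 := by
    have : (2 * (p - 1 : ℕ) : ℤ) = ((2 * (p - 1) : ℕ) : ℤ) := by push_cast; ring
    rw [this, zpow_natCast, ← pow_add, show 2 + 2 * (p - 1) = p * 2 by omega, pow_mul, hq, one_pow]
  have hq3 : q ^ (2 * (1 : ℕ) : ℤ) = q ^ 2 := by norm_cast
  rw [hq3] at k1
  rw [euler]
  linear_combination q ^ 2 * k2 - k1 + r (p - 1) * hq2

/-- The Euler characteristic is a homotopy invariant. -/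
theorem euler_eq_of_equiv {X Y : PComplex k p} (hp : 1 ≤ p)
    (h : ∀ n ≤ p, ∀ i, Nonempty (X.homology n i ≃ₗ[k] Y.homology n i)) (q : ℂ) :
    X.euler q = Y.euler q := by
  have h1 : ∀ n ≤ p, X.dimAt n q = Y.dimAt n q := fun n hn =>
    finsum_congr fun i => by rw [(h n hn i).some.finrank_eq]
  rw [euler, euler, h1 _ (Nat.sub_le p 1), h1 1 hp]

end PComplex

/-! ### The plane and its finite box -/

namespace PDGAux

open Module

variable {k : Type u} [Field k] (p : ℕ) [hp : Fact p.Prime] [CharP k p] (α β : ZMod p)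

theorem homotopySum_planeS_apply (hd : planeD k p α β ^ p = 0) (f : ℕ × ℕ × Fin 2 →₀ k)
    (i : ℕ × ℕ × Fin 2) : homotopySum p (planeD k p α β) (planeS k p α β) f i =
      if i ∈ planeBox p α β then 0 else f i := by
  have h : Finsupp.lapply i ∘ₗ homotopySum p (planeD k p α β) (planeS k p α β) =
      if i ∈ planeBox p α β then 0 else Finsupp.lapply (R := k) i := by
    refine Finsupp.lhom_ext' fun j => LinearMap.ext_ring ?_
    change homotopySum p (planeD k p α β) (planeS k p α β) (Finsupp.single j 1) i =
      (if i ∈ planeBox p α β then 0 else Finsupp.lapply (R := k) i) (Finsupp.single j 1)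
    rw [homotopySum_planeS p α β hd]
    by_cases hij : j = i
    · subst hij
      split_ifs <;> simp
    · split_ifs <;> simp [Finsupp.single_apply, hij]
  have h1 := LinearMap.congr_fun h f
  refine h1.trans ?_
  split_ifs <;> rfl

/-- As the kernel of an operator that commutes with the differential, the span of the box is a
subcomplex. -/
theorem mem_supported_planeBox (hd : planeD k p α β ^ p = 0) (f : ℕ × ℕ × Fin 2 →₀ k) :
    f ∈ Finsupp.supported k k (planeBox p α β : Set (ℕ × ℕ × Fin 2)) ↔
      homotopySum p (planeD k p α β) (planeS k p α β) f = 0 := by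
  rw [Finsupp.mem_supported']
  constructor
  · intro h
    refine Finsupp.ext fun i => ?_
    rw [homotopySum_planeS_apply p α β hd]
    split_ifs with hi
    · rfl
    · exact h i hi
  · intro h i hi
    have := homotopySum_planeS_apply p α β hd f i
    rw [h, if_neg (fun h' => hi (Finset.mem_coe.2 h'))] at this
    exact this.symm

theorem sub_homotopySum_mem (hd : planeD k p α β ^ p = 0) (f : ℕ × ℕ × Fin 2 →₀ k) :
    f - homotopySum p (planeD k p α β) (planeS k p α β) f ∈
      Finsupp.supported k k (planeBox p α β : Set (ℕ × ℕ × Fin 2)) := by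
  rw [Finsupp.mem_supported']
  intro i hi
  rw [Finsupp.sub_apply, homotopySum_planeS_apply p α β hd,
    if_neg (fun h' => hi (Finset.mem_coe.2 h')), sub_self]

/-- The plane as a complex. -/
noncomputable abbrev planeComplex (c : ℤ) (hd : planeD k p α β ^ p = 0) : PComplex k p where
  carrier := ℕ × ℕ × Fin 2 →₀ k
  gr := basisGr k (planeDeg c)
  d := planeD k p α β
  d_mem := planeD_mem p α β c
  d_pow := hd

/-- The finite part of the plane as a complex. -/
noncomputable abbrev boxComplex (c : ℤ) (hd : planeD k p α β ^ p = 0) : PComplex k p where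
  carrier := ℕ × ℕ × Fin 2 →₀ k
  gr i := basisGr k (planeDeg c) i ⊓
    Finsupp.supported k k (planeBox p α β : Set (ℕ × ℕ × Fin 2))
  d := planeD k p α β
  d_mem {i f} hf := ⟨planeD_mem p α β c hf.1, (mem_supported_planeBox p α β hd _).2 (by
    rw [homotopySum_comm hd, (mem_supported_planeBox p α β hd f).1 hf.2, map_zero])⟩
  d_pow := hd

theorem homotopySum_neg {M : Type*} [AddCommGroup M] [Module k M] (p : ℕ) (D s : Module.End k M) :
    homotopySum p D (-s) = -homotopySum p D s := by
  simp only [homotopySum, mul_neg, neg_mul, Finset.sum_neg_distrib]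

theorem homotopySum_planeS_mem (c : ℤ) {i : ℤ} {f : ℕ × ℕ × Fin 2 →₀ k}
    (hf : f ∈ basisGr k (planeDeg c) i) :
    homotopySum p (planeD k p α β) (planeS k p α β) f ∈ basisGr k (planeDeg c) i :=
  homotopySum_mem (G := basisGr k (planeDeg c)) p
    (fun _ _ h => planeD_mem p α β c h) (fun _ _ h => planeS_mem p α β c h) hf

/-- The plane is homotopy equivalent to its finite part. -/
noncomputable def planeEquiv (c : ℤ) (hd : planeD k p α β ^ p = 0) {n : ℕ} (hn : n ≤ p) (i : ℤ) :
    (planeComplex p α β c hd).homology n i ≃ₗ[k] (boxComplex p α β c hd).homology n i :=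
  PComplex.homologyEquiv (X := planeComplex p α β c hd) (Y := boxComplex p α β c hd)
    { lin := LinearMap.id - homotopySum p (planeD k p α β) (planeS k p α β)
      map_gr := fun hf => ⟨sub_mem hf (homotopySum_planeS_mem p α β c hf),
        sub_homotopySum_mem p α β hd _⟩
      map_d := fun f => by
        change planeD k p α β f - _ = planeD k p α β (f - _)
        rw [homotopySum_comm hd, map_sub] }
    { lin := LinearMap.id
      map_gr := fun hf => hf.1
      map_d := fun f => rfl }
    (s := -planeS k p α β) (fun i f hf => neg_mem (planeS_mem p α β c hf))
    (fun i f hf => by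
      change f - _ - f = _
      rw [homotopySum_neg, LinearMap.neg_apply]
      abel)
    (t := 0) (fun i f hf => zero_mem _)
    (fun i f hf => by
      change f - homotopySum p (planeD k p α β) (planeS k p α β) f - f = _
      rw [(mem_supported_planeBox p α β hd f).1 hf.2, homotopySum]
      simp) hn i

theorem finrank_supported {I : Type*} (B : Finset I) :
    finrank k (Finsupp.supported k k (B : Set I)) = B.card := by
  rw [(Finsupp.supportedEquivFinsupp (B : Set I)).finrank_eq, finrank_finsupp_self]
  simp

theorem box_gr_eq (c : ℤ) (hd : planeD k p α β ^ p = 0) (i : ℤ) :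
    (boxComplex p α β c hd).gr i = Finsupp.supported k k
      (((planeBox p α β).filter fun j => planeDeg c j = i : Finset _) : Set (ℕ × ℕ × Fin 2)) := by
  change basisGr k (planeDeg c) i ⊓ _ = _
  rw [basisGr, ← Finsupp.supported_inter]
  congr 1
  ext j
  simp [and_comm]

theorem euler_boxComplex (c : ℤ) (hd : planeD k p α β ^ p = 0) {q : ℂ} (hq : q ^ p = 1) :
    (boxComplex p α β c hd).euler q =
      (1 - q ^ 2) * ∑ j ∈ planeBox p α β, q ^ planeDeg c j := by
  have h1 : ∀ i, finrank k ((boxComplex p α β c hd).gr i) =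
      ((planeBox p α β).filter fun j => planeDeg c j = i).card := fun i => by
    rw [box_gr_eq, finrank_supported]
  have hfin : ∀ i, FiniteDimensional k ((boxComplex p α β c hd).gr i) := fun i => by
    rw [box_gr_eq]
    exact FiniteDimensional.of_injective (Finsupp.supportedEquivFinsupp _).toLinearMap
      (Finsupp.supportedEquivFinsupp _).injective
  have hsub : (Function.support fun i => finrank k ((boxComplex p α β c hd).gr i)) ⊆
      ((planeBox p α β).image (planeDeg c) : Finset ℤ) := by
    intro i hi
    rw [Function.mem_support, h1, Finset.card_ne_zero] at hi
    obtain ⟨j, hj⟩ := hi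
    rw [Finset.mem_filter] at hj
    exact Finset.mem_coe.2 (Finset.mem_image.2 ⟨j, hj⟩)
  rw [PComplex.euler_of_finite _ hp.out.one_le hfin ((Finset.finite_toSet _).subset hsub) hq,
    finsum_eq_sum_of_support_subset (s := (planeBox p α β).image (planeDeg c))]
  · congr 1
    rw [← Finset.sum_fiberwise_of_maps_to (t := (planeBox p α β).image (planeDeg c))
      (g := planeDeg c) fun j hj => Finset.mem_image_of_mem _ hj]
    refine Finset.sum_congr rfl fun i _ => ?_
    rw [h1, Finset.card_eq_sum_ones, Nat.cast_sum, Finset.sum_mul]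
    refine Finset.sum_congr rfl fun j hj => ?_
    rw [(Finset.mem_filter.1 hj).2, Nat.cast_one, one_mul]
  · intro i hi
    refine hsub fun h => hi ?_
    simp [h]

end PDGAux

/-! ### The diagrams that end at s₁, up to homotopy -/

namespace Webster

open PDGAux PDGModule

variable (k : Type u) [Field k] (p : ℕ) [hp : Fact p.Prime] [CharP k p] (l : ZMod p)

theorem d_e (μ : k) (w : Seq) : d μ (e w : Alg k) = 0 := by rw [d_gen, dGen_idem]

theorem isClosedIdem (w : Seq) : (webster k p l).IsClosedIdem (e w : Alg k) where
  closed := d_e k (l.cast : k) w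
  mem_zero := gen_mem_gr (.idem w)
  idem := e_mul_self w

variable {k}

theorem planeInv_d (w : Seq) (a : Alg k) :
    planeInv w (d (l.cast : k) a) = planeD k p (alpha p l w) (beta p l w) (planeInv w a) :=
  planeMap_injective w (by
    rw [planeMap_planeD, planeMap_planeInv, planeMap_planeInv, d_mul, d_mul, d_e, d_e, zero_mul,
      zero_add, mul_zero, add_zero])

variable (k)

/-- A homotopy on the diagrams that end at `s1`. -/
noncomputable def contraction : Module.End k (Alg k) :=
  ∑ w, planeMap w ∘ₗ planeS k p (alpha p l w) (beta p l w) ∘ₗ planeInv w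

variable {k}

theorem planeInv_planeMap_ne {v w : Seq} (h : v ≠ w) (f : ℕ × ℕ × Fin 2 →₀ k) :
    planeInv v (planeMap w f) = 0 :=
  planeMap_injective v (by
    rw [planeMap_planeInv, map_zero, ← planeMap_e, mul_assoc, mul_assoc, e_mul_ne _ _ h.symm,
      mul_zero, mul_zero])

theorem contraction_planeMap (w : Seq) (f : ℕ × ℕ × Fin 2 →₀ k) :
    contraction k p l (planeMap w f) =
      planeMap w (planeS k p (alpha p l w) (beta p l w) f) := by
  rw [contraction, LinearMap.sum_apply, Finset.sum_eq_single w]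
  · rw [LinearMap.comp_apply, LinearMap.comp_apply, planeInv_planeMap]
  · intro v _ hv
    rw [LinearMap.comp_apply, LinearMap.comp_apply, planeInv_planeMap_ne hv, map_zero, map_zero]
  · exact fun h => absurd (Finset.mem_univ w) h

theorem contraction_mem (i : ℤ) (a : Alg k) (ha : a ∈ gr i) :
    contraction k p l a ∈ gr (k := k) (i - 2 * ((p : ℤ) - 1)) := by
  rw [contraction, LinearMap.sum_apply]
  exact Submodule.sum_mem _ fun w _ =>
    planeMap_mem w (planeS_mem p _ _ _ (planeInv_mem w ha))

theorem eq_sum_planeMap {a : Alg k} (ha : e s1 * a = a) : a = ∑ w, planeMap w (planeInv w a) := by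
  simp only [planeMap_planeInv, ha]
  rw [← Finset.mul_sum, sum_e, mul_one]

variable (k)

/-- The span of the diagrams that end at `s1` and survive in the stable category. -/
noncomputable def boxSpan : Submodule k (Alg k) :=
  ⨆ w, (Finsupp.supported k k
    (planeBox p (alpha p l w) (beta p l w) : Set (ℕ × ℕ × Fin 2))).map (planeMap w)

instance : FiniteDimensional k (boxSpan k p l) := by
  have h : ∀ w, FiniteDimensional k (Finsupp.supported k k
      (planeBox p (alpha p l w) (beta p l w) : Set (ℕ × ℕ × Fin 2))) := fun w =>
    FiniteDimensional.of_injective (Finsupp.supportedEquivFinsupp _).toLinearMap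
      (Finsupp.supportedEquivFinsupp _).injective
  exact Submodule.finiteDimensional_iSup _

variable {k}

/-- The element is decomposed by its bottom sequence. On each summand `contraction` is the homotopy
of a plane, whose operator is the identity outside the box. -/
theorem sub_homotopySum_mem_boxSpan {a : Alg k} (ha : e s1 * a = a) :
    a - homotopySum p (d (l.cast : k)) (contraction k p l) a ∈ boxSpan k p l := by
  rw [eq_sum_planeMap ha, map_sum, ← Finset.sum_sub_distrib]
  refine Submodule.sum_mem _ fun w _ => Submodule.mem_iSup_of_mem w ?_
  have h := homotopySum_intertwine (f := planeMap w) (s' := contraction k p l)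
    (planeMap_planeD p l w) (fun f => (contraction_planeMap p l w f).symm) p (planeInv w a)
  exact ⟨_, sub_homotopySum_mem p _ _ (planeD_pow p l w) (planeInv w a),
    (map_sub _ _ _).trans (congrArg _ h)⟩

/-- Up to the homotopy `contraction`, e(s₁) W̃ is the finite-dimensional `boxSpan`; this is what the
general finiteness theorem for compact modules requires. -/
theorem isFinite_of_isCompact (M : PDGModule (webster k p l))
    (hM : DerivedPDG.IsCompact ((DerivedPDG.Q _).obj M)) :
    (part (isClosedIdem k p l s1) M).IsFinite (p - 1) ∧
      (part (isClosedIdem k p l s1) M).IsFinite 1 := by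
  let E : (webster k p l).carrier := (e s1 : Alg k)
  obtain ⟨F, hfin, hF⟩ : ∃ F : Submodule k (webster k p l).carrier, FiniteDimensional k F ∧
      ∀ a, E * a = a →
        a - homotopySum p (webster k p l).d (contraction k p l) a ∈ F :=
    ⟨boxSpan k p l, inferInstanceAs (FiniteDimensional k (boxSpan k p l)),
      fun a ha => sub_homotopySum_mem_boxSpan p l ha⟩
  have h := DerivedPDG.isFinite_of_isCompact (isClosedIdem k p l s1) (s := contraction k p l)
    (contraction_mem p l) F hF hp.out.one_le hM
  exact ⟨h, h.one hp.out.one_le⟩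

/-- The part of `W̃ e(w)` that ends at `s1` is a plane. -/
noncomputable def partEquiv (w : Seq) {n : ℕ} (hn : n ≤ p) (i : ℤ) :
    (part (isClosedIdem k p l s1) (projective k p l w)).homology n i ≃ₗ[k]
      (planeComplex (k := k) p (alpha p l w) (beta p l w) (connectDeg w - 2) (planeD_pow p l w)).homology
        n i :=
  PComplex.homologyEquiv
    (X := part (isClosedIdem k p l s1) (projective k p l w))
    (Y := planeComplex (k := k) p (alpha p l w) (beta p l w) (connectDeg w - 2) (planeD_pow p l w))
    { lin := planeInv w ∘ₗ ((webster k p l).idealOf (e w : Alg k)).subtype.restrictScalars k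
      map_gr := fun ha => planeInv_mem w ha.1
      map_d := fun a => planeInv_d p l w (val a) }
    { lin := (planeMap w).codRestrict
        (((webster k p l).idealOf (e w : Alg k)).restrictScalars k) fun f => planeMap_e w f
      map_gr := fun {i f} hf => ⟨planeMap_mem w hf, Subtype.ext (e_planeMap w f)⟩
      map_d := fun f => Subtype.ext (planeMap_planeD p l w f) }
    (s := 0) (fun i a _ => zero_mem _)
    (fun i a ha => by
      have h1 : e s1 * val a = val a := congrArg Subtype.val ha.2
      have h2 : val a * e w = val a := a.2
      have h3 : planeMap w (planeInv w (val a)) = val a := by rw [planeMap_planeInv, h1, h2]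
      refine (sub_eq_zero.2 (Subtype.ext h3)).trans ?_
      simp only [homotopySum, mul_zero, zero_mul, Finset.sum_const_zero]
      rfl)
    (t := 0) (fun i f _ => zero_mem _)
    (fun i f hf => by
      refine (sub_eq_zero.2 (planeInv_planeMap w f)).trans ?_
      simp [homotopySum]) hn i

theorem euler_projective (w : Seq) {q : ℂ} (hq : q ^ p = 1) :
    (part (isClosedIdem k p l s1) (projective k p l w)).euler q =
      (1 - q ^ 2) * ∑ j ∈ planeBox p (alpha p l w) (beta p l w),
        q ^ planeDeg (connectDeg w - 2) j := by
  rw [← euler_boxComplex (k := k) p _ _ _ (planeD_pow p l w) hq]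
  exact PComplex.euler_eq_of_equiv hp.out.one_le
    (fun n hn i => ⟨partEquiv p l w hn i ≪≫ₗ planeEquiv p _ _ _ _ hn i⟩) q

end Webster

/-! ### Values of the Euler characteristic -/

theorem PDGModule.euler_gradingShift {k : Type u} [Field k] {p : ℕ} {A : PDGAlgebra k p}
    {e : A.carrier} (he : A.IsClosedIdem e) (c : ℤ) (M : PDGModule A) {q : ℂ} (hq : q ≠ 0) :
    (part he (gradingShift c M)).euler q = q ^ c * (part he M).euler q := by
  have h : ∀ n, (part he (gradingShift c M)).dimAt n q = q ^ c * (part he M).dimAt n q := by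
    intro n
    rw [PComplex.dimAt, PComplex.dimAt,
      ← PComplex.finsum_shift (fun i => Module.finrank k ((part he M).homology n i)) c hq]
    refine finsum_congr fun i => ?_
    have h1 : (part he (gradingShift c M)).boundaries (p - n) i =
        (part he M).boundaries (p - n) (i - c) := by
      change Submodule.map _ (M.gr (i - 2 * ((p - n : ℕ) : ℤ) - c) ⊓ _) =
        Submodule.map _ (M.gr (i - c - 2 * ((p - n : ℕ) : ℤ)) ⊓ _)
      rw [sub_right_comm]
      rfl
    change (Module.finrank k ((part he M).cycles n (i - c) ⧸
      ((part he (gradingShift c M)).boundaries (p - n) i).submoduleOf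
        ((part he M).cycles n (i - c))) : ℂ) * q ^ i = _
    rw [h1]
  rw [PComplex.euler, PComplex.euler, h, h]
  ring

theorem PDGAux.sum_planeBox {p : ℕ} [Fact p.Prime] (α β : ZMod p) (c : ℤ) {q : ℂ} (hq : q ≠ 0) :
    ∑ j ∈ planeBox p α β, q ^ planeDeg c j =
      q ^ c * (1 + q ^ 2) * (∑ m ∈ Finset.range (1 - α).val, (q ^ 2) ^ m) *
        ∑ n ∈ Finset.range (1 - β).val, (q ^ 2) ^ n := by
  rw [planeBox, Finset.sum_product, mul_assoc, mul_comm (∑ m ∈ _, _), ← mul_assoc, Finset.mul_sum]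
  refine Finset.sum_congr rfl fun m _ => ?_
  rw [Finset.sum_product, Finset.mul_sum, Finset.sum_mul]
  refine Finset.sum_congr rfl fun n _ => ?_
  have h : ∀ j : Fin 2, q ^ planeDeg c (m, n, j) =
      q ^ c * (q ^ 2) ^ m * (q ^ 2) ^ n * (q ^ 2) ^ (j : ℕ) := by
    intro j
    simp only [planeDeg]
    rw [zpow_add₀ hq, zpow_add₀ hq, zpow_add₀ hq]
    simp only [zpow_mul, zpow_natCast]
    norm_cast
  rw [Fin.sum_univ_two, h, h]
  simp
  ring

/-! ### Arithmetic at roots of unity, and the conclusion -/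

namespace Webster

/-- If `u` and `2 u - 1` lie on the unit circle, then `u = 1`. -/
theorem eq_one_of_norm {u v : ℂ} (hu : ‖u‖ = 1) (hv : ‖v‖ = 1) (h : v = 2 * u - 1) : u = 1 := by
  have h1 : u.re * u.re + u.im * u.im = 1 := by
    have := Complex.sq_norm u
    rw [hu, Complex.normSq_apply] at this
    linarith
  have h2 : v.re * v.re + v.im * v.im = 1 := by
    have := Complex.sq_norm v
    rw [hv, Complex.normSq_apply] at this
    linarith
  have h3 : v.re = 2 * u.re - 1 := by rw [h]; simp
  have h4 : v.im = 2 * u.im := by rw [h]; simp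
  rw [h3, h4] at h2
  have h5 : u.re = 1 := by linarith
  rw [h5] at h1
  have h6 : u.im = 0 := by
    have : u.im * u.im = 0 := by linarith
    exact mul_self_eq_zero.1 this
  exact Complex.ext h5 h6

/-- Let L be the first geometric sum. The second one is 1 + z L, and the equation factors as (L −
1)(z² L − (1 + z)) = 0. The first factor gives z^λ = z, hence λ = 1. The second gives z² z^λ = 2 z²
− 1 with both z² and the left side on the unit circle; this forces z² = 1, which is impossible for
odd p. -/
theorem eq_one_of_sum_eq {p : ℕ} [hp : Fact p.Prime] (h2 : p ≠ 2) (l : ZMod p) {z : ℂ}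
    (hz : IsPrimitiveRoot z p)
    (h : (1 + z) ^ 2 * ∑ m ∈ Finset.range l.val, z ^ m = (1 + z) +
      z * (∑ m ∈ Finset.range l.val, z ^ m) * ∑ m ∈ Finset.range (1 + l).val, z ^ m) : l = 1 := by
  have hz1 : z ≠ 1 := hz.ne_one hp.out.one_lt
  have hz1' : z - 1 ≠ 0 := sub_ne_zero.2 hz1
  have h3 : (∑ m ∈ Finset.range l.val, z ^ m) * (z - 1) = z ^ l.val - 1 := geom_sum_mul z _
  have h4 : (∑ m ∈ Finset.range (1 + l).val, z ^ m) * (z - 1) = z ^ (1 + l).val - 1 :=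
    geom_sum_mul z _
  -- This also covers λ = −1, where the residue wraps around to 0, because zᵖ = 1.
  have h5 : z ^ (1 + l).val = z * z ^ l.val := by
    have := pow_mod_orderOf z (l.val + 1)
    rw [← hz.eq_orderOf] at this
    rw [← pow_succ', ZMod.val_add, ZMod.val_one_eq_one_mod, Nat.add_mod, Nat.mod_mod,
      ← Nat.add_mod, add_comm 1, this]
  set L := ∑ m ∈ Finset.range l.val, z ^ m
  have h6 : (∑ m ∈ Finset.range (1 + l).val, z ^ m) = 1 + z * L := by
    refine mul_right_cancel₀ hz1' ?_
    rw [h4, h5]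
    linear_combination -z * h3
  rw [h6] at h
  have h7 : (L - 1) * (z ^ 2 * L - (1 + z)) = 0 := by linear_combination -h
  rcases mul_eq_zero.1 h7 with h8 | h8
  · have h9 : z ^ l.val = z ^ 1 := by
      rw [pow_one]
      linear_combination (z - 1) * h8 - h3
    have h10 := hz.pow_inj (ZMod.val_lt l) hp.out.one_lt h9
    rw [← ZMod.natCast_zmod_val l, h10, Nat.cast_one]
  · exfalso
    have hn : ‖z‖ = 1 := hz.norm'_eq_one hp.out.ne_zero
    have h9 : z ^ 2 * z ^ l.val = 2 * z ^ 2 - 1 := by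
      linear_combination (z - 1) * h8 - z ^ 2 * h3
    have h10 : z ^ 2 = 1 := eq_one_of_norm (by rw [norm_pow, hn, one_pow])
      (by rw [norm_mul, norm_pow, norm_pow, hn, one_pow, one_pow, one_mul]) h9
    have h11 := hz.dvd_of_pow_eq_one 2 h10
    exact h2 ((Nat.prime_dvd_prime_iff_eq hp.out Nat.prime_two).1 h11)

open PDGAux PDGModule in
/-- The Euler characteristic of the part of a module that ends at `s1`, as an additive function
on the Grothendieck group. -/
theorem exists_euler (k : Type u) [Field k] (p : ℕ) [hp : Fact p.Prime] [CharP k p] (l : ZMod p)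
    {q : ℂ} (hq : q ^ p = 1) :
    ∃ (Φ : K0 (webster k p l) →+ ℂ) (χ : PDGModule (webster k p l) → ℂ),
      (∀ M (hM : DerivedPDG.IsCompact ((DerivedPDG.Q _).obj M)), Φ (K0.symbol _ hM) = χ M) ∧
      (∀ c M, χ (gradingShift c M) = q ^ c * χ M) ∧
      ∀ w, χ (projective k p l w) = (1 - q ^ 2) * (q ^ (connectDeg w - 2) * (1 + q ^ 2) *
        (∑ m ∈ Finset.range (1 - alpha p l w).val, (q ^ 2) ^ m) *
        ∑ n ∈ Finset.range (1 - beta p l w).val, (q ^ 2) ^ n) := by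
  have hq0 : q ≠ 0 := by
    rintro rfl
    rw [zero_pow hp.out.ne_zero] at hq
    exact zero_ne_one hq
  refine ⟨K0.euler (isClosedIdem k p l s1) (isFinite_of_isCompact p l) q hq,
    fun M => (part (isClosedIdem k p l s1) M).euler q,
    fun M hM => K0.euler_symbol (isClosedIdem k p l s1) (isFinite_of_isCompact p l) q hq M hM,
    fun c M => euler_gradingShift _ c M hq0, fun w => ?_⟩
  rw [← sum_planeBox _ _ _ hq0]
  exact euler_projective p l w hq

/-- The relation is evaluated by the Euler characteristic at a primitive p-th root of unity q. For
odd p also q² is primitive, so the common factors 1 − q² and 1 + q² do not vanish and can be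
cancelled. -/
theorem eq_one_of_symbol_relation {k : Type u} [Field k] (p : ℕ) [hp : Fact p.Prime] [CharP k p]
    (h2 : p ≠ 2) (l : ZMod p)
    (h0 : DerivedPDG.IsCompact ((DerivedPDG.Q _).obj (Webster.W0 k p l)))
    (h1 : DerivedPDG.IsCompact ((DerivedPDG.Q _).obj (Webster.W1 k p l)))
    (h3 : DerivedPDG.IsCompact ((DerivedPDG.Q _).obj (Webster.W2 k p l)))
    (h : K0.qPow _ 1 (K0.symbol _ h0) + K0.qPow _ (-1) (K0.symbol _ h0) =
      K0.symbol _ h1 + K0.symbol _ h3) : l = 1 := by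
  have hlt : 2 < p := lt_of_le_of_ne hp.out.two_le h2.symm
  have : Fact (2 < p) := ⟨hlt⟩
  have : Fact (1 < p) := ⟨by omega⟩
  obtain ⟨q, hq⟩ : ∃ q : ℂ, IsPrimitiveRoot q p := ⟨_, Complex.isPrimitiveRoot_exp p hp.out.ne_zero⟩
  have hq0 : q ≠ 0 := hq.ne_zero hp.out.ne_zero
  have hz : IsPrimitiveRoot (q ^ 2) p :=
    hq.pow_of_coprime 2 ((Nat.coprime_primes Nat.prime_two hp.out).2 h2.symm)
  have hz1 : 1 - q ^ 2 ≠ 0 := sub_ne_zero.2 (hz.ne_one hp.out.one_lt).symm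
  have hz2 : 1 + q ^ 2 ≠ 0 := by
    intro h4
    have h5 : (q ^ 2) ^ 2 = 1 := by linear_combination (q ^ 2 - 1) * h4
    exact h2 ((Nat.prime_dvd_prime_iff_eq hp.out Nat.prime_two).1 (hz.dvd_of_pow_eq_one 2 h5))
  obtain ⟨Φ, χ, hΦ, hshift, hproj⟩ := exists_euler k p l hq.pow_eq_one
  have key := congrArg Φ h
  rw [map_add, map_add, K0.qPow_symbol, K0.qPow_symbol] at key
  have e1 : ∀ (c : ℤ) (hc : DerivedPDG.IsCompact ((DerivedPDG.gradingShift _ c).obj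
      ((DerivedPDG.Q _).obj (Webster.W0 k p l)))), Φ (K0.symbol _ hc) =
        q ^ c * χ (Webster.W0 k p l) := fun c hc =>
    (hΦ (PDGModule.gradingShift c (Webster.W0 k p l)) hc).trans (hshift c _)
  rw [e1, e1, hΦ, hΦ, hproj, hproj, hproj] at key
  -- The sides of the boxes are the residues of λ and 2 for W₀, of 1 and 2 for W₁, and of λ and 1 +
  -- λ for W₂.
  have a0 : 1 - alpha p l s0 = l := by rw [alpha, if_neg (by decide)]; ring
  have a1 : 1 - alpha p l s1 = 1 := by rw [alpha, if_pos rfl]; ring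
  have a2 : 1 - alpha p l s2 = l := by rw [alpha, if_neg (by decide)]; ring
  have b0 : 1 - beta p l s0 = 2 := by rw [beta, if_neg (by decide)]; ring
  have b1 : 1 - beta p l s1 = 2 := by rw [beta, if_neg (by decide)]; ring
  have b2 : 1 - beta p l s2 = 1 + l := by rw [beta, if_pos rfl]; ring
  have v1 : (1 : ZMod p).val = 1 := ZMod.val_one p
  have v2 : (2 : ZMod p).val = 2 := ZMod.val_cast_of_lt hlt
  have c0 : connectDeg s0 - 2 = -1 := by decide
  have c1 : connectDeg s1 - 2 = -2 := by decide
  have c2 : connectDeg s2 - 2 = 0 := by decide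
  rw [a0, a1, a2, b0, b1, b2, v1, v2, c0, c1, c2] at key
  refine eq_one_of_sum_eq h2 l hz ?_
  set L := ∑ m ∈ Finset.range l.val, (q ^ 2) ^ m
  set L' := ∑ m ∈ Finset.range (1 + l).val, (q ^ 2) ^ m
  simp only [Finset.sum_range_succ, Finset.sum_range_zero, pow_zero, pow_one, zero_add, mul_one,
    zpow_zero, zpow_one, zpow_neg_one, one_mul] at key
  have e2 : q ^ (-2 : ℤ) = (q ^ 2)⁻¹ := by rw [zpow_neg]; norm_cast
  rw [e2] at key
  field_simp at key
  linear_combination key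

end Webster

theorem mainTheorem5 {k : Type u} [Field k] (p : ℕ) [Fact p.Prime] [CharP k p] :
    (∀ l : ZMod p,
      ∃ (h0 : DerivedPDG.IsCompact ((DerivedPDG.Q _).obj (Webster.W0 k p l)))
        (h1 : DerivedPDG.IsCompact ((DerivedPDG.Q _).obj (Webster.W1 k p l)))
        (h2 : DerivedPDG.IsCompact ((DerivedPDG.Q _).obj (Webster.W2 k p l))),
        (l = 1 →
          K0.qPow _ 1 (K0.symbol _ h0) + K0.qPow _ (-1) (K0.symbol _ h0) =
            K0.symbol _ h1 + K0.symbol _ h2) ∧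
        (p ≠ 2 →
          (K0.qPow _ 1 (K0.symbol _ h0) + K0.qPow _ (-1) (K0.symbol _ h0) =
            K0.symbol _ h1 + K0.symbol _ h2 ↔ l = 1))) ∧
    ∃ (ψ : Webster.W2div k p 1 ⟶ Webster.W0 k p 1) (φ : Webster.W0 k p 1 ⟶ Webster.W1div k p 1)
      (δ : (DerivedPDG.Q _).obj (Webster.W1div k p 1) ⟶
        (DerivedPDG.homShift _).obj ((DerivedPDG.Q _).obj (Webster.W2div k p 1))),
      (∀ a, (PDGModule.lin ψ a).1 = a.1 * Webster.psi2 k p 1) ∧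
      (∀ a, (PDGModule.lin φ a).1 = a.1 * Webster.phi1 k p 1) ∧
      DerivedPDG.IsDistinguished ((DerivedPDG.Q _).map ψ) ((DerivedPDG.Q _).map φ) δ := by
  refine ⟨fun l => ⟨Webster.isCompact_projective k p l _, Webster.isCompact_projective k p l _,
    Webster.isCompact_projective k p l _, ?_, fun h2 => ⟨fun h => ?_, ?_⟩⟩, ?_⟩
  · rintro rfl
    exact Webster.symbol_relation k p _ _ _
  · exact Webster.eq_one_of_symbol_relation p h2 l _ _ _ h
  · rintro rfl
    exact Webster.symbol_relation k p _ _ _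
  · obtain ⟨δ, hδ⟩ := (Webster.psiPhi k p).exists_isDistinguished
    exact ⟨Webster.psiHom k p, Webster.phiHom k p, δ, fun _ => rfl, fun _ => rfl, hδ⟩
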